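/- Let $p$ be a prime, let $C$ be a perfectoid field of mixed characteristic $(0,p)$ containing all $p$-power roots of unity, with ring of integers $\mathcal O$, and fix a compatible sequence $1,\zeta_p,\zeta_{p^2},\dots$ of primitive $p$-power roots of unity. Put $A_{\inf}=W(\mathcal O^\flat)$ with its Witt vector Frobenius $\phi$, $\varepsilon=(1,\zeta_p,\zeta_{p^2},\dots)\in\mathcal O^\flat$, $\mu=[\varepsilon]-1$, $\xi=\mu/\phi^{-1}(\mu)$, $\tilde\xi=\phi(\xi)$. Let $R\neq 0$ be a $p$-adically complete ring with a framing, i.e. a formally étale homomorphism, of topologically finite presentation, $\square:\mathcal O\langle T_1^{\pm1},\dots,T_d^{\pm1}\rangle\to R$ (so that $R$ is a small formally smooth $\mathcal O$-algebra). Let $R_\infty$ be the $p$-adic completion of $\varinjlim_j R\otimes_{\mathcal O\langle \underline T^{\pm1}\rangle}\mathcal O\langle \underline T^{\pm1/p^j}\rangle$ and $A_{\inf}(R_\infty)=W(R_\infty^\flat)$, with Fontaine's map $\theta:A_{\inf}(R_\infty)\to R_\infty$. The group $\Gamma=\mathbb Z_p(1)^d=\mathrm{Hom}((\mathbb Q_p/\mathbb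 Z_p)^d,\mu_{p^\infty})$, with its profinite topology, acts continuously and $R$-linearly on $R_\infty$ by $\gamma\cdot T^k=\gamma(k)T^k$ for $k\in\mathbb Z[1/p]^d$, hence it acts on $A_{\inf}(R_\infty)$. Let $A_{\inf}\langle\underline U^{\pm1}\rangle$ be the $(p,\xi)$-adic completion of $A_{\inf}[U_1^{\pm1},\dots,U_d^{\pm1}]$, mapping to $A_{\inf}(R_\infty)$ by $U_i\mapsto[(T_i,T_i^{1/p},T_i^{1/p^2},\dots)]$. There is a unique subring $A_{\inf}^\square(R)\subseteq A_{\inf}(R_\infty)$ containing the image of $A_{\inf}[\underline U^{\pm1}]$ which is $(p,\xi)$-adically complete, formally étale and of topologically finite presentation over $A_{\inf}\langle\underline U^{\pm1}\rangle$, and whose inclusion into $A_{\inf}(R_\infty)$ is identified modulo $\xi$ (via $\theta$) with $R\to R_\infty$; it is stable under $\Gamma$ and under the Frobenius $\phi$ of $A_{\inf}(R_\infty)$. For a ring $B$ with an adic topology and an action of $\Gamma$, and for a $\Gamma$-invariant $b\in B$, let $\mathrm{Rep}^b_\Gamma(B)$ be the category of finite projective $B$-modules $M$ with a continuous semilinear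 action of $\Gamma$ such that the $(B/b)^\Gamma$-module $(M/b)^\Gamma$ is finite projective and $(M/b)^\Gamma\otimes_{(B/b)^\Gamma}B/b\to M/b$ is an isomorphism. The rings $A_{\inf}^\square(R)$, $A_{\inf}(R_\infty)$ and their reductions modulo $p$ carry the $(p,\xi)$-adic topology. Let $\mathrm{Rep}_\Gamma^\mu(B,\phi)$, for $B=A_{\inf}^\square(R)$ or $B=A_{\inf}(R_\infty)$, be the category of pairs $(M,\phi_M)$ with $M\in\mathrm{Rep}_\Gamma^\mu(B)$ and $\phi_M:(\phi^*M)[1/\tilde\xi]\to M[1/\tilde\xi]$ a $\Gamma$-equivariant isomorphism of $B[1/\tilde\xi]$-modules. Then: 1. Base change along $A_{\inf}^\square(R)\to A_{\inf}(R_\infty)$ is an equivalence of categories $\mathrm{Rep}_\Gamma^\mu(A_{\inf}^\square(R))\to\mathrm{Rep}_\Gamma^\mu(A_{\inf}(R_\infty))$. 2. More generally, let $(A,A^\square,A_\infty)$ be either $(A_{\inf},A_{\inf}^\square(R),A_{\inf}(R_\infty))$ or $(A_{\inf}/p,A_{\inf}^\square(R)/p,A_{\inf}(R_\infty)/p)$.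 Let $c_0,c_1\in A$ be such that $c_1=c_0\,\phi^{-1}(\mu)$ and $c_1$ divides $\mu$ in $A$ (that is, $\mu A\subseteq c_1A\subseteq\phi^{-1}(\mu)A$), and assume that $c_0$ is not a unit of $A$. Then base change along $A^\square\to A_\infty$ is an equivalence of categories $\mathrm{Rep}_\Gamma^{c_1}(A^\square)\to\mathrm{Rep}_\Gamma^{c_1}(A_\infty)$. 3. Base change along $A_{\inf}^\square(R)\to A_{\inf}(R_\infty)$ is an equivalence of categories $\mathrm{Rep}_\Gamma^\mu(A_{\inf}^\square(R),\phi)\to\mathrm{Rep}_\Gamma^\mu(A_{\inf}(R_\infty),\phi)$. -/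

import Mathlib

universe u v

open CategoryTheory TensorProduct

set_option linter.unusedSectionVars false

noncomputable section

namespace SmallRep

/-! ### Base change of modules along an equivariant ring homomorphism -/

section BaseChange

variable {G : Type v} [Group G] {B B' B'' C : Type u} [CommRing B] [MulSemiringAction G B]
  [CommRing B'] [MulSemiringAction G B'] [CommRing B''] [MulSemiringAction G B'']
  [CommRing C] [MulSemiringAction G C]

/-- The base change `B' ⊗[B] M` of a `B`-module `M` along an equivariant ring homomorphism
`f : B → B'`. -/
def BaseChange (f : B →+*[G] B') (M : Type u) [AddCommGroup M] [Module B M] : Type u :=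
  @TensorProduct B _ B' M _ _ (Module.compHom B' (f : B →+* B')) _

namespace BaseChange

variable (f : B →+*[G] B') (g : B' →+*[G] C) {M : Type u} [AddCommGroup M] [Module B M]
  {N : Type u} [AddCommGroup N] [Module B N]
  {P : Type u} [AddCommGroup P] [Module C P]

instance : AddCommGroup (BaseChange f M) :=
  @TensorProduct.addCommGroup B _ B' M _ _ (Module.compHom B' (f : B →+* B')) _

instance : Module B' (BaseChange f M) :=
  letI := Module.compHom B' (f : B →+* B')
  haveI : SMulCommClass B B' B' := ⟨fun b x y => mul_left_comm (f b) x y⟩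
  (TensorProduct.leftModule : Module B' (B' ⊗[B] M))

/-- The pure tensor `b' ⊗ m`. -/
def tmul (b' : B') (m : M) : BaseChange f M :=
  @TensorProduct.tmul B _ B' M _ _ (Module.compHom B' (f : B →+* B')) _ b' m

lemma tmul_add (b' : B') (m n : M) : tmul f b' (m + n) = tmul f b' m + tmul f b' n :=
  letI := Module.compHom B' (f : B →+* B')
  TensorProduct.tmul_add b' m n

lemma add_tmul (b c : B') (m : M) : tmul f (b + c) m = tmul f b m + tmul f c m :=
  letI := Module.compHom B' (f : B →+* B')
  TensorProduct.add_tmul b c m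

lemma smul_tmul (a b' : B') (m : M) : a • tmul f b' m = tmul f (a * b') m := rfl

lemma tmul_smul (b' : B') (b : B) (m : M) : tmul f b' (b • m) = f b • tmul f b' m :=
  letI := Module.compHom B' (f : B →+* B')
  (TensorProduct.smul_tmul (R := B) b b' m).symm

lemma tmul_zero (b' : B') : tmul f b' (0 : M) = 0 :=
  letI := Module.compHom B' (f : B →+* B')
  TensorProduct.tmul_zero M b'

@[elab_as_elim]
lemma induction_on {p : BaseChange f M → Prop} (x : BaseChange f M)
    (tmul : ∀ b' m, p (tmul f b' m)) (add : ∀ x y, p x → p y → p (x + y)) : p x := by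
  let _ := Module.compHom B' (f : B →+* B')
  refine TensorProduct.induction_on (motive := p) x ?_ tmul add
  have := tmul 0 0
  rwa [tmul_zero] at this

/-- `m ↦ 1 ⊗ m`. -/
def incl : M →+ BaseChange f M where
  toFun m := tmul f 1 m
  map_zero' := tmul_zero f 1
  map_add' := tmul_add f 1

lemma tmul_eq (b' : B') (m : M) : tmul f b' m = b' • incl f m := by
  change _ = b' • tmul f 1 m
  rw [smul_tmul, mul_one]

lemma incl_smul (b : B) (m : M) : incl f (b • m) = f b • incl f m := tmul_smul f 1 b m

variable {f} in
/-- The `σ`-semilinear map `b' ⊗ m ↦ σ b' • h m`. -/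
def lift {σ : B' →+* C} (h : M →+ P) (hh : ∀ (b : B) (m : M), h (b • m) = σ (f b) • h m) :
    BaseChange f M →ₛₗ[σ] P :=
  letI := Module.compHom B' (f : B →+* B')
  let F : B' ⊗[B] M →+ P := TensorProduct.liftAddHom
    { toFun := fun b' =>
        { toFun := fun m => σ b' • h m
          map_zero' := by simp
          map_add' := by simp }
      map_zero' := by ext; simp
      map_add' := by intros; ext; simp [add_smul] }
    (by
      intro b b' m
      simp only [AddMonoidHom.coe_mk, ZeroHom.coe_mk, hh]
      rw [smul_smul, mul_comm, ← map_mul]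
      rfl)
  { toFun := F
    map_add' := F.map_add
    map_smul' := by
      intro a x
      refine induction_on f (p := fun x => F (a • x) = σ a • F x) x (fun b' m => ?_)
        (fun x y hx hy => ?_)
      · change σ (a * b') • h m = σ a • σ b' • h m
        rw [map_mul, mul_smul]
      · rw [smul_add]
        exact (F.map_add _ _).trans (by rw [hx, hy, ← smul_add]; exact congrArg _ (F.map_add _ _).symm) }

lemma lift_tmul {σ : B' →+* C} (h : M →+ P)
    (hh : ∀ (b : B) (m : M), h (b • m) = σ (f b) • h m) (b' : B') (m : M) :
    lift h hh (tmul f b' m) = σ b' • h m := rfl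

lemma lift_incl {σ : B' →+* C} (h : M →+ P)
    (hh : ∀ (b : B) (m : M), h (b • m) = σ (f b) • h m) (m : M) :
    lift h hh (incl f m) = h m := by
  change σ 1 • h m = _
  rw [map_one, one_smul]

/-- A semilinear map out of a base change is determined by its values on `1 ⊗ m`. -/
lemma ext_incl {σ : B' →+* C} {a b : BaseChange f M →ₛₗ[σ] P}
    (h : ∀ m, a (incl f m) = b (incl f m)) : a = b := by
  ext x
  induction x using induction_on with
  | tmul b' m => rw [tmul_eq, map_smulₛₗ, map_smulₛₗ, h]
  | add x y hx hy => rw [map_add, hx, hy, map_add]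

/-- The `B'`-linear map `b' ⊗ m ↦ b' ⊗ a m`. -/
def map (a : M →ₗ[B] N) : BaseChange f M →ₗ[B'] BaseChange f N :=
  lift (h := (incl f).comp a.toAddMonoidHom) (fun b m => by
    change incl f (a (b • m)) = f b • incl f (a m)
    rw [map_smul, incl_smul])

lemma map_incl (a : M →ₗ[B] N) (m : M) : map f a (incl f m) = incl f (a m) :=
  lift_incl f _ _ m

section Action

variable [DistribMulAction G M] [SMulDistribClass G B M]
  [DistribMulAction G N] [SMulDistribClass G B N]

/-- The action of `γ : G` on `B' ⊗[B] M`, given by `b' ⊗ m ↦ (γ • b') ⊗ (γ • m)`. -/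
def act (γ : G) : BaseChange f M →ₛₗ[MulSemiringAction.toRingHom G B' γ] BaseChange f M :=
  lift (h := (incl f).comp (DistribSMul.toAddMonoidHom M γ)) (fun b m => by
    change incl f (γ • b • m) = (γ • f b) • incl f (γ • m)
    rw [smul_distrib_smul, incl_smul, map_smul])

lemma act_incl (γ : G) (m : M) : act f γ (incl f m) = incl f (γ • m) := lift_incl f _ _ m

instance : DistribMulAction G (BaseChange f M) where
  smul γ x := act f γ x
  one_smul x := by
    change act f 1 x = x
    induction x using induction_on with
    | tmul b' m =>
      rw [tmul_eq, map_smulₛₗ, act_incl, one_smul]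
      exact congrArg (· • _) (one_smul G b')
    | add x y hx hy => rw [map_add, hx, hy]
  mul_smul γ δ x := by
    change act f (γ * δ) x = act f γ (act f δ x)
    induction x using induction_on with
    | tmul b' m =>
      simp only [tmul_eq, map_smulₛₗ, act_incl, mul_smul]
      exact congrArg (· • _) (mul_smul γ δ b')
    | add x y hx hy => simp only [map_add, hx, hy]
  smul_zero γ := map_zero (act f γ)
  smul_add γ := map_add (act f γ)

instance : SMulDistribClass G B' (BaseChange f M) :=
  ⟨fun γ b' x => (act f γ).map_smulₛₗ b' x⟩

lemma smul_incl (γ : G) (m : M) : γ • incl f m = incl f (γ • m) := act_incl f γ m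

lemma map_equivariant (a : M →ₗ[B] N) (ha : ∀ (γ : G) (m : M), a (γ • m) = γ • a m) (γ : G)
    (x : BaseChange f M) : map f a (γ • x) = γ • map f a x := by
  induction x using induction_on with
  | tmul b' m =>
    rw [tmul_eq, smul_distrib_smul, smul_incl, LinearMap.map_smul, LinearMap.map_smul, map_incl,
      map_incl, smul_distrib_smul, smul_incl, ha]
  | add x y hx hy => simp only [smul_add, map_add, hx, hy]

end Action

/-! For two factorisations `g ∘ f = g' ∘ f'` of one homomorphism, the canonical identification
`C ⊗ (B' ⊗ M) = C ⊗ (B'' ⊗ M)`. -/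

variable {f g} {f' : B →+*[G] B''} {g' : B'' →+*[G] C}

/-- The map `b' ⊗ m ↦ g b' ⊗ (1 ⊗ m)`. -/
def squareAux (H : ∀ b, g (f b) = g' (f' b)) (M : Type u) [AddCommGroup M] [Module B M] :
    BaseChange f M →ₛₗ[(g : B' →+* C)] BaseChange g' (BaseChange f' M) :=
  lift (h := (incl g').comp (incl f')) (fun b m => by
    change incl g' (incl f' (b • m)) = g (f b) • incl g' (incl f' m)
    rw [incl_smul, incl_smul, H])

lemma squareAux_incl (H : ∀ b, g (f b) = g' (f' b)) (m : M) :
    squareAux H M (incl f m) = incl g' (incl f' m) := by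
  unfold squareAux
  rw [lift_incl]
  rfl

/-- The map `c ⊗ (b' ⊗ m) ↦ (c * g b') ⊗ (1 ⊗ m)`. -/
def square (H : ∀ b, g (f b) = g' (f' b)) (M : Type u) [AddCommGroup M] [Module B M] :
    BaseChange g (BaseChange f M) →ₗ[C] BaseChange g' (BaseChange f' M) :=
  lift (h := (squareAux H M).toAddMonoidHom) (fun b m => (squareAux H M).map_smulₛₗ b m)

lemma square_incl (H : ∀ b, g (f b) = g' (f' b)) (m : M) :
    square H M (incl g (incl f m)) = incl g' (incl f' m) := by
  refine (lift_incl g _ _ _).trans ?_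
  exact squareAux_incl H m

lemma ext_incl_incl {a b : BaseChange g (BaseChange f M) →ₗ[C] P}
    (h : ∀ m, a (incl g (incl f m)) = b (incl g (incl f m))) : a = b := by
  refine ext_incl g (fun x => ?_)
  induction x using induction_on with
  | tmul b' m => rw [tmul_eq, incl_smul, map_smul, map_smul, h]
  | add x y hx hy => simp only [map_add, hx, hy]

lemma square_square (H : ∀ b, g (f b) = g' (f' b)) :
    (square (fun b => (H b).symm) M).comp (square H M) = LinearMap.id :=
  ext_incl_incl (fun m => by
    rw [LinearMap.comp_apply, square_incl, square_incl, LinearMap.id_apply])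

lemma square_natural (H : ∀ b, g (f b) = g' (f' b)) (a : M →ₗ[B] N) :
    (square H N).comp (map g (map f a)) = (map g' (map f' a)).comp (square H M) :=
  ext_incl_incl (fun m => by simp only [LinearMap.comp_apply, map_incl, square_incl])

lemma square_equivariant [DistribMulAction G M] [SMulDistribClass G B M]
    (H : ∀ b, g (f b) = g' (f' b)) (γ : G) (x : BaseChange g (BaseChange f M)) :
    square H M (γ • x) = γ • square H M x := by
  induction x using induction_on with
  | tmul c y =>
    induction y using induction_on with
    | tmul b' m =>
      simp only [tmul_eq, incl_smul, smul_distrib_smul, smul_incl, map_smul, square_incl]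
    | add y z hy hz =>
      simp only [tmul_add, smul_add, map_add, hy, hz]
  | add x y hx hy => simp only [smul_add, map_add, hx, hy]

end BaseChange

end BaseChange

/-! ### The category of modules with a semilinear group action -/

section SemilinRep

/-- A `B`-module with a semilinear action of the group `G`, where `G` acts on the ring `B`:
`g • (b • m) = (g • b) • (g • m)`. -/
structure SemilinRep (G : Type v) [Group G] (B : Type u) [CommRing B] [MulSemiringAction G B] where
  /-- The underlying type. -/
  carrier : Type u
  [addCommGroup : AddCommGroup carrier]
  [module : Module B carrier]
  [action : DistribMulAction G carrier]
  [semilinear : SMulDistribClass G B carrier]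

namespace SemilinRep

attribute [instance] addCommGroup module action semilinear

variable {G : Type v} [Group G] {B B' B'' C : Type u} [CommRing B] [MulSemiringAction G B]
  [CommRing B'] [MulSemiringAction G B'] [CommRing B''] [MulSemiringAction G B'']
  [CommRing C] [MulSemiringAction G C]

instance : CoeSort (SemilinRep G B) (Type u) := ⟨carrier⟩

/-- Morphisms are the `G`-equivariant `B`-linear maps. -/
@[ext]
structure Hom (M N : SemilinRep G B) where
  /-- The underlying linear map. -/
  toLin : M →ₗ[B] N
  equivariant : ∀ (g : G) (m : M), toLin (g • m) = g • toLin m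

instance : Category (SemilinRep G B) where
  Hom M N := Hom M N
  id M := ⟨LinearMap.id, fun _ _ => rfl⟩
  comp a b := ⟨b.toLin ∘ₗ a.toLin, fun g m => by simp [a.equivariant, b.equivariant]⟩

lemma hom_ext {M N : SemilinRep G B} {a b : M ⟶ N} (h : a.toLin = b.toLin) : a = b := Hom.ext h

/-- The base change functor `M ↦ B' ⊗[B] M`, with the diagonal action of `G`. -/
def baseChange (f : B →+*[G] B') : SemilinRep G B ⥤ SemilinRep G B' where
  obj M := { carrier := BaseChange f M }
  map a := ⟨BaseChange.map f a.toLin, BaseChange.map_equivariant f a.toLin a.equivariant⟩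
  map_id M := hom_ext (BaseChange.ext_incl f (fun m => BaseChange.map_incl f _ m))
  map_comp a b := hom_ext (BaseChange.ext_incl f (fun m => by
    refine (BaseChange.map_incl f _ m).trans ?_
    change _ = BaseChange.map f b.toLin (BaseChange.map f a.toLin (BaseChange.incl f m))
    rw [BaseChange.map_incl, BaseChange.map_incl]
    rfl))

/-- The canonical isomorphism `C ⊗ (B' ⊗ M) ≅ C ⊗ (B'' ⊗ M)` of base change functors attached to
a commutative square `g ∘ f = g' ∘ f'` of equivariant ring homomorphisms. -/
def squareIso (f : B →+*[G] B') (g : B' →+*[G] C) (f' : B →+*[G] B'') (g' : B'' →+*[G] C)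
    (H : ∀ b, g (f b) = g' (f' b)) :
    baseChange f ⋙ baseChange g ≅ baseChange f' ⋙ baseChange g' :=
  NatIso.ofComponents
    (fun M =>
      { hom := ⟨BaseChange.square H M, BaseChange.square_equivariant H⟩
        inv := ⟨BaseChange.square (fun b => (H b).symm) M,
          BaseChange.square_equivariant (fun b => (H b).symm)⟩
        hom_inv_id := hom_ext (BaseChange.square_square H)
        inv_hom_id := hom_ext (BaseChange.square_square (fun b => (H b).symm)) })
    (fun a => hom_ext (BaseChange.square_natural H a.toLin))

end SemilinRep

end SemilinRep

/-! ### Generalised representations and triviality modulo an element -/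

section GenRep

variable {G : Type v} [Group G] {B B' Bl Bl' : Type u} [CommRing B] [MulSemiringAction G B]
  [CommRing B'] [MulSemiringAction G B'] [CommRing Bl] [MulSemiringAction G Bl]
  [CommRing Bl'] [MulSemiringAction G Bl']

/-- Generalised representations: finite projective modules with a semilinear action which is
continuous for the `I`-adic topology, `I` being an ideal defining the topology of `B`. -/
structure IsGenRep [TopologicalSpace G] (I : Ideal B) (M : SemilinRep G B) : Prop where
  finite : Module.Finite B M
  projective : Module.Projective B M
  continuous : @Continuous (G × M) M
    (@instTopologicalSpaceProd G M _ (I.adicModuleTopology M)) (I.adicModuleTopology M)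
    (fun x => x.1 • x.2)

variable (G) in
/-- The subring `(B/J)^G` of `B/J` of classes fixed by `G`; here `J` is a `G`-stable ideal. -/
def invariantsRing (J : Ideal B) : Subring (B ⧸ J) where
  carrier := {x | ∃ b : B, Ideal.Quotient.mk J b = x ∧ ∀ g : G, g • b - b ∈ J}
  one_mem' := ⟨1, map_one _, fun g => by simp⟩
  zero_mem' := ⟨0, map_zero _, fun g => by simp⟩
  add_mem' := by
    rintro _ _ ⟨b, rfl, hb⟩ ⟨c, rfl, hc⟩
    refine ⟨b + c, map_add _ _ _, fun g => ?_⟩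
    rw [smul_add, add_sub_add_comm]
    exact J.add_mem (hb g) (hc g)
  neg_mem' := by
    rintro _ ⟨b, rfl, hb⟩
    refine ⟨-b, map_neg _ _, fun g => ?_⟩
    rw [smul_neg, neg_sub_neg, ← neg_sub]
    exact J.neg_mem (hb g)
  mul_mem' := by
    rintro _ _ ⟨b, rfl, hb⟩ ⟨c, rfl, hc⟩
    refine ⟨b * c, map_mul _ _ _, fun g => ?_⟩
    rw [smul_mul', show (g • b) * (g • c) - b * c = (g • b - b) * (g • c) + b * (g • c - c) by ring]
    exact J.add_mem (J.mul_mem_right _ (hb g)) (J.mul_mem_left _ (hc g))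

/-- The `(B/J)^G`-submodule `(M/J)^G` of `M/J` of classes fixed by `G`; here `J` is a `G`-stable
ideal. -/
def invariants (J : Ideal B) (M : SemilinRep G B) :
    Submodule (invariantsRing G J) (M ⧸ (J • ⊤ : Submodule B M)) where
  carrier := {x | ∃ m : M, Submodule.Quotient.mk m = x ∧
    ∀ g : G, g • m - m ∈ (J • ⊤ : Submodule B M)}
  zero_mem' := ⟨0, rfl, fun g => by simp⟩
  add_mem' := by
    rintro _ _ ⟨m, rfl, hm⟩ ⟨n, rfl, hn⟩
    refine ⟨m + n, rfl, fun g => ?_⟩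
    rw [smul_add, add_sub_add_comm]
    exact Submodule.add_mem _ (hm g) (hn g)
  smul_mem' := by
    rintro ⟨_, b, rfl, hb⟩ _ ⟨m, rfl, hm⟩
    refine ⟨b • m, rfl, fun g => ?_⟩
    rw [smul_distrib_smul, show (g • b) • (g • m) - b • m =
      (g • b - b) • (g • m) + b • (g • m - m) by rw [sub_smul, smul_sub]; abel]
    exact Submodule.add_mem _ (Submodule.smul_mem_smul (hb g) trivial)
      (Submodule.smul_mem _ _ (hm g))

/-- `M` is trivial modulo `b`: the `(B/b)^G`-module `(M/b)^G` is finite projective and the canonical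
map `(M/b)^G ⊗ B/b → M/b` is an isomorphism. -/
structure IsTrivialMod (b : B) (M : SemilinRep G B) : Prop where
  finite : Module.Finite (invariantsRing G (Ideal.span {b})) (invariants (Ideal.span {b}) M)
  projective :
    Module.Projective (invariantsRing G (Ideal.span {b})) (invariants (Ideal.span {b}) M)
  isBaseChange : IsBaseChange (B ⧸ Ideal.span {b}) (invariants (Ideal.span {b}) M).subtype

/-- The property defining `Rep_G^b(B)`: generalised representations which are trivial modulo `b`. -/
def repProp [TopologicalSpace G] (I : Ideal B) (b : B) : ObjectProperty (SemilinRep G B) :=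
  fun M => IsGenRep I M ∧ IsTrivialMod b M

/-- The category `Rep_G^b(B)`, a full subcategory of the semilinear representations. -/
abbrev Rep (G : Type v) [Group G] [TopologicalSpace G] {B : Type u} [CommRing B]
    [MulSemiringAction G B] (I : Ideal B) (b : B) :=
  (repProp (G := G) I b).FullSubcategory

/-- Base change along `f : B → B'` carries `Rep_G^b(B)` into `Rep_G^{b'}(B')` and is an equivalence
between these categories. -/
def IsRepEquivalence [TopologicalSpace G] (f : B →+*[G] B') (I : Ideal B) (I' : Ideal B')
    (b : B) (b' : B') : Prop :=
  ∃ h : ∀ M : SemilinRep G B, repProp I b M → repProp I' b' ((SemilinRep.baseChange f).obj M),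
    (show Rep G I b ⥤ Rep G I' b' from
      (repProp I' b').lift ((repProp I b).ι ⋙ SemilinRep.baseChange f)
        (fun M => h M.obj M.property)).IsEquivalence

/-! ### Frobenius structures -/

/-- A semilinear representation `M` over `B` with a Frobenius structure: an equivariant
isomorphism `(φ^* M) ⊗ Bl ≅ M ⊗ Bl` of `Bl`-modules, where `φ` is an equivariant endomorphism of `B`
and `l : B → Bl` (a localisation in the applications). -/
structure FrobRep (φ : B →+*[G] B) (l : B →+*[G] Bl) where
  /-- The underlying semilinear representation. -/
  M : SemilinRep G B
  /-- The Frobenius structure. -/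
  frob : (SemilinRep.baseChange l).obj ((SemilinRep.baseChange φ).obj M) ≅
    (SemilinRep.baseChange l).obj M

namespace FrobRep

variable {φ : B →+*[G] B} {l : B →+*[G] Bl} {φ' : B' →+*[G] B'} {l' : B' →+*[G] Bl'}

/-- Morphisms compatible with the Frobenius structures. -/
@[ext]
structure Hom (M N : FrobRep φ l) where
  /-- The underlying morphism of semilinear representations. -/
  hom : M.M ⟶ N.M
  comm : (SemilinRep.baseChange l).map ((SemilinRep.baseChange φ).map hom) ≫ N.frob.hom =
    M.frob.hom ≫ (SemilinRep.baseChange l).map hom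

instance : Category (FrobRep φ l) where
  Hom M N := Hom M N
  id M := ⟨𝟙 M.M, by simp⟩
  comp a b := ⟨a.hom ≫ b.hom, by
    simp only [Functor.map_comp, Category.assoc, b.comm]
    rw [← Category.assoc, a.comm, Category.assoc]⟩
  id_comp a := Hom.ext (Category.id_comp a.hom)
  comp_id a := Hom.ext (Category.comp_id a.hom)
  assoc a b c := Hom.ext (Category.assoc a.hom b.hom c.hom)

/-- The base change functor on representations with Frobenius structure, along `ι : B → B'` and
`ιl : Bl → Bl'` compatible with `φ`, `φ'` and `l`, `l'`. The Frobenius structure on the base change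
is `ιl^* frob`, under the canonical identifications. -/
def baseChange (ι : B →+*[G] B') (ιl : Bl →+*[G] Bl') (hφ : ∀ b, φ' (ι b) = ι (φ b))
    (hl : ∀ b, l' (ι b) = ιl (l b)) : FrobRep φ l ⥤ FrobRep φ' l' where
  obj M :=
    { M := (SemilinRep.baseChange ι).obj M.M
      frob := (SemilinRep.baseChange l').mapIso ((SemilinRep.squareIso ι φ' φ ι hφ).app M.M) ≪≫
        (SemilinRep.squareIso ι l' l ιl hl).app ((SemilinRep.baseChange φ).obj M.M) ≪≫
        (SemilinRep.baseChange ιl).mapIso M.frob ≪≫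
        ((SemilinRep.squareIso ι l' l ιl hl).app M.M).symm }
  map {M N} a :=
    { hom := (SemilinRep.baseChange ι).map a.hom
      comm := by
        have h1 := (SemilinRep.squareIso ι φ' φ ι hφ).hom.naturality a.hom
        have h2 := (SemilinRep.squareIso ι l' l ιl hl).hom.naturality
          ((SemilinRep.baseChange φ).map a.hom)
        have h3 := (SemilinRep.squareIso ι l' l ιl hl).inv.naturality a.hom
        simp only [Functor.comp_map] at h1 h2 h3
        simp only [Iso.trans_hom, Functor.mapIso_hom, Iso.app_hom, Iso.symm_hom, Iso.app_inv,
          Category.assoc]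
        rw [← h3, ← Category.assoc, ← Functor.map_comp, h1, Functor.map_comp, Category.assoc,
          ← Category.assoc _ ((SemilinRep.squareIso ι l' l ιl hl).hom.app _), h2, Category.assoc,
          ← Category.assoc ((SemilinRep.baseChange ιl).map _), ← Functor.map_comp, a.comm,
          Functor.map_comp, Category.assoc] }
  map_id M := Hom.ext ((SemilinRep.baseChange ι).map_id M.M)
  map_comp a b := Hom.ext ((SemilinRep.baseChange ι).map_comp a.hom b.hom)

end FrobRep

/-- The property defining `Rep_G^b(B, φ)`. -/
def frobRepProp [TopologicalSpace G] (φ : B →+*[G] B) (l : B →+*[G] Bl) (I : Ideal B) (b : B) :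
    ObjectProperty (FrobRep φ l) :=
  fun M => repProp I b M.M

/-- The category `Rep_G^b(B, φ)` of generalised representations, trivial modulo `b`, with a
Frobenius structure. -/
abbrev RepFrob [TopologicalSpace G] (φ : B →+*[G] B) (l : B →+*[G] Bl) (I : Ideal B) (b : B) :=
  (frobRepProp φ l I b).FullSubcategory

/-- Base change carries `Rep_G^b(B, φ)` into `Rep_G^{b'}(B', φ')` and is an equivalence between these
categories. -/
def IsRepFrobEquivalence [TopologicalSpace G] {φ : B →+*[G] B} {l : B →+*[G] Bl}
    {φ' : B' →+*[G] B'} {l' : B' →+*[G] Bl'} (ι : B →+*[G] B') (ιl : Bl →+*[G] Bl')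
    (hφ : ∀ b, φ' (ι b) = ι (φ b)) (hl : ∀ b, l' (ι b) = ιl (l b))
    (I : Ideal B) (I' : Ideal B') (b : B) (b' : B') : Prop :=
  ∃ h : ∀ M : FrobRep φ l, frobRepProp φ l I b M →
      frobRepProp φ' l' I' b' ((FrobRep.baseChange ι ιl hφ hl).obj M),
    (show RepFrob φ l I b ⥤ RepFrob φ' l' I' b' from
      (frobRepProp φ' l' I' b').lift
        ((frobRepProp φ l I b).ι ⋙ FrobRep.baseChange ι ιl hφ hl)
        (fun M => h M.obj M.property)).IsEquivalence

end GenRep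


/-! ### The rings of a framed small algebra -/

section Framing

variable (p : ℕ) [Fact p.Prime]

/-- `ℤ[1/p]` as an additive subgroup of `ℚ`. -/
def zInv : AddSubgroup ℚ where
  carrier := {q | ∃ (n : ℕ) (a : ℤ), (p : ℚ) ^ n * q = a}
  zero_mem' := ⟨0, 0, by simp⟩
  add_mem' := by
    rintro x y ⟨n, a, ha⟩ ⟨m, b, hb⟩
    refine ⟨n + m, p ^ m * a + p ^ n * b, ?_⟩
    push_cast
    rw [← ha, ← hb]
    ring
  neg_mem' := by
    rintro x ⟨n, a, ha⟩
    refine ⟨n, -a, ?_⟩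
    push_cast
    rw [← ha]
    ring

/-- Division by `p` on `ℤ[1/p]`. -/
def zInvDiv (x : zInv p) : zInv p :=
  ⟨x.1 / p, by
    obtain ⟨n, a, ha⟩ := x.2
    refine ⟨n + 1, a, ?_⟩
    have hp : (p : ℚ) ≠ 0 := Nat.cast_ne_zero.mpr (Fact.out : p.Prime).ne_zero
    rw [← ha, pow_succ]
    field_simp⟩

/-- The group of exponents `ℤ[1/p]^d`. -/
abbrev Expo (d : ℕ) : Type := Fin d → zInv p

/-- The inclusion `ℤ^d → ℤ[1/p]^d`. -/
def intExp (d : ℕ) : (Fin d → ℤ) →+ Expo p d where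
  toFun k i := ⟨(k i : ℚ), 0, k i, by simp⟩
  map_zero' := by
    funext i
    exact Subtype.ext (by simp)
  map_add' k l := by
    funext i
    exact Subtype.ext (by simp)

lemma intExp_injective (d : ℕ) : Function.Injective (intExp p d) := by
  intro k l h
  funext i
  have := congrArg (fun x : Expo p d => (x i).1) h
  exact Int.cast_injective (α := ℚ) this

/-- The exponent `k / p ^ n`. -/
def expDiv {d : ℕ} (k : Expo p d) : ℕ → Expo p d
  | 0 => k
  | n + 1 => fun i => zInvDiv p (expDiv k n i)

lemma nsmul_expDiv_succ {d : ℕ} (k : Expo p d) (n : ℕ) :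
    p • expDiv p k (n + 1) = expDiv p k n := by
  funext i
  refine Subtype.ext ?_
  have hp : (p : ℚ) ≠ 0 := Nat.cast_ne_zero.mpr (Fact.out : p.Prime).ne_zero
  simp only [Pi.smul_apply, AddSubgroup.coe_nsmul, nsmul_eq_mul]
  change (p : ℚ) * ((expDiv p k n i).1 / p) = _
  field_simp

lemma expDiv_add {d : ℕ} (k l : Expo p d) (n : ℕ) :
    expDiv p (k + l) n = expDiv p k n + expDiv p l n := by
  induction n with
  | zero => rfl
  | succ n ih =>
    funext i
    refine Subtype.ext ?_
    change (expDiv p (k + l) n i).1 / (p : ℚ) =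
      (expDiv p k n i).1 / (p : ℚ) + (expDiv p l n i).1 / (p : ℚ)
    rw [ih, ← add_div]
    rfl

lemma expDiv_zero_left {d : ℕ} (n : ℕ) : expDiv p (0 : Expo p d) n = 0 := by
  induction n with
  | zero => rfl
  | succ n ih =>
    funext i
    refine Subtype.ext ?_
    change (expDiv p (0 : Expo p d) n i).1 / (p : ℚ) = 0
    rw [ih]
    simp

variable (O : Type u) [CommRing O] (d : ℕ)

/-- The homomorphisms `ℤ[1/p]^d → O^×` which are trivial on `ℤ^d`. -/
def gamSubgroup : Subgroup (Multiplicative (Expo p d) →* Oˣ) where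
  carrier := {χ | ∀ k : Fin d → ℤ, χ (Multiplicative.ofAdd (intExp p d k)) = 1}
  one_mem' _ := rfl
  mul_mem' := by
    intro a b ha hb k
    rw [MonoidHom.mul_apply, ha, hb, one_mul]
  inv_mem' := by
    intro a ha k
    rw [MonoidHom.inv_apply, ha, inv_one]

/-- The group `Γ = ℤ_p(1)^d = Hom((ℚ_p/ℤ_p)^d, μ_{p^∞})`. Here `ℚ_p/ℤ_p = ℤ[1/p]/ℤ`, and homomorphisms
from `(ℤ[1/p]/ℤ)^d` to `O^×` automatically have values in `p`-power roots of unity. -/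
def Gam : Type u := gamSubgroup p O d

namespace Gam

instance : CommGroup (Gam p O d) := inferInstanceAs (CommGroup (gamSubgroup p O d))

variable {p O d}

/-- The root of unity `γ(k)`. -/
def eval (γ : Gam p O d) (k : Expo p d) : Oˣ := γ.1 (Multiplicative.ofAdd k)

lemma eval_intExp (γ : Gam p O d) (k : Fin d → ℤ) : γ.eval (intExp p d k) = 1 := γ.2 k

lemma eval_zero (γ : Gam p O d) : γ.eval 0 = 1 := map_one γ.1

lemma eval_add (γ : Gam p O d) (k l : Expo p d) : γ.eval (k + l) = γ.eval k * γ.eval l :=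
  map_mul γ.1 (Multiplicative.ofAdd k) (Multiplicative.ofAdd l)

lemma one_eval (k : Expo p d) : (1 : Gam p O d).eval k = 1 := rfl

lemma mul_eval (γ δ : Gam p O d) (k : Expo p d) : (γ * δ).eval k = γ.eval k * δ.eval k := rfl

/-- The profinite topology of `Γ`: the topology of pointwise convergence, for the discrete topology
on the roots of unity. -/
instance : TopologicalSpace (Gam p O d) :=
  TopologicalSpace.induced (fun γ k => γ.eval k)
    (@Pi.topologicalSpace (Expo p d) (fun _ => Oˣ) (fun _ => ⊥))

end Gam

/-- The Laurent polynomial ring `O[T_1^{±1}, …, T_d^{±1}]`. -/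
abbrev Laurent : Type u := AddMonoidAlgebra O (Fin d → ℤ)

/-- The ring `O[T_1^{±1/p^∞}, …, T_d^{±1/p^∞}]`. -/
abbrev LaurentRoot : Type u := AddMonoidAlgebra O (Expo p d)

/-- The inclusion of Laurent polynomial rings. -/
def laurentIncl : Laurent O d →+* LaurentRoot p O d :=
  AddMonoidAlgebra.mapDomainRingHom O (intExp p d)

instance : Algebra (Laurent O d) (LaurentRoot p O d) := (laurentIncl p O d).toAlgebra

/-- `O⟨T_1^{±1}, …, T_d^{±1}⟩`, the `p`-adic completion of the Laurent polynomial ring. -/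
abbrev TateLaurent : Type u :=
  AdicCompletion (Ideal.span {(p : Laurent O d)}) (Laurent O d)

/-- The canonical map from Laurent polynomials to the completion. -/
def toTate : Laurent O d →+* TateLaurent p O d :=
  (algebraMap (Laurent O d) (TateLaurent p O d))

variable {p O d} {R : Type u} [CommRing R]

/-- The ring `R`, viewed as an algebra over the Laurent polynomial ring through the homomorphism
`sq : O⟨T^{±1}⟩ → R`. -/
def FrAlg (_sq : TateLaurent p O d →+* R) : Type u := R

variable (sq : TateLaurent p O d →+* R)

instance : CommRing (FrAlg sq) := inferInstanceAs (CommRing R)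

/-- The identity map `R → R`. -/
def toFrAlg : R →+* FrAlg sq := RingHom.id R

instance : Algebra (Laurent O d) (FrAlg sq) :=
  RingHom.toAlgebra ((toFrAlg sq).comp (sq.comp (toTate p O d)))

/-- `R ⊗ O[T^{±1/p^∞}]` over `O[T^{±1}]`. This has the same `p`-adic completion as the colimit of the
rings `R ⊗ O⟨T^{±1/p^j}⟩` over `O⟨T^{±1}⟩`, because `O⟨T^{±1/p^j}⟩` is the base change of
`O[T^{±1/p^j}]`, which is finite free over `O[T^{±1}]`. -/
abbrev RInf0 : Type u := TensorProduct (Laurent O d) (FrAlg sq) (LaurentRoot p O d)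

/-- The ring `R_∞`, the `p`-adic completion of `R ⊗ O[T^{±1/p^∞}]`. -/
def RInf : Type u := AdicCompletion (Ideal.span {(p : RInf0 sq)}) (RInf0 sq)

instance : CommRing (RInf sq) :=
  inferInstanceAs (CommRing (AdicCompletion (Ideal.span {(p : RInf0 sq)}) (RInf0 sq)))

/-- The canonical map to the completion. -/
def toRInf : RInf0 sq →+* RInf sq :=
  algebraMap (RInf0 sq) (AdicCompletion (Ideal.span {(p : RInf0 sq)}) (RInf0 sq))

/-- The canonical map `R → R_∞`. -/
def baseRInf : R →+* RInf sq :=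
  (toRInf sq).comp
    ((Algebra.TensorProduct.includeLeftRingHom : FrAlg sq →+* RInf0 sq).comp (toFrAlg sq))

/-- The monomial `T^k` in `R_∞`, for `k` in `ℤ[1/p]^d`. -/
def monRInf (k : Expo p d) : RInf sq :=
  toRInf sq (1 ⊗ₜ AddMonoidAlgebra.single k 1)

/-- The structure map `O → R_∞`. -/
def constRInf : O →+* RInf sq :=
  (baseRInf sq).comp ((sq.comp (toTate p O d)).comp AddMonoidAlgebra.singleZeroRingHom)

end Framing

/-! ### Functoriality of completions, tilts and `A_inf` -/

section Functoriality

variable (p : ℕ) {S T U : Type u} [CommRing S] [CommRing T] [CommRing U]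

lemma span_p_pow_le (f : S →+* T) (n : ℕ) :
    (Ideal.span {(p : S)}) ^ n ≤ ((Ideal.span {(p : T)}) ^ n).comap f := by
  rw [← Ideal.map_le_iff_le_comap, Ideal.map_pow, Ideal.map_span, Set.image_singleton, map_natCast]

/-- The map from the `p`-adic completion of `S` to `T/p^n` induced by `f : S → T`. -/
def pComplMapAux (f : S →+* T) (n : ℕ) :
    AdicCompletion (Ideal.span {(p : S)}) S →+* T ⧸ (Ideal.span {(p : T)}) ^ n :=
  (Ideal.quotientMap ((Ideal.span {(p : T)}) ^ n) f (span_p_pow_le p f n)).comp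
    (AdicCompletion.evalₐ (Ideal.span {(p : S)}) n).toRingHom

lemma pComplMapAux_factor (f : S →+* T) {m n : ℕ} (hmn : m ≤ n) :
    (Ideal.Quotient.factorPow (Ideal.span {(p : T)}) hmn).comp (pComplMapAux p f n) =
      pComplMapAux p f m := by
  refine RingHom.ext (fun x => ?_)
  obtain ⟨y, rfl⟩ := AdicCompletion.mk_surjective _ _ x
  simp only [pComplMapAux, RingHom.comp_apply, AlgHom.toRingHom_eq_coe, RingHom.coe_coe,
    AdicCompletion.evalₐ_mk, Ideal.quotientMap_mk]
  change Ideal.Quotient.mk _ _ = _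
  rw [Ideal.Quotient.eq, ← map_sub]
  refine span_p_pow_le p f m ?_
  have := (y.2 hmn).symm
  rw [SModEq, Submodule.Quotient.eq] at this
  simpa using this

/-- The map induced on `p`-adic completions. -/
def pComplMap (f : S →+* T) :
    AdicCompletion (Ideal.span {(p : S)}) S →+* AdicCompletion (Ideal.span {(p : T)}) T :=
  AdicCompletion.liftRingHom (Ideal.span {(p : T)}) (pComplMapAux p f) (pComplMapAux_factor p f)

lemma evalₐ_pComplMap (f : S →+* T) (n : ℕ) (x) :
    AdicCompletion.evalₐ (Ideal.span {(p : T)}) n (pComplMap p f x) =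
      Ideal.quotientMap ((Ideal.span {(p : T)}) ^ n) f (span_p_pow_le p f n)
        (AdicCompletion.evalₐ (Ideal.span {(p : S)}) n x) :=
  AdicCompletion.evalₐ_liftRingHom (Ideal.span {(p : T)}) (pComplMapAux p f)
    (pComplMapAux_factor p f) n x

lemma pComplMap_id (x) : pComplMap p (RingHom.id S) x = x := by
  refine AdicCompletion.ext_evalₐ (fun n => ?_)
  rw [evalₐ_pComplMap]
  obtain ⟨y, hy⟩ := Ideal.Quotient.mk_surjective (AdicCompletion.evalₐ (Ideal.span {(p : S)}) n x)
  rw [← hy, Ideal.quotientMap_mk, RingHom.id_apply]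

lemma pComplMap_comp (f : S →+* T) (g : T →+* U) (x) :
    pComplMap p (g.comp f) x = pComplMap p g (pComplMap p f x) := by
  refine AdicCompletion.ext_evalₐ (fun n => ?_)
  rw [evalₐ_pComplMap, evalₐ_pComplMap, evalₐ_pComplMap]
  obtain ⟨y, hy⟩ := Ideal.Quotient.mk_surjective (AdicCompletion.evalₐ (Ideal.span {(p : S)}) n x)
  rw [← hy, Ideal.quotientMap_mk, Ideal.quotientMap_mk, Ideal.quotientMap_mk, RingHom.comp_apply]

lemma pComplMap_algebraMap (f : S →+* T) (x : S) :
    pComplMap p f (algebraMap S (AdicCompletion (Ideal.span {(p : S)}) S) x) =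
      algebraMap T (AdicCompletion (Ideal.span {(p : T)}) T) (f x) := by
  refine AdicCompletion.ext_evalₐ (fun n => ?_)
  rw [evalₐ_pComplMap, AlgHom.commutes, AlgHom.commutes]
  exact Ideal.quotientMap_mk

variable [Fact p.Prime]

/-- The map induced on reductions modulo `p`. -/
def modPMap (f : S →+* T) : ModP S p →+* ModP T p :=
  Ideal.quotientMap (Ideal.span {(p : T)}) f (by
    rw [← Ideal.map_le_iff_le_comap, Ideal.map_span, Set.image_singleton, map_natCast])

lemma modPMap_mk (f : S →+* T) (x : S) :
    modPMap p f (Ideal.Quotient.mk (Ideal.span {(p : S)}) x) =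
      Ideal.Quotient.mk (Ideal.span {(p : T)}) (f x) := rfl

lemma modPMap_id (x : ModP S p) : modPMap p (RingHom.id S) x = x := by
  obtain ⟨y, rfl⟩ := Ideal.Quotient.mk_surjective x
  rfl

lemma modPMap_comp (f : S →+* T) (g : T →+* U) (x : ModP S p) :
    modPMap p (g.comp f) x = modPMap p g (modPMap p f x) := by
  obtain ⟨y, rfl⟩ := Ideal.Quotient.mk_surjective x
  rfl

variable [Fact (¬IsUnit (p : S))] [Fact (¬IsUnit (p : T))] [Fact (¬IsUnit (p : U))]

/-- The map induced on tilts. -/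
def tiltMap (f : S →+* T) : PreTilt S p →+* PreTilt T p := Perfection.map p (modPMap p f)

lemma coeff_tiltMap (f : S →+* T) (x : PreTilt S p) (n : ℕ) :
    PreTilt.coeff n (tiltMap p f x) = modPMap p f (PreTilt.coeff n x) := rfl

lemma tilt_ext {x y : PreTilt S p} (h : ∀ n, PreTilt.coeff n x = PreTilt.coeff n y) : x = y :=
  Perfection.ext h

lemma tiltMap_id (x : PreTilt S p) : tiltMap p (RingHom.id S) x = x :=
  tilt_ext p (fun n => by rw [coeff_tiltMap, modPMap_id])

lemma tiltMap_comp (f : S →+* T) (g : T →+* U) (x : PreTilt S p) :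
    tiltMap p (g.comp f) x = tiltMap p g (tiltMap p f x) :=
  tilt_ext p (fun n => by rw [coeff_tiltMap, coeff_tiltMap, coeff_tiltMap, modPMap_comp])

variable (S) in
/-- Fontaine's ring `A_inf(S) = W(S^♭)`. -/
abbrev AInf : Type u := WittVector p (PreTilt S p)

/-- The map induced on `A_inf`. -/
def aInfMap (f : S →+* T) : AInf p S →+* AInf p T := WittVector.map (tiltMap p f)

lemma coeff_aInfMap (f : S →+* T) (x : AInf p S) (n : ℕ) :
    (aInfMap p f x).coeff n = tiltMap p f (x.coeff n) := WittVector.map_coeff _ _ _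

lemma aInfMap_id (x : AInf p S) : aInfMap p (RingHom.id S) x = x :=
  WittVector.ext (fun n => by rw [coeff_aInfMap, tiltMap_id])

lemma aInfMap_comp (f : S →+* T) (g : T →+* U) (x : AInf p S) :
    aInfMap p (g.comp f) x = aInfMap p g (aInfMap p f x) :=
  WittVector.ext (fun n => by rw [coeff_aInfMap, coeff_aInfMap, coeff_aInfMap, tiltMap_comp])

lemma aInfMap_frobenius (f : S →+* T) (x : AInf p S) :
    aInfMap p f (WittVector.frobenius x) = WittVector.frobenius (aInfMap p f x) := by
  refine WittVector.ext (fun n => ?_)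
  rw [coeff_aInfMap, WittVector.coeff_frobenius_charP, WittVector.coeff_frobenius_charP,
    coeff_aInfMap, map_pow]

end Functoriality

/-! ### The action of `Γ` on `R_∞` -/

section Action

variable {p : ℕ} [Fact p.Prime] {O : Type u} [CommRing O] {d : ℕ}

/-- The ring endomorphism `T^k ↦ γ(k) T^k` of `O[T^{±1/p^∞}]`. -/
def actLaurentRootHom (γ : Gam p O d) : LaurentRoot p O d →+* LaurentRoot p O d :=
  AddMonoidAlgebra.liftNCRingHom AddMonoidAlgebra.singleZeroRingHom
    { toFun := fun k => AddMonoidAlgebra.single k.toAdd (γ.eval k.toAdd : O)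
      map_one' := by simp [Gam.eval_zero, AddMonoidAlgebra.one_def]
      map_mul' := fun k l => by
        simp [Gam.eval_add, AddMonoidAlgebra.single_mul_single] }
    (fun _ _ => Commute.all _ _)

lemma actLaurentRootHom_single (γ : Gam p O d) (k : Expo p d) (a : O) :
    actLaurentRootHom γ (AddMonoidAlgebra.single k a) =
      AddMonoidAlgebra.single k ((γ.eval k : O) * a) := by
  unfold actLaurentRootHom
  rw [AddMonoidAlgebra.liftNCRingHom_single]
  change AddMonoidAlgebra.single 0 a * AddMonoidAlgebra.single k (γ.eval k : O) = _
  rw [AddMonoidAlgebra.single_mul_single, zero_add, mul_comm]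

/-- The action of `γ` on `O[T^{±1/p^∞}]`, which is linear over the Laurent polynomials. -/
def actLaurentRoot (γ : Gam p O d) : LaurentRoot p O d →ₐ[Laurent O d] LaurentRoot p O d :=
  { actLaurentRootHom γ with
    commutes' := by
      intro x
      change actLaurentRootHom γ (AddMonoidAlgebra.mapDomainRingHom O (intExp p d) x) =
        AddMonoidAlgebra.mapDomainRingHom O (intExp p d) x
      rw [← RingHom.comp_apply]
      congr 1
      refine AddMonoidAlgebra.ringHom_ext (fun r => ?_) (fun m => ?_)
      · simp [actLaurentRootHom_single, Gam.eval_zero]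
      · simp [actLaurentRootHom_single, Gam.eval_intExp] }

lemma actLaurentRoot_single (γ : Gam p O d) (k : Expo p d) (a : O) :
    actLaurentRoot γ (AddMonoidAlgebra.single k a) =
      AddMonoidAlgebra.single k ((γ.eval k : O) * a) :=
  actLaurentRootHom_single γ k a

@[elab_as_elim]
lemma LaurentRoot.induction {P : LaurentRoot p O d → Prop} (x : LaurentRoot p O d)
    (single : ∀ k a, P (AddMonoidAlgebra.single k a))
    (add : ∀ x y, P x → P y → P (x + y)) : P x := by
  refine AddMonoidAlgebra.induction_linear (motive := P) x ?_ add single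
  have := single 0 0
  rwa [AddMonoidAlgebra.single_zero] at this

lemma actLaurentRoot_one : actLaurentRoot (1 : Gam p O d) = AlgHom.id _ _ := by
  refine AlgHom.ext (fun x => ?_)
  induction x using LaurentRoot.induction with
  | single k a => rw [actLaurentRoot_single, Gam.one_eval, Units.val_one, one_mul]; rfl
  | add x y hx hy => rw [map_add, hx, hy, map_add]

lemma actLaurentRoot_mul (γ δ : Gam p O d) :
    actLaurentRoot (γ * δ) = (actLaurentRoot γ).comp (actLaurentRoot δ) := by
  refine AlgHom.ext (fun x => ?_)
  induction x using LaurentRoot.induction with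
  | single k a =>
    rw [AlgHom.comp_apply, actLaurentRoot_single, actLaurentRoot_single, actLaurentRoot_single,
      Gam.mul_eval, Units.val_mul, mul_assoc]
  | add x y hx hy => rw [map_add, hx, hy, map_add]

variable {R : Type u} [CommRing R] (sq : TateLaurent p O d →+* R)

/-- The action of `γ` on `R ⊗ O[T^{±1/p^∞}]`: `r ⊗ x ↦ r ⊗ γ x`. -/
def actRInf0 (γ : Gam p O d) : RInf0 sq →+* RInf0 sq :=
  (Algebra.TensorProduct.map (AlgHom.id (Laurent O d) (FrAlg sq)) (actLaurentRoot γ)).toRingHom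

lemma actRInf0_tmul (γ : Gam p O d) (r : FrAlg sq) (x : LaurentRoot p O d) :
    actRInf0 sq γ (r ⊗ₜ x) = r ⊗ₜ actLaurentRoot γ x := rfl

lemma actRInf0_one : actRInf0 sq (1 : Gam p O d) = RingHom.id _ := by
  refine RingHom.ext (fun x => ?_)
  induction x using TensorProduct.induction_on with
  | zero => simp
  | tmul r x => rw [actRInf0_tmul, actLaurentRoot_one]; rfl
  | add x y hx hy => rw [map_add, hx, hy, map_add]

lemma actRInf0_mul (γ δ : Gam p O d) :
    actRInf0 sq (γ * δ) = (actRInf0 sq γ).comp (actRInf0 sq δ) := by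
  refine RingHom.ext (fun x => ?_)
  induction x using TensorProduct.induction_on with
  | zero => simp
  | tmul r x =>
    rw [RingHom.comp_apply, actRInf0_tmul, actRInf0_tmul, actRInf0_tmul, actLaurentRoot_mul]
    rfl
  | add x y hx hy => rw [map_add, hx, hy, map_add]

/-- The action of `γ` on `R_∞`, the continuous `R`-linear extension of `T^k ↦ γ(k) T^k`. -/
def actRInf (γ : Gam p O d) : RInf sq →+* RInf sq := pComplMap p (actRInf0 sq γ)

lemma actRInf_one : actRInf sq (1 : Gam p O d) = RingHom.id _ := by
  refine RingHom.ext (fun x => ?_)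
  unfold actRInf
  rw [actRInf0_one]
  exact pComplMap_id p _

lemma actRInf_mul (γ δ : Gam p O d) :
    actRInf sq (γ * δ) = (actRInf sq γ).comp (actRInf sq δ) := by
  refine RingHom.ext (fun x => ?_)
  unfold actRInf
  rw [actRInf0_mul]
  exact pComplMap_comp p _ _ _

lemma actRInf_toRInf (γ : Gam p O d) (x : RInf0 sq) :
    actRInf sq γ (toRInf sq x) = toRInf sq (actRInf0 sq γ x) :=
  pComplMap_algebraMap p _ x

lemma actRInf_baseRInf (γ : Gam p O d) (r : R) :
    actRInf sq γ (baseRInf sq r) = baseRInf sq r := by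
  unfold baseRInf
  rw [RingHom.comp_apply, actRInf_toRInf]
  congr 1
  change actRInf0 sq γ (toFrAlg sq r ⊗ₜ 1) = toFrAlg sq r ⊗ₜ 1
  rw [actRInf0_tmul, map_one]

lemma constRInf_eq (a : O) :
    constRInf sq a = toRInf sq (1 ⊗ₜ AddMonoidAlgebra.single 0 a) := by
  have h1 : (AddMonoidAlgebra.single 0 a : LaurentRoot p O d) =
      algebraMap (Laurent O d) (LaurentRoot p O d) (AddMonoidAlgebra.single 0 a) := by
    change _ = AddMonoidAlgebra.mapDomainRingHom O (intExp p d) _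
    simp
  rw [h1, Algebra.algebraMap_eq_smul_one, ← TensorProduct.smul_tmul,
    ← Algebra.algebraMap_eq_smul_one]
  rfl

lemma actRInf_monRInf (γ : Gam p O d) (k : Expo p d) :
    actRInf sq γ (monRInf sq k) = constRInf sq (γ.eval k : O) * monRInf sq k := by
  unfold monRInf
  rw [actRInf_toRInf, actRInf0_tmul, constRInf_eq, ← map_mul, Algebra.TensorProduct.tmul_mul_tmul,
    one_mul, actLaurentRoot_single, mul_one, AddMonoidAlgebra.single_mul_single, zero_add, mul_one]

lemma monRInf_zero : monRInf sq (0 : Expo p d) = 1 := map_one (toRInf sq)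

lemma monRInf_add (k l : Expo p d) : monRInf sq (k + l) = monRInf sq k * monRInf sq l := by
  unfold monRInf
  rw [← map_mul, Algebra.TensorProduct.tmul_mul_tmul, one_mul, AddMonoidAlgebra.single_mul_single,
    mul_one]

lemma monRInf_nsmul (n : ℕ) (k : Expo p d) : monRInf sq (n • k) = monRInf sq k ^ n := by
  induction n with
  | zero => rw [zero_smul, pow_zero, monRInf_zero]
  | succ n ih => rw [succ_nsmul, monRInf_add, ih, pow_succ]

end Action

/-! ### `R_∞` is `p`-adically complete, and `p` is not a unit in it -/

section Facts

variable {p : ℕ} [Fact p.Prime]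

lemma not_isUnit_of_isAdicComplete {R : Type u} [CommRing R] [Nontrivial R]
    [IsAdicComplete (Ideal.span {(p : R)}) R] : ¬IsUnit (p : R) := by
  intro h
  have h1 : (p : R) ∈ (⊥ : Ideal R).jacobson :=
    IsAdicComplete.le_jacobson_bot (Ideal.span {(p : R)}) (Ideal.mem_span_singleton_self _)
  exact Ideal.jacobson_eq_top_iff.not.mpr bot_ne_top (Ideal.eq_top_of_isUnit_mem _ h1 h)

variable {O : Type u} [CommRing O] {d : ℕ}

lemma comapDomain_single_eq_zero {k : Expo p d} (a : O) (hk : k ∉ Set.range (intExp p d)) :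
    AddMonoidAlgebra.comapDomain (intExp p d) (intExp_injective p d)
      (AddMonoidAlgebra.single k a) = 0 := by
  refine AddMonoidAlgebra.ext (Finsupp.ext (fun m => ?_))
  rw [AddMonoidAlgebra.coeff_comapDomain, Finsupp.comapDomain_apply, AddMonoidAlgebra.coeff_single,
    Finsupp.single_apply, if_neg (fun h => hk ⟨m, h.symm⟩)]
  rfl

/-- The projection of `O[T^{±1/p^∞}]` onto its part with integral exponents. -/
def laurentRetract : LaurentRoot p O d →ₗ[Laurent O d] Laurent O d where
  toFun := AddMonoidAlgebra.comapDomainAddMonoidHom (intExp p d) (intExp_injective p d)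
  map_add' := map_add _
  map_smul' := by
    intro l x
    simp only [RingHom.id_apply, Algebra.smul_def]
    change AddMonoidAlgebra.comapDomain (intExp p d) (intExp_injective p d)
      (AddMonoidAlgebra.mapDomainRingHom O (intExp p d) l * x) =
      l * AddMonoidAlgebra.comapDomain (intExp p d) (intExp_injective p d) x
    induction l using AddMonoidAlgebra.induction_linear with
    | zero => simp
    | add a b ha hb => rw [map_add, add_mul, add_mul, AddMonoidAlgebra.comapDomain_add, ha, hb]
    | single m r =>
      induction x using LaurentRoot.induction with
      | add a b ha hb =>
        rw [mul_add, AddMonoidAlgebra.comapDomain_add, AddMonoidAlgebra.comapDomain_add, mul_add,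
          ha, hb]
      | single k a =>
        simp only [AddMonoidAlgebra.mapDomainRingHom_apply, AddMonoidAlgebra.mapDomain_single]
        rw [AddMonoidAlgebra.single_mul_single]
        by_cases hk : k ∈ Set.range (intExp p d)
        · obtain ⟨n, rfl⟩ := hk
          rw [← map_add, AddMonoidAlgebra.comapDomain_single_map,
            AddMonoidAlgebra.comapDomain_single_map, AddMonoidAlgebra.single_mul_single]
        · rw [comapDomain_single_eq_zero a hk, comapDomain_single_eq_zero, mul_zero]
          rintro ⟨n, hn⟩
          exact hk ⟨n - m, by rw [map_sub, hn, add_sub_cancel_left]⟩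

lemma laurentRetract_one : laurentRetract (1 : LaurentRoot p O d) = 1 := by
  have h := AddMonoidAlgebra.comapDomain_single_map (intExp p d) (intExp_injective p d) 0 (1 : O)
  rw [map_zero] at h
  exact h

variable {R : Type u} [CommRing R] (sq : TateLaurent p O d →+* R)

/-- The projection of `R ⊗ O[T^{±1/p^∞}]` onto `R`. -/
def retractRInf0 : RInf0 sq →ₗ[Laurent O d] FrAlg sq :=
  (TensorProduct.rid (Laurent O d) (FrAlg sq)).toLinearMap ∘ₗ
    LinearMap.lTensor (FrAlg sq) laurentRetract

lemma retractRInf0_one : retractRInf0 sq 1 = 1 := by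
  rw [Algebra.TensorProduct.one_def]
  simp [retractRInf0, laurentRetract_one]

variable [Nontrivial R] [IsAdicComplete (Ideal.span {(p : R)}) R]

instance : Fact (¬IsUnit (p : RInf sq)) := ⟨by
  intro h
  have h1 : IsUnit ((p : RInf0 sq ⧸ (Ideal.span {(p : RInf0 sq)}) ^ 1)) := by
    have := RingHom.isUnit_map
      (AdicCompletion.evalₐ (Ideal.span {(p : RInf0 sq)}) 1).toRingHom h
    exact (map_natCast (AdicCompletion.evalₐ (Ideal.span {(p : RInf0 sq)}) 1).toRingHom p) ▸ this
  have h2 : (p : RInf0 sq ⧸ (Ideal.span {(p : RInf0 sq)}) ^ 1) = 0 := by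
    rw [← map_natCast (Ideal.Quotient.mk ((Ideal.span {(p : RInf0 sq)}) ^ 1)),
      Ideal.Quotient.eq_zero_iff_mem, pow_one]
    exact Ideal.mem_span_singleton_self _
  rw [h2, isUnit_zero_iff, ← map_one (Ideal.Quotient.mk _), eq_comm,
    Ideal.Quotient.eq_zero_iff_mem, pow_one, Ideal.mem_span_singleton] at h1
  obtain ⟨x, hx⟩ := h1
  have h3 := congrArg (retractRInf0 sq) hx
  rw [retractRInf0_one, ← nsmul_eq_mul, map_nsmul, nsmul_eq_mul] at h3
  exact not_isUnit_of_isAdicComplete (R := R) (p := p) (IsUnit.of_mul_eq_one _ h3.symm)⟩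

instance : IsAdicComplete (Ideal.span {(p : RInf sq)}) (RInf sq) := by
  have h := AdicCompletion.isAdicComplete_self (Ideal.span {(p : RInf0 sq)})
    ⟨{(p : RInf0 sq)}, by simp⟩
  rwa [Ideal.map_span, Set.image_singleton, map_natCast] at h

end Facts

/-! ### The elements `ε`, `μ`, `ξ` and `ξ̃` -/

section Elements

/-- A compatible system `1, ζ_p, ζ_{p²}, …` of primitive `p`-power roots of unity. -/
structure PRoots (p : ℕ) (O : Type u) [CommRing O] where
  /-- The root of unity of order `p ^ n`. -/
  zeta : ℕ → O
  primitive : ∀ n, IsPrimitiveRoot (zeta n) (p ^ n)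
  pow_succ : ∀ n, zeta (n + 1) ^ p = zeta n

namespace PRoots

variable {p : ℕ} [Fact p.Prime] {O : Type u} [CommRing O] [Fact (¬IsUnit (p : O))] (ζ : PRoots p O)

/-- `ε = (1, ζ_p, ζ_{p²}, …)` in `O^♭`. -/
def eps : PreTilt O p :=
  (⟨fun n => Ideal.Quotient.mk (Ideal.span {(p : O)}) (ζ.zeta n), fun n => by
    rw [← map_pow, ζ.pow_succ]⟩ : Perfection (ModP O p) p)

/-- `ε^{1/p}`. -/
def epsRoot : PreTilt O p := (frobeniusEquiv (PreTilt O p) p).symm ζ.eps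

/-- `μ = [ε] - 1`. -/
def mu : AInf p O := WittVector.teichmuller p ζ.eps - 1

/-- `φ⁻¹(μ)`. -/
def phiInvMu : AInf p O := (WittVector.frobeniusEquiv p (PreTilt O p)).symm ζ.mu

/-- `ξ = μ / φ⁻¹(μ) = 1 + [ε^{1/p}] + ⋯ + [ε^{1/p}]^{p-1}`. -/
def xi : AInf p O := ∑ i ∈ Finset.range p, WittVector.teichmuller p ζ.epsRoot ^ i

/-- `ξ̃ = φ(ξ)`. -/
def xiTilde : AInf p O := WittVector.frobenius ζ.xi

lemma frobenius_teichmuller {A : Type u} [CommRing A] [CharP A p] (x : A) :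
    WittVector.frobenius (WittVector.teichmuller p x) = WittVector.teichmuller p (x ^ p) := by
  rw [WittVector.frobenius_eq_map_frobenius, WittVector.map_teichmuller]
  rfl

lemma phiInvMu_eq : ζ.phiInvMu = WittVector.teichmuller p ζ.epsRoot - 1 := by
  unfold phiInvMu
  rw [RingEquiv.symm_apply_eq]
  change _ = WittVector.frobenius _
  rw [map_sub, map_one, frobenius_teichmuller, epsRoot, frobeniusEquiv_symm_pow_p]
  rfl

lemma xi_mul_phiInvMu : ζ.xi * ζ.phiInvMu = ζ.mu := by
  rw [phiInvMu_eq, xi, geom_sum_mul, ← map_pow, epsRoot, frobeniusEquiv_symm_pow_p]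
  rfl

end PRoots

end Elements

/-! ### `A_inf(R_∞)` -/

section PeriodRings

variable {p : ℕ} [Fact p.Prime] {O : Type u} [CommRing O] [Fact (¬IsUnit (p : O))] {d : ℕ}
  {R : Type u} [CommRing R] [Nontrivial R] [IsAdicComplete (Ideal.span {(p : R)}) R]
  (sq : TateLaurent p O d →+* R)

/-- The ring `A_inf(R_∞) = W(R_∞^♭)`. -/
abbrev AInfR : Type u := AInf p (RInf sq)

/-- The action of `Γ` on `A_inf(R_∞)` induced by the action on `R_∞`. -/
instance : MulSemiringAction (Gam p O d) (AInfR sq) where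
  smul γ x := aInfMap p (actRInf sq γ) x
  one_smul x := by
    change aInfMap p (actRInf sq 1) x = x
    rw [actRInf_one, aInfMap_id]
  mul_smul γ δ x := by
    change aInfMap p (actRInf sq (γ * δ)) x = aInfMap p (actRInf sq γ) (aInfMap p (actRInf sq δ) x)
    rw [actRInf_mul, aInfMap_comp]
  smul_zero γ := map_zero (aInfMap p (actRInf sq γ))
  smul_add γ := map_add (aInfMap p (actRInf sq γ))
  smul_one γ := map_one (aInfMap p (actRInf sq γ))
  smul_mul γ := map_mul (aInfMap p (actRInf sq γ))

lemma smul_aInfR (γ : Gam p O d) (x : AInfR sq) : γ • x = aInfMap p (actRInf sq γ) x := rfl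

/-- The structure map `A_inf → A_inf(R_∞)`. -/
def aInfToR : AInf p O →+* AInfR sq := aInfMap p (constRInf sq)

lemma smul_aInfToR (γ : Gam p O d) (a : AInf p O) : γ • aInfToR sq a = aInfToR sq a := by
  rw [smul_aInfR]
  unfold aInfToR
  have h : (actRInf sq γ).comp (constRInf sq) = constRInf sq :=
    RingHom.ext (fun x => actRInf_baseRInf sq γ _)
  rw [← aInfMap_comp, h]

lemma smul_frobenius (γ : Gam p O d) (x : AInfR sq) :
    γ • WittVector.frobenius x = WittVector.frobenius (γ • x) := aInfMap_frobenius p _ x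

lemma aInfToR_frobenius (a : AInf p O) :
    aInfToR sq (WittVector.frobenius a) = WittVector.frobenius (aInfToR sq a) :=
  aInfMap_frobenius p _ a

/-- The element `(T^k, T^{k/p}, T^{k/p²}, …)` of `R_∞^♭`. -/
def monFlat (k : Expo p d) : PreTilt (RInf sq) p :=
  (⟨fun n => Ideal.Quotient.mk (Ideal.span {(p : RInf sq)}) (monRInf sq (expDiv p k n)), fun n => by
    rw [← map_pow, ← monRInf_nsmul, nsmul_expDiv_succ]⟩ : Perfection (ModP (RInf sq) p) p)

lemma monFlat_zero : monFlat sq (0 : Expo p d) = 1 := tilt_ext p (fun n => by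
  change Ideal.Quotient.mk (Ideal.span {(p : RInf sq)}) (monRInf sq (expDiv p 0 n)) = _
  rw [expDiv_zero_left, monRInf_zero, map_one, map_one])

lemma monFlat_add (k l : Expo p d) : monFlat sq (k + l) = monFlat sq k * monFlat sq l :=
  tilt_ext p (fun n => by
    rw [map_mul]
    change Ideal.Quotient.mk (Ideal.span {(p : RInf sq)}) (monRInf sq (expDiv p (k + l) n)) =
      Ideal.Quotient.mk (Ideal.span {(p : RInf sq)}) (monRInf sq (expDiv p k n)) *
        Ideal.Quotient.mk (Ideal.span {(p : RInf sq)}) (monRInf sq (expDiv p l n))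
    rw [expDiv_add, monRInf_add, map_mul])

/-- The ring homomorphism `A_inf[U_1^{±1}, …, U_d^{±1}] → A_inf(R_∞)` of `A_inf`-algebras with
`U_i ↦ [T_i^♭]`, where `T_i^♭ = (T_i, T_i^{1/p}, …)`. -/
def uMap : Laurent (AInf p O) d →+* AInfR sq :=
  AddMonoidAlgebra.liftNCRingHom (aInfToR sq)
    { toFun := fun k => WittVector.teichmuller p (monFlat sq (intExp p d k.toAdd))
      map_one' := by
        rw [toAdd_one, map_zero, monFlat_zero, map_one]
      map_mul' := fun k l => by
        rw [toAdd_mul, map_add, monFlat_add, map_mul] }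
    (fun _ _ => Commute.all _ _)

lemma uMap_single_zero (a : AInf p O) : uMap sq (AddMonoidAlgebra.single 0 a) = aInfToR sq a := by
  unfold uMap
  rw [AddMonoidAlgebra.liftNCRingHom_single]
  change _ * WittVector.teichmuller p (monFlat sq (intExp p d 0)) = _
  rw [map_zero, monFlat_zero, map_one, mul_one]

end PeriodRings

/-! ### Reduction modulo `p`, and localisation at an invariant element -/

section RedLoc

variable (p : ℕ) {G : Type v} [Group G] {B B' : Type u} [CommRing B] [CommRing B']

variable (B) in
/-- The ring `B/p`. -/
def RedP : Type u := B ⧸ Ideal.span {(p : B)}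

instance : CommRing (RedP p B) := inferInstanceAs (CommRing (B ⧸ Ideal.span {(p : B)}))

variable (B) in
/-- The reduction map `B → B/p`. -/
def toRedP : B →+* RedP p B := Ideal.Quotient.mk (Ideal.span {(p : B)})

lemma toRedP_surjective : Function.Surjective (toRedP p B) := Ideal.Quotient.mk_surjective

/-- The map `B/p → B'/p` induced by `f : B → B'`. -/
def redP (f : B →+* B') : RedP p B →+* RedP p B' :=
  Ideal.quotientMap (Ideal.span {(p : B')}) f (by
    rw [← Ideal.map_le_iff_le_comap, Ideal.map_span, Set.image_singleton, map_natCast])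

lemma redP_toRedP (f : B →+* B') (b : B) : redP p f (toRedP p B b) = toRedP p B' (f b) := rfl

variable [MulSemiringAction G B] [MulSemiringAction G B']

instance : MulSemiringAction G (RedP p B) where
  smul g x := redP p (MulSemiringAction.toRingHom G B g) x
  one_smul x := by
    obtain ⟨b, rfl⟩ := toRedP_surjective p x
    exact congrArg (toRedP p B) (one_smul G b)
  mul_smul g h x := by
    obtain ⟨b, rfl⟩ := toRedP_surjective p x
    exact congrArg (toRedP p B) (mul_smul g h b)
  smul_zero g := map_zero (redP p (MulSemiringAction.toRingHom G B g))
  smul_add g := map_add (redP p (MulSemiringAction.toRingHom G B g))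
  smul_one g := map_one (redP p (MulSemiringAction.toRingHom G B g))
  smul_mul g := map_mul (redP p (MulSemiringAction.toRingHom G B g))

/-- The equivariant map `B/p → B'/p` induced by an equivariant map `f : B → B'`. -/
def redPEquiv (f : B →+*[G] B') : RedP p B →+*[G] RedP p B' :=
  { redP p (f : B →+* B') with
    map_smul' := by
      intro g x
      obtain ⟨b, rfl⟩ := toRedP_surjective p x
      exact congrArg (toRedP p B') (map_smul f g b) }

/-- The localisation `B[1/b]` at an element `b` fixed by `G`. -/
def Loc (b : B) (_hb : ∀ g : G, g • b = b) : Type u := Localization.Away b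

namespace Loc

variable {b : B} (hb : ∀ g : G, g • b = b) {b' : B'} (hb' : ∀ g : G, g • b' = b')

instance : CommRing (Loc b hb) := inferInstanceAs (CommRing (Localization.Away b))

instance : Algebra B (Loc b hb) := inferInstanceAs (Algebra B (Localization.Away b))

instance : IsLocalization.Away b (Loc b hb) :=
  inferInstanceAs (IsLocalization.Away b (Localization.Away b))

/-- The map `B[1/b] → B'[1/b']` induced by `f : B → B'` with `f b = b'`. -/
def mapHom (f : B →+* B') (h : f b = b') : Loc b hb →+* Loc b' hb' :=
  IsLocalization.Away.lift b (g := (algebraMap B' (Loc b' hb')).comp f) (by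
    rw [RingHom.comp_apply, h]
    exact IsLocalization.Away.algebraMap_isUnit b')

lemma mapHom_algebraMap (f : B →+* B') (h : f b = b') (x : B) :
    mapHom hb hb' f h (algebraMap B (Loc b hb) x) = algebraMap B' (Loc b' hb') (f x) :=
  IsLocalization.Away.lift_eq b _ x

lemma hom_ext {A : Type u} [CommRing A] {f g : Loc b hb →+* A}
    (h : ∀ x, f (algebraMap B (Loc b hb) x) = g (algebraMap B (Loc b hb) x)) : f = g :=
  IsLocalization.ringHom_ext (Submonoid.powers b) (RingHom.ext h)

/-- The action of `g` on `B[1/b]`. -/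
def act (g : G) : Loc b hb →+* Loc b hb :=
  mapHom hb hb (MulSemiringAction.toRingHom G B g) (hb g)

lemma act_algebraMap (g : G) (x : B) :
    act hb g (algebraMap B (Loc b hb) x) = algebraMap B (Loc b hb) (g • x) :=
  mapHom_algebraMap hb hb _ _ x

lemma act_one : act hb 1 = RingHom.id (Loc b hb) :=
  hom_ext hb (fun y => by rw [act_algebraMap, one_smul]; rfl)

lemma act_mul (g h : G) : act hb (g * h) = (act hb g).comp (act hb h) :=
  hom_ext hb (fun y => by
    rw [RingHom.comp_apply, act_algebraMap, act_algebraMap, act_algebraMap, mul_smul])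

instance : MulSemiringAction G (Loc b hb) where
  smul g x := act hb g x
  one_smul x := congrArg (fun f : Loc b hb →+* Loc b hb => f x) (act_one hb)
  mul_smul g h x := congrArg (fun f : Loc b hb →+* Loc b hb => f x) (act_mul hb g h)
  smul_zero g := map_zero (act hb g)
  smul_add g := map_add (act hb g)
  smul_one g := map_one (act hb g)
  smul_mul g := map_mul (act hb g)

/-- The equivariant map `B → B[1/b]`. -/
def incl : B →+*[G] Loc b hb :=
  { algebraMap B (Loc b hb) with
    map_smul' := fun g x => (act_algebraMap hb g x).symm }

lemma mapHom_comp_act (f : B →+* B') (h : f b = b') (hf : ∀ (g : G) (x : B), f (g • x) = g • f x)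
    (g : G) : (mapHom hb hb' f h).comp (act hb g) = (act hb' g).comp (mapHom hb hb' f h) :=
  hom_ext hb (fun y => by
    rw [RingHom.comp_apply, RingHom.comp_apply, act_algebraMap, mapHom_algebraMap,
      mapHom_algebraMap, act_algebraMap, hf])

/-- The equivariant map `B[1/b] → B'[1/b']` induced by an equivariant `f : B → B'` with
`f b = b'`. -/
def map (f : B →+*[G] B') (h : f b = b') : Loc b hb →+*[G] Loc b' hb' :=
  { mapHom hb hb' (f : B →+* B') h with
    map_smul' := fun g x => congrArg (fun k : Loc b hb →+* Loc b' hb' => k x)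
      (mapHom_comp_act hb hb' (f : B →+* B') h (fun g x => map_smul f g x) g) }

lemma map_incl (f : B →+*[G] B') (h : f b = b') (x : B) :
    incl hb' (f x) = map hb hb' f h (incl hb x) :=
  (mapHom_algebraMap hb hb' (f : B →+* B') h x).symm

end Loc

end RedLoc

/-! ### The framed period ring -/

section Framed

/-- For a finitely generated ideal `I` of `A`: the map `A → B` is formally étale for the `I`-adic
topologies and of topologically finite presentation, that is, `A/I^n → B/I^n B` is étale (in
particular of finite presentation) for all `n`. When `B` is `I`-adically complete this means that
`B` is a formally étale algebra, of topologically finite presentation, over the `I`-adic completion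
of `A`, which has the same quotients `A/I^n`. -/
def AdicEtale {A B : Type u} [CommRing A] [CommRing B] (I : Ideal A) (f : A →+* B) : Prop :=
  ∀ n : ℕ, (Ideal.quotientMap ((I ^ n).map f) f Ideal.le_comap_map :
    A ⧸ I ^ n →+* B ⧸ (I ^ n).map f).Etale

variable {p : ℕ} [Fact p.Prime] {O : Type u} [CommRing O] [Fact (¬IsUnit (p : O))] {d : ℕ}
  {R : Type u} [CommRing R] [Nontrivial R] [IsAdicComplete (Ideal.span {(p : R)}) R]

/-- The ideal `(p, ξ)` of `A_inf`. -/
def PRoots.pxIdeal (ζ : PRoots p O) : Ideal (AInf p O) := Ideal.span {(p : AInf p O), ζ.xi}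

/-- The framed period ring `A_inf^□(R)`, as a subring `S` of `A_inf(R_∞)`: a subring containing
`A_inf[U^{±1}]`, which is `(p, ξ)`-adically complete and formally étale over (the completion of)
`A_inf[U^{±1}]`, and whose inclusion into `A_inf(R_∞)` becomes `R → R_∞` modulo `ξ`, the map
`A_inf(R_∞) → R_∞` being Fontaine's map. -/
structure IsFramedPeriodRing (ζ : PRoots p O) (sq : TateLaurent p O d →+* R)
    (S : Subring (AInfR sq)) : Prop where
  uMap_mem : ∀ x, uMap sq x ∈ S
  isAdicComplete : IsAdicComplete
    ((ζ.pxIdeal.map AddMonoidAlgebra.singleZeroRingHom).map ((uMap sq).codRestrict S uMap_mem)) S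
  adicEtale : AdicEtale (ζ.pxIdeal.map AddMonoidAlgebra.singleZeroRingHom)
    ((uMap sq).codRestrict S uMap_mem)
  map_theta : S.map (WittVector.fontaineTheta (RInf sq) p) = (baseRInf sq).range
  ker_theta : ∀ x ∈ S, WittVector.fontaineTheta (RInf sq) p x = 0 →
    ∃ y ∈ S, x = aInfToR sq ζ.xi * y

/-- Subrings of `A_inf(R_∞)` which contain `A_inf[U^{±1}]` and are stable under `Γ` and under the
Frobenius. -/
structure StableSubring (sq : TateLaurent p O d →+* R) where
  /-- The underlying subring. -/
  toSubring : Subring (AInfR sq)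
  uMap_mem : ∀ x, uMap sq x ∈ toSubring
  smul_mem : ∀ (γ : Gam p O d), ∀ x ∈ toSubring, γ • x ∈ toSubring
  frobenius_mem : ∀ x ∈ toSubring, WittVector.frobenius x ∈ toSubring

variable (sq : TateLaurent p O d →+* R)

/-- The Frobenius of `A_inf(R_∞)`, as an equivariant endomorphism. -/
def frobAInfR : AInfR sq →+*[Gam p O d] AInfR sq :=
  { (WittVector.frobenius : AInfR sq →+* AInfR sq) with
    map_smul' := fun γ x => (smul_frobenius sq γ x).symm }

/-- The element `ξ̃` is fixed by `Γ`. -/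
lemma xiTilde_fixed (ζ : PRoots p O) :
    ∀ γ : Gam p O d, γ • aInfToR sq ζ.xiTilde = aInfToR sq ζ.xiTilde :=
  fun γ => smul_aInfToR sq γ ζ.xiTilde

namespace StableSubring

variable {sq} (P : StableSubring sq)

/-- The ring underlying a stable subring. -/
def Ring : Type u := P.toSubring

instance : CommRing P.Ring := inferInstanceAs (CommRing P.toSubring)

/-- The inclusion into `A_inf(R_∞)`, as a ring homomorphism. -/
def val : P.Ring →+* AInfR sq := P.toSubring.subtype

lemma val_injective : Function.Injective P.val := Subtype.val_injective

lemma val_mem (x : P.Ring) : P.val x ∈ P.toSubring := x.2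

/-- An endomorphism of `A_inf(R_∞)` preserving a stable subring restricts to it. -/
def restrict (f : AInfR sq →+* AInfR sq) (hf : ∀ x ∈ P.toSubring, f x ∈ P.toSubring) :
    P.Ring →+* P.Ring :=
  (f.comp P.val).codRestrict P.toSubring (fun x => hf _ (P.val_mem x))

lemma val_restrict (f : AInfR sq →+* AInfR sq) (hf : ∀ x ∈ P.toSubring, f x ∈ P.toSubring)
    (x : P.Ring) : P.val (P.restrict f hf x) = f (P.val x) := rfl

/-- The action of `Γ` on a stable subring. -/
def act (γ : Gam p O d) : P.Ring →+* P.Ring :=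
  P.restrict (MulSemiringAction.toRingHom (Gam p O d) (AInfR sq) γ) (P.smul_mem γ)

instance : MulSemiringAction (Gam p O d) P.Ring where
  smul γ x := P.act γ x
  one_smul x := P.val_injective (one_smul (Gam p O d) (P.val x))
  mul_smul γ δ x := P.val_injective (mul_smul γ δ (P.val x))
  smul_zero γ := map_zero (P.act γ)
  smul_add γ := map_add (P.act γ)
  smul_one γ := map_one (P.act γ)
  smul_mul γ := map_mul (P.act γ)

/-- The inclusion into `A_inf(R_∞)`. -/
def incl : P.Ring →+*[Gam p O d] AInfR sq :=
  { P.val with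
    map_smul' := fun _ _ => rfl }

/-- The structure map from `A_inf`. -/
def base : AInf p O →+* P.Ring :=
  (aInfToR sq).codRestrict P.toSubring (fun a => by
    rw [← uMap_single_zero]
    exact P.uMap_mem _)

lemma val_base (a : AInf p O) : P.val (P.base a) = aInfToR sq a := rfl

lemma incl_base (a : AInf p O) : P.incl (P.base a) = aInfToR sq a := rfl

lemma smul_base (γ : Gam p O d) (a : AInf p O) : γ • P.base a = P.base a :=
  P.val_injective (smul_aInfToR sq γ a)

/-- The Frobenius of a stable subring, as an equivariant endomorphism. -/
def frob : P.Ring →+*[Gam p O d] P.Ring :=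
  { P.restrict (WittVector.frobenius : AInfR sq →+* AInfR sq) P.frobenius_mem with
    map_smul' := fun γ x => P.val_injective (smul_frobenius sq γ (P.val x)).symm }

/-- The element `ξ̃` is fixed by `Γ`. -/
lemma xiTilde_fixed (ζ : PRoots p O) :
    ∀ γ : Gam p O d, γ • P.base ζ.xiTilde = P.base ζ.xiTilde :=
  fun γ => P.smul_base γ ζ.xiTilde

lemma frob_incl (x : P.Ring) : frobAInfR sq (P.incl x) = P.incl (P.frob x) := rfl

end StableSubring

end Framed

/-! ### Perfectoid fields -/

section Perfectoid

/-- A perfectoid field of residue characteristic `p`: a complete nonarchimedean field with `|p| < 1`,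
with non-discrete valuation of rank one, and such that the Frobenius is surjective on `𝒪/p`. -/
class IsPerfectoidField (p : ℕ) (C : Type u) [NontriviallyNormedField C] [IsUltrametricDist C] :
    Prop where
  completeSpace : CompleteSpace C
  norm_p_lt_one : ‖(p : C)‖ < 1
  nondiscrete : ∀ r < (1 : ℝ), ∃ x : C, r < ‖x‖ ∧ ‖x‖ < 1
  frobenius_surjective : ∀ x : C, ‖x‖ ≤ 1 → ∃ y z : C, ‖y‖ ≤ 1 ∧ ‖z‖ ≤ 1 ∧ x = y ^ p + p * z

variable (C : Type u) [NontriviallyNormedField C] [IsUltrametricDist C]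

/-- The ring of integers `𝒪 = {x ∈ C : |x| ≤ 1}`. -/
abbrev IntegerRing : Type u := (NormedField.valuation (K := C)).integer

instance (p : ℕ) [IsPerfectoidField p C] : Fact (¬IsUnit (p : IntegerRing C)) := ⟨by
  rintro ⟨u, hu⟩
  have h1 : ‖(p : C)‖ < 1 := IsPerfectoidField.norm_p_lt_one
  have h2 : ‖((↑u⁻¹ : IntegerRing C) : C)‖ ≤ 1 := (↑u⁻¹ : IntegerRing C).2
  have h3 : (p : C) * ((↑u⁻¹ : IntegerRing C) : C) = 1 := by
    have := congrArg (fun x : IntegerRing C => (x : C)) u.mul_inv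
    simp only [hu] at this
    simpa using this
  have h4 := congrArg norm h3
  rw [norm_mul, norm_one] at h4
  nlinarith [norm_nonneg (p : C), norm_nonneg ((↑u⁻¹ : IntegerRing C) : C)]⟩

end Perfectoid

end SmallRep

end

open SmallRep

universe w

open CategoryTheory TensorProduct

noncomputable section

namespace SmallRep

/-! ### Adic completeness -/

section Adic

variable {R : Type*} [CommRing R] {I : Ideal R}

lemma eq_zero_of_forall_mem_pow [IsHausdorff I R] {x : R} (h : ∀ n, x ∈ I ^ n) : x = 0 :=
  IsHausdorff.haus (I := I) inferInstance x (fun n => by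
    rw [SModEq.zero, smul_eq_mul, Ideal.mul_top]
    exact h n)

lemma sub_mem_pow_of_le {f : ℕ → R} (hf : ∀ n, f (n + 1) - f n ∈ I ^ n) {m n : ℕ} (h : m ≤ n) :
    f n - f m ∈ I ^ m := by
  induction n, h using Nat.le_induction with
  | base => simp
  | succ n hn ih =>
    have := (I ^ m).add_mem (Ideal.pow_le_pow_right hn (hf n)) ih
    rwa [sub_add_sub_cancel] at this

variable (I) in
lemma exists_adic_limit [IsPrecomplete I R] (f : ℕ → R) (hf : ∀ n, f (n + 1) - f n ∈ I ^ n) :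
    ∃ L, ∀ n, f n - L ∈ I ^ n := by
  obtain ⟨L, hL⟩ := IsPrecomplete.prec (I := I) inferInstance (f := f) (fun {m n} h => by
    rw [SModEq.sub_mem, smul_eq_mul, Ideal.mul_top, ← neg_sub]
    exact (I ^ m).neg_mem (sub_mem_pow_of_le hf h))
  refine ⟨L, fun n => ?_⟩
  have := hL n
  rwa [SModEq.sub_mem, smul_eq_mul, Ideal.mul_top] at this

lemma isAdicComplete_of_limits (hz : ∀ x : R, (∀ n, x ∈ I ^ n) → x = 0)
    (hl : ∀ f : ℕ → R, (∀ n, f (n + 1) - f n ∈ I ^ n) → ∃ L, ∀ n, f n - L ∈ I ^ n) :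
    IsAdicComplete I R where
  haus' x h := hz x (fun n => by
    have := h n
    rwa [SModEq.zero, smul_eq_mul, Ideal.mul_top] at this)
  prec' f hf := by
    obtain ⟨L, hL⟩ := hl f (fun n => by
      have := hf (Nat.le_succ n)
      rw [SModEq.sub_mem, smul_eq_mul, Ideal.mul_top, ← neg_sub] at this
      exact neg_mem_iff.mp this)
    exact ⟨L, fun n => by
      rw [SModEq.sub_mem, smul_eq_mul, Ideal.mul_top]
      exact hL n⟩

/-- Multiplication by `c` is injective with continuous inverse for the `I`-adic topology. -/
def AdicEmbedding (I : Ideal R) (c : R) : Prop := ∀ n, ∃ N, ∀ b, c * b ∈ I ^ N → b ∈ I ^ n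

namespace AdicEmbedding

variable {c d : R}

lemma of_dvd (h : AdicEmbedding I c) (hd : d ∣ c) : AdicEmbedding I d := by
  obtain ⟨a, rfl⟩ := hd
  intro n
  obtain ⟨N, hN⟩ := h n
  refine ⟨N, fun b hb => hN b ?_⟩
  rw [show d * a * b = a * (d * b) by ring]
  exact Ideal.mul_mem_left _ _ hb

lemma mul (hc : AdicEmbedding I c) (hd : AdicEmbedding I d) : AdicEmbedding I (c * d) := by
  intro n
  obtain ⟨N, hN⟩ := hd n
  obtain ⟨M, hM⟩ := hc N
  exact ⟨M, fun b hb => hN b (hM _ (by rwa [← mul_assoc]))⟩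

lemma pow (hc : AdicEmbedding I c) (n : ℕ) : AdicEmbedding I (c ^ n) := by
  induction n with
  | zero => exact fun n => ⟨n, fun b hb => by simpa using hb⟩
  | succ n ih => exact pow_succ c n ▸ ih.mul hc

lemma eq_zero [IsHausdorff I R] (hc : AdicEmbedding I c) {b : R} (h : c * b = 0) : b = 0 :=
  eq_zero_of_forall_mem_pow (I := I) (fun n => by
    obtain ⟨N, hN⟩ := hc n
    exact hN b (h ▸ Ideal.zero_mem _))

lemma cancel [IsHausdorff I R] (hc : AdicEmbedding I c) {a b : R} (h : c * a = c * b) : a = b :=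
  sub_eq_zero.mp (hc.eq_zero (by rw [mul_sub, h, sub_self]))

/-- The ideal `c R` is closed. -/
lemma dvd_of_forall [IsAdicComplete I R] (hc : AdicEmbedding I c) {x : R}
    (h : ∀ n, ∃ a, x - c * a ∈ I ^ n) : c ∣ x := by
  choose N hN using hc
  let M : ℕ → ℕ := fun n => ∑ i ∈ Finset.range (n + 1), N i + n
  have hNM : ∀ n, N n ≤ M n := fun n =>
    (Finset.single_le_sum (f := N) (fun _ _ => Nat.zero_le _)
      (Finset.self_mem_range_succ n)).trans (Nat.le_add_right _ _)
  have hMM : ∀ n, M n ≤ M (n + 1) := fun n => by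
    simp only [M, Finset.sum_range_succ _ (n + 1)]
    omega
  choose a ha using fun n => h (M n)
  obtain ⟨L, hL⟩ := exists_adic_limit I a (fun n => hN n _ (by
    have := (I ^ M n).sub_mem (ha n) (Ideal.pow_le_pow_right (hMM n) (ha (n + 1)))
    rw [show x - c * a n - (x - c * a (n + 1)) = c * (a (n + 1) - a n) by ring] at this
    exact Ideal.pow_le_pow_right (hNM n) this))
  refine ⟨L, sub_eq_zero.mp (eq_zero_of_forall_mem_pow (I := I) (fun n => ?_))⟩
  have h1 := (I ^ n).add_mem (Ideal.pow_le_pow_right (Nat.le_add_left _ _) (ha n))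
    (Ideal.mul_mem_left _ c (hL n))
  rwa [show x - c * a n + c * (a n - L) = x - c * L by ring] at h1

end AdicEmbedding

/-- A ring which is complete for `I` is complete for `c` if a power of `c` is in `I`. -/
lemma isAdicComplete_span_of_pow_mem [IsAdicComplete I R] {c : R} {N : ℕ} (hc : c ^ N ∈ I) :
    IsAdicComplete (Ideal.span {c}) R := by
  have hcI : ∀ m i, m * N ≤ i → ∀ z, c ^ i * z ∈ I ^ m := fun m i hi z => by
    obtain ⟨j, rfl⟩ := Nat.exists_eq_add_of_le hi
    rw [pow_add, mul_comm m, pow_mul, mul_assoc]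
    exact Ideal.mul_mem_right _ _ (Ideal.pow_mem_pow hc m)
  refine isAdicComplete_of_limits (fun x hx => ?_) (fun f hf => ?_)
  · refine eq_zero_of_forall_mem_pow (I := I) (fun n => ?_)
    have := hx (n * N)
    rw [Ideal.span_singleton_pow, Ideal.mem_span_singleton] at this
    obtain ⟨y, rfl⟩ := this
    exact hcI n _ le_rfl y
  · simp only [Ideal.span_singleton_pow, Ideal.mem_span_singleton] at hf ⊢
    choose z hz using hf
    have hsum : ∀ n, f n = f 0 + ∑ i ∈ Finset.range n, c ^ i * z i := by
      intro n
      induction n with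
      | zero => simp
      | succ n ih => rw [Finset.sum_range_succ, ← add_assoc, ← ih, ← hz]; ring
    have htail : ∀ n, ∃ t, ∀ m, ∑ i ∈ Finset.range (m * N), c ^ i * z (n + i) - t ∈ I ^ m :=
      fun n => exists_adic_limit I _ (fun m => by
        rw [Nat.succ_mul, Finset.sum_range_add, add_sub_cancel_left]
        exact sum_mem (fun i _ => hcI m _ (Nat.le_add_right _ _) _))
    choose t ht using htail
    refine ⟨f 0 + t 0, fun n => ⟨-t n, ?_⟩⟩
    rw [← sub_eq_zero]
    refine eq_zero_of_forall_mem_pow (I := I) (fun m => ?_)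
    have h1 := ht 0 m
    have h2 := Ideal.mul_mem_left _ (c ^ n) (ht n m)
    have h3 : ∑ i ∈ Finset.range n, c ^ i * z i +
        c ^ n * ∑ i ∈ Finset.range (m * N), c ^ i * z (n + i) =
        ∑ i ∈ Finset.range (m * N), c ^ i * z i +
          ∑ i ∈ Finset.range n, c ^ (m * N + i) * z (m * N + i) := by
      rw [← Finset.sum_range_add, add_comm (m * N), Finset.sum_range_add, Finset.mul_sum]
      simp only [pow_add, mul_assoc]
    have h4 : ∑ i ∈ Finset.range n, c ^ (m * N + i) * z (m * N + i) ∈ I ^ m :=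
      sum_mem (fun i _ => hcI m _ (Nat.le_add_right _ _) _)
    simp only [zero_add] at h1
    have h5 := (I ^ m).add_mem ((I ^ m).sub_mem h1 h2) h4
    rw [hsum n]
    convert h5 using 1
    linear_combination h3

lemma isUnit_one_add_of_pow_mem [IsAdicComplete I R] {c : R} {N : ℕ} (hc : c ^ N ∈ I) {x : R}
    (hx : c ∣ x) : IsUnit (1 + x) := by
  have h1 : c ∈ (⊥ : Ideal R).jacobson := by
    have h2 : c ^ N ∈ (⊥ : Ideal R).jacobson := IsAdicComplete.le_jacobson_bot I hc
    exact Ideal.isRadical_jacobson (⊥ : Ideal R) ⟨N, h2⟩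
  obtain ⟨y, rfl⟩ := hx
  have := Ideal.mem_jacobson_bot.mp h1 y
  rwa [add_comm]

end Adic

/-! ### Decompositions of an extension into isotypic pieces -/

section Decomposition

variable {G : Type v} [CommGroup G] {B B' : Type u} [CommRing B] [MulSemiringAction G B]
  [CommRing B'] [MulSemiringAction G B']

/-- The data of an extension `B → B'` which is a completed direct sum of free modules of rank one
over `B`, indexed by `K`, on which `G` acts by the semilinear characters `χ k`, such that the
action is trivial modulo `c₁` on `B` and `c₁` is a proper multiple, by `c₀`, of the denominators
`χ k (gen k) - 1`. -/
structure DescentDatum (ι : B →+*[G] B') (J : Ideal B) (K : Type w) [Zero K] (c₀ c₁ : B) where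
  /-- The characters. -/
  χ : K → G → B
  /-- The components. -/
  pr : K → B' →+ B
  pr_mul : ∀ k b x, pr k (ι b * x) = b * pr k x
  pr_smul : ∀ k (g : G) x, pr k (g • x) = χ k g * (g • pr k x)
  finite_pr : ∀ x n, {k | pr k x ∉ J ^ n}.Finite
  ext_pr : ∀ x, (∀ k, pr k x = 0) → x = 0
  exists_pr : ∀ f : K → B, (∀ n, {k | f k ∉ J ^ n}.Finite) → ∃ x, ∀ k, pr k x = f k
  pr_zero : ∀ b, pr 0 (ι b) = b
  pr_ne_zero : ∀ k, k ≠ 0 → ∀ b, pr k (ι b) = 0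
  complete : IsAdicComplete J B
  complete' : IsAdicComplete (J.map (ι : B →+* B')) B'
  /-- Elements of the group acting non-trivially on the given piece. -/
  gen : K → G
  finite_gen : (Set.range gen).Finite
  /-- The quotient of `c₁` by `c₀`. -/
  ν : B
  c₁_eq : c₁ = c₀ * ν
  gen_dvd : ∀ k, k ≠ 0 → χ k (gen k) - 1 ∣ ν
  smul_c₀ : ∀ g : G, g • c₀ = c₀
  smul_c₁ : ∀ g : G, g • c₁ = c₁
  dvd_smul_sub : ∀ (g : G) (b : B), c₁ ∣ g • b - b
  embedding : AdicEmbedding J c₁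
  /-- A bound for the topological nilpotence of `c₀`. -/
  N : ℕ
  pow_mem : c₀ ^ N ∈ J

namespace DescentDatum

variable {ι : B →+*[G] B'} {J : Ideal B} {K : Type w} [Zero K] {c₀ c₁ : B}
  (D : DescentDatum ι J K c₀ c₁)

include D

lemma embedding₀ : AdicEmbedding J c₀ := D.embedding.of_dvd ⟨_, D.c₁_eq⟩

lemma cancel₀ (n : ℕ) {a b : B} (h : c₀ ^ n * a = c₀ ^ n * b) : a = b :=
  have := D.complete
  (D.embedding₀.pow n).cancel h

lemma cancel₁ {a b : B} (h : c₁ * a = c₁ * b) : a = b :=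
  have := D.complete
  D.embedding.cancel h

lemma ext_pr' {x y : B'} (h : ∀ k, D.pr k x = D.pr k y) : x = y :=
  sub_eq_zero.mp (D.ext_pr _ (fun k => by rw [map_sub, h, sub_self]))

lemma dvd_of_pr {c : B} (hc : AdicEmbedding J c) {x : B'} (h : ∀ k, c ∣ D.pr k x) : ι c ∣ x := by
  choose y hy using h
  obtain ⟨z, hz⟩ := D.exists_pr y (fun n => by
    obtain ⟨N, hN⟩ := hc n
    refine (D.finite_pr x N).subset (fun k hk h => hk (hN _ ?_))
    rwa [hy k] at h)
  exact ⟨z, D.ext_pr' (fun k => by rw [D.pr_mul, hz, hy])⟩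

lemma cancel₁' {x y : B'} (h : ι c₁ * x = ι c₁ * y) : x = y :=
  D.ext_pr' (fun k => D.cancel₁ (by rw [← D.pr_mul, ← D.pr_mul, h]))

lemma injective : Function.Injective ι := fun a b h => by
  rw [← D.pr_zero a, h, D.pr_zero]

lemma eq_ι {x : B'} (h : ∀ k, k ≠ 0 → D.pr k x = 0) : x = ι (D.pr 0 x) :=
  D.ext_pr' (fun k => by
    by_cases hk : k = 0
    · rw [hk, D.pr_zero]
    · rw [h k hk, D.pr_ne_zero k hk])

lemma pow_mem' : ι c₀ ^ D.N ∈ J.map (ι : B →+* B') := by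
  rw [← map_pow]
  exact Ideal.mem_map_of_mem (ι : B →+* B') D.pow_mem

lemma complete₀ : IsAdicComplete (Ideal.span {c₀}) B :=
  have := D.complete
  isAdicComplete_span_of_pow_mem D.pow_mem

lemma complete₀' : IsAdicComplete (Ideal.span {ι c₀}) B' :=
  have := D.complete'
  isAdicComplete_span_of_pow_mem D.pow_mem'

lemma isUnit_one_add' {x : B'} (h : ι c₀ ∣ x) : IsUnit (1 + x) :=
  have := D.complete'
  isUnit_one_add_of_pow_mem D.pow_mem' h

lemma eq_zero_of_dvd_pow {x : B} (h : ∀ n, c₀ ^ n ∣ x) : x = 0 :=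
  have := D.complete₀
  eq_zero_of_forall_mem_pow (I := Ideal.span {c₀}) (fun n => by
    rw [Ideal.span_singleton_pow, Ideal.mem_span_singleton]
    exact h n)

lemma ι_dvd_smul_sub (g : G) (b : B) : ι c₁ ∣ g • ι b - ι b := by
  obtain ⟨y, hy⟩ := D.dvd_smul_sub g b
  exact ⟨ι y, by rw [← map_mul, ← hy, map_sub, map_smul]⟩

/-- An element of `B'` which is invariant modulo `c₁` is in `B` modulo `c₀`. -/
lemma dvd_pr_of_invariant {x : B'} (h : ∀ g : G, ι c₁ ∣ g • x - x) {k : K} (hk : k ≠ 0) :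
    c₀ ∣ D.pr k x := by
  obtain ⟨y, hy⟩ := h (D.gen k)
  obtain ⟨z, hz⟩ := D.dvd_smul_sub (D.gen k) (D.pr k x)
  obtain ⟨w, hw⟩ := D.gen_dvd k hk
  have h1 := congrArg (D.pr k) hy
  rw [map_sub, D.pr_smul, D.pr_mul] at h1
  set t := D.χ k (D.gen k) - 1 with ht
  have h2 : t * D.pr k x = t * (c₀ * (w * (D.pr k y - D.χ k (D.gen k) * z))) := by
    linear_combination h1 - D.χ k (D.gen k) * hz +
      (D.pr k y - D.χ k (D.gen k) * z) * (D.c₁_eq + c₀ * hw) + D.pr k x * ht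
  have := D.complete
  have h3 : AdicEmbedding J t := D.embedding.of_dvd (D.c₁_eq ▸ ⟨c₀ * w, by rw [hw]; ring⟩)
  exact ⟨_, h3.cancel h2⟩

end DescentDatum

end Decomposition

section MatrixDescent

variable {G : Type v} [CommGroup G] {B B' : Type u} [CommRing B] [MulSemiringAction G B]
  [CommRing B'] [MulSemiringAction G B'] {r : ℕ}

/-- The entrywise action of the group on matrices. -/
def matAct (B : Type u) [CommRing B] [MulSemiringAction G B] (r : ℕ) (g : G) :
    Matrix (Fin r) (Fin r) B →+* Matrix (Fin r) (Fin r) B :=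
  (MulSemiringAction.toRingHom G B g).mapMatrix

lemma matAct_apply (g : G) (X : Matrix (Fin r) (Fin r) B) (i j) :
    matAct B r g X i j = g • X i j := rfl

lemma matAct_smul (g : G) (c : B) (X : Matrix (Fin r) (Fin r) B) :
    matAct B r g (c • X) = (g • c) • matAct B r g X := by
  ext i j
  simp [matAct_apply]

namespace DescentDatum

variable {ι : B →+*[G] B'} {J : Ideal B} {K : Type w} [Zero K] {c₀ c₁ : B}
  (D : DescentDatum ι J K c₀ c₁)

/-- The entrywise components of a matrix. -/
def prM (k : K) : Matrix (Fin r) (Fin r) B' →+ Matrix (Fin r) (Fin r) B :=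
  (D.pr k).mapMatrix

/-- Extension of scalars for matrices. -/
def ιM (_D : DescentDatum ι J K c₀ c₁) :
    Matrix (Fin r) (Fin r) B →+* Matrix (Fin r) (Fin r) B' :=
  (ι : B →+* B').mapMatrix

lemma prM_apply (k : K) (X : Matrix (Fin r) (Fin r) B') (i j) :
    D.prM k X i j = D.pr k (X i j) := rfl

lemma ιM_apply (X : Matrix (Fin r) (Fin r) B) (i j) : D.ιM X i j = ι (X i j) := rfl

lemma ιM_smul (c : B) (X : Matrix (Fin r) (Fin r) B) : D.ιM (c • X) = ι c • D.ιM X := by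
  ext i j
  simp [ιM_apply]

lemma prM_mul (k : K) (a : Matrix (Fin r) (Fin r) B) (X : Matrix (Fin r) (Fin r) B') :
    D.prM k (D.ιM a * X) = a * D.prM k X := by
  ext i j
  simp only [prM_apply, Matrix.mul_apply, ιM_apply, map_sum, D.pr_mul]

lemma prM_mul_right (k : K) (a : Matrix (Fin r) (Fin r) B) (X : Matrix (Fin r) (Fin r) B') :
    D.prM k (X * D.ιM a) = D.prM k X * a := by
  ext i j
  simp only [prM_apply, Matrix.mul_apply, ιM_apply, map_sum, mul_comm _ (ι _), D.pr_mul]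
  simp only [mul_comm]

lemma prM_smul (k : K) (c : B) (X : Matrix (Fin r) (Fin r) B') :
    D.prM k (ι c • X) = c • D.prM k X := by
  ext i j
  simp only [prM_apply, Matrix.smul_apply, smul_eq_mul, D.pr_mul]

lemma prM_matAct (k : K) (g : G) (X : Matrix (Fin r) (Fin r) B') :
    D.prM k (matAct B' r g X) = D.χ k g • matAct B r g (D.prM k X) := by
  ext i j
  simp only [prM_apply, Matrix.smul_apply, smul_eq_mul, D.pr_smul, matAct_apply]

lemma prM_zero (a : Matrix (Fin r) (Fin r) B) : D.prM 0 (D.ιM a) = a := by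
  ext i j
  simp only [prM_apply, ιM_apply, D.pr_zero]

lemma prM_ne_zero {k : K} (hk : k ≠ 0) (a : Matrix (Fin r) (Fin r) B) : D.prM k (D.ιM a) = 0 := by
  ext i j
  simp only [prM_apply, ιM_apply, D.pr_ne_zero k hk, Matrix.zero_apply]

lemma ext_prM {X Y : Matrix (Fin r) (Fin r) B'} (h : ∀ k, D.prM k X = D.prM k Y) : X = Y := by
  ext i j
  exact D.ext_pr' (fun k => congrFun (congrFun (h k) i) j)

lemma exists_prM (f : K → Matrix (Fin r) (Fin r) B)
    (hf : ∀ i j n, {k | f k i j ∉ J ^ n}.Finite) :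
    ∃ X : Matrix (Fin r) (Fin r) B', ∀ k, D.prM k X = f k := by
  choose X hX using fun i j => D.exists_pr (fun k => f k i j) (hf i j)
  exact ⟨Matrix.of X, fun k => by ext i j; exact hX i j k⟩

lemma exists_smul_of_prM {c : B} (hc : AdicEmbedding J c) {X : Matrix (Fin r) (Fin r) B'}
    (h : ∀ k, ∃ Z, D.prM k X = c • Z) : ∃ Y, X = ι c • Y := by
  have h1 : ∀ i j, ι c ∣ X i j := fun i j => D.dvd_of_pr hc (fun k => by
    obtain ⟨Z, hZ⟩ := h k
    exact ⟨Z i j, congrFun (congrFun hZ i) j⟩)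
  choose Y hY using h1
  exact ⟨Matrix.of Y, by ext i j; exact hY i j⟩

lemma matAct_ιM (g : G) (X : Matrix (Fin r) (Fin r) B) :
    matAct B' r g (D.ιM X) = D.ιM (matAct B r g X) := by
  ext i j
  simp only [matAct_apply, ιM_apply, map_smul]

include D

lemma smul_cancel_pow (n : ℕ) {X Y : Matrix (Fin r) (Fin r) B} (h : c₀ ^ n • X = c₀ ^ n • Y) :
    X = Y := by
  ext i j
  exact D.cancel₀ n (congrFun (congrFun h i) j)

lemma smul_cancel₁ {X Y : Matrix (Fin r) (Fin r) B} (h : c₁ • X = c₁ • Y) : X = Y := by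
  ext i j
  exact D.cancel₁ (congrFun (congrFun h i) j)

lemma smul_cancel₁' {X Y : Matrix (Fin r) (Fin r) B'} (h : ι c₁ • X = ι c₁ • Y) : X = Y := by
  ext i j
  exact D.cancel₁' (congrFun (congrFun h i) j)

lemma exists_matAct_eq (g : G) (X : Matrix (Fin r) (Fin r) B) :
    ∃ Z, matAct B r g X = X + c₁ • Z := by
  choose Z hZ using fun i j => D.dvd_smul_sub g (X i j)
  refine ⟨Matrix.of Z, ?_⟩
  ext i j
  have := hZ i j
  simp only [matAct_apply, Matrix.add_apply, Matrix.smul_apply, Matrix.of_apply, smul_eq_mul]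
  linear_combination this

lemma exists_inverse (Y : Matrix (Fin r) (Fin r) B') :
    ∃ V, (1 + ι c₀ • Y) * V = 1 ∧ V * (1 + ι c₀ • Y) = 1 := by
  have h1 : ι c₀ ∣ (1 + ι c₀ • Y).det - 1 := by
    rw [← Ideal.mem_span_singleton, ← Ideal.Quotient.eq, RingHom.map_det, map_one, map_add,
      map_one]
    have : (Ideal.Quotient.mk (Ideal.span {ι c₀})).mapMatrix (ι c₀ • Y) = 0 := by
      ext i j
      exact Ideal.Quotient.eq_zero_iff_mem.mpr (Ideal.mem_span_singleton.mpr ⟨Y i j, rfl⟩)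
    rw [this, add_zero, Matrix.det_one]
  have h2 := D.isUnit_one_add' h1
  rw [add_sub_cancel] at h2
  exact ⟨_, Matrix.mul_nonsing_inv _ h2, Matrix.nonsing_inv_mul _ h2⟩

/-- A matrix with idempotent `e` and the matrices of commuting semilinear maps. -/
structure IsSystem (e : Matrix (Fin r) (Fin r) B) (F : G → Matrix (Fin r) (Fin r) B') : Prop where
  left : ∀ g, D.ιM e * F g = F g
  right : ∀ g, F g * matAct B' r g (D.ιM e) = F g
  comm : ∀ g h, F g * matAct B' r g (F h) = F h * matAct B' r h (F g)

variable {e : Matrix (Fin r) (Fin r) B}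

/-- Change of basis for the matrices of commuting semilinear maps. -/
lemma IsSystem.conj {F F' : G → Matrix (Fin r) (Fin r) B'} (hF : D.IsSystem e F)
    {T V : Matrix (Fin r) (Fin r) B'} (hVT : V * T = 1)
    (he : D.ιM e * T = T * D.ιM e) (h : ∀ g, T * F' g = F g * matAct B' r g T) :
    D.IsSystem e F' := by
  have hF' : ∀ g, F' g = V * (F g * matAct B' r g T) := fun g => by
    rw [← h, ← mul_assoc, hVT, one_mul]
  have hcan : ∀ X Y : Matrix (Fin r) (Fin r) B', T * X = T * Y → X = Y := fun X Y hXY => by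
    rw [← one_mul X, ← hVT, mul_assoc, hXY, ← mul_assoc, hVT, one_mul]
  refine ⟨fun g => hcan _ _ ?_, fun g => hcan _ _ ?_, fun g k => hcan _ _ ?_⟩
  · rw [← mul_assoc, ← he, mul_assoc, h, ← mul_assoc, hF.left]
  · rw [← mul_assoc, h, mul_assoc, ← map_mul, ← he, map_mul, ← mul_assoc, hF.right]
  · rw [← mul_assoc, ← mul_assoc, h, h, mul_assoc, mul_assoc, ← map_mul, ← map_mul, h, h, map_mul,
      map_mul, ← mul_assoc, ← mul_assoc, hF.comm]
    congr 1
    ext i j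
    simp only [matAct_apply, ← mul_smul, mul_comm g k]

/-- The non-integral components are removed modulo a further power of `c₀`. -/
lemma exists_improvement (he : e * e = e) {F P : G → Matrix (Fin r) (Fin r) B'}
    (hF : D.IsSystem e F) (hFP : ∀ g, F g = D.ιM e + ι c₁ • P g) {n : ℕ}
    (hP : ∀ k, k ≠ 0 → ∀ g, ∃ X, D.prM k (P g) = c₀ ^ n • X) :
    ∃ Y, D.ιM e * Y = Y * D.ιM e ∧ ∃ F' P' : G → Matrix (Fin r) (Fin r) B',
      (∀ g, (1 + ι c₀ • ι (c₀ ^ n) • Y) * F' g =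
        F g * matAct B' r g (1 + ι c₀ • ι (c₀ ^ n) • Y)) ∧
      (∀ g, F' g = D.ιM e + ι c₁ • P' g) ∧
      ∀ k, k ≠ 0 → ∀ g, ∃ X, D.prM k (P' g) = c₀ ^ (n + 1) • X := by
  have hι : ∀ g : G, ∀ c : B, g • c = c → g • ι c = ι c := fun g c h => by rw [← map_smul, h]
  have hc0 : ∀ g : G, g • ι c₀ = ι c₀ := fun g => hι g _ (D.smul_c₀ g)
  have hc1 : ∀ g : G, g • ι c₁ = ι c₁ := fun g => hι g _ (D.smul_c₁ g)
  have ha : ∀ g : G, g • (c₀ ^ n) = c₀ ^ n := fun g => by rw [smul_pow', D.smul_c₀]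
  have haι : ∀ g : G, g • ι (c₀ ^ n) = ι (c₀ ^ n) := fun g => hι g _ (ha g)
  choose! X hX using hP
  have hc₁ : ∀ X : Matrix (Fin r) (Fin r) B, c₁ • X = c₀ • D.ν • X := fun X =>
    (congrArg (· • X) D.c₁_eq).trans (mul_smul _ _ _)
  set a := c₀ ^ n with ha_def
  have haemb : AdicEmbedding J a := D.embedding₀.pow n
  have hcan : ∀ {X Y : Matrix (Fin r) (Fin r) B}, a • X = a • Y → X = Y :=
    fun h => D.smul_cancel_pow n h
  choose De hDe using fun g => D.exists_matAct_eq g e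
  have heP : ∀ g, D.ιM e * P g = P g := fun g => by
    have := hF.left g
    rw [hFP, mul_add, ← map_mul, he, mul_smul_comm] at this
    exact D.smul_cancel₁' (add_left_cancel this)
  have heX : ∀ k, k ≠ 0 → ∀ g, e * X k g = X k g := fun k hk g => hcan (by
    rw [← hX k hk, ← mul_smul_comm, ← hX k hk, ← D.prM_mul, heP])
  have hXe : ∀ k, k ≠ 0 → ∀ g, X k g = X k g * e + c₁ • (X k g * De g) := fun k hk g => by
    have h1 := congrArg (D.prM k) (hF.right g)
    rw [D.matAct_ιM, D.prM_mul_right, hFP, map_add, D.prM_ne_zero hk, zero_add, D.prM_smul,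
      hX k hk, hDe, mul_add, smul_mul_assoc, smul_mul_assoc, mul_smul_comm, smul_mul_assoc] at h1
    refine hcan (D.smul_cancel₁ ?_)
    rw [← h1]
    simp only [smul_add, smul_smul, smul_mul_assoc]
    congr 2
    ring
  have hcomm : ∀ g h, P g + F g * matAct B' r g (P h) = P h + F h * matAct B' r h (P g) := by
    intro g h
    have h1 := hF.comm g h
    have h2 : ∀ g h, F g * matAct B' r g (F h) =
        D.ιM e + ι c₁ • (P g + F g * matAct B' r g (P h)) := fun g h => by
      rw [hFP h, map_add, matAct_smul, hc1, mul_add, hF.right, mul_smul_comm, smul_add, ← add_assoc,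
        ← hFP g]
    rw [h2, h2] at h1
    exact D.smul_cancel₁' (add_left_cancel h1)
  have hQ : ∀ g, ∃ Q, P g = D.ιM (D.prM 0 (P g)) + ι a • Q := fun g => by
    obtain ⟨Q, hQ⟩ := D.exists_smul_of_prM haemb (X := P g - D.ιM (D.prM 0 (P g))) (fun k => by
      by_cases hk : k = 0
      · exact ⟨0, by rw [hk, map_sub, D.prM_zero, sub_self, smul_zero]⟩
      · exact ⟨X k g, by rw [map_sub, D.prM_ne_zero hk, sub_zero, hX k hk]⟩)
    exact ⟨Q, by rw [← hQ, add_sub_cancel]⟩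
  have hcoc : ∀ k, k ≠ 0 → ∀ g h, ∃ Z,
      D.prM k (F g * matAct B' r g (P h)) = a • (D.χ k g • X k h + c₁ • Z) := by
    intro k hk g h
    obtain ⟨Q, hQ⟩ := hQ g
    obtain ⟨Z, hZ⟩ := D.exists_matAct_eq g (X k h)
    have h1 : D.prM k (matAct B' r g (P h)) = a • D.χ k g • (X k h + c₁ • Z) := by
      rw [D.prM_matAct, hX k hk, matAct_smul, ha, hZ, smul_comm]
    refine ⟨D.χ k g • (e * Z) + (D.prM 0 (P g) * (D.χ k g • (X k h + c₁ • Z)) +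
      D.prM k (Q * matAct B' r g (P h))), ?_⟩
    rw [hFP g, add_mul, map_add, D.prM_mul, h1, smul_mul_assoc, D.prM_smul]
    nth_rewrite 1 [hQ]
    rw [add_mul, map_add, D.prM_mul, h1, smul_mul_assoc, D.prM_smul]
    simp only [mul_smul_comm, mul_add, heX k hk, smul_add, smul_smul]
    simp only [mul_comm, mul_left_comm]
    abel
  have hW : ∀ k, k ≠ 0 → ∀ g h, ∃ W,
      (D.χ k g - 1) • X k h = (D.χ k h - 1) • X k g + c₁ • W := by
    intro k hk g h
    obtain ⟨Z, hZ⟩ := hcoc k hk g h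
    obtain ⟨Z', hZ'⟩ := hcoc k hk h g
    have h1 := congrArg (D.prM k) (hcomm g h)
    rw [map_add, map_add, hZ, hZ', hX k hk, hX k hk, ← smul_add, ← smul_add] at h1
    refine ⟨Z' - Z, ?_⟩
    have h2 := hcan h1
    rw [sub_smul, sub_smul, one_smul, one_smul, smul_sub, sub_eq_iff_eq_add, ← sub_eq_zero]
    rw [← sub_eq_zero] at h2
    rw [← h2]
    abel
  have hκ : ∀ k, ∃ κ, k ≠ 0 → D.ν = (D.χ k (D.gen k) - 1) * κ := fun k => by
    by_cases hk : k = 0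
    · exact ⟨0, fun h => absurd hk h⟩
    · obtain ⟨κ, hκ⟩ := D.gen_dvd k hk
      exact ⟨κ, fun _ => hκ⟩
  choose κ hκ using hκ
  classical
  obtain ⟨Y, hY⟩ := D.exists_prM
    (fun k => if k = 0 then 0 else -(κ k • (X k (D.gen k) * e))) (fun i j m => by
      obtain ⟨N, hN⟩ := haemb m
      have hfin : (⋃ g ∈ Set.range D.gen, ⋃ l, {k | D.pr k (P g i l) ∉ J ^ N}).Finite :=
        D.finite_gen.biUnion (fun g _ => Set.finite_iUnion (fun l => D.finite_pr _ _))
      refine hfin.subset (fun k hk => ?_)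
      by_contra hk'
      simp only [Set.mem_range, Set.mem_iUnion, not_exists, Set.mem_ofPred_eq, not_not] at hk'
      refine hk ?_
      by_cases h0 : k = 0
      · simp [h0]
      · simp only [h0, if_false, Matrix.neg_apply, Matrix.smul_apply, Matrix.mul_apply, smul_eq_mul]
        refine neg_mem (Ideal.mul_mem_left _ _ (sum_mem (fun l _ => Ideal.mul_mem_right _ _
          (hN _ ?_))))
        have := hk' (D.gen k) ⟨_, rfl⟩ l
        rwa [← D.prM_apply, hX k h0] at this)
  have hY0 : D.prM 0 Y = 0 := by rw [hY, if_pos rfl]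
  have hYk : ∀ k, k ≠ 0 → D.prM k Y = -(κ k • (X k (D.gen k) * e)) :=
    fun k hk => by rw [hY, if_neg hk]
  have heY : D.ιM e * Y = Y := D.ext_prM (fun k => by
    rw [D.prM_mul]
    by_cases hk : k = 0
    · rw [hk, hY0, mul_zero]
    · rw [hYk k hk, mul_neg, mul_smul_comm, ← mul_assoc, heX k hk])
  have hYe : Y * D.ιM e = Y := D.ext_prM (fun k => by
    rw [D.prM_mul_right]
    by_cases hk : k = 0
    · rw [hk, hY0, zero_mul]
    · rw [hYk k hk, neg_mul, smul_mul_assoc, mul_assoc, he])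
  have hE : ∀ g, ∃ R, ι c₀ • (D.ιM e * matAct B' r g Y - Y) = ι c₁ • R ∧
      ∀ k, k ≠ 0 → ∃ V, D.prM k R = -(X k g * e) + c₀ • V := by
    intro g
    have hk : ∀ k, k ≠ 0 → ∃ V, D.prM k (ι c₀ • (D.ιM e * matAct B' r g Y - Y)) =
        c₁ • (-(X k g * e) + c₀ • V) := by
      intro k hk
      obtain ⟨Z, hZ⟩ := D.exists_matAct_eq g (κ k • (X k (D.gen k) * e))
      obtain ⟨W, hW⟩ := hW k hk g (D.gen k)
      refine ⟨-(κ k • (W * e)) - D.χ k g • (e * Z), ?_⟩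
      rw [D.prM_smul, map_sub, D.prM_mul, D.prM_matAct, hYk k hk, map_neg, hZ]
      have h1 : D.χ k g • (X k (D.gen k) * e) = X k (D.gen k) * e +
          (D.χ k (D.gen k) - 1) • (X k g * e) + c₁ • (W * e) := by
        rw [← smul_mul_assoc, ← smul_mul_assoc, ← smul_mul_assoc, ← add_mul, ← add_mul]
        congr 1
        rw [add_assoc, ← hW, sub_smul, one_smul, add_sub_cancel]
      have h2 : e * (κ k • (X k (D.gen k) * e)) = κ k • (X k (D.gen k) * e) := by
        rw [mul_smul_comm, ← mul_assoc, heX k hk]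
      rw [mul_smul_comm, mul_neg, mul_add, h2, mul_smul_comm, smul_neg, smul_add,
        smul_comm (D.χ k g) (κ k), h1]
      have h4 : c₁ • -(X k g * e) = -(c₀ • κ k • (D.χ k (D.gen k) - 1) • (X k g * e)) := by
        rw [smul_neg, hc₁ (X k g * e), hκ k hk, mul_comm, mul_smul]
      rw [smul_add c₁, h4]
      simp only [smul_add, smul_sub, smul_neg, smul_comm c₁ c₀, smul_comm c₁ (κ k),
        smul_comm c₁ (D.χ k g)]
      abel
    obtain ⟨R, hR⟩ := D.exists_smul_of_prM D.embedding
      (X := ι c₀ • (D.ιM e * matAct B' r g Y - Y)) (fun k => by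
        by_cases h0 : k = 0
        · refine ⟨0, ?_⟩
          rw [h0, D.prM_smul, map_sub, D.prM_mul, D.prM_matAct, hY0]
          simp
        · obtain ⟨V, hV⟩ := hk k h0
          exact ⟨_, hV⟩)
    refine ⟨R, hR, fun k h0 => ?_⟩
    obtain ⟨V, hV⟩ := hk k h0
    rw [hR, D.prM_smul] at hV
    exact ⟨V, D.smul_cancel₁ hV⟩
  choose R hR hRk using hE
  obtain ⟨V, hHV, hVH⟩ := D.exists_inverse (ι a • Y)
  set H := 1 + ι c₀ • ι a • Y with hH
  have hHact : ∀ g : G, matAct B' r g H = 1 + ι c₀ • ι a • matAct B' r g Y := fun g => by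
    rw [hH, map_add, map_one, matAct_smul, hc0, matAct_smul, haι]
  have hFH : ∀ g, F g * matAct B' r g H =
      H * D.ιM e + ι c₁ • (P g + ι a • R g + ι c₀ • ι a • (P g * matAct B' r g Y)) := by
    intro g
    rw [hHact, mul_add, mul_one, mul_smul_comm, mul_smul_comm, hH, add_mul, one_mul,
      smul_mul_assoc, smul_mul_assoc, hYe, smul_add, smul_add, smul_comm (ι c₁) (ι a), ← hR, hFP,
      add_mul, smul_mul_assoc]
    simp only [smul_add, smul_sub, smul_comm (ι a) (ι c₀), smul_comm (ι c₁) (ι a),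
      smul_comm (ι c₁) (ι c₀)]
    abel
  set S : G → Matrix (Fin r) (Fin r) B' :=
    fun g => P g + ι a • R g + ι c₀ • ι a • (P g * matAct B' r g Y) with hS
  refine ⟨Y, by rw [heY, hYe], fun g => D.ιM e + ι c₁ • (V * S g), fun g => V * S g,
    fun g => ?_, fun g => rfl, fun k hk g => ?_⟩
  · rw [mul_add, mul_smul_comm, ← mul_assoc, hHV, one_mul, hFH]
  · have hVS : V * S g = S g - ι c₀ • ι a • (Y * V * S g) := by
      have hV : V = 1 - ι c₀ • ι a • (Y * V) := by
        rw [← hHV, hH, add_mul, one_mul, smul_mul_assoc, smul_mul_assoc, add_sub_cancel_right]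
      nth_rewrite 1 [hV]
      rw [sub_mul, one_mul, smul_mul_assoc, smul_mul_assoc]
    obtain ⟨U, hU⟩ := hRk g k hk
    refine ⟨D.ν • (X k g * De g) + U + D.prM k (P g * matAct B' r g Y) -
      D.prM k (Y * V * S g), ?_⟩
    beta_reduce
    rw [hVS, map_sub, D.prM_smul, D.prM_smul]
    have hSg : S g = P g + ι a • R g + ι c₀ • ι a • (P g * matAct B' r g Y) := rfl
    nth_rewrite 1 [hSg]
    rw [map_add, map_add, D.prM_smul, D.prM_smul, D.prM_smul, hX k hk, hU]
    nth_rewrite 1 [hXe k hk g]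
    rw [hc₁]
    simp only [pow_succ, ← ha_def, mul_smul, smul_add, smul_sub, smul_neg, smul_comm a c₀]
    abel

end DescentDatum

end MatrixDescent

section MatrixLimit

variable {G : Type v} [CommGroup G] {B B' : Type u} [CommRing B] [MulSemiringAction G B]
  [CommRing B'] [MulSemiringAction G B'] {r : ℕ}

lemma exists_seq_of_step {α : Type*} {Q : ℕ → α → Prop} {rel : ℕ → α → α → Prop} {a : α}
    (h0 : Q 0 a) (h : ∀ n x, Q n x → ∃ y, Q (n + 1) y ∧ rel n x y) :
    ∃ f : ℕ → α, f 0 = a ∧ ∀ n, Q n (f n) ∧ rel n (f n) (f (n + 1)) := by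
  choose! s hs hr using h
  let f : ℕ → α := fun n => Nat.rec a (fun n x => s n x) n
  have hf : ∀ n, Q n (f n) := fun n => by
    induction n with
    | zero => exact h0
    | succ n ih => exact hs n _ ih
  exact ⟨f, rfl, fun n => ⟨hf n, hr n _ (hf n)⟩⟩

lemma exists_matrix_limit {R : Type*} [CommRing R] {c : R} [IsAdicComplete (Ideal.span {c}) R]
    {T : ℕ → Matrix (Fin r) (Fin r) R} (h : ∀ n, ∃ Y, T (n + 1) = T n + c ^ n • Y) :
    ∃ L, ∀ n, ∃ Z, L = T n + c ^ n • Z := by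
  have h1 : ∀ i j, ∃ L, ∀ n, T n i j - L ∈ Ideal.span {c} ^ n := fun i j =>
    exists_adic_limit _ (fun n => T n i j) (fun n => by
      obtain ⟨Y, hY⟩ := h n
      rw [Ideal.span_singleton_pow, Ideal.mem_span_singleton]
      exact ⟨Y i j, by simp [hY]⟩)
  choose L hL using h1
  refine ⟨Matrix.of L, fun n => ?_⟩
  simp only [Ideal.span_singleton_pow, Ideal.mem_span_singleton] at hL
  choose Z hZ using fun i j => hL i j n
  refine ⟨-Matrix.of Z, ?_⟩
  ext i j
  simp only [Matrix.of_apply, Matrix.add_apply, Matrix.smul_apply, Matrix.neg_apply, smul_eq_mul]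
  linear_combination -hZ i j

lemma matrix_eq_zero_of_dvd_pow {R : Type*} [CommRing R] {c : R} [IsAdicComplete (Ideal.span {c}) R]
    {X : Matrix (Fin r) (Fin r) R} (h : ∀ n, ∃ Z, X = c ^ n • Z) : X = 0 := by
  ext i j
  refine eq_zero_of_forall_mem_pow (I := Ideal.span {c}) (fun n => ?_)
  rw [Ideal.span_singleton_pow, Ideal.mem_span_singleton]
  obtain ⟨Z, hZ⟩ := h n
  exact ⟨Z i j, congrFun (congrFun hZ i) j⟩

/-- Idempotent matrices lift along an adic quotient. -/
lemma exists_idempotent_lift {R : Type*} [CommRing R] {c : R} [IsAdicComplete (Ideal.span {c}) R]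
    {E Z : Matrix (Fin r) (Fin r) R} (hE : E * E = E + c • Z) :
    ∃ e W, e * e = e ∧ e = E + c • W := by
  obtain ⟨f, hf0, hf⟩ := exists_seq_of_step (Q := fun n (x : Matrix (Fin r) (Fin r) R) =>
    ∃ Z, x * x = x + c ^ (n + 1) • Z) (rel := fun n x y => ∃ Y, y = x + c ^ (n + 1) • Y) (a := E)
    ⟨Z, by rw [hE, zero_add, pow_one]⟩ (by
    rintro n x ⟨Z, hZ⟩
    have hZ' : c ^ (n + 1) • Z = x * x - x := by rw [hZ, add_sub_cancel_left]
    refine ⟨x * x * (3 - 2 * x), ⟨c ^ n • (Z * Z * (4 * x * x - 4 * x - 3)), ?_⟩,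
      Z * (1 - 2 * x), ?_⟩
    · have h1 : c ^ (n + 1 + 1) • c ^ n • (Z * Z * (4 * x * x - 4 * x - 3)) =
          (c ^ (n + 1) • Z) * (c ^ (n + 1) • Z) * (4 * x * x - 4 * x - 3) := by
        simp only [smul_mul_assoc, mul_smul_comm, smul_smul, ← pow_add]
        congr 2
        omega
      rw [h1, hZ']
      noncomm_ring
    · rw [← smul_mul_assoc, hZ']
      noncomm_ring)
  obtain ⟨e, he⟩ := exists_matrix_limit (c := c) (T := f) (fun n => by
    obtain ⟨Y, hY⟩ := (hf n).2
    exact ⟨c • Y, by rw [hY, smul_smul, ← pow_succ]⟩)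
  obtain ⟨Y, hY⟩ := (hf 0).2
  obtain ⟨Z₁, hZ₁⟩ := he 1
  refine ⟨e, Y + Z₁, ?_, ?_⟩
  · rw [← sub_eq_zero]
    refine matrix_eq_zero_of_dvd_pow (c := c) (fun n => ?_)
    obtain ⟨Z₂, hZ₂⟩ := he n
    obtain ⟨Z₃, hZ₃⟩ := (hf n).1
    refine ⟨Z₂ * e + f n * Z₂ + c • Z₃ - Z₂, ?_⟩
    have h1 : e * e = f n * f n + c ^ n • (Z₂ * e + f n * Z₂) := by
      calc e * e = f n * e + c ^ n • (Z₂ * e) := by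
            nth_rewrite 1 [hZ₂]
            rw [add_mul, smul_mul_assoc]
        _ = _ := by
            nth_rewrite 1 [hZ₂]
            rw [mul_add, mul_smul_comm, smul_add]
            abel
    rw [h1, hZ₃, pow_succ, mul_smul]
    generalize Z₂ * e + f n * Z₂ = W
    rw [hZ₂]
    simp only [smul_add, smul_sub]
    abel
  · rw [zero_add] at hY
    rw [hZ₁, hY, hf0, pow_one, smul_add, add_assoc]

namespace DescentDatum

variable {ι : B →+*[G] B'} {J : Ideal B} {K : Type w} [Zero K] {c₀ c₁ : B}
  (D : DescentDatum ι J K c₀ c₁)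

include D

/-- Commuting semilinear maps which are trivial modulo `c₁` descend after a change of basis. -/
theorem exists_descent {e : Matrix (Fin r) (Fin r) B} (he : e * e = e)
    {F : G → Matrix (Fin r) (Fin r) B'} (hF : D.IsSystem e F)
    (hFP : ∀ g, ∃ P, F g = D.ιM e + ι c₁ • P) :
    ∃ T V, T * V = 1 ∧ V * T = 1 ∧ D.ιM e * T = T * D.ιM e ∧ ∃ E : G → Matrix (Fin r) (Fin r) B,
      (∀ g, T * D.ιM (E g) = F g * matAct B' r g T) ∧ ∀ g, ∃ Z, E g = e + c₁ • Z := by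
  choose P hP using hFP
  let Q : ℕ → Matrix (Fin r) (Fin r) B' × (G → Matrix (Fin r) (Fin r) B') ×
      (G → Matrix (Fin r) (Fin r) B') → Prop := fun n s =>
    D.ιM e * s.1 = s.1 * D.ιM e ∧ (∀ g, s.1 * s.2.1 g = F g * matAct B' r g s.1) ∧
    D.IsSystem e s.2.1 ∧ (∀ g, s.2.1 g = D.ιM e + ι c₁ • s.2.2 g) ∧
    ∀ k, k ≠ 0 → ∀ g, ∃ X, D.prM k (s.2.2 g) = c₀ ^ n • X
  obtain ⟨f, hf0, hf⟩ := exists_seq_of_step (Q := Q) (a := (1, F, P))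
    (rel := fun n s s' => ∃ Y, s'.1 = s.1 + ι c₀ ^ (n + 1) • Y)
    ⟨by rw [mul_one, one_mul], fun g => by rw [map_one, mul_one, one_mul], hF, hP,
      fun k hk g => ⟨_, by rw [pow_zero, one_smul]⟩⟩ (by
    rintro n ⟨T, F₁, P₁⟩ ⟨h1, h2, h3, h4, h5⟩
    obtain ⟨Y, hYe, F', P', h6, h7, h8⟩ := D.exists_improvement he h3 h4 h5
    have he1 : D.ιM e * (1 + ι c₀ • ι (c₀ ^ n) • Y) = (1 + ι c₀ • ι (c₀ ^ n) • Y) * D.ιM e := by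
      rw [mul_add, add_mul, mul_one, one_mul, mul_smul_comm, mul_smul_comm, smul_mul_assoc,
        smul_mul_assoc, hYe]
    obtain ⟨V, hV1, hV2⟩ := D.exists_inverse (ι (c₀ ^ n) • Y)
    refine ⟨(T * (1 + ι c₀ • ι (c₀ ^ n) • Y), F', P'),
      ⟨?_, ?_, h3.conj D hV2 he1 h6, h7, h8⟩, T * Y, ?_⟩
    · change D.ιM e * (T * _) = T * _ * D.ιM e
      rw [mul_assoc, ← he1, ← mul_assoc, ← mul_assoc]
      exact congrArg (· * _) h1
    · intro g
      change T * _ * F' g = F g * matAct B' r g (T * _)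
      rw [mul_assoc, h6, ← mul_assoc, map_mul, ← mul_assoc]
      exact congrArg (· * _) (h2 g)
    · change T * _ = T + _
      rw [mul_add, mul_one, mul_smul_comm, mul_smul_comm, smul_smul, map_pow, pow_succ'])
  have := D.complete₀'
  obtain ⟨T, hT⟩ := exists_matrix_limit (c := ι c₀) (T := fun n => (f n).1) (fun n => by
    obtain ⟨Y, hY⟩ := (hf n).2
    exact ⟨ι c₀ • Y, by rw [hY, smul_smul, ← pow_succ]⟩)
  obtain ⟨V, hV1, hV2⟩ : ∃ V, T * V = 1 ∧ V * T = 1 := by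
    obtain ⟨Z, hZ⟩ := hT 1
    obtain ⟨Y, hY⟩ := (hf 0).2
    rw [zero_add] at hY
    rw [hY, hf0, pow_one, add_assoc, ← smul_add] at hZ
    rw [hZ]
    exact D.exists_inverse _
  have hact : ∀ (n : ℕ) (g : G) (Z : Matrix (Fin r) (Fin r) B'),
      matAct B' r g (ι c₀ ^ n • Z) = ι c₀ ^ n • matAct B' r g Z := fun n g Z => by
    rw [matAct_smul, smul_pow', ← map_smul ι, D.smul_c₀]
  have hVF : ∀ n g, ∃ Z, V * (F g * matAct B' r g T) = (f n).2.1 g + ι c₀ ^ n • Z := by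
    intro n g
    obtain ⟨Z, hZ⟩ := hT n
    refine ⟨-(V * (Z * (f n).2.1 g)) + V * (F g * matAct B' r g Z), ?_⟩
    have h1 := (hf n).1.2.1 g
    have h2 : (f n).1 = T - ι c₀ ^ n • Z := by rw [hZ, add_sub_cancel_right]
    nth_rewrite 1 [hZ]
    rw [map_add, hact, mul_add, ← h1, h2, sub_mul, mul_add, mul_sub, ← mul_assoc V T, hV2, one_mul]
    simp only [smul_mul_assoc, mul_smul_comm, smul_add, smul_neg]
    abel
  have hE : ∀ g, D.ιM (D.prM 0 (V * (F g * matAct B' r g T))) = V * (F g * matAct B' r g T) := by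
    intro g
    refine D.ext_prM (fun k => ?_)
    by_cases hk : k = 0
    · rw [hk, D.prM_zero]
    · rw [D.prM_ne_zero hk]
      symm
      ext i j
      refine D.eq_zero_of_dvd_pow (fun n => ?_)
      obtain ⟨Z, hZ⟩ := hVF n g
      obtain ⟨X, hX⟩ := (hf n).1.2.2.2.2 k hk g
      rw [hZ, (hf n).1.2.2.2.1, map_add, map_add, D.prM_ne_zero hk, zero_add, D.prM_smul,
        ← map_pow, D.prM_smul, hX]
      refine ⟨(c₁ • X + D.prM k Z) i j, ?_⟩
      simp only [Matrix.add_apply, Matrix.smul_apply, smul_eq_mul]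
      ring
  refine ⟨T, V, hV1, hV2, ?_, fun g => D.prM 0 (V * (F g * matAct B' r g T)), fun g => ?_,
    fun g => ?_⟩
  · rw [← sub_eq_zero]
    refine matrix_eq_zero_of_dvd_pow (c := ι c₀) (fun n => ?_)
    obtain ⟨Z, hZ⟩ := hT n
    refine ⟨D.ιM e * Z - Z * D.ιM e, ?_⟩
    rw [hZ, mul_add, add_mul, (hf n).1.1, mul_smul_comm, smul_mul_assoc, smul_sub]
    abel
  · rw [hE, ← mul_assoc, hV1, one_mul]
  · have := D.complete
    have h1 : ∀ i j, c₁ ∣ (D.prM 0 (V * (F g * matAct B' r g T)) - e) i j := fun i j => by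
      refine D.embedding.dvd_of_forall (fun n => ?_)
      obtain ⟨Z, hZ⟩ := hVF (D.N * n) g
      rw [hZ, (hf _).1.2.2.2.1, map_add, map_add, D.prM_zero, D.prM_smul, ← map_pow, D.prM_smul]
      refine ⟨D.prM 0 ((f (D.N * n)).2.2 g) i j, ?_⟩
      simp only [Matrix.add_apply, Matrix.sub_apply, Matrix.smul_apply, smul_eq_mul]
      rw [show ∀ a b c d : B, a + b + c - a - b = c by intros; ring, pow_mul]
      · exact Ideal.mul_mem_right _ _ (Ideal.pow_mem_pow D.pow_mem n)
      · exact 0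
    choose Z hZ using h1
    refine ⟨Matrix.of Z, ?_⟩
    rw [← sub_eq_iff_eq_add']
    ext i j
    exact hZ i j

end DescentDatum

end MatrixLimit

section Triviality

variable {G : Type v} [Group G] {B : Type u} [CommRing B] [MulSemiringAction G B] {b : B}
  {M : SemilinRep G B}

lemma mem_span_smul_top {M : Type*} [AddCommGroup M] [Module B M] {x : M} :
    x ∈ (Ideal.span {b} • ⊤ : Submodule B M) ↔ ∃ y, x = b • y := by
  rw [Submodule.ideal_span_singleton_smul, Submodule.mem_smul_pointwise_iff_exists]
  exact ⟨fun ⟨y, _, h⟩ => ⟨y, h.symm⟩, fun ⟨y, h⟩ => ⟨y, trivial, h.symm⟩⟩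

/-- A linear form on a module, modulo `b`. -/
def formMod (b : B) {M : Type*} [AddCommGroup M] [Module B M] (l : M →ₗ[B] B) :
    (M ⧸ (Ideal.span {b} • ⊤ : Submodule B M)) →ₗ[B ⧸ Ideal.span {b}] B ⧸ Ideal.span {b} :=
  LinearMap.extendScalarsOfSurjective (R := B) Ideal.Quotient.mk_surjective
    (Submodule.mapQ _ (Ideal.span {b}) l (by
      intro x hx
      obtain ⟨y, rfl⟩ := mem_span_smul_top.mp hx
      rw [Submodule.mem_comap, map_smul]
      exact Ideal.mem_span_singleton.mpr ⟨_, rfl⟩))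

lemma formMod_mk {M : Type*} [AddCommGroup M] [Module B M] (l : M →ₗ[B] B) (x : M) :
    formMod b l (Submodule.Quotient.mk x) = Ideal.Quotient.mk _ (l x) := rfl

/-- A representation with a dual basis which is invariant modulo `b` is trivial modulo `b`. -/
theorem isTrivialMod_of_frame {r : ℕ} (x : Fin r → M) (l : Fin r → M →ₗ[B] B)
    (hl : ∀ y, ∑ i, l i y • x i = y) (hx : ∀ (g : G) i, ∃ y, g • x i - x i = b • y)
    (hg : ∀ (g : G) i y, b ∣ l i (g • y) - g • l i y) : IsTrivialMod b M := by
  set H := invariantsRing G (Ideal.span {b})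
  set V := invariants (Ideal.span {b}) M
  let L : Fin r → V →ₗ[H] H := fun i =>
    { toFun := fun v => ⟨formMod b (l i) v, by
        obtain ⟨m, hm, hmg⟩ := v.2
        refine ⟨l i m, by rw [← hm, formMod_mk], fun g => ?_⟩
        obtain ⟨y, hy⟩ := mem_span_smul_top.mp (hmg g)
        rw [Ideal.mem_span_singleton]
        have h1 := congrArg (l i) hy
        rw [map_sub, (l i).map_smul, smul_eq_mul] at h1
        rw [show g • l i m - l i m = b * l i y - (l i (g • m) - g • l i m) by rw [← h1]; ring]
        exact dvd_sub ⟨_, rfl⟩ (hg g i m)⟩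
      map_add' := fun v w => Subtype.ext (map_add (formMod b (l i)) (v : M ⧸ _) w)
      map_smul' := fun h v => Subtype.ext (map_smul (formMod b (l i)) (h : B ⧸ _) (v : M ⧸ _)) }
  let X : Fin r → V := fun i => ⟨Submodule.Quotient.mk (x i), x i, rfl, fun g =>
    mem_span_smul_top.mpr (hx g i)⟩
  have hsum : ∀ y : M ⧸ (Ideal.span {b} • ⊤ : Submodule B M),
      ∑ i, formMod b (l i) y • (X i : M ⧸ (Ideal.span {b} • ⊤ : Submodule B M)) = y := fun y => by
    obtain ⟨m, rfl⟩ := Submodule.Quotient.mk_surjective _ y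
    simp only [formMod_mk]
    nth_rewrite 2 [← hl m]
    exact (map_sum (Submodule.mkQ (Ideal.span {b} • ⊤ : Submodule B M)) _ _).symm
  have hsumV : ∀ v : V, ∑ i, L i v • X i = v := fun v => Subtype.ext (by
    refine Eq.trans ?_ (hsum v)
    exact map_sum V.subtype _ _)
  have hsplit : (Fintype.linearCombination H X).comp (LinearMap.pi L) = LinearMap.id :=
    LinearMap.ext (fun v => hsumV v)
  refine ⟨Module.Finite.of_surjective (Fintype.linearCombination H X) (fun v =>
      ⟨_, LinearMap.congr_fun hsplit v⟩), Module.Projective.of_split _ _ hsplit,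
    IsBaseChange.of_lift_unique _ (fun Q _ _ _ _ f => ?_)⟩
  have hf : ∀ h : H, ∀ v, f (h • v) = (h : B ⧸ Ideal.span {b}) • f v := fun h v => by
    rw [map_smul]
    exact (algebraMap_smul (B ⧸ Ideal.span {b}) h (f v)).symm
  refine ⟨∑ i, (formMod b (l i)).smulRight (f (X i)), ?_, fun f' hf' => ?_⟩
  · refine LinearMap.ext (fun v => ?_)
    nth_rewrite 2 [← hsumV v]
    rw [map_sum]
    simp only [hf]
    exact LinearMap.sum_apply _ _ _
  · refine LinearMap.ext (fun y => ?_)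
    nth_rewrite 1 [← hsum y]
    rw [map_sum]
    simp only [map_smul]
    refine Eq.trans ?_ (LinearMap.sum_apply _ _ _).symm
    exact Finset.sum_congr rfl (fun i _ => congrArg _ (LinearMap.congr_fun hf' (X i)))

/-- A projective representation which is trivial modulo `b` has a dual basis modulo `b` consisting
of invariant elements and equivariant forms. -/
theorem IsTrivialMod.exists_frame (h : IsTrivialMod b M) (hb : ∀ g : G, g • b = b)
    (hM : Module.Projective B M) :
    ∃ (r : ℕ) (m : Fin r → M) (s : Fin r → M →ₗ[B] B),
      (∀ x, ∃ y, x - ∑ i, s i x • m i = b • y) ∧ (∀ (g : G) i, ∃ y, g • m i - m i = b • y) ∧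
      ∀ (g : G) i j, b ∣ g • s i (m j) - s i (m j) := by
  set H := invariantsRing G (Ideal.span {b}) with hH
  set V := invariants (Ideal.span {b}) M with hV
  have := h.finite
  have := h.projective
  obtain ⟨r, f, g, -, -, hfg⟩ := Module.Finite.exists_comp_eq_id_of_projective H V
  let f1 : Fin r → V := fun i => f (Pi.single i 1)
  have hsumV : ∀ v : V, ∑ i, g v i • f1 i = v := fun v => by
    refine Eq.trans ?_ (LinearMap.congr_fun hfg v)
    rw [LinearMap.comp_apply]
    nth_rewrite 2 [pi_eq_sum_univ' (g v)]
    rw [map_sum]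
    simp only [map_smul]
    rfl
  let ext : Fin r → (M ⧸ (Ideal.span {b} • ⊤ : Submodule B M)) →ₗ[B ⧸ Ideal.span {b}]
      B ⧸ Ideal.span {b} := fun i =>
    h.isBaseChange.lift ((Algebra.linearMap H (B ⧸ Ideal.span {b})).comp
      ((LinearMap.proj i).comp g))
  have hext : ∀ i (v : V), ext i v = g v i := fun i v => h.isBaseChange.lift_eq _ v
  have hsum : ∀ y : M ⧸ (Ideal.span {b} • ⊤ : Submodule B M),
      ∑ i, ext i y • (f1 i : M ⧸ (Ideal.span {b} • ⊤ : Submodule B M)) = y := fun y => by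
    refine h.isBaseChange.inductionOn y (motive := fun y => ∑ i, ext i y •
      (f1 i : M ⧸ (Ideal.span {b} • ⊤ : Submodule B M)) = y) (by simp) (fun v => ?_)
      (fun c y hy => ?_) (fun y z hy hz => ?_)
    · refine Eq.trans ?_ (congrArg V.subtype (hsumV v))
      rw [map_sum]
      refine Finset.sum_congr rfl (fun i _ => ?_)
      exact congrArg (· • _) (hext i v)
    · nth_rewrite 2 [← hy]
      rw [Finset.smul_sum]
      simp only [map_smul, smul_assoc]
    · nth_rewrite 2 [← hy]
      nth_rewrite 2 [← hz]
      rw [← Finset.sum_add_distrib]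
      simp only [map_add, add_smul]
  choose m hm hmg using fun i => (f1 i).2
  have hs : ∀ i, ∃ s : M →ₗ[B] B, ∀ x, Ideal.Quotient.mk (Ideal.span {b}) (s x) =
      ext i (Submodule.Quotient.mk x) := fun i => by
    obtain ⟨s, hs⟩ := Module.projective_lifting_property (Ideal.span {b}).mkQ
      (((ext i).restrictScalars B).comp (Submodule.mkQ _)) (Submodule.mkQ_surjective _)
    exact ⟨s, fun x => LinearMap.congr_fun hs x⟩
  choose s hs using hs
  refine ⟨r, m, s, fun x => ?_, fun γ i => mem_span_smul_top.mp (hmg i γ), fun γ i j => ?_⟩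
  · rw [← mem_span_smul_top, ← Submodule.Quotient.eq]
    refine (hsum _).symm.trans ?_
    refine Eq.trans ?_ (map_sum (Submodule.mkQ (Ideal.span {b} • ⊤ : Submodule B M)) _ _).symm
    refine Finset.sum_congr rfl (fun i _ => ?_)
    rw [← hs, ← hm]
    rfl
  · have h1 := hext i (f1 j)
    rw [← hm j, ← hs] at h1
    obtain ⟨c, hc, hcγ⟩ := (g (f1 j) i).2
    rw [← h1, Ideal.Quotient.eq, Ideal.mem_span_singleton] at hc
    obtain ⟨z, hz⟩ := hc
    obtain ⟨w, hw⟩ := Ideal.mem_span_singleton.mp (hcγ γ)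
    refine ⟨w + z - γ • z, ?_⟩
    have h2 : γ • (c - s i (m j)) = b * γ • z := by rw [hz, smul_mul', hb]
    rw [smul_sub] at h2
    linear_combination hw + hz - h2

end Triviality

section Lattice

variable {G : Type v} [CommGroup G] {B B' : Type u} [CommRing B] [MulSemiringAction G B]
  [CommRing B'] [MulSemiringAction G B'] {ι : B →+*[G] B'} {J : Ideal B} {K : Type w} [Zero K]
  {c₀ c₁ : B}

/-- A family of generators and a dual family of linear forms of a representation over `B'` for which
the idempotent matrix and the matrices of the action have entries in `B`, and such that the action is
trivial modulo `c₁`. -/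
structure Lattice (ι : B →+*[G] B') (c₁ : B) (M : SemilinRep G B') where
  /-- The number of generators. -/
  rank : ℕ
  /-- The generators. -/
  basis : Fin rank → M
  /-- The coordinates. -/
  coord : M →ₗ[B'] (Fin rank → B')
  /-- The matrices of the action. -/
  mat : G → Matrix (Fin rank) (Fin rank) B
  sum_coord : ∀ x, ∑ j, coord x j • basis j = x
  coord_smul_basis : ∀ g i j, coord (g • basis j) i = ι (mat g i j)
  smul_basis_sub : ∀ (g : G) j, ∃ a : Fin rank → B,
    g • basis j - basis j = ∑ i, ι (c₁ * a i) • basis i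

namespace DescentDatum

variable (D : DescentDatum ι J K c₀ c₁)

include D

/-- A projective representation over `B'` which is trivial modulo `c₁` has generators for which the
idempotent matrix has entries in `B`. -/
lemma exists_basis {M : SemilinRep G B'} (hM : Module.Projective B' M)
    (hfin : Module.Finite B' M) (h : IsTrivialMod (ι c₁) M) :
    ∃ (r : ℕ) (e : Matrix (Fin r) (Fin r) B) (m : Fin r → M) (q : M →ₗ[B'] (Fin r → B')),
      e * e = e ∧ (∀ x, ∑ j, q x j • m j = x) ∧ (∀ i j, q (m j) i = ι (e i j)) ∧
      ∀ (g : G) j, ∃ y, g • m j - m j = ι c₁ • y := by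
  have hc1 : ∀ g : G, g • ι c₁ = ι c₁ := fun g => by rw [← map_smul, D.smul_c₁]
  obtain ⟨r, m, s, hs, hm, hsm⟩ := h.exists_frame hc1 hM
  set S : Matrix (Fin r) (Fin r) B' := Matrix.of (fun i j => s i (m j)) with hS
  set E := D.prM 0 S with hE
  obtain ⟨U, hU⟩ : ∃ U, S - D.ιM E = ι c₀ • U := by
    refine D.exists_smul_of_prM D.embedding₀ (fun k => ?_)
    by_cases hk : k = 0
    · exact ⟨0, by rw [hk, map_sub, D.prM_zero, hE, sub_self, smul_zero]⟩
    · rw [map_sub, D.prM_ne_zero hk, sub_zero]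
      choose Z hZ using fun i j => D.dvd_pr_of_invariant (fun g => hsm g i j) hk
      exact ⟨Matrix.of Z, by ext i j; exact hZ i j⟩
  have hSS : ∃ Z, S - S * S = ι c₀ • Z := by
    choose y hy using fun j => hs (m j)
    refine ⟨Matrix.of (fun i j => ι D.ν * s i (y j)), ?_⟩
    ext i j
    have h1 := congrArg (s i) (hy j)
    have h2 : ι c₁ = ι c₀ * ι D.ν := by rw [← map_mul]; exact congrArg ι D.c₁_eq
    simp only [map_sub, map_sum, map_smul, smul_eq_mul] at h1
    simp only [Matrix.sub_apply, Matrix.mul_apply, Matrix.smul_apply, Matrix.of_apply, smul_eq_mul,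
      S]
    rw [← mul_assoc, ← h2, ← h1]
    simp only [mul_comm]
  obtain ⟨Z, hZ⟩ : ∃ Z, E * E = E + c₀ • Z := by
    obtain ⟨Z, hZ⟩ := hSS
    refine ⟨D.prM 0 (U - Z - U * S - D.ιM E * U), ?_⟩
    have h1 : D.ιM (E * E) = D.ιM E + ι c₀ • (U - Z - U * S - D.ιM E * U) := by
      rw [map_mul, smul_sub, smul_sub, smul_sub, ← smul_mul_assoc,
        ← mul_smul_comm (ι c₀) (D.ιM E) U, ← hU, ← hZ]
      noncomm_ring
    rw [← D.prM_smul, ← D.prM_zero (E * E), h1, map_add, D.prM_zero]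
  have := D.complete₀
  obtain ⟨e, W, he, heE⟩ := exists_idempotent_lift hZ
  obtain ⟨W', hW'⟩ : ∃ W', S = D.ιM e + ι c₀ • W' :=
    ⟨U - D.ιM W, by rw [smul_sub, ← hU, heE, map_add, D.ιM_smul]; abel⟩
  let f : (Fin r → B') →ₗ[B'] M := Fintype.linearCombination B' m
  let t : M →ₗ[B'] (Fin r → B') := LinearMap.pi s
  let ε : (Fin r → B') →ₗ[B'] (Fin r → B') := (D.ιM e).mulVecLin
  have hεε : ∀ x, ε (ε x) = ε x := fun x => by
    simp only [ε, Matrix.mulVecLin_apply, Matrix.mulVec_mulVec, ← map_mul, he]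
  have htf : ∀ x, t (f x) = ε x + ι c₀ • W'.mulVec x := fun x => by
    simp only [ε, Matrix.mulVecLin_apply]
    rw [← Matrix.smul_mulVec, ← Matrix.add_mulVec, ← hW']
    funext i
    simp [t, f, Fintype.linearCombination_apply, Matrix.mulVec, dotProduct, S, mul_comm]
  have hft : ∀ x, ∃ y, f (t x) = x + ι c₀ • y := fun x => by
    obtain ⟨y, hy⟩ := hs x
    have h2 : ι c₁ = ι c₀ * ι D.ν := by rw [← map_mul]; exact congrArg ι D.c₁_eq
    refine ⟨-(ι D.ν • y), ?_⟩
    rw [smul_neg, smul_smul, ← h2, ← hy, neg_sub, add_sub_cancel]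
    simp [t, f, Fintype.linearCombination_apply]
  let α : M →ₗ[B'] M := f ∘ₗ ε ∘ₗ t
  have hα : ∀ x, ∃ y, α x = x + ι c₀ • y := fun x => by
    obtain ⟨y, hy⟩ := hft x
    obtain ⟨z, hz⟩ := hft (f (t x))
    refine ⟨y + z - f (W'.mulVec (t x)), ?_⟩
    have h1 : ε (t x) = t (f (t x)) - ι c₀ • W'.mulVec (t x) := by
      rw [htf, add_sub_cancel_right]
    change f (ε (t x)) = _
    rw [h1, map_sub, hz, map_smul, hy]
    simp only [smul_add, smul_sub]
    abel
  have hsurj : Function.Surjective α := by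
    rw [← LinearMap.range_eq_top, ← top_le_iff]
    refine Submodule.le_of_le_smul_of_le_jacobson_bot (I := Ideal.span {ι c₀}) hfin.fg_top ?_ ?_
    · have := D.complete₀'
      exact IsAdicComplete.le_jacobson_bot _
    · intro x _
      obtain ⟨y, hy⟩ := hα x
      rw [show x = α x + -(ι c₀ • y) by rw [hy, add_neg_cancel_right]]
      refine Submodule.add_mem_sup ⟨x, rfl⟩ (neg_mem ?_)
      exact Submodule.smul_mem_smul (Ideal.mem_span_singleton_self _) trivial
  have hbij : Function.Bijective α :=
    ⟨OrzechProperty.injective_of_surjective_endomorphism α hsurj, hsurj⟩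
  let β := LinearEquiv.ofBijective α hbij
  have hβ : ∀ x, f (ε (t (β.symm x))) = x := fun x => β.apply_symm_apply x
  let q : M →ₗ[B'] (Fin r → B') := ε ∘ₗ t ∘ₗ β.symm.toLinearMap
  have hfq : ∀ x, f (ε (q x)) = x := fun x => by
    change f (ε (ε _)) = x
    rw [hεε]
    exact hβ x
  have hεq : ∀ x, ε (q x) = q x := fun x => hεε _
  have hfq' : ∀ x, f (q x) = x := fun x => by rw [← hεq, hfq]
  have hρ : ∀ x, ∃ y, ε x - q (f (ε x)) = ι c₀ • y := fun x => by
    obtain ⟨z, hz⟩ := hα (β.symm (f (ε x)))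
    have h1 : β.symm (f (ε x)) = f (ε x) - ι c₀ • z :=
      eq_sub_of_add_eq (hz.symm.trans (β.apply_symm_apply _))
    refine ⟨ε (t z) - ε (W'.mulVec (ε x)), ?_⟩
    change ε x - ε (t (β.symm (f (ε x)))) = _
    rw [h1, map_sub, htf, map_smul, map_sub, map_add, hεε, hεε, map_smul, map_smul, smul_sub]
    abel
  have hρn : ∀ n x, ∃ y, ε x - q (f (ε x)) = ι c₀ ^ n • y := fun n => by
    induction n with
    | zero => exact fun x => ⟨_, by rw [pow_zero, one_smul]⟩
    | succ n ih =>
      intro x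
      obtain ⟨y, hy⟩ := ih x
      obtain ⟨z, hz⟩ := hρ y
      refine ⟨z, ?_⟩
      have h1 : ε x - q (f (ε x)) = ε (ε x - q (f (ε x))) - q (f (ε (ε x - q (f (ε x))))) := by
        rw [map_sub, hεε, hεq, map_sub, map_sub, hfq', sub_self, sub_zero]
      rw [h1, hy, map_smul, map_smul, map_smul, ← smul_sub, hz, smul_smul, ← pow_succ]
  have hqf : ∀ x, q (f (ε x)) = ε x := fun x => by
    rw [eq_comm, ← sub_eq_zero]
    funext i
    have := D.complete₀'
    refine eq_zero_of_forall_mem_pow (I := Ideal.span {ι c₀}) (fun n => ?_)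
    obtain ⟨y, hy⟩ := hρn n x
    rw [hy, Ideal.span_singleton_pow, Ideal.mem_span_singleton]
    exact ⟨y i, rfl⟩
  have hfe : ∀ j, f (ε (Pi.single j 1)) = ∑ i, ι (e i j) • m i := fun j => by
    simp [ε, f, Fintype.linearCombination_apply, D.ιM_apply]
  refine ⟨r, e, fun j => f (ε (Pi.single j 1)), q, he, fun x => ?_, fun i j => ?_, fun g j => ?_⟩
  · refine Eq.trans ?_ (hfq x)
    nth_rewrite 2 [pi_eq_sum_univ' (q x)]
    simp only [map_sum, map_smul]
  · rw [hqf]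
    simp [ε, D.ιM_apply]
  · choose y hy using fun i => hm g i
    choose a ha using fun i => D.ι_dvd_smul_sub g (e i j)
    refine ⟨∑ i, (ι (e i j) • y i + a i • m i + ι c₁ • a i • y i), ?_⟩
    beta_reduce
    rw [hfe, Finset.smul_sum, ← Finset.sum_sub_distrib, Finset.smul_sum]
    refine Finset.sum_congr rfl (fun i _ => ?_)
    rw [smul_distrib_smul, eq_add_of_sub_eq (hy i), eq_add_of_sub_eq (ha i)]
    simp only [add_smul, smul_add, mul_smul, smul_comm (ι (e i j)) (ι c₁), smul_comm (a i) (ι c₁)]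
    abel

/-- A representation over `B'` which is trivial modulo `c₁` contains a lattice. -/
theorem exists_lattice {M : SemilinRep G B'} (hM : Module.Projective B' M)
    (hfin : Module.Finite B' M) (h : IsTrivialMod (ι c₁) M) : Nonempty (Lattice ι c₁ M) := by
  obtain ⟨r, e, m, q, he, hqm, hmq, hm⟩ := D.exists_basis hM hfin h
  set F : G → Matrix (Fin r) (Fin r) B' := fun g => Matrix.of (fun i j => q (g • m j) i) with hF
  have hFq : ∀ (g : G) x, q (g • x) = (F g).mulVec (fun i => g • q x i) := fun g x => by
    nth_rewrite 1 [← hqm x]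
    funext i
    simp [Finset.smul_sum, smul_distrib_smul, Matrix.mulVec, dotProduct, F, mul_comm]
  have heq : ∀ x, (D.ιM e).mulVec (q x) = q x := fun x => by
    nth_rewrite 2 [← hqm x]
    funext i
    simp [Matrix.mulVec, dotProduct, hmq, D.ιM_apply, mul_comm]
  have hsys : D.IsSystem e F := by
    refine ⟨fun g => ?_, fun g => ?_, fun g k => ?_⟩
    · ext i j
      exact congrFun (heq (g • m j)) i
    · ext i j
      have := congrFun (hFq g (m j)) i
      simp only [hmq] at this
      exact this.symm
    · ext i j
      have h1 := congrFun (hFq g (k • m j)) i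
      have h2 := congrFun (hFq k (g • m j)) i
      rw [← mul_smul, mul_comm, mul_smul, h2] at h1
      exact h1.symm
  obtain ⟨T, V, hTV, hVT, heT, E, hE, hEe⟩ := D.exists_descent he hsys (fun g => by
    choose y hy using hm g
    refine ⟨Matrix.of (fun i j => q (y j) i), ?_⟩
    ext i j
    have h1 := congrArg (fun x => q x i) (hy j)
    simp only [map_sub, map_smul, Pi.sub_apply, Pi.smul_apply, smul_eq_mul, hmq] at h1
    simp only [F, Matrix.of_apply, Matrix.add_apply, Matrix.smul_apply, D.ιM_apply, smul_eq_mul]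
    linear_combination h1)
  choose Z hZ using hEe
  have hqn : ∀ j, q (∑ i, T i j • m i) = fun i => (T * D.ιM e) i j := fun j => by
    rw [← heT]
    funext i
    simp [hmq, Matrix.mul_apply, D.ιM_apply, mul_comm]
  have hsum : ∀ x, ∑ j, (V.mulVec (q x)) j • ∑ i, T i j • m i = x := fun x => by
    nth_rewrite 2 [← hqm x]
    have h1 : T.mulVec (V.mulVec (q x)) = q x := by rw [Matrix.mulVec_mulVec, hTV, Matrix.one_mulVec]
    nth_rewrite 2 [← h1]
    generalize V.mulVec (q x) = w
    simp only [Matrix.mulVec, dotProduct, Finset.smul_sum, Finset.sum_smul, smul_smul]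
    rw [Finset.sum_comm]
    simp only [mul_comm]
  have hcoord : ∀ (g : G) j, V.mulVec (q (g • ∑ i, T i j • m i)) = fun i => D.ιM (E g) i j :=
    fun g j => by
    have h1 : q (g • ∑ i, T i j • m i) = fun i => (T * D.ιM (E g)) i j := by
      rw [hFq, hqn, hE]
      nth_rewrite 2 [← hsys.right]
      rw [mul_assoc, ← map_mul, heT]
      rfl
    rw [h1]
    funext i
    change (V * (T * D.ιM (E g))) i j = _
    rw [← mul_assoc, hVT, one_mul]
  refine ⟨⟨r, fun j => ∑ i, T i j • m i, (V.mulVecLin).comp q, E, hsum,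
    fun g i j => congrFun (hcoord g j) i, fun g j => ⟨fun i => Z g i j, ?_⟩⟩⟩
  have h1 : V.mulVec (q (∑ i, T i j • m i)) = fun i => D.ιM e i j := by
    rw [hqn]
    funext i
    change (V * (T * D.ιM e)) i j = _
    rw [← mul_assoc, hVT, one_mul]
  rw [← hsum (g • ∑ i, T i j • m i)]
  nth_rewrite 2 [← hsum (∑ i, T i j • m i)]
  rw [hcoord, h1, ← Finset.sum_sub_distrib]
  refine Finset.sum_congr rfl (fun i _ => ?_)
  rw [← sub_smul, hZ]
  congr 1
  simp [D.ιM_apply]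

end DescentDatum

end Lattice

section Continuity

open Topology

lemma hasBasis_nhds_adicModule {B : Type*} [CommRing B] (I : Ideal B) {M : Type*} [AddCommGroup M]
    [Module B M] (x : M) : (@nhds M (I.adicModuleTopology M) x).HasBasis (fun _ : ℕ => True)
      (fun n => {y | y - x ∈ (I ^ n • ⊤ : Submodule B M)}) := by
  let _ := I.adic_basis.topology
  let T := (I.ringFilterBasis.moduleFilterBasis (I.adic_module_basis M)).toAddGroupFilterBasis
  have h := T.nhds_hasBasis x
  refine ⟨fun U => ?_⟩
  refine (h.mem_iff).trans ⟨?_, ?_⟩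
  · rintro ⟨_, ⟨n, rfl⟩, hV⟩
    refine ⟨n, trivial, fun y hy => hV ⟨y - x, hy, add_sub_cancel _ _⟩⟩
  · rintro ⟨n, -, hn⟩
    refine ⟨_, ⟨n, rfl⟩, ?_⟩
    rintro _ ⟨y, hy, rfl⟩
    refine hn ?_
    change x + y - x ∈ (I ^ n • ⊤ : Submodule B M)
    rw [add_sub_cancel_left]
    exact hy

variable {G : Type v} [Group G] [TopologicalSpace G] {B : Type u} [CommRing B]
  [MulSemiringAction G B] {I : Ideal B}

lemma smul_mem_pow (hI : ∀ (g : G), ∀ b ∈ I, g • b ∈ I) (g : G) (n : ℕ) {b : B} (hb : b ∈ I ^ n) :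
    g • b ∈ I ^ n := by
  have h1 : I.map (MulSemiringAction.toRingHom G B g) ≤ I := by
    rw [Ideal.map_le_iff_le_comap]
    exact hI g
  have h2 := Ideal.mem_map_of_mem (MulSemiringAction.toRingHom G B g) hb
  rw [Ideal.map_pow] at h2
  exact Ideal.pow_right_mono h1 n h2

lemma smul_mem_pow_smul_top (hI : ∀ (g : G), ∀ b ∈ I, g • b ∈ I) {M : SemilinRep G B} (g : G)
    (n : ℕ) {x : M} (hx : x ∈ (I ^ n • ⊤ : Submodule B M)) :
    g • x ∈ (I ^ n • ⊤ : Submodule B M) := by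
  refine Submodule.smul_induction_on hx (fun b hb m _ => ?_) (fun x y hx hy => ?_)
  · rw [smul_distrib_smul]
    exact Submodule.smul_mem_smul (smul_mem_pow hI g n hb) trivial
  · rw [smul_add]
    exact add_mem hx hy

/-- The continuity of the action is a condition on the orbits. -/
lemma continuous_action_iff (hI : ∀ (g : G), ∀ b ∈ I, g • b ∈ I) {M : SemilinRep G B} :
    @Continuous (G × M) M
      (@instTopologicalSpaceProd G M _ (I.adicModuleTopology M)) (I.adicModuleTopology M)
      (fun x => x.1 • x.2) ↔
    ∀ (x : M) (n : ℕ) (g₀ : G), ∀ᶠ g in 𝓝 g₀, g • x - g₀ • x ∈ (I ^ n • ⊤ : Submodule B M) := by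
  let := I.adicModuleTopology M
  have hb := hasBasis_nhds_adicModule I (M := M)
  constructor
  · intro h x n g₀
    have h1 := (h.comp (Continuous.prodMk_left x)).tendsto g₀
    exact h1.eventually ((hb _).mem_of_mem (i := n) trivial)
  · intro h
    rw [continuous_iff_continuousAt]
    rintro ⟨g₀, x₀⟩
    rw [ContinuousAt, (hb _).tendsto_right_iff, nhds_prod_eq]
    intro n _
    have h2 := (h x₀ n g₀).prod_mk ((hb x₀).mem_of_mem (i := n) trivial)
    refine h2.mono ?_
    rintro ⟨g, x⟩ ⟨h3, h4⟩
    have h5 := add_mem (smul_mem_pow_smul_top hI g n h4) h3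
    rw [smul_sub, sub_add_sub_cancel] at h5
    exact h5

end Continuity

section Lattice

variable {G : Type v} [CommGroup G] {B B' : Type u} [CommRing B] [MulSemiringAction G B]
  [CommRing B'] [MulSemiringAction G B'] {ι : B →+*[G] B'} {J : Ideal B} {K : Type w} [Zero K]
  {c₀ c₁ : B}

namespace Lattice

variable {M : SemilinRep G B'} (Λ : Lattice ι c₁ M)

lemma coord_basis (i j) : Λ.coord (Λ.basis j) i = ι (Λ.mat 1 i j) := by
  rw [← Λ.coord_smul_basis, one_smul]

lemma coord_sum (y : Fin Λ.rank → B') (i) :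
    Λ.coord (∑ j, y j • Λ.basis j) i = ∑ j, y j * ι (Λ.mat 1 i j) := by
  simp [Λ.coord_basis]

lemma coord_smul (g : G) (x : M) (i) :
    Λ.coord (g • x) i = ∑ j, g • Λ.coord x j * ι (Λ.mat g i j) := by
  nth_rewrite 1 [← Λ.sum_coord x]
  simp [Finset.smul_sum, smul_distrib_smul, Λ.coord_smul_basis]

lemma finite (Λ : Lattice ι c₁ M) : Module.Finite B' M :=
  Module.Finite.of_surjective (Fintype.linearCombination B' Λ.basis)
    (fun x => ⟨Λ.coord x, Λ.sum_coord x⟩)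

lemma projective (Λ : Lattice ι c₁ M) : Module.Projective B' M :=
  Module.Projective.of_split Λ.coord (Fintype.linearCombination B' Λ.basis)
    (LinearMap.ext Λ.sum_coord)

/-- The elements with coordinates in `B`. -/
def sub : AddSubgroup M where
  carrier := {x | ∀ i, Λ.coord x i ∈ Set.range ι}
  zero_mem' i := ⟨0, by simp⟩
  add_mem' hx hy i := by
    obtain ⟨a, ha⟩ := hx i
    obtain ⟨b, hb⟩ := hy i
    exact ⟨a + b, by rw [map_add, map_add, ha, hb]; rfl⟩
  neg_mem' hx i := by
    obtain ⟨a, ha⟩ := hx i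
    exact ⟨-a, by rw [map_neg, map_neg, ha]; rfl⟩

lemma smul_mem_sub (g : G) {x : M} (hx : x ∈ Λ.sub) : g • x ∈ Λ.sub := fun i => by
  choose b hb using hx
  refine ⟨∑ j, g • b j * Λ.mat g i j, ?_⟩
  rw [coord_smul]
  simp [← hb]

lemma ι_smul_mem_sub (b : B) {x : M} (hx : x ∈ Λ.sub) : ι b • x ∈ Λ.sub := fun i => by
  obtain ⟨a, ha⟩ := hx i
  exact ⟨b * a, by rw [map_mul, ha, map_smul]; rfl⟩

lemma basis_mem_sub (j) : Λ.basis j ∈ Λ.sub := fun i => ⟨_, (Λ.coord_basis i j).symm⟩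

instance : Module B Λ.sub where
  smul b x := ⟨ι b • x.1, Λ.ι_smul_mem_sub b x.2⟩
  one_smul x := Subtype.ext (by change ι 1 • x.1 = x.1; rw [map_one, one_smul])
  mul_smul a b x := Subtype.ext (by
    change ι (a * b) • x.1 = ι a • ι b • x.1; rw [map_mul, mul_smul])
  smul_zero a := Subtype.ext (smul_zero (ι a))
  smul_add a x y := Subtype.ext (smul_add (ι a) x.1 y.1)
  add_smul a b x := Subtype.ext (by
    change ι (a + b) • x.1 = ι a • x.1 + ι b • x.1; rw [map_add, add_smul])
  zero_smul x := Subtype.ext (by change ι 0 • x.1 = 0; rw [map_zero, zero_smul])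

instance : DistribMulAction G Λ.sub where
  smul g x := ⟨g • x.1, Λ.smul_mem_sub g x.2⟩
  one_smul x := Subtype.ext (one_smul G x.1)
  mul_smul g h x := Subtype.ext (mul_smul g h x.1)
  smul_zero g := Subtype.ext (smul_zero g)
  smul_add g x y := Subtype.ext (smul_add g x.1 y.1)

/-- The representation over `B` on the elements with coordinates in `B`. -/
def rep : SemilinRep G B where
  carrier := Λ.sub
  semilinear := ⟨fun g b x => Subtype.ext (by
    change g • ι b • x.1 = ι (g • b) • g • x.1
    rw [smul_distrib_smul, map_smul])⟩

/-- The inclusion of the representation over `B`. -/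
def val : Λ.rep →+ M := Λ.sub.subtype

lemma val_injective : Function.Injective Λ.val := Subtype.val_injective

lemma val_mem (x : Λ.rep) : Λ.val x ∈ Λ.sub := x.2

lemma val_smul (b : B) (x : Λ.rep) : Λ.val (b • x) = ι b • Λ.val x := rfl

lemma val_act (g : G) (x : Λ.rep) : Λ.val (g • x) = g • Λ.val x := rfl

/-- The generators of the representation over `B`. -/
def repBasis (j : Fin Λ.rank) : Λ.rep := (⟨Λ.basis j, Λ.basis_mem_sub j⟩ : Λ.sub)

lemma val_repBasis (j) : Λ.val (Λ.repBasis j) = Λ.basis j := rfl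

/-- The base change of the representation over `B` is the given one. -/
def repIso : (SemilinRep.baseChange ι).obj Λ.rep ≅ M :=
  let f : BaseChange ι Λ.rep →ₗ[B'] M := BaseChange.lift (σ := RingHom.id B') Λ.val (fun _ _ => rfl)
  let g : M →ₗ[B'] BaseChange ι Λ.rep :=
    (Fintype.linearCombination B' (fun j => BaseChange.incl ι (Λ.repBasis j))).comp Λ.coord
  have hf : ∀ x : Λ.rep, f (BaseChange.incl ι x) = Λ.val x := BaseChange.lift_incl ι _ _
  have hg : ∀ x, g x = ∑ j, Λ.coord x j • BaseChange.incl ι (Λ.repBasis j) := fun x => rfl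
  have hfg : ∀ x, f (g x) = x := fun x => by
    rw [hg, map_sum]
    simp only [map_smul, hf, val_repBasis, Λ.sum_coord]
  have hgf : g.comp f = LinearMap.id := BaseChange.ext_incl ι (fun x => by
    change g (f (BaseChange.incl ι x)) = BaseChange.incl ι x
    rw [hf, hg]
    choose b hb using Λ.val_mem x
    have h1 : x = ∑ j, b j • Λ.repBasis j := Λ.val_injective (by
      rw [map_sum]
      simp only [val_smul, val_repBasis, hb, Λ.sum_coord])
    nth_rewrite 2 [h1]
    rw [map_sum]
    simp only [BaseChange.incl_smul, hb])
  have hact : ∀ (γ : G) x, f (γ • x) = γ • f x := fun γ x => by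
    induction x using BaseChange.induction_on with
    | tmul b' m =>
      rw [BaseChange.tmul_eq, smul_distrib_smul, BaseChange.smul_incl, f.map_smul, f.map_smul, hf, hf,
        smul_distrib_smul, val_act]
    | add x y hx hy => rw [smul_add, map_add, map_add, hx, hy, smul_add]
  { hom := ⟨f, hact⟩
    inv := ⟨g, fun γ x => by
      have h1 : ∀ y, g (f y) = y := LinearMap.congr_fun hgf
      exact (congrArg (fun z => g (γ • z)) (hfg x).symm).trans
        ((congrArg g (hact γ (g x)).symm).trans (h1 _))⟩
    hom_inv_id := SemilinRep.hom_ext hgf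
    inv_hom_id := SemilinRep.hom_ext (LinearMap.ext hfg) }

section

variable (D : DescentDatum ι J K c₀ c₁)

include D

lemma mat_sub_dvd (g : G) (i j) : c₁ ∣ Λ.mat g i j - Λ.mat 1 i j := by
  obtain ⟨a, ha⟩ := Λ.smul_basis_sub g j
  refine ⟨∑ k, a k * Λ.mat 1 i k, D.injective ?_⟩
  have h1 := congrArg (fun x => Λ.coord x i) ha
  simp only [map_sub, Pi.sub_apply, Λ.coord_smul_basis, Λ.coord_basis, Λ.coord_sum] at h1
  rw [map_sub, h1, Finset.mul_sum, map_sum]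
  simp only [map_mul, mul_assoc]

lemma isTrivialMod (Λ : Lattice ι c₁ M) : IsTrivialMod (ι c₁) M := by
  refine isTrivialMod_of_frame (r := Λ.rank) Λ.basis (fun i => (LinearMap.proj i).comp Λ.coord)
    Λ.sum_coord (fun g j => ?_) (fun g i y => ?_)
  · obtain ⟨a, ha⟩ := Λ.smul_basis_sub g j
    refine ⟨∑ i, ι (a i) • Λ.basis i, ?_⟩
    rw [ha, Finset.smul_sum]
    simp only [smul_smul, map_mul]
  · change ι c₁ ∣ Λ.coord (g • y) i - g • Λ.coord y i
    have h1 : Λ.coord y i = ∑ j, Λ.coord y j * ι (Λ.mat 1 i j) := by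
      rw [← Λ.coord_sum, Λ.sum_coord]
    rw [Λ.coord_smul, h1, Finset.smul_sum, ← Finset.sum_sub_distrib]
    refine Finset.dvd_sum (fun j _ => ?_)
    rw [smul_mul', ← mul_sub, ← map_smul, ← map_sub]
    refine Dvd.dvd.mul_left (map_dvd ι ?_) _
    rw [show Λ.mat g i j - g • Λ.mat 1 i j = Λ.mat g i j - Λ.mat 1 i j -
      (g • Λ.mat 1 i j - Λ.mat 1 i j) by ring]
    exact dvd_sub (Λ.mat_sub_dvd D g i j) (D.dvd_smul_sub _ _)

/-- A set of elements on which the group acts trivially modulo `c₁`, within the set, has coordinates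
in `B`. -/
theorem mem_sub_of_forall (V : Set M)
    (hV : ∀ v ∈ V, ∀ g : G, ∃ w ∈ V, g • v - v = ι c₁ • w) {v : M} (hv : v ∈ V) : v ∈ Λ.sub := by
  have hsum : ∀ k (y : Fin Λ.rank → B') i, D.pr k (Λ.coord (∑ j, y j • Λ.basis j) i) =
      ∑ j, Λ.mat 1 i j * D.pr k (y j) := fun k y i => by
    rw [Λ.coord_sum, map_sum]
    simp only [mul_comm _ (ι _), D.pr_mul]
  have key : ∀ n, ∀ k, k ≠ 0 → ∀ v ∈ V, ∀ i, c₀ ^ n ∣ D.pr k (Λ.coord v i) := by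
    intro n k hk
    induction n with
    | zero => exact fun v _ i => by rw [pow_zero]; exact one_dvd _
    | succ n ih =>
      intro v hv i
      obtain ⟨w, hw, hvw⟩ := hV v hv (D.gen k)
      choose x hx using ih v hv
      obtain ⟨y, hy⟩ := ih w hw i
      choose a ha using Λ.smul_basis_sub (D.gen k)
      choose z hz using fun j => D.dvd_smul_sub (D.gen k) (x j)
      obtain ⟨κ, hκ⟩ := D.gen_dvd k hk
      set g := D.gen k with hg
      have hgx : ∀ j, g • D.pr k (Λ.coord v j) = c₀ ^ n * (x j + c₁ * z j) := fun j => by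
        rw [hx, smul_mul', smul_pow', D.smul_c₀, eq_add_of_sub_eq (hz j), add_comm]
      have h1 : D.pr k (Λ.coord (g • v) i) = D.χ k g * (c₀ ^ n * (∑ j, (x j + c₁ * z j) *
          Λ.mat g i j)) := by
        rw [Λ.coord_smul, map_sum, Finset.mul_sum, Finset.mul_sum]
        refine Finset.sum_congr rfl (fun j _ => ?_)
        rw [mul_comm _ (ι _), D.pr_mul, D.pr_smul, hgx]
        ring
      choose b hb using fun j => Λ.mat_sub_dvd D g i j
      have h2 : D.pr k (Λ.coord v i) = ∑ j, Λ.mat 1 i j * (c₀ ^ n * x j) := by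
        nth_rewrite 1 [← Λ.sum_coord v]
        rw [hsum]
        simp only [hx]
      have h3 : ∑ j, (x j + c₁ * z j) * Λ.mat g i j = ∑ j, Λ.mat 1 i j * x j + c₁ *
          ∑ j, (z j * Λ.mat g i j + x j * b j) := by
        rw [Finset.mul_sum, ← Finset.sum_add_distrib]
        refine Finset.sum_congr rfl (fun j _ => ?_)
        rw [eq_add_of_sub_eq (hb j)]
        ring
      have h4 : D.pr k (Λ.coord v i) = c₀ ^ n * ∑ j, Λ.mat 1 i j * x j := by
        rw [h2, Finset.mul_sum]
        exact Finset.sum_congr rfl (fun j _ => by ring)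
      have h5 := congrArg (fun m => D.pr k (Λ.coord m i)) hvw
      simp only [map_sub, Pi.sub_apply, map_smul, Pi.smul_apply, smul_eq_mul, D.pr_mul, h1, hy]
        at h5
      rw [h3, h4] at h5
      have hx' : ∑ j, Λ.mat 1 i j * x j = x i := D.cancel₀ n (by rw [← h4, hx])
      rw [hx'] at h5
      rw [hx]
      set t := D.χ k g - 1 with ht
      have := D.complete
      have hte : AdicEmbedding J t := D.embedding.of_dvd (D.c₁_eq ▸ ⟨c₀ * κ, by rw [hκ]; ring⟩)
      set s := ∑ j, (z j * Λ.mat g i j + x j * b j)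
      have h6 : t * x i = t * (c₀ * (κ * (y - D.χ k g * s))) := D.cancel₀ n (by
        have h7 : c₁ = c₀ * (t * κ) := D.c₁_eq.trans (congrArg _ hκ)
        linear_combination h5 + c₀ ^ n * (y - D.χ k g * s) * h7 + c₀ ^ n * x i * ht)
      rw [hte.cancel h6, pow_succ]
      exact ⟨_, (mul_assoc _ _ _).symm⟩
  exact fun i => ⟨_, (D.eq_ι (fun k hk => D.eq_zero_of_dvd_pow (fun n => key n k hk v hv i))).symm⟩

end

end Lattice

end Lattice

lemma isEquivalence_lift {C D : Type*} [Category C] [Category D] {P : ObjectProperty C}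
    {Q : ObjectProperty D} (F : C ⥤ D) (h : ∀ X, P X → Q (F.obj X))
    (hfaith : ∀ X Y, P X → P Y → ∀ f g : X ⟶ Y, F.map f = F.map g → f = g)
    (hfull : ∀ X Y, P X → P Y → ∀ g : F.obj X ⟶ F.obj Y, ∃ f, F.map f = g)
    (hsurj : ∀ Y, Q Y → ∃ X, P X ∧ Nonempty (F.obj X ≅ Y)) :
    (Q.lift (P.ι ⋙ F) (fun M => h M.obj M.property)).IsEquivalence where
  faithful := ⟨fun {X Y f g} hfg => ObjectProperty.hom_ext P
    (hfaith _ _ X.property Y.property _ _ (congrArg (fun k => k.hom) hfg))⟩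
  full := ⟨fun {X Y} g => by
    obtain ⟨f, hf⟩ := hfull _ _ X.property Y.property g.hom
    exact ⟨P.homMk f, ObjectProperty.hom_ext Q hf⟩⟩
  essSurj := ⟨fun Y => by
    obtain ⟨X, hX, ⟨e⟩⟩ := hsurj Y.obj Y.property
    exact ⟨⟨X, hX⟩, ⟨Q.isoMk e⟩⟩⟩

lemma exists_dual_basis {B : Type*} [CommRing B] {M : Type*} [AddCommGroup M] [Module B M]
    (hfin : Module.Finite B M) (hproj : Module.Projective B M) :
    ∃ (r : ℕ) (x : Fin r → M) (l : M →ₗ[B] Fin r → B), ∀ y, ∑ i, l y i • x i = y := by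
  obtain ⟨r, f, g, -, -, hfg⟩ := Module.Finite.exists_comp_eq_id_of_projective B M
  refine ⟨r, fun i => f (Pi.single i 1), g, fun y => ?_⟩
  refine Eq.trans ?_ (LinearMap.congr_fun hfg y)
  rw [LinearMap.comp_apply]
  nth_rewrite 2 [pi_eq_sum_univ' (g y)]
  rw [map_sum]
  simp only [map_smul]

section Descent

open Topology

variable {G : Type v} [CommGroup G] {B B' : Type u} [CommRing B] [MulSemiringAction G B]
  [CommRing B'] [MulSemiringAction G B'] {ι : B →+*[G] B'} {J : Ideal B} {K : Type w} [Zero K]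
  {c₀ c₁ : B}

/-- The extension of a linear map to the base change. -/
def coordBaseChange (ι : B →+*[G] B') {M : Type u} [AddCommGroup M] [Module B M] {r : ℕ}
    (l : M →ₗ[B] Fin r → B) : BaseChange ι M →ₗ[B'] Fin r → B' :=
  BaseChange.lift (σ := RingHom.id B')
    (h := ((ι : B →+* B').toAddMonoidHom.compLeft (Fin r)).comp l.toAddMonoidHom)
    (fun b m => by
      funext i
      change ι (l (b • m) i) = ι b * ι (l m i)
      rw [map_smul, Pi.smul_apply, smul_eq_mul, map_mul])

lemma coordBaseChange_incl {M : Type u} [AddCommGroup M] [Module B M] {r : ℕ}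
    (l : M →ₗ[B] Fin r → B) (m : M) (i) :
    coordBaseChange ι l (BaseChange.incl ι m) i = ι (l m i) :=
  congrFun (BaseChange.lift_incl ι _ _ m) i

lemma sum_coordBaseChange {M : Type u} [AddCommGroup M] [Module B M] {r : ℕ} {x : Fin r → M}
    {l : M →ₗ[B] Fin r → B} (hl : ∀ y, ∑ i, l y i • x i = y) (y : BaseChange ι M) :
    ∑ i, coordBaseChange ι l y i • BaseChange.incl ι (x i) = y := by
  have h : (Fintype.linearCombination B' (fun i => BaseChange.incl ι (x i))).comp
      (coordBaseChange ι l) = LinearMap.id := BaseChange.ext_incl ι (fun m => by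
    change ∑ i, coordBaseChange ι l (BaseChange.incl ι m) i • BaseChange.incl ι (x i) =
      BaseChange.incl ι m
    nth_rewrite 2 [← hl m]
    rw [map_sum]
    simp only [coordBaseChange_incl, BaseChange.incl_smul])
  exact LinearMap.congr_fun h y

lemma incl_injective (hι : Function.Injective ι) {M : Type u} [AddCommGroup M] [Module B M] {r : ℕ}
    {x : Fin r → M} {l : M →ₗ[B] Fin r → B} (hl : ∀ y, ∑ i, l y i • x i = y) :
    Function.Injective (BaseChange.incl ι (M := M)) := by
  intro m n h
  rw [← hl m, ← hl n]
  refine Finset.sum_congr rfl (fun i _ => ?_)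
  congr 1
  apply hι
  rw [← coordBaseChange_incl l, h, coordBaseChange_incl]

/-- The lattice in a base change. -/
def Lattice.ofRep (M : SemilinRep G B) {r : ℕ} (x : Fin r → M) (l : M →ₗ[B] Fin r → B)
    (hl : ∀ y, ∑ i, l y i • x i = y) (hM : ∀ (g : G) (y : M), ∃ z, g • y - y = c₁ • z) :
    Lattice ι c₁ ((SemilinRep.baseChange ι).obj M) where
  rank := r
  basis i := BaseChange.incl ι (x i)
  coord := coordBaseChange ι l
  mat g := Matrix.of (fun i j => l (g • x j) i)
  sum_coord := sum_coordBaseChange hl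
  coord_smul_basis g i j := by
    refine Eq.trans (congrArg (fun y => coordBaseChange ι l y i) (BaseChange.smul_incl ι g (x j)))
      (coordBaseChange_incl l _ i)
  smul_basis_sub g j := by
    obtain ⟨z, hz⟩ := hM g (x j)
    refine ⟨l z, ?_⟩
    refine Eq.trans (b := BaseChange.incl ι (g • x j - x j)) ?_ ?_
    · rw [map_sub, ← BaseChange.smul_incl]
      rfl
    · rw [hz]
      nth_rewrite 1 [← hl z]
      rw [Finset.smul_sum, map_sum]
      refine Finset.sum_congr rfl (fun i _ => ?_)
      rw [smul_smul, BaseChange.incl_smul]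
      rfl

lemma mem_sub_ofRep {M : SemilinRep G B} {r : ℕ} {x : Fin r → M} {l : M →ₗ[B] Fin r → B}
    {hl : ∀ y, ∑ i, l y i • x i = y} {hM : ∀ (g : G) (y : M), ∃ z, g • y - y = c₁ • z}
    {y : (SemilinRep.baseChange ι).obj M} (hy : y ∈ (Lattice.ofRep (ι := ι) M x l hl hM).sub) :
    ∃ m : M, BaseChange.incl ι m = y := by
  choose b hb using hy
  refine ⟨∑ i, b i • x i, ?_⟩
  refine Eq.trans ?_ (sum_coordBaseChange hl y)
  rw [map_sum]
  refine Finset.sum_congr rfl (fun i _ => ?_)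
  rw [BaseChange.incl_smul]
  exact congrArg (· • _) (hb i)

/-- A linear map of base changes which preserves the modules over `B` descends. -/
lemma exists_linearMap_of_incl {M N : Type u} [AddCommGroup M] [Module B M] [AddCommGroup N]
    [Module B N] (hinj : Function.Injective (BaseChange.incl ι (M := N)))
    (f : BaseChange ι M →ₗ[B'] BaseChange ι N)
    (hf : ∀ m, ∃ n, BaseChange.incl ι n = f (BaseChange.incl ι m)) :
    ∃ a : M →ₗ[B] N, BaseChange.map ι a = f := by
  choose a ha using hf
  refine ⟨⟨⟨a, fun x y => hinj ?_⟩, fun b x => hinj ?_⟩, BaseChange.ext_incl ι (fun m => ?_)⟩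
  · rw [map_add, ha, ha, ha, map_add, map_add]
  · rw [ha, RingHom.id_apply, BaseChange.incl_smul, BaseChange.incl_smul, map_smul, ha]
  · rw [BaseChange.map_incl]
    exact ha m

lemma smul_mem_map (hJ : ∀ (g : G), ∀ b ∈ J, g • b ∈ J) (g : G) {b : B'}
    (hb : b ∈ J.map (ι : B →+* B')) : g • b ∈ J.map (ι : B →+* B') := by
  revert b
  change J.map (ι : B →+* B') ≤ (J.map (ι : B →+* B')).comap (MulSemiringAction.toRingHom G B' g)
  rw [Ideal.map_le_iff_le_comap]
  intro b hb
  change g • ι b ∈ J.map (ι : B →+* B')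
  rw [← map_smul]
  exact Ideal.mem_map_of_mem (ι : B →+* B') (hJ g b hb)

lemma eventually_smul_sub_mem [TopologicalSpace G]
    (hcont : ∀ (x : B') (n : ℕ) (g₀ : G), ∀ᶠ g in 𝓝 g₀,
      g • x - g₀ • x ∈ (J.map (ι : B →+* B')) ^ n) {M : SemilinRep G B}
    (hM : ∀ (x : M) (n : ℕ) (g₀ : G), ∀ᶠ g in 𝓝 g₀,
      g • x - g₀ • x ∈ (J ^ n • ⊤ : Submodule B M)) (y : BaseChange ι M) (n : ℕ) (g₀ : G) :
    ∀ᶠ g in 𝓝 g₀, g • y - g₀ • y ∈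
      ((J.map (ι : B →+* B')) ^ n • ⊤ : Submodule B' (BaseChange ι M)) := by
  induction y using BaseChange.induction_on with
  | tmul b' m =>
    filter_upwards [hcont b' n g₀, hM m n g₀] with g h1 h2
    have h3 : BaseChange.incl ι (g • m) - BaseChange.incl ι (g₀ • m) ∈
        ((J.map (ι : B →+* B')) ^ n • ⊤ : Submodule B' (BaseChange ι M)) := by
      rw [← map_sub]
      refine Submodule.smul_induction_on h2 (fun b hb m _ => ?_) (fun x y hx hy => ?_)
      · rw [BaseChange.incl_smul]
        refine Submodule.smul_mem_smul ?_ trivial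
        rw [← Ideal.map_pow]
        exact Ideal.mem_map_of_mem (ι : B →+* B') hb
      · rw [map_add]
        exact add_mem hx hy
    rw [BaseChange.tmul_eq, smul_distrib_smul g b' (BaseChange.incl ι m),
      smul_distrib_smul g₀ b' (BaseChange.incl ι m), BaseChange.smul_incl,
      BaseChange.smul_incl, show (g • b') • BaseChange.incl ι (g • m) -
        (g₀ • b') • BaseChange.incl ι (g₀ • m) = (g • b' - g₀ • b') • BaseChange.incl ι (g • m) +
        (g₀ • b') • (BaseChange.incl ι (g • m) - BaseChange.incl ι (g₀ • m)) by
          rw [sub_smul, smul_sub]; abel]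
    exact add_mem (Submodule.smul_mem_smul h1 trivial) (Submodule.smul_mem _ _ h3)
  | add y z hy hz =>
    filter_upwards [hy, hz] with g h1 h2
    rw [smul_add, smul_add, add_sub_add_comm]
    exact add_mem h1 h2

namespace DescentDatum

variable (D : DescentDatum ι J K c₀ c₁)

include D

lemma exists_smul_sum_sub_eq {M : SemilinRep G B} {r : ℕ} {m : Fin r → M} {g : G}
    (hm : ∀ i, ∃ n, g • m i - m i = c₁ • n) (s : Fin r → B) :
    ∃ z, g • ∑ i, s i • m i - ∑ i, s i • m i = c₁ • z := by
  choose n hn using hm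
  choose b hb using fun i => D.dvd_smul_sub g (s i)
  refine ⟨∑ i, (s i • n i + b i • m i + c₁ • b i • n i), ?_⟩
  rw [Finset.smul_sum, Finset.smul_sum, ← Finset.sum_sub_distrib]
  refine Finset.sum_congr rfl (fun i _ => ?_)
  rw [smul_distrib_smul, eq_add_of_sub_eq (hn i), eq_add_of_sub_eq (hb i)]
  simp only [add_smul, smul_add, mul_smul, smul_comm (s i) c₁, smul_comm (b i) c₁]
  abel

lemma exists_smul_sub_eq {M : SemilinRep G B} (hproj : Module.Projective B M)
    (h : IsTrivialMod c₁ M) (g : G) (y : M) : ∃ z, g • y - y = c₁ • z := by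
  obtain ⟨r, m, s, hs, hm, -⟩ := h.exists_frame D.smul_c₁ hproj
  obtain ⟨z, hz⟩ := hs y
  obtain ⟨w, hw⟩ := D.exists_smul_sum_sub_eq (hm g) (fun i => s i y)
  refine ⟨w + (g • z - z), ?_⟩
  rw [smul_add, ← hw, smul_sub, ← hz]
  nth_rewrite 1 [← D.smul_c₁ g]
  rw [← smul_distrib_smul, ← hz, smul_sub]
  abel

lemma pr_mem_pow {n : ℕ} {x : B'} (hx : x ∈ (J.map (ι : B →+* B')) ^ n) (k : K) :
    D.pr k x ∈ J ^ n := by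
  rw [← Ideal.map_pow] at hx
  have h : ∀ s, D.pr k (s * x) ∈ J ^ n := by
    refine Submodule.span_induction (p := fun x _ => ∀ s, D.pr k (s * x) ∈ J ^ n) ?_ ?_ ?_ ?_ hx
    · rintro _ ⟨b, hb, rfl⟩ s
      change D.pr k (s * ι b) ∈ _
      rw [mul_comm, D.pr_mul]
      exact Ideal.mul_mem_right _ _ hb
    · intro s
      rw [mul_zero, map_zero]
      exact zero_mem _
    · intro x y _ _ hx hy s
      rw [mul_add, map_add]
      exact add_mem (hx s) (hy s)
    · intro a x _ hx s
      rw [smul_eq_mul, ← mul_assoc]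
      exact hx _
  simpa using h 1

variable [TopologicalSpace G]

lemma baseChange_repProp (hJ : ∀ (g : G), ∀ b ∈ J, g • b ∈ J)
    (hcont : ∀ (x : B') (n : ℕ) (g₀ : G), ∀ᶠ g in 𝓝 g₀,
      g • x - g₀ • x ∈ (J.map (ι : B →+* B')) ^ n) {M : SemilinRep G B} (hM : repProp J c₁ M) :
    repProp (J.map (ι : B →+* B')) (ι c₁) ((SemilinRep.baseChange ι).obj M) := by
  obtain ⟨r, x, l, hl⟩ := exists_dual_basis hM.1.finite hM.1.projective
  let Λ : Lattice ι c₁ ((SemilinRep.baseChange ι).obj M) :=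
    Lattice.ofRep M x l hl (D.exists_smul_sub_eq hM.1.projective hM.2)
  refine ⟨⟨Λ.finite, Λ.projective, (continuous_action_iff
    (fun g _ hb => smul_mem_map hJ g hb)).mpr (fun y n g₀ => ?_)⟩,
    Λ.isTrivialMod D⟩
  exact eventually_smul_sub_mem hcont ((continuous_action_iff hJ).mp hM.1.continuous) y n g₀

lemma rep_repProp (hJ : ∀ (g : G), ∀ b ∈ J, g • b ∈ J)
    (hJ' : ∀ (g : G), ∀ b ∈ J.map (ι : B →+* B'), g • b ∈ J.map (ι : B →+* B')) {M : SemilinRep G B'}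
    (hM : repProp (J.map (ι : B →+* B')) (ι c₁) M) (Λ : Lattice ι c₁ M) : repProp J c₁ Λ.rep := by
  let l : Λ.rep →ₗ[B] Fin Λ.rank → B :=
    { toFun := fun x i => D.pr 0 (Λ.coord (Λ.val x) i)
      map_add' := fun x y => by
        funext i
        simp
      map_smul' := fun b x => by
        funext i
        simp [Λ.val_smul, D.pr_mul] }
  have hlι : ∀ x i, ι (l x i) = Λ.coord (Λ.val x) i := fun x i => by
    obtain ⟨b, hb⟩ := Λ.val_mem x i
    change ι (D.pr 0 (Λ.coord (Λ.val x) i)) = _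
    rw [← hb, D.pr_zero]
  have hl : ∀ x, ∑ i, l x i • Λ.repBasis i = x := fun x => Λ.val_injective (by
    rw [map_sum]
    simp only [Λ.val_smul, hlι, Λ.val_repBasis, Λ.sum_coord])
  have hsub : ∀ (g : G) (x : Λ.rep), ∃ z, g • x - x = c₁ • z := fun g x => by
    rw [← hl x]
    refine D.exists_smul_sum_sub_eq (fun j => ?_) _
    obtain ⟨a, ha⟩ := Λ.smul_basis_sub g j
    refine ⟨∑ i, a i • Λ.repBasis i, Λ.val_injective ?_⟩
    rw [map_sub, Λ.val_act, Λ.val_smul, map_sum, Λ.val_repBasis, ha, Finset.smul_sum]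
    simp only [Λ.val_smul, Λ.val_repBasis, map_mul, mul_smul]
  refine ⟨⟨Module.Finite.of_surjective (Fintype.linearCombination B Λ.repBasis)
      (fun x => ⟨l x, hl x⟩),
    Module.Projective.of_split l (Fintype.linearCombination B Λ.repBasis) (LinearMap.ext hl),
    (continuous_action_iff hJ).mpr (fun x n g₀ => ?_)⟩,
    isTrivialMod_of_frame (r := Λ.rank) Λ.repBasis (fun i => (LinearMap.proj i).comp l) hl
      (fun g i => hsub g _) (fun g i y => ?_)⟩
  · filter_upwards [(continuous_action_iff hJ').mp hM.1.continuous (Λ.val x) n g₀] with g hg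
    rw [← Λ.val_act, ← Λ.val_act, ← map_sub] at hg
    rw [← hl (g • x - g₀ • x)]
    refine sum_mem (fun i _ => Submodule.smul_mem_smul (D.pr_mem_pow ?_ 0) trivial)
    refine Submodule.smul_induction_on (p := fun y => Λ.coord y i ∈ (J.map (ι : B →+* B')) ^ n)
      hg (fun b hb m _ => ?_) (fun x y hx hy => ?_)
    · rw [map_smul]
      exact Ideal.mul_mem_right _ _ hb
    · rw [map_add]
      exact add_mem hx hy
  · obtain ⟨z, hz⟩ := hsub g y
    obtain ⟨b, hb⟩ := D.dvd_smul_sub g (l y i)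
    refine ⟨l z i - b, ?_⟩
    change l (g • y) i - g • l y i = _
    rw [eq_add_of_sub_eq hz, eq_add_of_sub_eq hb, map_add, map_smul]
    simp only [Pi.add_apply, Pi.smul_apply, smul_eq_mul]
    ring

/-- An equivariant map of base changes descends. -/
lemma exists_map_eq {M N : SemilinRep G B} (hM : ∀ (g : G) (y : M), ∃ z, g • y - y = c₁ • z)
    (hN : ∀ (g : G) (y : N), ∃ z, g • y - y = c₁ • z)
    (hfin : Module.Finite B N) (hproj : Module.Projective B N)
    (f : (SemilinRep.baseChange ι).obj M ⟶ (SemilinRep.baseChange ι).obj N) :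
    ∃ a : M ⟶ N, (SemilinRep.baseChange ι).map a = f := by
  obtain ⟨r, x, l, hl⟩ := exists_dual_basis hfin hproj
  have hinj : Function.Injective (BaseChange.incl ι (M := N)) := incl_injective D.injective hl
  let F : BaseChange ι M →ₗ[B'] BaseChange ι N := f.toLin
  have hF : ∀ (g : G) x, F (g • x) = g • F x := f.equivariant
  obtain ⟨a, ha⟩ := exists_linearMap_of_incl hinj F (fun m => by
    refine mem_sub_ofRep (hl := hl) (hM := hN)
      ((Lattice.ofRep (ι := ι) N x l hl hN).mem_sub_of_forall D
        (Set.range (fun m => F (BaseChange.incl ι m))) ?_ ⟨m, rfl⟩)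
    rintro _ ⟨m, rfl⟩ g
    obtain ⟨z, hz⟩ := hM g m
    refine ⟨_, ⟨z, rfl⟩, ?_⟩
    change g • F (BaseChange.incl ι m) - F (BaseChange.incl ι m) = ι c₁ • F (BaseChange.incl ι z)
    rw [← hF, BaseChange.smul_incl, ← map_sub, ← map_sub, hz, BaseChange.incl_smul, map_smul])
  refine ⟨⟨a, fun g m => hinj ?_⟩, SemilinRep.hom_ext ha⟩
  rw [← BaseChange.map_incl, ha, ← BaseChange.smul_incl, hF, ← BaseChange.smul_incl,
    ← BaseChange.map_incl, ha]

lemma map_injective {M N : SemilinRep G B} (hfin : Module.Finite B N)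
    (hproj : Module.Projective B N) {a b : M ⟶ N}
    (h : (SemilinRep.baseChange ι).map a = (SemilinRep.baseChange ι).map b) : a = b := by
  obtain ⟨r, x, l, hl⟩ := exists_dual_basis hfin hproj
  have hinj : Function.Injective (BaseChange.incl ι (M := N)) := incl_injective D.injective hl
  refine SemilinRep.hom_ext (LinearMap.ext (fun m => hinj ?_))
  rw [← BaseChange.map_incl, ← BaseChange.map_incl]
  exact congrArg (fun k => k.toLin (BaseChange.incl ι m)) h

/-- Descent of representations which are trivial modulo `c₁`. -/
theorem isRepEquivalence (hJ : ∀ (g : G), ∀ b ∈ J, g • b ∈ J)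
    (hcont : ∀ (x : B') (n : ℕ) (g₀ : G), ∀ᶠ g in 𝓝 g₀,
      g • x - g₀ • x ∈ (J.map (ι : B →+* B')) ^ n) :
    IsRepEquivalence ι J (J.map (ι : B →+* B')) c₁ (ι c₁) := by
  refine ⟨fun M hM => D.baseChange_repProp hJ hcont hM,
    isEquivalence_lift _ (fun M hM => D.baseChange_repProp hJ hcont hM)
    (fun M N _ hN a b hab => D.map_injective hN.1.finite hN.1.projective hab)
    (fun M N hM hN f => D.exists_map_eq (D.exists_smul_sub_eq hM.1.projective hM.2)
      (D.exists_smul_sub_eq hN.1.projective hN.2) hN.1.finite hN.1.projective f)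
    (fun M hM => ?_)⟩
  obtain ⟨Λ⟩ := D.exists_lattice hM.1.projective hM.1.finite hM.2
  exact ⟨Λ.rep, D.rep_repProp hJ (fun g _ hb => smul_mem_map hJ g hb) hM Λ, ⟨Λ.repIso⟩⟩

end DescentDatum

end Descent

section FrobeniusDescent

open Topology

variable {G : Type v} [CommGroup G] {B B' Bl Bl' : Type u} [CommRing B] [MulSemiringAction G B]
  [CommRing B'] [MulSemiringAction G B'] [CommRing Bl] [MulSemiringAction G Bl]
  [CommRing Bl'] [MulSemiringAction G Bl'] {ι : B →+*[G] B'} {J : Ideal B} {K : Type w} [Zero K]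
  {c₀ c₁ : B}

/-- The property of being the localisation at a non-zero divisor fixed by the group. -/
structure IsInvariantLoc (l : B →+*[G] Bl) (t : B) : Prop where
  fixed : ∀ g : G, g • t = t
  isUnit : IsUnit (l t)
  injective : Function.Injective l
  exists_pow_mul : ∀ y, ∃ n b, l t ^ n * y = l b

namespace IsInvariantLoc

variable {l : B →+*[G] Bl} {t : B}

lemma exists_pow_smul (h : IsInvariantLoc l t) {M : Type u} [AddCommGroup M] [Module B M]
    (y : BaseChange l M) : ∃ n m, l t ^ n • y = BaseChange.incl l m := by
  induction y using BaseChange.induction_on with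
  | tmul b m =>
    obtain ⟨n, b', hb⟩ := h.exists_pow_mul b
    exact ⟨n, b' • m, by rw [BaseChange.tmul_eq, smul_smul, hb, BaseChange.incl_smul]⟩
  | add x y hx hy =>
    obtain ⟨n, a, ha⟩ := hx
    obtain ⟨m, b, hb⟩ := hy
    refine ⟨n + m, t ^ m • a + t ^ n • b, ?_⟩
    rw [map_add, BaseChange.incl_smul, BaseChange.incl_smul, ← ha, ← hb, map_pow, map_pow, smul_add,
      smul_smul, smul_smul, pow_add, mul_comm]

lemma exists_pow_smul_forall (h : IsInvariantLoc l t) {M : Type u} [AddCommGroup M] [Module B M]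
    {s : ℕ} (y : Fin s → BaseChange l M) :
    ∃ n, ∀ i, ∃ m, l t ^ n • y i = BaseChange.incl l m := by
  choose n m hm using fun i => h.exists_pow_smul (y i)
  refine ⟨∑ i, n i, fun i => ⟨t ^ (∑ j ∈ Finset.univ.erase i, n j) • m i, ?_⟩⟩
  rw [BaseChange.incl_smul, ← hm, smul_smul, map_pow, ← pow_add,
    Finset.sum_erase_add _ _ (Finset.mem_univ i)]

end IsInvariantLoc

variable {φ : B →+*[G] B} {l : B →+*[G] Bl} {φ' : B' →+*[G] B'} {l' : B' →+*[G] Bl'}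
  {ιl : Bl →+*[G] Bl'} {t : B}

lemma loc_map_injective (hl : ∀ b, l' (ι b) = ιl (l b)) (h : IsInvariantLoc l t)
    (h' : IsInvariantLoc l' (ι t)) (hι : Function.Injective ι) : Function.Injective ιl := by
  rw [injective_iff_map_eq_zero]
  intro y hy
  obtain ⟨n, b, hb⟩ := h.exists_pow_mul y
  have h1 : l' (ι b) = 0 := by rw [hl, ← hb, map_mul, hy, mul_zero]
  have h2 : b = 0 := hι (h'.injective (by rw [h1, map_zero, map_zero]))
  rw [h2, map_zero] at hb
  exact (h.isUnit.pow n).mul_right_eq_zero.mp hb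

namespace DescentDatum

variable (D : DescentDatum ι J K c₀ c₁)

include D

lemma exists_smul_sub_eq_baseChange (hc : c₁ ∣ φ c₁) {M : SemilinRep G B}
    (hM : ∀ (g : G) (y : M), ∃ z, g • y - y = c₁ • z) (hfin : Module.Finite B M)
    (hproj : Module.Projective B M) (g : G) (y : (SemilinRep.baseChange φ).obj M) :
    ∃ z, g • y - y = c₁ • z := by
  obtain ⟨r, x, f, hf⟩ := exists_dual_basis hfin hproj
  obtain ⟨c, hc⟩ := hc
  have h := D.exists_smul_sum_sub_eq (M := (SemilinRep.baseChange φ).obj M) (g := g)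
    (m := fun i => BaseChange.incl φ (x i)) (fun i => by
      obtain ⟨z, hz⟩ := hM g (x i)
      refine ⟨(c • BaseChange.incl φ z : BaseChange φ M), ?_⟩
      refine Eq.trans (b := BaseChange.incl φ (g • x i - x i)) ?_ ?_
      · rw [map_sub, ← BaseChange.smul_incl]
        rfl
      · rw [hz, BaseChange.incl_smul, hc, mul_smul]
        rfl) (coordBaseChange φ f y)
  have h1 := sum_coordBaseChange (ι := φ) hf y
  obtain ⟨z, hz⟩ := h
  refine ⟨z, Eq.trans ?_ hz⟩
  exact congrArg (fun w : (SemilinRep.baseChange φ).obj M => g • w - w) h1.symm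

/-- Equivariant maps between localised base changes descend. -/
lemma exists_map_eq_loc (hl : ∀ b, l' (ι b) = ιl (l b)) (h : IsInvariantLoc l t)
    (h' : IsInvariantLoc l' (ι t)) {X N : SemilinRep G B}
    (hX : ∀ (g : G) (y : X), ∃ z, g • y - y = c₁ • z)
    (hN : ∀ (g : G) (y : N), ∃ z, g • y - y = c₁ • z) (hXfin : Module.Finite B X)
    (hfin : Module.Finite B N) (hproj : Module.Projective B N)
    (f : (SemilinRep.baseChange ιl).obj ((SemilinRep.baseChange l).obj X) ⟶
      (SemilinRep.baseChange ιl).obj ((SemilinRep.baseChange l).obj N)) :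
    ∃ a, (SemilinRep.baseChange ιl).map a = f := by
  obtain ⟨r, x, co, hco⟩ := exists_dual_basis hfin hproj
  have hιl := loc_map_injective hl h h' D.injective
  have hinj : Function.Injective (BaseChange.incl ιl (M := BaseChange l N)) :=
    incl_injective hιl (sum_coordBaseChange hco)
  have hinj' : Function.Injective (BaseChange.incl l' (M := BaseChange ι N)) :=
    incl_injective h'.injective (sum_coordBaseChange hco)
  let F : BaseChange ιl (BaseChange l X) →ₗ[Bl'] BaseChange ιl (BaseChange l N) := f.toLin
  have hF : ∀ (g : G) x, F (g • x) = g • F x := f.equivariant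
  let H : X →+ BaseChange l' (BaseChange ι N) :=
    (BaseChange.square (fun b => (hl b).symm) N).toAddMonoidHom.comp
      (F.toAddMonoidHom.comp ((BaseChange.incl ιl).comp (BaseChange.incl l)))
  have hHdef : ∀ x, H x = BaseChange.square (fun b => (hl b).symm) N
      (F (BaseChange.incl ιl (BaseChange.incl l x))) := fun x => rfl
  have hHb : ∀ b x, H (b • x) = l' (ι b) • H x := fun b x => by
    rw [hHdef, BaseChange.incl_smul, BaseChange.incl_smul, map_smul, map_smul, hl]
    rfl
  have hHg : ∀ (g : G) x, H (g • x) = g • H x := fun g x => by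
    rw [hHdef, ← BaseChange.smul_incl, ← BaseChange.smul_incl, hF, BaseChange.square_equivariant]
    rfl
  obtain ⟨s, z, hz⟩ := Module.Finite.exists_fin (R := B) (M := X)
  obtain ⟨n, hn⟩ := h'.exists_pow_smul_forall (fun i => H (z i))
  have hn' : ∀ x, ∃ v, l' (ι t) ^ n • H x = BaseChange.incl l' v := fun x => by
    have hx : x ∈ Submodule.span B (Set.range z) := hz ▸ trivial
    refine Submodule.span_induction ?_ ?_ ?_ ?_ hx
    · rintro _ ⟨i, rfl⟩
      exact hn i
    · exact ⟨0, by rw [map_zero, map_zero, smul_zero]⟩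
    · rintro x y _ _ ⟨v, hv⟩ ⟨w, hw⟩
      exact ⟨v + w, by rw [map_add, map_add, smul_add, hv, hw]⟩
    · rintro b x _ ⟨v, hv⟩
      exact ⟨ι b • v, by rw [hHb, smul_comm, hv, BaseChange.incl_smul]⟩
  have htn : ∀ g : G, g • l' (ι t) ^ n = l' (ι t) ^ n := fun g => by
    rw [smul_pow', ← map_smul, h'.fixed]
  have hstep : ∀ {g : G} {x z : X} {v w : BaseChange ι N},
      l' (ι t) ^ n • H x = BaseChange.incl l' v → g • x - x = c₁ • z →
      l' (ι t) ^ n • H z = BaseChange.incl l' w → g • v - v = ι c₁ • w := by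
    intro g x z v w hx hz hw
    refine hinj' ?_
    rw [map_sub, ← BaseChange.smul_incl, BaseChange.incl_smul, ← hw, ← hx,
      smul_distrib_smul g (l' (ι t) ^ n) (H x), htn, ← hHg, ← smul_sub, ← map_sub, hz, hHb,
      smul_comm]
  have key : ∀ x, ∃ m, BaseChange.incl ιl m = F (BaseChange.incl ιl (BaseChange.incl l x)) := by
    intro x₀
    obtain ⟨v₀, hv₀⟩ := hn' x₀
    obtain ⟨m, hm⟩ := mem_sub_ofRep (hl := hco) (hM := hN)
      ((Lattice.ofRep (ι := ι) N x co hco hN).mem_sub_of_forall D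
        {v | ∃ x, l' (ι t) ^ n • H x = BaseChange.incl l' v} (by
          rintro v ⟨x, hx⟩ g
          obtain ⟨z, hz⟩ := hX g x
          obtain ⟨w, hw⟩ := hn' z
          exact ⟨w, ⟨z, hw⟩, hstep hx hz hw⟩) ⟨x₀, hv₀⟩)
    obtain ⟨u, hu⟩ := h.isUnit
    refine ⟨((u⁻¹ : Blˣ) : Bl) ^ n • BaseChange.incl l m, ?_⟩
    have h1 : ∀ y, BaseChange.square hl N (BaseChange.square (fun b => (hl b).symm) N y) = y :=
      LinearMap.congr_fun (BaseChange.square_square (fun b => (hl b).symm))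
    have h2 := congrArg (BaseChange.square hl N) hv₀
    rw [← hm, hHdef, map_smul, h1, BaseChange.square_incl] at h2
    rw [BaseChange.incl_smul, ← h2, smul_smul, hl, ← hu, ← map_pow, ← map_mul, ← mul_pow,
      Units.inv_mul, one_pow, map_one, one_smul]
  obtain ⟨a, ha⟩ := exists_linearMap_of_incl hinj F (fun y => by
    induction y using BaseChange.induction_on with
    | tmul b m =>
      obtain ⟨n, hn⟩ := key m
      exact ⟨b • n, by rw [BaseChange.tmul_eq, BaseChange.incl_smul, BaseChange.incl_smul, hn,
        map_smul]⟩
    | add y z hy hz =>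
      obtain ⟨n, hn⟩ := hy
      obtain ⟨m, hm⟩ := hz
      exact ⟨n + m, by rw [map_add, map_add, map_add, hn, hm]⟩)
  have hact : ∀ (g : G) (m : BaseChange l X), a (g • m) = g • a m := fun g m => hinj (by
    rw [← BaseChange.map_incl, ha, ← BaseChange.smul_incl, hF, ← BaseChange.smul_incl,
      ← BaseChange.map_incl, ha])
  exact ⟨⟨a, hact⟩, SemilinRep.hom_ext ha⟩

lemma map_injective_loc (hl : ∀ b, l' (ι b) = ιl (l b)) (h : IsInvariantLoc l t)
    (h' : IsInvariantLoc l' (ι t)) {X : SemilinRep G Bl} {N : SemilinRep G B}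
    (hfin : Module.Finite B N) (hproj : Module.Projective B N)
    {a b : X ⟶ (SemilinRep.baseChange l).obj N}
    (hab : (SemilinRep.baseChange ιl).map a = (SemilinRep.baseChange ιl).map b) : a = b := by
  obtain ⟨r, x, co, hco⟩ := exists_dual_basis hfin hproj
  have hιl := loc_map_injective hl h h' D.injective
  have hinj : Function.Injective (BaseChange.incl ιl (M := BaseChange l N)) :=
    incl_injective hιl (sum_coordBaseChange hco)
  refine SemilinRep.hom_ext (LinearMap.ext (fun m => hinj ?_))
  refine (BaseChange.map_incl ιl a.toLin m).symm.trans
    (Eq.trans ?_ (BaseChange.map_incl ιl b.toLin m))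
  exact congrArg (fun k => k.toLin (BaseChange.incl ιl m)) hab

end DescentDatum

/-- An isomorphism of the underlying representations which is compatible with the Frobenius
structures. -/
def FrobRep.isoMk {M N : FrobRep φ l} (e : M.M ≅ N.M)
    (h : (SemilinRep.baseChange l).map ((SemilinRep.baseChange φ).map e.hom) ≫ N.frob.hom =
      M.frob.hom ≫ (SemilinRep.baseChange l).map e.hom) : M ≅ N where
  hom := ⟨e.hom, h⟩
  inv := ⟨e.inv, by
    rw [← cancel_epi ((SemilinRep.baseChange l).map ((SemilinRep.baseChange φ).map e.hom)),
      ← cancel_mono ((SemilinRep.baseChange l).map e.hom)]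
    simp only [Category.assoc, ← h, ← Functor.map_comp_assoc, ← Functor.map_comp, e.hom_inv_id,
      e.inv_hom_id, CategoryTheory.Functor.map_id, Category.id_comp, Category.comp_id]⟩
  hom_inv_id := FrobRep.Hom.ext e.hom_inv_id
  inv_hom_id := FrobRep.Hom.ext e.inv_hom_id

namespace DescentDatum

variable (D : DescentDatum ι J K c₀ c₁) [TopologicalSpace G]

include D

/-- Descent of representations with Frobenius structure. -/
theorem isRepFrobEquivalence (hJ : ∀ (g : G), ∀ b ∈ J, g • b ∈ J)
    (hcont : ∀ (x : B') (n : ℕ) (g₀ : G), ∀ᶠ g in 𝓝 g₀,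
      g • x - g₀ • x ∈ (J.map (ι : B →+* B')) ^ n)
    (hφ : ∀ b, φ' (ι b) = ι (φ b)) (hl : ∀ b, l' (ι b) = ιl (l b)) (h : IsInvariantLoc l t)
    (h' : IsInvariantLoc l' (ι t)) (hc : c₁ ∣ φ c₁) :
    IsRepFrobEquivalence (φ := φ) (l := l) (φ' := φ') (l' := l') ι ιl hφ hl J
      (J.map (ι : B →+* B')) c₁ (ι c₁) := by
  refine ⟨fun M hM => D.baseChange_repProp hJ hcont hM,
    isEquivalence_lift (FrobRep.baseChange ι ιl hφ hl)
      (fun M hM => D.baseChange_repProp hJ hcont hM)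
    (fun M N _ hN a b hab => FrobRep.Hom.ext (D.map_injective hN.1.finite hN.1.projective
      (congrArg (fun k => k.hom) hab))) (fun M N hM hN f => ?_) (fun M hM => ?_)⟩
  · obtain ⟨a, ha⟩ := D.exists_map_eq (D.exists_smul_sub_eq hM.1.projective hM.2)
      (D.exists_smul_sub_eq hN.1.projective hN.2) hN.1.finite hN.1.projective f.hom
    have h1 := (SemilinRep.squareIso ι φ' φ ι hφ).hom.naturality a
    have h2 := (SemilinRep.squareIso ι l' l ιl hl).hom.naturality
      ((SemilinRep.baseChange φ).map a)
    have h3 := (SemilinRep.squareIso ι l' l ιl hl).inv.naturality a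
    simp only [Functor.comp_map] at h1 h2 h3
    have h4 := f.comm
    rw [← ha] at h4
    simp only [FrobRep.baseChange, Iso.trans_hom, Functor.mapIso_hom, Iso.app_hom, Iso.symm_hom,
      Iso.app_inv, Category.assoc] at h4
    rw [← h3, ← Category.assoc, ← Functor.map_comp, h1, Functor.map_comp, Category.assoc,
      ← Category.assoc _ ((SemilinRep.squareIso ι l' l ιl hl).hom.app _), h2, Category.assoc,
      ← Category.assoc ((SemilinRep.baseChange ιl).map _), ← Functor.map_comp,
      ← Category.assoc ((SemilinRep.baseChange ιl).map M.frob.hom), ← Functor.map_comp,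
      cancel_epi, cancel_epi, cancel_mono] at h4
    exact ⟨⟨a, D.map_injective_loc hl h h' hN.1.finite hN.1.projective h4⟩, FrobRep.Hom.ext ha⟩
  · have hM' : repProp (J.map (ι : B →+* B')) (ι c₁) M.M := hM
    obtain ⟨Λ⟩ := D.exists_lattice hM'.1.projective hM'.1.finite hM'.2
    have hΛ := D.rep_repProp hJ (fun g _ hb => smul_mem_map hJ g hb) hM' Λ
    have hsub := D.exists_smul_sub_eq hΛ.1.projective hΛ.2
    have hfin := hΛ.1.finite
    have hproj := hΛ.1.projective
    obtain ⟨r, x, co, hco⟩ := exists_dual_basis hfin hproj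
    have hsub' := D.exists_smul_sub_eq_baseChange (φ := φ) hc hsub hfin hproj
    have hfin' : Module.Finite B ((SemilinRep.baseChange φ).obj Λ.rep) :=
      Module.Finite.of_surjective
        (Fintype.linearCombination B (fun i => (BaseChange.incl φ (x i) : BaseChange φ Λ.rep)))
        (fun y => ⟨coordBaseChange φ co y, sum_coordBaseChange hco y⟩)
    have hproj' : Module.Projective B ((SemilinRep.baseChange φ).obj Λ.rep) :=
      Module.Projective.of_split (coordBaseChange φ co)
        (Fintype.linearCombination B (fun i => (BaseChange.incl φ (x i) : BaseChange φ Λ.rep)))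
        (LinearMap.ext (sum_coordBaseChange hco))
    let E := (SemilinRep.baseChange l').mapIso ((SemilinRep.squareIso ι φ' φ ι hφ).app Λ.rep) ≪≫
        (SemilinRep.squareIso ι l' l ιl hl).app ((SemilinRep.baseChange φ).obj Λ.rep)
    let S := (SemilinRep.squareIso ι l' l ιl hl).app Λ.rep
    let g := E.symm ≪≫
      (SemilinRep.baseChange l').mapIso ((SemilinRep.baseChange φ').mapIso Λ.repIso) ≪≫ M.frob ≪≫
      (SemilinRep.baseChange l').mapIso Λ.repIso.symm ≪≫ S
    obtain ⟨a, ha⟩ := D.exists_map_eq_loc hl h h' hsub' hsub hfin' hfin hproj g.hom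
    obtain ⟨b, hb⟩ := D.exists_map_eq_loc hl h h' hsub hsub' hfin hfin' hproj' g.inv
    let f : (SemilinRep.baseChange l).obj ((SemilinRep.baseChange φ).obj Λ.rep) ≅
        (SemilinRep.baseChange l).obj Λ.rep :=
      ⟨a, b, D.map_injective_loc hl h h' hfin' hproj' (by
          rw [Functor.map_comp, ha, hb, g.hom_inv_id, CategoryTheory.Functor.map_id]
          rfl),
        D.map_injective_loc hl h h' hfin hproj (by
          rw [Functor.map_comp, ha, hb, g.inv_hom_id, CategoryTheory.Functor.map_id]
          rfl)⟩
    refine ⟨⟨Λ.rep, f⟩, hΛ, ⟨FrobRep.isoMk Λ.repIso ?_⟩⟩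
    have h5 : ((FrobRep.baseChange ι ιl hφ hl).obj ⟨Λ.rep, f⟩).frob.hom =
        E.hom ≫ (SemilinRep.baseChange ιl).map a ≫ S.inv := by
      simp [FrobRep.baseChange, E, S, f]
    rw [h5, ha]
    simp only [g, Iso.trans_hom, Iso.symm_hom, Category.assoc, Iso.hom_inv_id, Category.comp_id,
      Iso.hom_inv_id_assoc, Functor.mapIso_hom]
    have h6 : (SemilinRep.baseChange l').map Λ.repIso.inv ≫
        (SemilinRep.baseChange l').map Λ.repIso.hom = 𝟙 _ := by
      rw [← Functor.map_comp, Λ.repIso.inv_hom_id, CategoryTheory.Functor.map_id]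
    exact ((Category.assoc _ _ _).trans (congrArg (_ ≫ ·) ((Category.assoc _ _ _).trans
      ((congrArg (M.frob.hom ≫ ·) h6).trans (Category.comp_id _))))).symm

end DescentDatum

end FrobeniusDescent

/-! ### Lifting étale algebras -/

section EtaleLift

/-- An étale algebra over a quotient of `A` lifts to an étale algebra over `A`. -/
theorem exists_etale_lift {A k : Type v} {E : Type u} [CommRing A] [CommRing k] [CommRing E]
    [Algebra A k] [Algebra A E] [Algebra k E] [IsScalarTower A k E]
    (hk : Function.Surjective (algebraMap A k)) [Algebra.Etale k E] :
    ∃ (A₁ : Type v) (_ : CommRing A₁) (_ : Algebra A A₁), Algebra.Etale A A₁ ∧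
      ∃ q : A₁ →ₐ[A] E, Function.Surjective q ∧
        RingHom.ker (q : A₁ →+* E) ≤ (RingHom.ker (algebraMap A k)).map (algebraMap A A₁) := by
  classical
  obtain ⟨ι, σ, _, _, P, hP⟩ :=
    (Algebra.Etale.iff_isStandardSmoothOfRelativeDimension_zero.mp ‹Algebra.Etale k E›).out
  cases nonempty_fintype σ
  set red : MvPolynomial ι A →+* MvPolynomial ι k := MvPolynomial.map (algebraMap A k) with hred
  have hreds : Function.Surjective red := MvPolynomial.map_surjective _ hk
  choose v hv using fun j => hreds (P.relation j)
  let A₀ := MvPolynomial ι A ⧸ Ideal.span (Set.range v)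
  let N : Algebra.PreSubmersivePresentation A A₀ ι σ :=
    Algebra.PreSubmersivePresentation.naive P.map P.map_inj
  let ev : MvPolynomial ι A →ₐ[A] E := MvPolynomial.aeval P.val
  have hev : ∀ F, ev F = MvPolynomial.aeval P.val (red F) := by
    intro F
    rw [hred, MvPolynomial.aeval_map_algebraMap]
  have hevv : ∀ F ∈ Ideal.span (Set.range v), ev F = 0 := by
    have : Ideal.span (Set.range v) ≤ RingHom.ker ev := by
      rw [Ideal.span_le]
      rintro _ ⟨j, rfl⟩
      change ev (v j) = 0
      rw [hev, hv]
      exact P.aeval_val_relation j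
    exact this
  let q₀ : A₀ →ₐ[A] E := Ideal.Quotient.liftₐ _ ev hevv
  have hq₀ : ∀ F, q₀ (Ideal.Quotient.mk _ F) = ev F := fun F => rfl
  have hker : ∀ x, q₀ x = 0 → x ∈ (RingHom.ker (algebraMap A k)).map (algebraMap A A₀) := by
    intro x hx
    obtain ⟨F, rfl⟩ := Ideal.Quotient.mk_surjective x
    rw [hq₀, hev] at hx
    have h1 : red F ∈ (Ideal.span (Set.range v)).map red := by
      rw [Ideal.map_span, ← Set.range_comp, show (red ∘ v) = P.relation from funext hv,
        P.span_range_relation_eq_ker, Algebra.Generators.ker_eq_ker_aeval_val]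
      exact hx
    obtain ⟨Gp, hG, hFG⟩ := (Ideal.mem_map_iff_of_surjective red hreds).mp h1
    have h2 : F - Gp ∈ RingHom.ker red := by
      rw [RingHom.mem_ker, map_sub, hFG, sub_self]
    rw [hred, MvPolynomial.ker_map] at h2
    have h3 := Ideal.mem_map_of_mem (Ideal.Quotient.mk (Ideal.span (Set.range v))) h2
    rw [map_sub, Ideal.Quotient.eq_zero_iff_mem.mpr hG, sub_zero, Ideal.map_map] at h3
    exact h3
  let j : A₀ := N.jacobian
  have hj : q₀ j = P.jacobian := by
    change q₀ N.jacobian = _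
    rw [Algebra.PreSubmersivePresentation.jacobian_eq_jacobiMatrix_det,
      Algebra.PreSubmersivePresentation.jacobian_eq_jacobiMatrix_det]
    have h1 : red N.jacobiMatrix.det = P.jacobiMatrix.det := by
      rw [RingHom.map_det]
      congr 1
      ext a b : 2
      rw [RingHom.mapMatrix_apply, Matrix.map_apply,
        Algebra.PreSubmersivePresentation.jacobiMatrix_naive,
        Algebra.PreSubmersivePresentation.jacobiMatrix_apply, ← hv, hred,
        MvPolynomial.pderiv_map]
    rw [← h1]
    rw [Algebra.Generators.algebraMap_apply, Algebra.Generators.algebraMap_apply]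
    refine Eq.trans ?_ (hev N.jacobiMatrix.det)
    rw [← AlgHom.comp_apply]
    congr 1
    refine MvPolynomial.algHom_ext (fun i => ?_)
    rw [AlgHom.comp_apply, MvPolynomial.aeval_X, MvPolynomial.aeval_X]
    change q₀ (Ideal.Quotient.mk _ (MvPolynomial.X i)) = _
    rw [hq₀]
    exact MvPolynomial.aeval_X _ _
  let A₁ := Localization.Away j
  let Q : Algebra.PreSubmersivePresentation A A₁ (Unit ⊕ ι) (Unit ⊕ σ) :=
    (Algebra.PreSubmersivePresentation.localizationAway A₁ j).comp N
  have hQ : IsUnit Q.jacobian := by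
    change IsUnit ((Algebra.PreSubmersivePresentation.localizationAway A₁ j).comp N).jacobian
    rw [Algebra.PreSubmersivePresentation.comp_jacobian_eq_jacobian_smul_jacobian,
      Algebra.PreSubmersivePresentation.localizationAway_jacobian, Algebra.smul_def]
    exact (IsLocalization.Away.algebraMap_isUnit j).mul (IsLocalization.Away.algebraMap_isUnit j)
  have hQd : Q.dimension = 0 := by
    change Nat.card _ - Nat.card _ = 0 at hP
    change Nat.card (Unit ⊕ ι) - Nat.card (Unit ⊕ σ) = 0
    rw [Nat.card_sum, Nat.card_sum]
    omega
  have hE : Algebra.IsStandardSmoothOfRelativeDimension 0 A A₁ :=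
    Algebra.SubmersivePresentation.isStandardSmoothOfRelativeDimension
      ⟨Q, hQ⟩ hQd
  have hunit : ∀ y : Submonoid.powers j, IsUnit (q₀ y) := by
    rintro ⟨_, n, rfl⟩
    change IsUnit (q₀ (j ^ n))
    rw [map_pow, hj]
    exact P.jacobian_isUnit.pow n
  let q : A₁ →ₐ[A] E := IsLocalization.liftAlgHom (M := Submonoid.powers j) (f := q₀) hunit
  have hq : ∀ x, q (algebraMap A₀ A₁ x) = q₀ x := fun x =>
    IsLocalization.lift_eq (M := Submonoid.powers j) (g := (q₀ : A₀ →+* E)) hunit x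
  refine ⟨A₁, inferInstance, inferInstance, inferInstance, q, ?_, ?_⟩
  · intro e
    obtain ⟨F, hF⟩ := P.aeval_val_surjective e
    obtain ⟨F', rfl⟩ := hreds F
    exact ⟨algebraMap A₀ A₁ (Ideal.Quotient.mk _ F'), by rw [hq, hq₀, hev, hF]⟩
  · intro x hx
    rw [RingHom.mem_ker] at hx
    obtain ⟨⟨y, s⟩, hy⟩ := IsLocalization.surj (Submonoid.powers j) x
    have h1 : q₀ y = 0 := by
      rw [← hq, ← hy, map_mul]
      change q x * _ = 0
      rw [show q x = 0 from hx, zero_mul]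
    have h2 := Ideal.mem_map_of_mem (algebraMap A₀ A₁) (hker y h1)
    rw [Ideal.map_map, ← hy] at h2
    have h3 : IsUnit (algebraMap A₀ A₁ s) := IsLocalization.map_units A₁ s
    rwa [Ideal.mul_unit_mem_iff_mem _ h3, ← IsScalarTower.algebraMap_eq A A₀ A₁] at h2

end EtaleLift

/-! ### The Frobenius of an étale algebra over a perfect ring -/

section EtaleFrobenius

lemma sub_pow_prime_of_natCast_eq_zero {A : Type u} [CommRing A] {p : ℕ} [Fact p.Prime]
    (h : (p : A) = 0) (x y : A) : (x - y) ^ p = x ^ p - y ^ p := by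
  nontriviality A
  have : CharP A p := (CharP.charP_iff_prime_eq_zero Fact.out).mpr h
  exact sub_pow_char x y

lemma formallyEtale_of_etale {A B : Type*} [CommRing A] [CommRing B] {f : A →+* B}
    (h : f.Etale) : f.FormallyEtale := by
  let := f.toAlgebra
  have : Algebra.Etale A B := h
  exact RingHom.formallyEtale_algebraMap.mpr inferInstance

lemma ker_fg_of_finitePresentation {A B : Type*} [CommRing A] [CommRing B] {f : A →+* B}
    (hf : Function.Surjective f) (h : f.FinitePresentation) : (RingHom.ker f).FG := by
  let := f.toAlgebra
  have : Algebra.FinitePresentation A B := h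
  exact Algebra.FinitePresentation.ker_fG_of_surjective (Algebra.ofId A B) hf

variable {P B : Type u} [CommRing P] [CommRing B] (p : ℕ) [Fact p.Prime] [CharP P p] [CharP B p]
  [PerfectRing P p] [Algebra P B] [Algebra.Etale P B]

include P in
lemma surjective_frobenius_of_etale : Function.Surjective (frobenius B p) := by
  let B' := (frobenius B p).range
  have hP : ∀ a : P, algebraMap P B a ∈ B' := fun a => by
    obtain ⟨b, rfl⟩ := surjective_frobenius P p a
    exact ⟨algebraMap P B b, ((algebraMap P B).map_frobenius p b).symm⟩
  let : Algebra P B' := ((algebraMap P B).codRestrict B' hP).toAlgebra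
  have : IsScalarTower P B' B := IsScalarTower.of_algebraMap_eq (fun _ => rfl)
  have : Algebra.FormallyUnramified B' B := Algebra.FormallyUnramified.of_restrictScalars P B' B
  have : Algebra.FiniteType B' B := Algebra.FiniteType.of_restrictScalars_finiteType P B' B
  have hpow : ∀ b : B, b ^ p ∈ B' := fun b => ⟨b, rfl⟩
  have : Algebra.IsIntegral B' B := ⟨fun b =>
    IsIntegral.of_pow (Fact.out : p.Prime).pos
      (isIntegral_algebraMap (R := B') (x := ⟨b ^ p, hpow b⟩))⟩
  have : Module.Finite B' B := Algebra.IsIntegral.finite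
  have h0 : ((p : ℕ) : B ⊗[B'] B) = 0 := by
    rw [← map_natCast (algebraMap B (B ⊗[B'] B)), CharP.cast_eq_zero, map_zero]
  have hnil : ∀ b : B, IsNilpotent ((1 : B) ⊗ₜ[B'] b - b ⊗ₜ[B'] (1 : B)) := fun b => by
    refine ⟨p, ?_⟩
    rw [sub_pow_prime_of_natCast_eq_zero h0, Algebra.TensorProduct.tmul_pow,
      Algebra.TensorProduct.tmul_pow, one_pow, sub_eq_zero]
    have : b ^ p = (⟨b ^ p, hpow b⟩ : B') • (1 : B) := by
      rw [Subring.smul_def, smul_eq_mul, mul_one]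
    rw [this, TensorProduct.smul_tmul]
  obtain ⟨t, ht, ht1⟩ :=
    (Algebra.FormallyUnramified.iff_exists_tensorProduct (R := B') (S := B)).mp inferInstance
  have h1 : 1 - t ∈ nilradical (B ⊗[B'] B) := by
    have h2 : 1 - t ∈ KaehlerDifferential.ideal B' B := by
      rw [KaehlerDifferential.ideal, RingHom.mem_ker, map_sub, map_one]
      exact sub_eq_zero.mpr ht1.symm
    rw [← KaehlerDifferential.span_range_eq_ideal] at h2
    refine (Ideal.span_le.mpr ?_) h2
    rintro _ ⟨b, rfl⟩
    exact mem_nilradical.mpr (hnil b)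
  have hu : IsUnit t := by
    have := (mem_nilradical.mp h1).isUnit_one_sub
    rwa [sub_sub_cancel] at this
  have hepi : Algebra.IsEpi B' B := (Algebra.isEpi_iff_forall_one_tmul_eq B' B).mpr (fun b => by
    have := ht b
    rwa [hu.mul_left_eq_zero, sub_eq_zero] at this)
  have := Algebra.isEpi_iff_surjective_algebraMap_of_finite.mp hepi
  intro b
  obtain ⟨⟨_, c, rfl⟩, hc⟩ := this b
  exact ⟨c, hc⟩

include P in
lemma injective_frobenius_of_etale : Function.Injective (frobenius B p) := by
  have hsurj := surjective_frobenius_of_etale (P := P) (B := B) p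
  have hE : (algebraMap P B).Etale := RingHom.etale_algebraMap.mpr inferInstance
  have hcomp : ((frobenius B p).comp (algebraMap P B)).Etale := by
    have h1 : (frobenius B p).comp (algebraMap P B) =
        (algebraMap P B).comp (frobenius P p) :=
      RingHom.ext (fun a => ((algebraMap P B).map_frobenius p a).symm)
    rw [h1]
    exact RingHom.Etale.stableUnderComposition _ _
      (RingHom.Etale.of_bijective (bijective_frobenius P p)) hE
  have h2 : (frobenius B p).FormallyEtale := by
    refine RingHom.FormallyEtale.of_comp hE.formallyUnramified ?_
    exact formallyEtale_of_etale hcomp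
  have h3 : (frobenius B p).FinitePresentation := by
    refine RingHom.FinitePresentation.of_comp_finiteType (algebraMap P B)
      (RingHom.Etale.iff_flat_and_formallyUnramified.mp hcomp).2.2 ?_
    exact RingHom.finiteType_algebraMap.mpr inferInstance
  have h4 : (RingHom.ker (frobenius B p)).FG := by
    exact ker_fg_of_finitePresentation hsurj h3
  have h5 : IsIdempotentElem (RingHom.ker (frobenius B p)) := by
    let := (frobenius B p).toAlgebra
    exact (Algebra.FormallyEtale.iff_of_surjective (R := B) (S := B) hsurj).mp h2
  obtain ⟨e, he, hIe⟩ := (Ideal.isIdempotentElem_iff_of_fg _ h4).mp h5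
  have he0 : e = 0 := by
    have h6 : e ∈ RingHom.ker (frobenius B p) := by
      rw [hIe]
      exact Submodule.mem_span_singleton_self e
    rw [RingHom.mem_ker, frobenius_def, he.pow_eq (Fact.out : p.Prime).ne_zero] at h6
    exact h6
  rw [RingHom.injective_iff_ker_eq_bot, hIe, he0]
  exact Submodule.span_zero_singleton _

include P in
/-- An étale algebra over a perfect ring is perfect. -/
theorem perfectRing_of_etale : PerfectRing B p :=
  ⟨injective_frobenius_of_etale (P := P) p, surjective_frobenius_of_etale (P := P) p⟩

end EtaleFrobenius

/-! ### Elements generating the kernel of the projection of a perfection -/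

section Tilting

variable {Q : Type u} [CommRing Q] {p : ℕ} [Fact p.Prime] [CharP Q p]

lemma exists_perfection (f : ℕ → Q) (hf : ∀ n, f (n + 1) ^ p = f n) :
    ∃ x : Perfection Q p, ∀ n, Perfection.coeff Q p n x = f n := ⟨⟨f, hf⟩, fun _ => rfl⟩

lemma coeff_pow_pow_self (x : Perfection Q p) (n : ℕ) :
    Perfection.coeff Q p n (x ^ p ^ n) = Perfection.coeff Q p 0 x :=
  Perfection.coeffMonoidHom_pow_p_pow_self x n

/-- Conditions on `ϖ = (ϖ_0, ϖ_1, …)` in the perfection of `Q` which ensure that `ϖ` is a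
non-zero-divisor which generates the kernel of the projection onto `Q`. -/
structure IsTiltingElement (ϖ : Perfection Q p) : Prop where
  coeff_zero : Perfection.coeff Q p 0 ϖ = 0
  surjective : Function.Surjective (frobenius Q p)
  dvd_of_pow : ∀ c : Q, c ^ p = 0 → Perfection.coeff Q p 1 ϖ ∣ c
  pow_eq_zero : ∀ n (c : Q), Perfection.coeff Q p (n + 1) ϖ * c = 0 → c ^ p = 0

namespace IsTiltingElement

variable {ϖ : Perfection Q p} (h : IsTiltingElement ϖ)

include h

lemma eq_zero_of_mul {x : Perfection Q p} (hx : ϖ * x = 0) : x = 0 := by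
  refine Perfection.ext (fun n => ?_)
  have h1 := congrArg (Perfection.coeff Q p (n + 1)) hx
  rw [map_mul, map_zero] at h1
  rw [← Perfection.coeff_pow_p', h.pow_eq_zero n _ h1, map_zero]

lemma cancel {x y : Perfection Q p} (hx : ϖ * x = ϖ * y) : x = y :=
  sub_eq_zero.mp (h.eq_zero_of_mul (by rw [mul_sub, hx, sub_self]))

lemma dvd_of_pow_pow (n : ℕ) : ∀ y : Q, y ^ p ^ n = 0 → Perfection.coeff Q p n ϖ ∣ y := by
  induction n with
  | zero =>
    intro y hy
    rw [pow_zero, pow_one] at hy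
    exact hy ▸ dvd_zero _
  | succ n ih =>
    intro y hy
    rw [pow_succ', pow_mul] at hy
    obtain ⟨z, hz⟩ := ih _ hy
    obtain ⟨w, rfl⟩ := h.surjective z
    rw [frobenius_def, ← Perfection.coeff_pow_p' ϖ n, ← mul_pow] at hz
    have h1 := h.dvd_of_pow (y - Perfection.coeff Q p (n + 1) ϖ * w) (by
      rw [sub_pow_char, hz, sub_self])
    have h2 : Perfection.coeff Q p (n + 1) ϖ ∣ Perfection.coeff Q p 1 ϖ := by
      have : ∀ m, Perfection.coeff Q p (m + 1) ϖ ∣ Perfection.coeff Q p 1 ϖ := fun m => by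
        induction m with
        | zero => exact dvd_rfl
        | succ m ih =>
          refine Dvd.dvd.trans ?_ ih
          rw [← Perfection.coeff_pow_p' ϖ (m + 1)]
          exact dvd_pow_self _ (Fact.out : p.Prime).ne_zero
      exact this n
    have h3 := dvd_add (h2.trans h1) (dvd_mul_right (Perfection.coeff Q p (n + 1) ϖ) w)
    rwa [sub_add_cancel] at h3

lemma dvd_of_coeff_zero {x : Perfection Q p} (hx : Perfection.coeff Q p 0 x = 0) : ϖ ∣ x := by
  have h1 : ∀ n, Perfection.coeff Q p n x ^ p ^ n = 0 := fun n => by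
    rw [← map_pow]
    rw [coeff_pow_pow_self, hx]
  choose y hy using fun n => h.dvd_of_pow_pow n _ (h1 n)
  obtain ⟨z, hz⟩ := exists_perfection (fun n => y (n + 1) ^ p) (fun n => by
    have h2 : Perfection.coeff Q p (n + 1) ϖ * (y (n + 2) ^ p - y (n + 1)) = 0 := by
      rw [mul_sub, ← hy, ← Perfection.coeff_pow_p' ϖ, ← mul_pow, ← hy, Perfection.coeff_pow_p',
        sub_self]
    have h3 := h.pow_eq_zero n _ h2
    rwa [sub_pow_char, sub_eq_zero] at h3)
  exact ⟨z, Perfection.ext (fun n => by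
    rw [map_mul, hz, ← Perfection.coeff_pow_p' ϖ, ← mul_pow, ← hy, Perfection.coeff_pow_p'])⟩

lemma dvd_of_coeff {n : ℕ} {x : Perfection Q p} (hx : Perfection.coeff Q p n x = 0) :
    ϖ ^ p ^ n ∣ x := by
  obtain ⟨y, rfl⟩ : ∃ y, y ^ p ^ n = x := by
    induction n generalizing x with
    | zero => exact ⟨x, by simp⟩
    | succ n ih =>
      obtain ⟨z, rfl⟩ := surjective_frobenius (Perfection Q p) p x
      rw [Perfection.coeff_frobenius] at hx
      obtain ⟨y, rfl⟩ := ih hx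
      exact ⟨y, by rw [frobenius_def, ← pow_mul, ← pow_succ]⟩
  have h1 := coeff_pow_pow_self y n
  exact pow_dvd_pow_of_dvd (h.dvd_of_coeff_zero (h1.symm.trans hx)) _

omit h in
lemma coeff_pow_self (h0 : Perfection.coeff Q p 0 ϖ = 0) (n : ℕ) :
    Perfection.coeff Q p n (ϖ ^ p ^ n) = 0 :=
  (coeff_pow_pow_self ϖ n).trans h0

lemma coeff_eq_iff {n : ℕ} {x y : Perfection Q p} :
    Perfection.coeff Q p n x = Perfection.coeff Q p n y ↔ ϖ ^ p ^ n ∣ x - y := by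
  refine ⟨fun hxy => h.dvd_of_coeff (by rw [map_sub, hxy, sub_self]), fun ⟨z, hz⟩ => ?_⟩
  have h1 := congrArg (Perfection.coeff Q p n) hz
  rwa [map_mul, coeff_pow_self h.coeff_zero, zero_mul, map_sub, sub_eq_zero] at h1

lemma isAdicComplete : IsAdicComplete (Ideal.span {ϖ}) (Perfection Q p) := by
  have hp := (Fact.out : p.Prime)
  refine isAdicComplete_of_limits (fun x hx => Perfection.ext (fun n => ?_)) (fun f hf => ?_)
  · have h1 := hx (p ^ n)
    rw [Ideal.span_singleton_pow, Ideal.mem_span_singleton] at h1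
    exact h.coeff_eq_iff.mpr (by rwa [sub_zero])
  · have h1 : ∀ n m, p ^ n ≤ m → Perfection.coeff Q p n (f m) =
        Perfection.coeff Q p n (f (p ^ n)) := fun n m hm => by
      have h2 := sub_mem_pow_of_le hf hm
      rw [Ideal.span_singleton_pow, Ideal.mem_span_singleton] at h2
      exact h.coeff_eq_iff.mpr h2
    obtain ⟨L, hL⟩ := exists_perfection (fun n => Perfection.coeff Q p n (f (p ^ n))) (fun n => by
      rw [Perfection.coeff_pow_p', h1 n _ (Nat.pow_le_pow_right hp.pos (Nat.le_succ n))])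
    refine ⟨L, fun n => ?_⟩
    have h3 := sub_mem_pow_of_le hf (Nat.lt_pow_self hp.one_lt).le (m := n)
    have h4 : f (p ^ n) - L ∈ Ideal.span {ϖ} ^ n := by
      rw [Ideal.span_singleton_pow, Ideal.mem_span_singleton]
      exact (pow_dvd_pow ϖ (Nat.lt_pow_self hp.one_lt).le).trans
        (h.coeff_eq_iff.mp (hL n).symm)
    have h5 := (Ideal.span {ϖ} ^ n).sub_mem h4 h3
    rwa [sub_sub_sub_cancel_left, ← neg_sub, ← neg_sub (f n), neg_sub, neg_sub] at h5

end IsTiltingElement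

end Tilting

/-! ### Regular pairs -/

section Regular

variable {B : Type u} [CommRing B]

/-- The pair `(π, ξ)` is a regular sequence (`B/(π, ξ)` may be zero). -/
structure IsRegPair (π ξ : B) : Prop where
  left : ∀ x, π * x = 0 → x = 0
  right : ∀ x, π ∣ ξ * x → π ∣ x

variable {π ξ : B}

lemma mem_span_pair_pow {a b : ℕ} {x : B} :
    x ∈ Ideal.span {π ^ a, ξ ^ b} ↔ ∃ s t, x = π ^ a * s + ξ ^ b * t := by
  rw [Ideal.mem_span_pair]
  exact ⟨fun ⟨s, t, h⟩ => ⟨s, t, by rw [← h]; ring⟩, fun ⟨s, t, h⟩ => ⟨s, t, by rw [h]; ring⟩⟩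

lemma span_pair_pow_le (a b : ℕ) :
    Ideal.span {π, ξ} ^ (a + b) ≤ Ideal.span {π ^ a, ξ ^ b} := by
  rw [Ideal.span_insert, Ideal.span_insert, ← Ideal.span_singleton_pow, ← Ideal.span_singleton_pow]
  exact Ideal.sup_pow_add_le_pow_sup_pow

lemma span_pow_pair_le (n : ℕ) : Ideal.span {π ^ n, ξ ^ n} ≤ Ideal.span {π, ξ} ^ n := by
  rw [Ideal.span_le]
  rintro x (rfl | rfl)
  · exact Ideal.pow_mem_pow (Ideal.subset_span (by simp)) n
  · exact Ideal.pow_mem_pow (Ideal.subset_span (by simp)) n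

namespace IsRegPair

variable (h : IsRegPair π ξ)

include h

lemma cancel_left {x y : B} (hxy : π * x = π * y) : x = y :=
  sub_eq_zero.mp (h.left _ (by rw [mul_sub, hxy, sub_self]))

lemma cancel_pow (n : ℕ) {x y : B} (hxy : π ^ n * x = π ^ n * y) : x = y := by
  induction n with
  | zero => simpa using hxy
  | succ n ih => exact ih (h.cancel_left (by rw [← mul_assoc, ← mul_assoc, ← pow_succ', hxy]))

lemma dvd_of_dvd_pow_mul {b : ℕ} {x : B} (hx : π ∣ ξ ^ b * x) : π ∣ x := by
  induction b with
  | zero => simpa using hx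
  | succ b ih => exact ih (h.right _ (by rwa [← mul_assoc, ← pow_succ']))

lemma pow_dvd_of_dvd_pow_mul {a b : ℕ} {x : B} (hx : π ^ a ∣ ξ ^ b * x) : π ^ a ∣ x := by
  induction a generalizing x with
  | zero => simp
  | succ a ih =>
    obtain ⟨y, rfl⟩ := h.dvd_of_dvd_pow_mul ((dvd_pow_self π (Nat.succ_ne_zero a)).trans hx)
    obtain ⟨z, hz⟩ := hx
    rw [pow_succ']
    refine mul_dvd_mul_left π (ih ⟨z, h.cancel_left ?_⟩)
    rw [← mul_assoc π (π ^ a), ← pow_succ', ← hz]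
    ring

lemma mem_of_pow_mul_mem_left {a c b : ℕ} {z : B}
    (hz : π ^ a * z ∈ Ideal.span {π ^ (a + c), ξ ^ b}) : z ∈ Ideal.span {π ^ c, ξ ^ b} := by
  obtain ⟨s, t, hst⟩ := mem_span_pair_pow.mp hz
  obtain ⟨t', rfl⟩ := h.pow_dvd_of_dvd_pow_mul (a := a) (b := b) (x := t)
    ⟨z - π ^ c * s, by rw [mul_sub, hst]; ring⟩
  exact mem_span_pair_pow.mpr ⟨s, t', h.cancel_pow a (by rw [hst]; ring)⟩

lemma mem_of_pow_mul_mem_right {b c : ℕ} {z : B}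
    (hz : ξ ^ b * z ∈ Ideal.span {π ^ 1, ξ ^ (b + c)}) : z ∈ Ideal.span {π ^ 1, ξ ^ c} := by
  obtain ⟨s, t, hst⟩ := mem_span_pair_pow.mp hz
  obtain ⟨y, hy⟩ := h.dvd_of_dvd_pow_mul (b := b) (x := z - ξ ^ c * t) ⟨s, by
    rw [mul_sub, hst]; ring⟩
  exact mem_span_pair_pow.mpr ⟨y, t, by rw [pow_one, ← hy]; ring⟩

/-- A ring is complete for `(π, ξ)` if it is complete for `π` and its reduction modulo `π` is
complete for `ξ`. -/
theorem isAdicComplete [IsAdicComplete (Ideal.span {π}) B]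
    (hz : ∀ x, (∀ n, x ∈ Ideal.span {π ^ 1, ξ ^ n}) → π ∣ x)
    (hl : ∀ f : ℕ → B, ∃ T : ℕ → B, ∀ n, π ∣ T n - ξ * T (n + 1) - f n) :
    IsAdicComplete (Ideal.span {π, ξ}) B := by
  refine isAdicComplete_of_limits (fun x hx => ?_) (fun f hf => ?_)
  · refine eq_zero_of_forall_mem_pow (I := Ideal.span {π}) (fun n => ?_)
    rw [Ideal.span_singleton_pow, Ideal.mem_span_singleton]
    induction n with
    | zero => simp
    | succ n ih =>
      obtain ⟨y, rfl⟩ := ih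
      rw [pow_succ]
      refine mul_dvd_mul_left _ (hz y (fun m => h.mem_of_pow_mul_mem_left (a := n) ?_))
      exact span_pair_pow_le _ _ (hx _)
  · have hD : ∀ g : ℕ → B, ∃ T : ℕ → B, ∀ n, T n - ξ * T (n + 1) = g n := by
      intro g
      choose T hT using hl
      choose r hr using hT
      let rr : ℕ → ℕ → B := fun m => (fun g' n => -r g' n)^[m] g
      have hrr : ∀ m n, T (rr m) n - ξ * T (rr m) (n + 1) = rr m n - π * rr (m + 1) n := by
        intro m n
        simp only [rr, Function.iterate_succ_apply']
        linear_combination hr ((fun g' n => -r g' n)^[m] g) n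
      have hlim := fun n => exists_adic_limit (Ideal.span {π})
        (fun m => ∑ i ∈ Finset.range m, π ^ i * T (rr i) n) (fun m => by
          rw [Finset.sum_range_succ, add_sub_cancel_left, Ideal.span_singleton_pow]
          exact Ideal.mul_mem_right _ _ (Ideal.mem_span_singleton_self _))
      choose L hL using hlim
      refine ⟨L, fun n => sub_eq_zero.mp
        (eq_zero_of_forall_mem_pow (I := Ideal.span {π}) (fun m => ?_))⟩
      have h1 : ∑ i ∈ Finset.range m, π ^ i * T (rr i) n -
          ξ * ∑ i ∈ Finset.range m, π ^ i * T (rr i) (n + 1) = g n - π ^ m * rr m n := by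
        induction m with
        | zero => simp [rr]
        | succ m ih =>
          rw [Finset.sum_range_succ, Finset.sum_range_succ]
          linear_combination ih + π ^ m * hrr m n
      have h2 : π ^ m * rr m n ∈ Ideal.span {π} ^ m := by
        rw [Ideal.span_singleton_pow]
        exact Ideal.mul_mem_right _ _ (Ideal.mem_span_singleton_self _)
      have h3 := (Ideal.span {π} ^ m).sub_mem (Ideal.mul_mem_left _ ξ (hL (n + 1) m))
        ((Ideal.span {π} ^ m).add_mem (hL n m) h2)
      convert h3 using 1
      linear_combination h1
    have hf2 : ∀ n, ∃ s t, f (2 * (n + 1)) - f (2 * n) = π ^ n * s + ξ ^ n * t := fun n => by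
      rw [← mem_span_pair_pow]
      refine span_pair_pow_le n n ?_
      rw [← two_mul]
      exact sub_mem_pow_of_le hf (by omega)
    choose s t hst using hf2
    obtain ⟨S, hS⟩ := exists_adic_limit (Ideal.span {π})
      (fun m => ∑ i ∈ Finset.range m, π ^ i * s i) (fun m => by
        rw [Finset.sum_range_succ, add_sub_cancel_left, Ideal.span_singleton_pow]
        exact Ideal.mul_mem_right _ _ (Ideal.mem_span_singleton_self _))
    obtain ⟨T, hT⟩ := hD t
    have hTn : ∀ n, ∑ i ∈ Finset.range n, ξ ^ i * t i = T 0 - ξ ^ n * T n := fun n => by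
      induction n with
      | zero => simp
      | succ n ih =>
        rw [Finset.sum_range_succ, ih]
        linear_combination (-ξ ^ n) * hT n
    have hfn : ∀ n, f (2 * n) = f 0 + ∑ i ∈ Finset.range n, π ^ i * s i +
        ∑ i ∈ Finset.range n, ξ ^ i * t i := fun n => by
      induction n with
      | zero => simp
      | succ n ih =>
        rw [Finset.sum_range_succ, Finset.sum_range_succ]
        linear_combination ih + hst n
    refine ⟨f 0 + S + T 0, fun n => ?_⟩
    have h1 := sub_mem_pow_of_le hf (show n ≤ 2 * n by omega)
    have h2 : ∑ i ∈ Finset.range n, π ^ i * s i - S ∈ Ideal.span {π, ξ} ^ n :=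
      Ideal.pow_right_mono (Ideal.span_mono (by simp)) n (hS n)
    have h3 : ξ ^ n * T n ∈ Ideal.span {π, ξ} ^ n :=
      Ideal.mul_mem_right _ _ (Ideal.pow_mem_pow (Ideal.subset_span (by simp)) n)
    have h4 := (Ideal.span {π, ξ} ^ n).sub_mem h2 ((Ideal.span {π, ξ} ^ n).add_mem h1 h3)
    convert h4 using 1
    linear_combination hfn n + hTn n

/-- Multiplication by `c` is a topological embedding if `c` divides a power of `ξ` modulo `π`. -/
theorem adicEmbedding {c : B} {N : ℕ} (hc : ξ ^ N ∈ Ideal.span {π, c}) :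
    AdicEmbedding (Ideal.span {π, ξ}) c := by
  obtain ⟨a', a, ha⟩ := Ideal.mem_span_pair.mp hc
  have key : ∀ n m x, c * x ∈ Ideal.span {π ^ n, ξ ^ (n * N + m)} →
      x ∈ Ideal.span {π ^ n, ξ ^ m} := by
    intro n
    induction n with
    | zero => exact fun m x _ => mem_span_pair_pow.mpr ⟨x, 0, by ring⟩
    | succ n ih =>
      intro m x hx
      obtain ⟨s, t, hst⟩ := mem_span_pair_pow.mp hx
      have h1 : ξ ^ N * (x - ξ ^ (n * N + m) * (a * t)) = π * (a' * x + a * π ^ n * s) := by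
        have e1 : ξ ^ ((n + 1) * N + m) = ξ ^ N * ξ ^ (n * N + m) := by
          rw [← pow_add]; congr 1; ring
        rw [e1] at hst
        linear_combination a * hst - x * ha
      obtain ⟨y, hy⟩ := h.dvd_of_dvd_pow_mul ⟨_, h1⟩
      have h2 : π ^ 1 * (c * y) ∈ Ideal.span {π ^ (1 + n), ξ ^ (n * N + m)} := by
        refine mem_span_pair_pow.mpr ⟨s, ξ ^ N * t - c * (a * t), ?_⟩
        have e1 : ξ ^ ((n + 1) * N + m) = ξ ^ N * ξ ^ (n * N + m) := by
          rw [← pow_add]; congr 1; ring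
        rw [e1] at hst
        rw [add_comm 1 n]
        linear_combination hst - c * hy
      obtain ⟨s', t', hy'⟩ := mem_span_pair_pow.mp (ih m y (h.mem_of_pow_mul_mem_left h2))
      refine mem_span_pair_pow.mpr ⟨s', π * t' + ξ ^ (n * N) * (a * t), ?_⟩
      rw [hy'] at hy
      rw [pow_succ, pow_add] at *
      linear_combination hy
  intro n
  refine ⟨n + (n * N + n), fun b hb => span_pow_pair_le n (key n n b ?_)⟩
  exact span_pair_pow_le _ _ hb

end IsRegPair

end Regular

/-! ### Witt vectors over tilts -/

section WittTilt

lemma witt_dvd_iff {p : ℕ} [Fact p.Prime] {k : Type u} [CommRing k] [CharP k p] [PerfectRing k p]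
    {x : WittVector p k} : (p : WittVector p k) ∣ x ↔ x.coeff 0 = 0 := by
  rw [← Ideal.mem_span_singleton, WittVector.mem_span_p_iff_coeff_zero_eq_zero]

variable {p : ℕ} [Fact p.Prime] {T : Type u} [CommRing T] [Fact (¬IsUnit (p : T))]

/-- The element `ξ` of `A_inf(T)` reduces to a generator, and non-zero-divisor, of the kernel of
`T^♭ → T/p`. -/
def IsTiltingXi (ξ : AInf p T) : Prop :=
  IsTiltingElement (Q := ModP T p) (p := p) (ξ.coeff 0 : PreTilt T p)

variable (p T) in
/-- The reduction map `A_inf(T) → T/p`. -/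
def aInfToModP : AInf p T →+* ModP T p := (PreTilt.coeff 0).comp WittVector.constantCoeff

lemma aInfToModP_apply (x : AInf p T) : aInfToModP p T x = PreTilt.coeff 0 (x.coeff 0) := rfl

lemma aInfToModP_teichmuller (x : PreTilt T p) :
    aInfToModP p T (WittVector.teichmuller p x) = PreTilt.coeff 0 x := by
  rw [aInfToModP_apply, WittVector.teichmuller_coeff_zero]

namespace IsTiltingXi

variable {ξ : AInf p T} (h : IsTiltingXi ξ)

include h

lemma tilt_cancel {x y : PreTilt T p} (hxy : ξ.coeff 0 * x = ξ.coeff 0 * y) : x = y :=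
  IsTiltingElement.cancel h hxy

lemma tilt_complete : IsAdicComplete (Ideal.span {(ξ.coeff 0 : PreTilt T p)}) (PreTilt T p) :=
  IsTiltingElement.isAdicComplete h

lemma tilt_dvd_iff {x : PreTilt T p} : ξ.coeff 0 ∣ x ↔ PreTilt.coeff 0 x = 0 :=
  ⟨fun ⟨y, hy⟩ => by
    rw [hy, map_mul]
    exact (congrArg (· * _) h.coeff_zero).trans (zero_mul _),
    fun hx => IsTiltingElement.dvd_of_coeff_zero h hx⟩

lemma surjective_aInfToModP : Function.Surjective (aInfToModP p T) :=
  (Perfection.coeff_surjective h.surjective 0).comp (WittVector.constantCoeff_surjective p)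

lemma isRegPair : IsRegPair (p : AInf p T) ξ where
  left x hx := WittVector.eq_zero_of_p_mul_eq_zero x (by rwa [mul_comm])
  right x hx := by
    rw [witt_dvd_iff] at hx ⊢
    refine h.tilt_cancel ?_
    rw [mul_zero, ← hx, WittVector.mul_coeff_zero]

lemma isAdicComplete : IsAdicComplete (Ideal.span {(p : AInf p T), ξ}) (AInf p T) := by
  have := h.tilt_complete
  have hcc : ∀ (a b : AInf p T) n, ((p : AInf p T) ^ 1 * a + ξ ^ n * b).coeff 0 =
      (ξ.coeff 0) ^ n * b.coeff 0 := fun a b n => by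
    have h1 : ((p : AInf p T) ^ 1 * a).coeff 0 = 0 :=
      witt_dvd_iff.mp ((pow_one (p : AInf p T)).symm ▸ dvd_mul_right _ _)
    have h2 := map_add (WittVector.constantCoeff (p := p) (R := PreTilt T p))
      ((p : AInf p T) ^ 1 * a) (ξ ^ n * b)
    rw [map_mul _ (ξ ^ n), map_pow] at h2
    exact h2.trans (by
      change ((p : AInf p T) ^ 1 * a).coeff 0 + ξ.coeff 0 ^ n * b.coeff 0 = _
      rw [h1, zero_add])
  refine h.isRegPair.isAdicComplete (fun x hx => ?_) (fun f => ?_)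
  · rw [witt_dvd_iff]
    refine eq_zero_of_forall_mem_pow (I := Ideal.span {(ξ.coeff 0 : PreTilt T p)}) (fun n => ?_)
    obtain ⟨s, t, rfl⟩ := mem_span_pair_pow.mp (hx n)
    rw [hcc, Ideal.span_singleton_pow]
    exact Ideal.mul_mem_right _ _ (Ideal.mem_span_singleton_self _)
  · set ϖ : PreTilt T p := ξ.coeff 0 with hϖ
    have hlim := fun n => exists_adic_limit (Ideal.span {ϖ})
      (fun m => ∑ i ∈ Finset.range m, ϖ ^ i * (f (n + i)).coeff 0) (fun m => by
        rw [Finset.sum_range_succ, add_sub_cancel_left, Ideal.span_singleton_pow]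
        exact Ideal.mul_mem_right _ _ (Ideal.mem_span_singleton_self _))
    choose L hL using hlim
    have hLL : ∀ n, L n - ϖ * L (n + 1) - (f n).coeff 0 = 0 := fun n => by
      refine eq_zero_of_forall_mem_pow (I := Ideal.span {ϖ}) (fun m => ?_)
      have h1 := Ideal.pow_le_pow_right (Nat.le_succ m) (hL n (m + 1))
      have h2 := Ideal.mul_mem_left _ ϖ (hL (n + 1) m)
      have h3 := (Ideal.span {ϖ} ^ m).sub_mem h2 h1
      convert h3 using 1
      rw [Finset.sum_range_succ', mul_sub, Finset.mul_sum]
      have : ∀ i, ϖ * (ϖ ^ i * (f (n + 1 + i)).coeff 0) =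
          ϖ ^ (i + 1) * (f (n + (i + 1))).coeff 0 := fun i => by
        rw [pow_succ', mul_assoc, add_assoc, add_comm 1 i]
      simp only [this, pow_zero, one_mul, add_zero]
      ring
    refine ⟨fun n => WittVector.teichmuller p (L n), fun n => ?_⟩
    rw [witt_dvd_iff, ← hLL n]
    have h2 := map_sub (WittVector.constantCoeff (p := p) (R := PreTilt T p))
      (WittVector.teichmuller p (L n) - ξ * WittVector.teichmuller p (L (n + 1))) (f n)
    have h3 := map_sub (WittVector.constantCoeff (p := p) (R := PreTilt T p))
      (WittVector.teichmuller p (L n)) (ξ * WittVector.teichmuller p (L (n + 1)))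
    rw [map_mul] at h3
    rw [h3] at h2
    refine h2.trans ?_
    change (WittVector.teichmuller p (L n)).coeff 0 - ξ.coeff 0 *
      (WittVector.teichmuller p (L (n + 1))).coeff 0 - (f n).coeff 0 = _
    rw [WittVector.teichmuller_coeff_zero, WittVector.teichmuller_coeff_zero]

lemma mem_iff {x : AInf p T} :
    x ∈ Ideal.span {(p : AInf p T), ξ} ↔ aInfToModP p T x = 0 := by
  constructor
  · intro hx
    have : Ideal.span {(p : AInf p T), ξ} ≤ RingHom.ker (aInfToModP p T) := by
      rw [Ideal.span_le]
      rintro y (rfl | rfl)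
      · change aInfToModP p T (p : AInf p T) = 0
        rw [map_natCast, CharP.cast_eq_zero]
      · exact h.coeff_zero
    exact this hx
  · intro hx
    obtain ⟨y, hy⟩ := h.tilt_dvd_iff.mpr hx
    obtain ⟨z, rfl⟩ := WittVector.constantCoeff_surjective p y
    have h1 : (p : AInf p T) ∣ x - ξ * z := by
      rw [witt_dvd_iff]
      have h2 := map_sub (WittVector.constantCoeff (p := p) (R := PreTilt T p)) x (ξ * z)
      rw [map_mul] at h2
      refine h2.trans ?_
      exact sub_eq_zero.mpr hy
    obtain ⟨w, hw⟩ := h1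
    rw [Ideal.mem_span_pair]
    exact ⟨w, z, by linear_combination -hw⟩

lemma ker_aInfToModP : RingHom.ker (aInfToModP p T) = Ideal.span {(p : AInf p T), ξ} :=
  Ideal.ext (fun _ => h.mem_iff.symm)

/-- Elements of the tilt with the same `n`-th component have congruent Teichmüller
representatives. -/
lemma teichmuller_sub_mem {x y : PreTilt T p} (n : ℕ)
    (hxy : PreTilt.coeff n x = PreTilt.coeff n y) :
    WittVector.teichmuller p x - WittVector.teichmuller p y ∈
      Ideal.span {(p : AInf p T), ξ} ^ (n + 1) := by
  have hpow : ∀ z : PreTilt T p, ∃ z', z' ^ p ^ n = z ∧ PreTilt.coeff 0 z' = PreTilt.coeff n z := by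
    intro z
    have hs : ∀ m : ℕ, ∀ z : PreTilt T p, ∃ z', z' ^ p ^ m = z := fun m => by
      induction m with
      | zero => exact fun z => ⟨z, by simp⟩
      | succ m ih =>
        intro z
        obtain ⟨y, rfl⟩ := surjective_frobenius (PreTilt T p) p z
        obtain ⟨z', rfl⟩ := ih y
        exact ⟨z', by rw [frobenius_def, ← pow_mul, ← pow_succ]⟩
    obtain ⟨z', rfl⟩ := hs n z
    exact ⟨z', rfl, (coeff_pow_pow_self (Q := ModP T p) z' n).symm⟩
  obtain ⟨x', rfl, hx⟩ := hpow x
  obtain ⟨y', rfl, hy⟩ := hpow y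
  have h1 : WittVector.teichmuller p x' ≡ WittVector.teichmuller p y'
      [SMOD Ideal.span {(p : AInf p T), ξ}] := by
    rw [SModEq.sub_mem, h.mem_iff, map_sub, aInfToModP_teichmuller, aInfToModP_teichmuller, hx, hy,
      hxy, sub_self]
  have h2 := SModEq.pow_pow_add_one (m := n) (p := p)
    (Ideal.subset_span (by simp) : (p : AInf p T) ∈ Ideal.span {(p : AInf p T), ξ}) h1
  rwa [SModEq.sub_mem, ← map_pow, ← map_pow] at h2

end IsTiltingXi

end WittTilt

/-! ### Norms of differences of roots of unity -/

section Norms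

variable {C : Type u} [NontriviallyNormedField C] [IsUltrametricDist C]

lemma norm_integerRing_le (x : IntegerRing C) : ‖(x : C)‖ ≤ 1 := x.2

lemma integerRing_dvd_iff {x y : IntegerRing C} : x ∣ y ↔ ‖(y : C)‖ ≤ ‖(x : C)‖ := by
  constructor
  · rintro ⟨z, rfl⟩
    rw [Subring.coe_mul, norm_mul]
    exact mul_le_of_le_one_right (norm_nonneg _) (norm_integerRing_le z)
  · intro h
    by_cases hx : (x : C) = 0
    · rw [hx, norm_zero, norm_le_zero_iff] at h
      rw [show y = 0 from Subtype.ext h]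
      exact dvd_zero x
    · refine ⟨⟨(y : C) / x, ?_⟩, Subtype.ext (mul_div_cancel₀ _ hx).symm⟩
      change ‖(y : C) / x‖ ≤ 1
      rw [norm_div]
      exact div_le_one_of_le₀ h (norm_nonneg _)

lemma integerRing_isUnit_iff {x : IntegerRing C} : IsUnit x ↔ ‖(x : C)‖ = 1 := by
  rw [isUnit_iff_dvd_one, integerRing_dvd_iff]
  simp only [OneMemClass.coe_one, norm_one]
  exact ⟨fun h => le_antisymm (norm_integerRing_le x) h, fun h => h.ge⟩

lemma norm_eq_of_associated {x y : IntegerRing C} (h : Associated x y) : ‖(x : C)‖ = ‖(y : C)‖ :=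
  le_antisymm (integerRing_dvd_iff.mp h.symm.dvd) (integerRing_dvd_iff.mp h.dvd)

variable [CharZero C] {p : ℕ} [Fact p.Prime] [IsPerfectoidField p C]

instance : CharZero (IntegerRing C) :=
  ⟨fun m n h => by
    have := congrArg (fun x : IntegerRing C => (x : C)) h
    simpa using this⟩

variable (p C) in
lemma norm_p_pos : 0 < ‖(p : C)‖ :=
  norm_pos_iff.mpr (Nat.cast_ne_zero.mpr (Fact.out : p.Prime).ne_zero)

lemma natCast_dvd_pow_iff {m : ℕ} {x : IntegerRing C} :
    (p : IntegerRing C) ∣ x ^ m ↔ ‖(x : C)‖ ^ m ≤ ‖(p : C)‖ := by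
  rw [integerRing_dvd_iff]
  simp

lemma isNilpotent_modP {x : ModP (IntegerRing C) p} (hx : ¬IsUnit x) : IsNilpotent x := by
  obtain ⟨y, rfl⟩ := Ideal.Quotient.mk_surjective x
  have h1 : ‖(y : C)‖ < 1 := lt_of_le_of_ne (norm_integerRing_le y) (fun h =>
    hx ((integerRing_isUnit_iff.mpr h).map _))
  obtain ⟨n, hn⟩ := exists_pow_lt_of_lt_one (norm_p_pos C p) h1
  refine ⟨n, ?_⟩
  rw [← map_pow, Ideal.Quotient.eq_zero_iff_mem, Ideal.mem_span_singleton]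
  exact natCast_dvd_pow_iff.mpr hn.le

lemma surjective_frobenius_modP : Function.Surjective (frobenius (ModP (IntegerRing C) p) p) := by
  intro x
  obtain ⟨y, rfl⟩ := Ideal.Quotient.mk_surjective x
  obtain ⟨a, b, ha, hb, h⟩ := IsPerfectoidField.frobenius_surjective (p := p) (y : C) y.2
  refine ⟨Ideal.Quotient.mk _ (⟨a, ha⟩ : IntegerRing C), ?_⟩
  rw [frobenius_def, ← map_pow, Ideal.Quotient.eq, ← neg_mem_iff, neg_sub,
    Ideal.mem_span_singleton]
  exact ⟨⟨b, hb⟩, Subtype.ext (by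
    change (y : C) - a ^ p = p * b
    rw [h]
    ring)⟩

variable (ζ : PRoots p (IntegerRing C))

lemma zeta_one_pow_card : ‖(p : C)‖ = ‖((ζ.zeta 1 - 1 : IntegerRing C) : C)‖ ^ (p - 1) := by
  have hp := (Fact.out : p.Prime)
  have h1 : IsPrimitiveRoot (ζ.zeta 1) (p - 1 + 1) := by
    rw [Nat.sub_add_cancel hp.one_le]
    simpa using ζ.primitive 1
  have h2 := h1.prod_one_sub_pow_eq_order
  rw [← Nat.cast_add_one, Nat.sub_add_cancel hp.one_le] at h2
  have h3 := congrArg (fun x : IntegerRing C => ‖(x : C)‖) h2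
  simp only [Subring.coe_natCast] at h3
  rw [← h3]
  push_cast
  rw [norm_prod]
  refine (Finset.prod_congr rfl (g := fun _ => ‖(ζ.zeta 1 : C) - 1‖) (fun k hk => ?_)).trans
    (by rw [Finset.prod_const, Finset.card_range])
  have h4 : Nat.Coprime (k + 1) p :=
    Nat.Coprime.symm ((Nat.Prime.coprime_iff_not_dvd hp).mpr (fun h => by
      have := Nat.le_of_dvd (Nat.succ_pos k) h
      have := Finset.mem_range.mp hk
      omega))
  have h5 := (show IsPrimitiveRoot (ζ.zeta 1) p by
    simpa using ζ.primitive 1).associated_sub_one_pow_sub_one_of_coprime h4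
  have h6 := norm_eq_of_associated h5
  rw [norm_sub_rev]
  push_cast at h6
  exact h6.symm

lemma zeta_ne_one (n : ℕ) : ζ.zeta (n + 1) ≠ 1 := by
  intro h
  have h1 := ζ.primitive (n + 1)
  have h2 := Nat.le_of_dvd one_pos (h1.dvd_of_pow_eq_one 1 (by rw [h, one_pow]))
  exact absurd h2 (not_le.mpr (Nat.one_lt_pow (Nat.succ_ne_zero n) (Fact.out : p.Prime).one_lt))

/-- The norm of `ζ_{p^n} - 1`. -/
def zetaNorm (n : ℕ) : ℝ := ‖((ζ.zeta n - 1 : IntegerRing C) : C)‖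

lemma zetaNorm_pos (n : ℕ) : 0 < zetaNorm ζ (n + 1) :=
  norm_pos_iff.mpr (fun h => zeta_ne_one ζ n (sub_eq_zero.mp (Subtype.ext h)))

/-- A lift of the `n`-th component of the reduction of `ξ`. -/
def xiLift (n : ℕ) : IntegerRing C := ∑ i ∈ Finset.range p, ζ.zeta (n + 1) ^ i

lemma xiLift_mul (n : ℕ) : xiLift ζ n * (ζ.zeta (n + 1) - 1) = ζ.zeta n - 1 := by
  rw [xiLift, geom_sum_mul, ζ.pow_succ]

lemma norm_xiLift_mul (n : ℕ) : ‖(xiLift ζ n : C)‖ * zetaNorm ζ (n + 1) = zetaNorm ζ n := by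
  rw [zetaNorm, ← norm_mul, ← Subring.coe_mul, xiLift_mul, zetaNorm]

lemma zetaNorm_le (n : ℕ) : zetaNorm ζ n ≤ zetaNorm ζ (n + 1) := by
  rw [← norm_xiLift_mul]
  exact mul_le_of_le_one_left (norm_nonneg _) (norm_integerRing_le _)

lemma zetaNorm_mono : Monotone (zetaNorm ζ) := monotone_nat_of_le_succ (zetaNorm_le ζ)

lemma zetaNorm_pow_succ (n : ℕ) (h1 : zetaNorm ζ (n + 1) < 1) :
    zetaNorm ζ (n + 2) ^ p = zetaNorm ζ (n + 1) := by
  have hp := (Fact.out : p.Prime)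
  obtain ⟨r, hr⟩ := exists_add_pow_prime_eq hp (ζ.zeta (n + 2) - 1) 1
  rw [sub_add_cancel, ζ.pow_succ, one_pow, mul_one] at hr
  have h2 : ζ.zeta (n + 1) - 1 = (ζ.zeta (n + 2) - 1) ^ p + p * (ζ.zeta (n + 2) - 1) * r := by
    rw [hr]
    ring
  have hpos := zetaNorm_pos ζ n
  have hle := zetaNorm_le ζ (n + 1)
  have hpn : ‖(p : C)‖ ≤ zetaNorm ζ (n + 1) ^ (p - 1) := by
    rw [zeta_one_pow_card ζ]
    exact pow_le_pow_left₀ (norm_nonneg _) (zetaNorm_mono ζ (Nat.le_add_left 1 n)) _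
  have h3 : ‖((p * (ζ.zeta (n + 2) - 1) * r : IntegerRing C) : C)‖ ≤
      zetaNorm ζ (n + 1) ^ (p - 1) * zetaNorm ζ (n + 2) := by
    rw [Subring.coe_mul, norm_mul, Subring.coe_mul, norm_mul, Subring.coe_natCast]
    exact (mul_le_of_le_one_right (by positivity) (norm_integerRing_le r)).trans
      (mul_le_mul_of_nonneg_right hpn (norm_nonneg _))
  have h4 : ‖(((ζ.zeta (n + 2) - 1) ^ p : IntegerRing C) : C)‖ = zetaNorm ζ (n + 2) ^ p := by
    rw [Subring.coe_pow, norm_pow, zetaNorm]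
  have hpow : zetaNorm ζ (n + 2) ^ p = zetaNorm ζ (n + 2) ^ (p - 1) * zetaNorm ζ (n + 2) := by
    rw [← pow_succ, Nat.sub_add_cancel hp.one_le]
  have h5 : zetaNorm ζ (n + 1) < zetaNorm ζ (n + 2) := by
    refine lt_of_le_of_ne hle (fun heq => ?_)
    have h6 : zetaNorm ζ (n + 1) ≤ zetaNorm ζ (n + 1) ^ p := by
      conv_lhs => rw [zetaNorm, h2, Subring.coe_add]
      refine (IsUltrametricDist.norm_add_le_max _ _).trans (max_le ?_ ?_)
      · rw [h4, ← heq]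
      · rw [heq, hpow]
        rw [heq] at h3
        exact h3
    have h7 : zetaNorm ζ (n + 1) ^ p < zetaNorm ζ (n + 1) := by
      conv_rhs => rw [← pow_one (zetaNorm ζ (n + 1))]
      exact pow_lt_pow_right_of_lt_one₀ hpos h1 hp.one_lt
    exact absurd h6 (not_le.mpr h7)
  have h8 : ‖((p * (ζ.zeta (n + 2) - 1) * r : IntegerRing C) : C)‖ <
      ‖(((ζ.zeta (n + 2) - 1) ^ p : IntegerRing C) : C)‖ := by
    rw [h4, hpow]
    refine h3.trans_lt (mul_lt_mul_of_pos_right ?_ (zetaNorm_pos ζ (n + 1)))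
    exact pow_lt_pow_left₀ h5 hpos.le (by have := hp.two_le; omega)
  rw [← h4]
  conv_rhs => rw [zetaNorm, h2, Subring.coe_add]
  rw [IsUltrametricDist.norm_add_eq_max_of_norm_ne_norm h8.ne', max_eq_left h8.le]

lemma zetaNorm_lt_one (n : ℕ) : zetaNorm ζ (n + 1) < 1 := by
  have hp := (Fact.out : p.Prime)
  induction n with
  | zero =>
    have h1 : ‖(p : C)‖ < 1 := IsPerfectoidField.norm_p_lt_one
    rw [zeta_one_pow_card ζ] at h1
    exact lt_of_not_ge (fun h => absurd h1 (not_lt.mpr (one_le_pow₀ h)))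
  | succ n ih =>
    have h1 := zetaNorm_pow_succ ζ n ih
    refine lt_of_not_ge (fun h => ?_)
    rw [← h1] at ih
    exact absurd ih (not_lt.mpr (one_le_pow₀ h))

lemma norm_xiLift (n : ℕ) : ‖(xiLift ζ (n + 1) : C)‖ = zetaNorm ζ (n + 2) ^ (p - 1) := by
  have h1 := norm_xiLift_mul ζ (n + 1)
  rw [← zetaNorm_pow_succ ζ n (zetaNorm_lt_one ζ n)] at h1
  refine mul_right_cancel₀ (zetaNorm_pos ζ (n + 1)).ne' (h1.trans ?_)
  rw [← pow_succ, Nat.sub_add_cancel (Fact.out : p.Prime).one_le]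

lemma norm_xiLift_one_pow : ‖(xiLift ζ 1 : C)‖ ^ p = ‖(p : C)‖ := by
  rw [norm_xiLift ζ 0, ← pow_mul, mul_comm, pow_mul, zetaNorm_pow_succ ζ 0 (zetaNorm_lt_one ζ 0),
    zeta_one_pow_card ζ, zetaNorm]

lemma coeff_xi (n : ℕ) : PreTilt.coeff n (ζ.xi.coeff 0) =
    Ideal.Quotient.mk (Ideal.span {(p : IntegerRing C)}) (xiLift ζ n) := by
  have h1 : ζ.xi.coeff 0 = ∑ i ∈ Finset.range p, ζ.epsRoot ^ i := by
    change WittVector.constantCoeff ζ.xi = _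
    rw [PRoots.xi, map_sum]
    refine Finset.sum_congr rfl (fun i _ => ?_)
    rw [map_pow]
    exact congrArg (· ^ i) (WittVector.teichmuller_coeff_zero p _)
  have h2 : PreTilt.coeff n ζ.epsRoot = Ideal.Quotient.mk _ (ζ.zeta (n + 1)) := by
    rw [PRoots.epsRoot, PreTilt.coeff_frobeniusEquiv_symm]
    rfl
  rw [h1, map_sum, xiLift, map_sum]
  simp only [map_pow, h2]

/-- The element `ξ` of `A_inf` generates the kernel of `𝒪^♭ → 𝒪/p` modulo `p`. -/
theorem isTiltingXi_xi : IsTiltingXi ζ.xi where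
  coeff_zero := by
    refine (coeff_xi ζ 0).trans ?_
    have h1 : IsPrimitiveRoot (ζ.zeta 1) p := by simpa using ζ.primitive 1
    rw [xiLift, zero_add, h1.geom_sum_eq_zero (Fact.out : p.Prime).one_lt, map_zero]
  surjective := surjective_frobenius_modP
  dvd_of_pow c hc := by
    obtain ⟨y, rfl⟩ := Ideal.Quotient.mk_surjective c
    rw [← map_pow, Ideal.Quotient.eq_zero_iff_mem, Ideal.mem_span_singleton, natCast_dvd_pow_iff,
      ← norm_xiLift_one_pow ζ] at hc
    have h1 : xiLift ζ 1 ∣ y := integerRing_dvd_iff.mpr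
      (le_of_pow_le_pow_left₀ (Fact.out : p.Prime).ne_zero (norm_nonneg _) hc)
    exact (coeff_xi ζ 1).symm ▸ map_dvd (Ideal.Quotient.mk (Ideal.span {(p : IntegerRing C)})) h1
  pow_eq_zero n c hc := by
    have hp := (Fact.out : p.Prime)
    obtain ⟨y, rfl⟩ := Ideal.Quotient.mk_surjective c
    have h0 := (congrArg (· * _) (coeff_xi ζ (n + 1))).symm.trans hc
    rw [← map_mul, Ideal.Quotient.eq_zero_iff_mem, Ideal.mem_span_singleton,
      integerRing_dvd_iff, Subring.coe_mul, norm_mul, Subring.coe_natCast] at h0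
    rw [← map_pow, Ideal.Quotient.eq_zero_iff_mem, Ideal.mem_span_singleton, natCast_dvd_pow_iff]
    have h1 : ‖(xiLift ζ 1 : C)‖ ≤ ‖(xiLift ζ (n + 1) : C)‖ := by
      rw [norm_xiLift, norm_xiLift]
      exact pow_le_pow_left₀ (norm_nonneg _) (zetaNorm_mono ζ (by omega)) _
    have hpos : 0 < ‖(xiLift ζ 1 : C)‖ := by
      rw [norm_xiLift ζ 0]
      exact pow_pos (zetaNorm_pos ζ 1) _
    have h2 : ‖(xiLift ζ 1 : C)‖ * ‖(y : C)‖ ≤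
        ‖(xiLift ζ 1 : C)‖ * ‖(xiLift ζ 1 : C)‖ ^ (p - 1) := by
      rw [← pow_succ', Nat.sub_add_cancel hp.one_le, norm_xiLift_one_pow]
      exact (mul_le_mul_of_nonneg_right h1 (norm_nonneg _)).trans h0
    have h3 := le_of_mul_le_mul_left h2 hpos
    refine (pow_le_pow_left₀ (norm_nonneg _) h3 p).trans ?_
    rw [← pow_mul, mul_comm, pow_mul, norm_xiLift_one_pow]
    exact pow_le_of_le_one (norm_nonneg _)
      (IsPerfectoidField.norm_p_lt_one : ‖(p : C)‖ < 1).le (by have := hp.two_le; omega)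

end Norms

/-! ### The `p`-adic completion of a ring -/

section PCompletion

variable {S : Type u} [CommRing S] (p : ℕ)

lemma map_span_natCast {T : Type*} [CommRing T] (f : S →+* T) :
    (Ideal.span {(p : S)}).map f = Ideal.span {(p : T)} := by
  rw [Ideal.map_span, Set.image_singleton, map_natCast]

lemma ker_evalOne_span_natCast (y : AdicCompletion (Ideal.span {(p : S)}) S) :
    AdicCompletion.evalOneₐ (Ideal.span {(p : S)}) y = 0 ↔
      (p : AdicCompletion (Ideal.span {(p : S)}) S) ∣ y := by
  have h := AdicCompletion.ker_evalOneₐ_eq_map (Ideal.span {(p : S)}) ⟨{(p : S)}, by simp⟩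
  rw [map_span_natCast] at h
  rw [← Ideal.mem_span_singleton, ← h]
  rfl

lemma exists_dvd_sub_algebraMap (y : AdicCompletion (Ideal.span {(p : S)}) S) :
    ∃ x : S, (p : AdicCompletion (Ideal.span {(p : S)}) S) ∣ y - algebraMap S _ x := by
  obtain ⟨x, hx⟩ := Ideal.Quotient.mk_surjective
    (AdicCompletion.evalOneₐ (Ideal.span {(p : S)}) y)
  refine ⟨x, (ker_evalOne_span_natCast p _).mp ?_⟩
  rw [map_sub, AlgHom.commutes, ← hx]
  exact sub_self _

lemma dvd_of_dvd_algebraMap {x : S}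
    (h : (p : AdicCompletion (Ideal.span {(p : S)}) S) ∣ algebraMap S _ x) : (p : S) ∣ x := by
  rw [← ker_evalOne_span_natCast, AlgHom.commutes] at h
  exact Ideal.mem_span_singleton.mp (Ideal.Quotient.eq_zero_iff_mem.mp h)

lemma eq_zero_of_natCast_mul_completion (hS : ∀ x : S, (p : S) * x = 0 → x = 0)
    {y : AdicCompletion (Ideal.span {(p : S)}) S}
    (hy : (p : AdicCompletion (Ideal.span {(p : S)}) S) * y = 0) : y = 0 := by
  refine AdicCompletion.ext_evalₐ (fun n => ?_)
  obtain ⟨f, rfl⟩ := AdicCompletion.mk_surjective _ _ y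
  have h1 := congrArg (AdicCompletion.evalₐ (Ideal.span {(p : S)}) (n + 1)) hy
  rw [map_mul, map_natCast, map_zero, AdicCompletion.evalₐ_mk,
    ← map_natCast (Ideal.Quotient.mk _), ← map_mul, Ideal.Quotient.eq_zero_iff_mem,
    Ideal.span_singleton_pow, Ideal.mem_span_singleton] at h1
  obtain ⟨z, hz⟩ := h1
  have h2 : f (n + 1) = p ^ n * z := sub_eq_zero.mp (hS _ (by rw [mul_sub, hz]; ring))
  rw [AdicCompletion.evalₐ_mk, map_zero, Ideal.Quotient.eq_zero_iff_mem]
  have h3 := f.2 (Nat.le_succ n)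
  rw [SModEq.sub_mem, smul_eq_mul, Ideal.mul_top] at h3
  have h4 : f (n + 1) ∈ Ideal.span {(p : S)} ^ n := by
    rw [h2, Ideal.span_singleton_pow]
    exact Ideal.mul_mem_right _ _ (Ideal.mem_span_singleton_self _)
  have h5 := (Ideal.span {(p : S)} ^ n).add_mem h3 h4
  rwa [sub_add_cancel] at h5

end PCompletion

/-! ### Finite expansions -/

section Expand

variable {K : Type w} {S : Type u} {W : Type v} [CommRing S] [CommRing W] (ι : S →+* W) (t : K → W)

/-- The sum `∑ ι (a k) * t k`. -/
def expand : (K →₀ S) →+ W :=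
  Finsupp.liftAddHom (fun k => (AddMonoidHom.mulRight (t k)).comp (ι : S →+ W))

lemma expand_single (k : K) (a : S) : expand ι t (Finsupp.single k a) = ι a * t k := by
  rw [expand, Finsupp.liftAddHom_apply_single]
  rfl

lemma expand_smul (b : S) (a : K →₀ S) : expand ι t (b • a) = ι b * expand ι t a := by
  induction a using Finsupp.induction_linear with
  | zero => simp
  | add f g hf hg => rw [smul_add, map_add, hf, hg, map_add, mul_add]
  | single k x => rw [Finsupp.smul_single, expand_single, expand_single, smul_eq_mul, map_mul, mul_assoc]

lemma map_expand {W' : Type*} [CommRing W'] (f : W →+* W') (a : K →₀ S) :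
    f (expand ι t a) = expand (f.comp ι) (fun k => f (t k)) a := by
  induction a using Finsupp.induction_linear with
  | zero => simp
  | add x y hx hy => rw [map_add, map_add, hx, hy, map_add]
  | single k x => rw [expand_single, expand_single, map_mul]; rfl

lemma expand_mapRange {S' : Type*} [CommRing S'] (g : S' →+* S) (a : K →₀ S') :
    expand ι t (a.mapRange g (map_zero g)) = expand (ι.comp g) t a := by
  induction a using Finsupp.induction_linear with
  | zero => simp
  | add x y hx hy => rw [Finsupp.mapRange_add (map_add g), map_add, hx, hy, map_add]
  | single k x => rw [Finsupp.mapRange_single, expand_single, expand_single]; rfl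

lemma expand_mem {I : Ideal S} {a : K →₀ S} (ha : ∀ k, a k ∈ I) : expand ι t a ∈ I.map ι := by
  rw [expand, Finsupp.liftAddHom_apply, Finsupp.sum]
  exact sum_mem (fun k _ => Ideal.mul_mem_right _ _ (Ideal.mem_map_of_mem ι (ha k)))

end Expand

/-! ### Fractional exponents -/

section FracExpo

variable (p : ℕ) [Fact p.Prime] (d : ℕ)

/-- The exponents in `[0, 1)^d`, which represent `ℤ[1/p]^d` modulo `ℤ^d`. -/
def FracExpo : Type := {k : Expo p d // ∀ i, 0 ≤ (k i : ℚ) ∧ (k i : ℚ) < 1}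

instance : Zero (FracExpo p d) := ⟨⟨0, fun _ => ⟨le_rfl, one_pos⟩⟩⟩

variable {p d}

lemma exists_intExp_add (k : Expo p d) : ∃ (m : Fin d → ℤ) (l : FracExpo p d),
    k = intExp p d m + l.1 := by
  let m : Fin d → ℤ := fun i => ⌊(k i : ℚ)⌋
  refine ⟨m, ⟨k - intExp p d m, fun i => ?_⟩, by simp⟩
  have h1 : ((k - intExp p d m) i : ℚ) = (k i : ℚ) - ⌊(k i : ℚ)⌋ := rfl
  rw [h1]
  exact ⟨sub_nonneg.mpr (Int.floor_le _), by linarith [Int.lt_floor_add_one (k i : ℚ)]⟩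

lemma FracExpo.eq_of_sub_mem {k l : FracExpo p d} (h : k.1 - l.1 ∈ Set.range (intExp p d)) :
    k = l := by
  obtain ⟨m, hm⟩ := h
  refine Subtype.ext (funext (fun i => Subtype.ext ?_))
  have h1 : ((m i : ℤ) : ℚ) = (k.1 i : ℚ) - (l.1 i : ℚ) :=
    congrArg (fun x : Expo p d => (x i : ℚ)) hm
  have h2 := k.2 i
  have h3 := l.2 i
  have h4 : (m i : ℚ) < 1 := by linarith
  have h5 : (-1 : ℚ) < m i := by linarith
  have h6 : m i < 1 := by exact_mod_cast h4
  have h7 : -1 < m i := by exact_mod_cast h5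
  have h8 : m i = 0 := by omega
  rw [h8, Int.cast_zero] at h1
  linarith

end FracExpo

/-! ### The decomposition of `R_∞` -/

section RInfDecomposition

variable {p : ℕ} [Fact p.Prime] {O : Type u} [CommRing O] {d : ℕ}
  {R : Type u} [CommRing R] (sq : TateLaurent p O d →+* R)

/-- The map `R → R ⊗ O[T^{±1/p^∞}]`. -/
def baseRInf0 : R →+* RInf0 sq :=
  (Algebra.TensorProduct.includeLeftRingHom : FrAlg sq →+* RInf0 sq).comp (toFrAlg sq)

/-- The monomials in `R ⊗ O[T^{±1/p^∞}]`. -/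
def monRInf0 (k : Expo p d) : RInf0 sq := 1 ⊗ₜ AddMonoidAlgebra.single k 1

lemma monRInf0_add (k l : Expo p d) : monRInf0 sq (k + l) = monRInf0 sq k * monRInf0 sq l := by
  rw [monRInf0, monRInf0, monRInf0, Algebra.TensorProduct.tmul_mul_tmul, one_mul,
    AddMonoidAlgebra.single_mul_single, mul_one]

lemma monRInf0_zero : monRInf0 sq 0 = 1 := rfl

lemma monRInf0_intExp (m : Fin d → ℤ) (a : O) :
    ((1 : FrAlg sq) ⊗ₜ[Laurent O d] (AddMonoidAlgebra.single (intExp p d m) a : LaurentRoot p O d) :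
      RInf0 sq) = baseRInf0 sq (sq (toTate p O d (AddMonoidAlgebra.single m a))) := by
  have h1 : (AddMonoidAlgebra.single (intExp p d m) a : LaurentRoot p O d) =
      algebraMap (Laurent O d) (LaurentRoot p O d) (AddMonoidAlgebra.single m a) := by
    change _ = AddMonoidAlgebra.mapDomainRingHom O (intExp p d) _
    simp
  rw [h1, Algebra.algebraMap_eq_smul_one, ← TensorProduct.smul_tmul,
    ← Algebra.algebraMap_eq_smul_one]
  rfl

/-- `R ⊗ O[T^{±1/p^∞}]` is spanned by the monomials with exponents in `[0, 1)^d`. -/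
lemma exists_expand_RInf0 (x : RInf0 sq) :
    ∃ a : FracExpo p d →₀ R, expand (baseRInf0 sq) (fun k => monRInf0 sq k.1) a = x := by
  induction x using TensorProduct.induction_on with
  | zero => exact ⟨0, map_zero _⟩
  | add x y hx hy =>
    obtain ⟨a, rfl⟩ := hx
    obtain ⟨b, rfl⟩ := hy
    exact ⟨a + b, map_add _ _ _⟩
  | tmul r y =>
    have h0 : (r ⊗ₜ[Laurent O d] y : RInf0 sq) = baseRInf0 sq (show R from r) * 1 ⊗ₜ[Laurent O d] y := by
      change _ = (r ⊗ₜ[Laurent O d] 1 : RInf0 sq) * 1 ⊗ₜ[Laurent O d] y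
      rw [Algebra.TensorProduct.tmul_mul_tmul, mul_one, one_mul]
    rw [h0]
    clear h0
    induction y using LaurentRoot.induction with
    | add x y hx hy =>
      obtain ⟨a, ha⟩ := hx
      obtain ⟨b, hb⟩ := hy
      exact ⟨a + b, by rw [map_add, ha, hb, TensorProduct.tmul_add, mul_add]⟩
    | single k c =>
      obtain ⟨m, l, rfl⟩ := exists_intExp_add k
      refine ⟨Finsupp.single l ((show R from r) * sq (toTate p O d (AddMonoidAlgebra.single m c))), ?_⟩
      rw [expand_single, map_mul, mul_assoc, ← monRInf0_intExp, monRInf0,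
        Algebra.TensorProduct.tmul_mul_tmul, one_mul, AddMonoidAlgebra.single_mul_single, mul_one]

lemma retractRInf0_base_mul_mon (r : R) (k : Expo p d) (hk : k ∉ Set.range (intExp p d)) :
    retractRInf0 sq (baseRInf0 sq r * monRInf0 sq k) = 0 := by
  change retractRInf0 sq ((toFrAlg sq r ⊗ₜ[Laurent O d] 1 : RInf0 sq) * 1 ⊗ₜ _) = 0
  rw [Algebra.TensorProduct.tmul_mul_tmul, mul_one, one_mul, retractRInf0, LinearMap.comp_apply,
    LinearMap.lTensor_tmul]
  have h1 : laurentRetract (p := p) (AddMonoidAlgebra.single k (1 : O)) = 0 :=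
    comapDomain_single_eq_zero (1 : O) hk
  rw [h1, TensorProduct.tmul_zero, map_zero]

lemma retractRInf0_base (r : R) : retractRInf0 sq (baseRInf0 sq r) = toFrAlg sq r := by
  change retractRInf0 sq (toFrAlg sq r ⊗ₜ[Laurent O d] 1) = _
  rw [retractRInf0, LinearMap.comp_apply, LinearMap.lTensor_tmul, laurentRetract_one]
  change TensorProduct.rid (Laurent O d) (FrAlg sq) (toFrAlg sq r ⊗ₜ 1) = _
  rw [TensorProduct.rid_tmul, one_smul]

/-- The coefficient of `T^k` of an element of `R ⊗ O[T^{±1/p^∞}]`, for `k` in `[0, 1)^d`. -/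
def coeffRInf0 (k : FracExpo p d) : RInf0 sq →+ R :=
  (retractRInf0 sq).toAddMonoidHom.comp (AddMonoidHom.mulRight (monRInf0 sq (-k.1)))

lemma coeffRInf0_expand (k : FracExpo p d) (a : FracExpo p d →₀ R) :
    coeffRInf0 sq k (expand (baseRInf0 sq) (fun k => monRInf0 sq k.1) a) = a k := by
  classical
  induction a using Finsupp.induction_linear with
  | zero => simp
  | add x y hx hy => rw [map_add, map_add, hx, hy, Finsupp.add_apply]
  | single l r =>
    rw [expand_single]
    change retractRInf0 sq (_ * monRInf0 sq (-k.1)) = _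
    rw [mul_assoc, ← monRInf0_add, ← sub_eq_add_neg]
    by_cases h : l = k
    · subst h
      rw [sub_self, monRInf0_zero, mul_one, retractRInf0_base, Finsupp.single_eq_same]
      rfl
    · rw [retractRInf0_base_mul_mon _ _ _ (fun hm => h (FracExpo.eq_of_sub_mem hm)),
        Finsupp.single_eq_of_ne' h]
      rfl

lemma coeffRInf0_natCast_mul (k : FracExpo p d) (n : ℕ) (x : RInf0 sq) :
    coeffRInf0 sq k (n * x) = n * coeffRInf0 sq k x := by
  rw [← nsmul_eq_mul, map_nsmul, nsmul_eq_mul]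

lemma eq_zero_of_natCast_mul_RInf0 (hR : ∀ r : R, (p : R) * r = 0 → r = 0) (x : RInf0 sq)
    (hx : (p : RInf0 sq) * x = 0) : x = 0 := by
  obtain ⟨a, rfl⟩ := exists_expand_RInf0 sq x
  have : a = 0 := Finsupp.ext (fun k => hR _ (by
    rw [← coeffRInf0_expand sq k a, ← coeffRInf0_natCast_mul, hx, map_zero]))
  rw [this, map_zero]

lemma eq_zero_of_natCast_mul_RInf (hR : ∀ r : R, (p : R) * r = 0 → r = 0) {x : RInf sq}
    (hx : (p : RInf sq) * x = 0) : x = 0 :=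
  eq_zero_of_natCast_mul_completion p (eq_zero_of_natCast_mul_RInf0 sq hR) hx

variable [Nontrivial R] [IsAdicComplete (Ideal.span {(p : R)}) R]

/-- The map `R → R_∞/p`. -/
def baseModP : R →+* ModP (RInf sq) p := (Ideal.Quotient.mk _).comp (baseRInf sq)

/-- The monomials in `R_∞/p`. -/
def monModP (k : Expo p d) : ModP (RInf sq) p := Ideal.Quotient.mk _ (monRInf sq k)

lemma exists_expand_modP (x : ModP (RInf sq) p) :
    ∃ a : FracExpo p d →₀ R, expand (baseModP sq) (fun k => monModP sq k.1) a = x := by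
  obtain ⟨y, rfl⟩ := Ideal.Quotient.mk_surjective x
  obtain ⟨z, hz⟩ := exists_dvd_sub_algebraMap p y
  obtain ⟨a, rfl⟩ := exists_expand_RInf0 sq z
  refine ⟨a, ?_⟩
  have h1 := map_expand (baseRInf0 sq) (fun k : FracExpo p d => monRInf0 sq k.1)
    ((Ideal.Quotient.mk (Ideal.span {(p : RInf sq)})).comp (toRInf sq)) a
  refine h1.symm.trans ?_
  rw [RingHom.comp_apply, eq_comm, Ideal.Quotient.eq, Ideal.mem_span_singleton]
  exact hz

lemma dvd_of_expand_modP_eq_zero {a : FracExpo p d →₀ R}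
    (ha : expand (baseModP sq) (fun k => monModP sq k.1) a = 0) (k : FracExpo p d) :
    (p : R) ∣ a k := by
  have h1 := map_expand (baseRInf0 sq) (fun k : FracExpo p d => monRInf0 sq k.1)
    ((Ideal.Quotient.mk (Ideal.span {(p : RInf sq)})).comp (toRInf sq)) a
  have h2 := h1.trans ha
  rw [RingHom.comp_apply, Ideal.Quotient.eq_zero_iff_mem, Ideal.mem_span_singleton] at h2
  obtain ⟨y, hy⟩ := dvd_of_dvd_algebraMap p h2
  have h3 := congrArg (coeffRInf0 sq k) hy
  rw [coeffRInf0_natCast_mul, coeffRInf0_expand] at h3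
  exact ⟨_, h3⟩

lemma dvd_of_dvd_baseRInf {r : R} (h : (p : RInf sq) ∣ baseRInf sq r) : (p : R) ∣ r := by
  classical
  have := dvd_of_expand_modP_eq_zero sq (a := Finsupp.single 0 r) (by
    rw [expand_single]
    change Ideal.Quotient.mk _ (baseRInf sq r) * Ideal.Quotient.mk _ (monRInf sq 0) = 0
    rw [monRInf_zero, map_one, mul_one, Ideal.Quotient.eq_zero_iff_mem, Ideal.mem_span_singleton]
    exact h) 0
  rwa [Finsupp.single_eq_same] at this

end RInfDecomposition

/-! ### An étale model of `R/p` over the Laurent polynomials with coefficients in `A_inf` -/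

section EtaleModel

variable {p : ℕ} [Fact p.Prime] {O : Type u} [CommRing O] [Fact (¬IsUnit (p : O))] {d : ℕ}
  {R : Type u} [CommRing R] (sq : TateLaurent p O d →+* R)

/-- The ideal of `A[U^{±1}]` generated by an ideal of `A`. -/
abbrev laurentIdeal {A : Type u} [CommRing A] (d : ℕ) (J : Ideal A) : Ideal (Laurent A d) :=
  J.map AddMonoidAlgebra.singleZeroRingHom

lemma mem_laurentIdeal {A : Type u} [CommRing A] {J : Ideal A} {f : Laurent A d}
    (hf : ∀ m, f.coeff m ∈ J) : f ∈ laurentIdeal d J := by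
  rw [← AddMonoidAlgebra.sum_coeff_single f]
  refine sum_mem (fun m _ => ?_)
  have h1 : (AddMonoidAlgebra.single m (f.coeff m) : Laurent A d) =
      AddMonoidAlgebra.singleZeroRingHom (f.coeff m) * AddMonoidAlgebra.single m 1 := by
    change _ = AddMonoidAlgebra.single 0 _ * _
    rw [AddMonoidAlgebra.single_mul_single, zero_add, mul_one]
  rw [h1]
  exact Ideal.mul_mem_right _ _ (Ideal.mem_map_of_mem _ (hf m))

variable (p O d) in
/-- The structure map `O/p → O⟨T^{±1}⟩/p`. -/
def constTate : ModP O p →+* TateLaurent p O d ⧸ (Ideal.span {(p : TateLaurent p O d)}) ^ 1 :=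
  Ideal.quotientMap _ ((toTate p O d).comp AddMonoidAlgebra.singleZeroRingHom) (by
    rw [← Ideal.map_le_iff_le_comap, map_span_natCast, pow_one])

variable (p O d) in
/-- The reduction map `A_inf[U^{±1}] → O⟨T^{±1}⟩/p`. -/
def redTate : Laurent (AInf p O) d →+*
    TateLaurent p O d ⧸ (Ideal.span {(p : TateLaurent p O d)}) ^ 1 :=
  AddMonoidAlgebra.liftNCRingHom ((constTate p O d).comp (aInfToModP p O))
    (((Ideal.Quotient.mk _).comp (toTate p O d)).toMonoidHom.comp
      (AddMonoidAlgebra.of O (Fin d → ℤ))) (fun _ _ => Commute.all _ _)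

lemma redTate_single (m : Fin d → ℤ) (a : AInf p O) (b : O)
    (hb : Ideal.Quotient.mk _ b = aInfToModP p O a) :
    redTate p O d (AddMonoidAlgebra.single m a) =
      Ideal.Quotient.mk _ (toTate p O d (AddMonoidAlgebra.single m b)) := by
  unfold redTate
  rw [AddMonoidAlgebra.liftNCRingHom_single, RingHom.comp_apply, ← hb]
  change Ideal.Quotient.mk _ (toTate p O d (AddMonoidAlgebra.single 0 b)) *
    Ideal.Quotient.mk _ (toTate p O d (AddMonoidAlgebra.single m 1)) = _
  rw [← map_mul, ← map_mul, AddMonoidAlgebra.single_mul_single, zero_add, mul_one]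

lemma exists_redTate_eq (f : Laurent (AInf p O) d) : ∃ F : Laurent O d,
    redTate p O d f = Ideal.Quotient.mk _ (toTate p O d F) ∧
      ∀ m, Ideal.Quotient.mk (Ideal.span {(p : O)}) (F.coeff m) = aInfToModP p O (f.coeff m) := by
  classical
  induction f using AddMonoidAlgebra.induction_linear with
  | zero => exact ⟨0, by simp, fun m => by simp⟩
  | add f g hf hg =>
    obtain ⟨F, hF, hF'⟩ := hf
    obtain ⟨G, hG, hG'⟩ := hg
    refine ⟨F + G, by rw [map_add, hF, hG, map_add, map_add], fun m => ?_⟩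
    rw [AddMonoidAlgebra.coeff_add, AddMonoidAlgebra.coeff_add, Finsupp.add_apply,
      Finsupp.add_apply, map_add, map_add, hF', hG']
  | single m a =>
    obtain ⟨b, hb⟩ := Ideal.Quotient.mk_surjective (aInfToModP p O a)
    refine ⟨AddMonoidAlgebra.single m b, redTate_single m a b hb, fun l => ?_⟩
    rw [AddMonoidAlgebra.coeff_single, AddMonoidAlgebra.coeff_single, Finsupp.single_apply,
      Finsupp.single_apply]
    split_ifs
    · exact hb
    · rw [map_zero, map_zero]

variable {ξ : AInf p O} (h : IsTiltingXi ξ)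

include h in
lemma redTate_surjective : Function.Surjective (redTate p O d) := by
  intro x
  obtain ⟨y, rfl⟩ := Ideal.Quotient.mk_surjective x
  obtain ⟨F, hF⟩ := exists_dvd_sub_algebraMap p y
  have h1 : Ideal.Quotient.mk ((Ideal.span {(p : TateLaurent p O d)}) ^ 1) y =
      Ideal.Quotient.mk _ (toTate p O d F) := by
    rw [Ideal.Quotient.eq, pow_one, Ideal.mem_span_singleton]
    exact hF
  rw [h1]
  clear h1 hF
  induction F using AddMonoidAlgebra.induction_linear with
  | zero => exact ⟨0, by simp⟩
  | add F G hF hG =>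
    obtain ⟨f, hf⟩ := hF
    obtain ⟨g, hg⟩ := hG
    exact ⟨f + g, by rw [map_add, hf, hg, map_add, map_add]⟩
  | single m b =>
    obtain ⟨a, ha⟩ := h.surjective_aInfToModP (Ideal.Quotient.mk _ b)
    exact ⟨AddMonoidAlgebra.single m a, redTate_single m a b ha.symm⟩

include h in
lemma ker_redTate_le :
    RingHom.ker (redTate p O d) ≤ laurentIdeal d (Ideal.span {(p : AInf p O), ξ}) := by
  intro f hf
  obtain ⟨F, hF, hF'⟩ := exists_redTate_eq f
  rw [RingHom.mem_ker, hF, Ideal.Quotient.eq_zero_iff_mem, pow_one, Ideal.mem_span_singleton] at hf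
  obtain ⟨G, rfl⟩ := dvd_of_dvd_algebraMap p hf
  refine mem_laurentIdeal (fun m => ?_)
  rw [h.mem_iff, ← hF', Ideal.Quotient.eq_zero_iff_mem, Ideal.mem_span_singleton]
  refine ⟨G.coeff m, ?_⟩
  rw [← nsmul_eq_mul, ← nsmul_eq_mul, AddMonoidAlgebra.coeff_smul]
  rfl

/-- The reduction map `A_inf[U^{±1}] → R/p`. -/
def redR : Laurent (AInf p O) d →+* ModP R p :=
  (Ideal.quotientMap (Ideal.span {(p : R)}) sq (by
    rw [← Ideal.map_le_iff_le_comap, pow_one, map_span_natCast]) :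
      TateLaurent p O d ⧸ (Ideal.span {(p : TateLaurent p O d)}) ^ 1 →+* ModP R p).comp
    (redTate p O d)

lemma redR_single (m : Fin d → ℤ) (a : AInf p O) (b : O)
    (hb : Ideal.Quotient.mk _ b = aInfToModP p O a) :
    redR sq (AddMonoidAlgebra.single m a) =
      Ideal.Quotient.mk _ (sq (toTate p O d (AddMonoidAlgebra.single m b))) := by
  unfold redR
  rw [RingHom.comp_apply, redTate_single m a b hb]
  rfl

include h in
theorem exists_etale_model (hsq : AdicEtale (Ideal.span {(p : TateLaurent p O d)}) sq) :
    ∃ (A : Type u) (_ : CommRing A) (_ : Algebra (Laurent (AInf p O) d) A),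
      Algebra.Etale (Laurent (AInf p O) d) A ∧ ∃ q : A →+* ModP R p, Function.Surjective q ∧
        RingHom.ker q ≤ (laurentIdeal d (Ideal.span {(p : AInf p O), ξ})).map
          (algebraMap (Laurent (AInf p O) d) A) ∧
        ∀ x, q (algebraMap _ A x) = redR sq x := by
  have h1 : ((Ideal.span {(p : TateLaurent p O d)}) ^ 1).map sq = Ideal.span {(p : R)} := by
    rw [pow_one, map_span_natCast]
  let f : TateLaurent p O d ⧸ (Ideal.span {(p : TateLaurent p O d)}) ^ 1 →+*
    R ⧸ ((Ideal.span {(p : TateLaurent p O d)}) ^ 1).map sq :=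
      Ideal.quotientMap _ sq Ideal.le_comap_map
  let _ := (redTate p O d).toAlgebra
  let _ := f.toAlgebra
  let _ := (f.comp (redTate p O d)).toAlgebra
  have : IsScalarTower (Laurent (AInf p O) d)
      (TateLaurent p O d ⧸ (Ideal.span {(p : TateLaurent p O d)}) ^ 1)
      (R ⧸ ((Ideal.span {(p : TateLaurent p O d)}) ^ 1).map sq) := IsScalarTower.of_algebraMap_eq' rfl
  have : Algebra.Etale (TateLaurent p O d ⧸ (Ideal.span {(p : TateLaurent p O d)}) ^ 1)
      (R ⧸ ((Ideal.span {(p : TateLaurent p O d)}) ^ 1).map sq) := hsq 1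
  obtain ⟨A, i1, i2, he, q, hq, hk⟩ := exists_etale_lift (A := Laurent (AInf p O) d)
    (k := TateLaurent p O d ⧸ (Ideal.span {(p : TateLaurent p O d)}) ^ 1)
    (E := R ⧸ ((Ideal.span {(p : TateLaurent p O d)}) ^ 1).map sq) (redTate_surjective h)
  let e : R ⧸ ((Ideal.span {(p : TateLaurent p O d)}) ^ 1).map sq ≃+* ModP R p :=
    Ideal.quotEquivOfEq h1
  refine ⟨A, i1, i2, he, (e : R ⧸ ((Ideal.span {(p : TateLaurent p O d)}) ^ 1).map sq →+* ModP R p).comp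
    (q : A →+* _), fun y => ?_, ?_, ?_⟩
  · obtain ⟨z, rfl⟩ := e.surjective y
    obtain ⟨x, rfl⟩ := hq z
    exact ⟨x, rfl⟩
  · intro x hx
    refine (Ideal.map_mono (ker_redTate_le h)) (hk ?_)
    exact e.map_eq_zero_iff.mp hx
  · intro x
    have h2 : q (algebraMap _ A x) = f (redTate p O d x) := q.commutes x
    change e (q _) = _
    rw [h2]
    unfold redR
    obtain ⟨y, hy⟩ := Ideal.Quotient.mk_surjective (redTate p O d x)
    rw [RingHom.comp_apply, ← hy]
    rfl

variable [Nontrivial R] [IsAdicComplete (Ideal.span {(p : R)}) R]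

/-- The map `R/p → R_∞/p`. -/
def modPBase : ModP R p →+* ModP (RInf sq) p := modPMap p (baseRInf sq)

lemma modPBase_redR (x : Laurent (AInf p O) d) :
    modPBase sq (redR sq x) = aInfToModP p (RInf sq) (uMap sq x) := by
  induction x using AddMonoidAlgebra.induction_linear with
  | zero => simp
  | add x y hx hy => rw [map_add, map_add, map_add, map_add, hx, hy]
  | single m a =>
    obtain ⟨b, hb⟩ := Ideal.Quotient.mk_surjective (aInfToModP p O a)
    rw [redR_single sq m a b hb]
    unfold uMap
    rw [AddMonoidAlgebra.liftNCRingHom_single, map_mul]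
    change _ = aInfToModP p (RInf sq) (aInfMap p (constRInf sq) a) *
      aInfToModP p (RInf sq) (WittVector.teichmuller p (monFlat sq (intExp p d m)))
    rw [aInfToModP_teichmuller]
    have h1 : aInfToModP p (RInf sq) (aInfMap p (constRInf sq) a) =
        modPMap p (constRInf sq) (aInfToModP p O a) := by
      rw [aInfToModP_apply, coeff_aInfMap, coeff_tiltMap]
      rfl
    have h2 : baseRInf sq (sq (toTate p O d (AddMonoidAlgebra.single m b))) =
        constRInf sq b * monRInf sq (intExp p d m) := by
      have h3 : (AddMonoidAlgebra.single m b : Laurent O d) =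
          AddMonoidAlgebra.singleZeroRingHom b * AddMonoidAlgebra.single m 1 := by
        change _ = AddMonoidAlgebra.single 0 b * _
        rw [AddMonoidAlgebra.single_mul_single, zero_add, mul_one]
      have h4 : baseRInf0 sq (sq (toTate p O d (AddMonoidAlgebra.single m b))) =
          baseRInf0 sq (sq (toTate p O d (AddMonoidAlgebra.singleZeroRingHom b))) *
            monRInf0 sq (intExp p d m) := by
        rw [monRInf0, monRInf0_intExp, ← map_mul, ← map_mul, ← map_mul, h3]
      exact (congrArg (toRInf sq) h4).trans (map_mul _ _ _)
    rw [h1, ← hb]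
    change Ideal.Quotient.mk _ (baseRInf sq _) = Ideal.Quotient.mk _ _ * Ideal.Quotient.mk _ _
    rw [h2, map_mul]
    rfl

end EtaleModel

section TiltingCriterion

variable {Q : Type u} [CommRing Q] {p : ℕ} [Fact p.Prime] [CharP Q p]
  {Z : Type v} [CommRing Z] [CharP Z p] [PerfectRing Z p]

/-- If `Q = Z/π_0` for a perfect ring `Z` and a non-zero-divisor `π_0`, then the element of the
perfection of `Q` given by a compatible system of `p`-power roots of `π_0` is tilting. -/
theorem isTiltingElement_of_surjective {ϖ : Perfection Q p} {g : Z →+* Q} {π : ℕ → Z}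
    (hg : Function.Surjective g) (hker : RingHom.ker g ≤ Ideal.span {π 0}) (h0 : g (π 0) = 0)
    (hπ : ∀ n, π (n + 1) ^ p = π n) (hreg : ∀ z, π 0 * z = 0 → z = 0)
    (hϖ : ∀ n, Perfection.coeff Q p n ϖ = g (π n)) : IsTiltingElement ϖ := by
  have hp : p ≠ 0 := (Fact.out : p.Prime).ne_zero
  have hpow : ∀ n, π n ^ p ^ n = π 0 := fun n => by
    induction n with
    | zero => simp
    | succ n ih => rw [pow_succ', pow_mul, hπ, ih]
  have hregn : ∀ n z, π n * z = 0 → z = 0 := fun n z hz => by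
    refine hreg z ?_
    have h1 : p ^ n ≠ 0 := pow_ne_zero _ hp
    rw [← hpow n, ← Nat.succ_pred h1, pow_succ, mul_assoc, hz, mul_zero]
  have hroot : ∀ z : Z, ∃ y, y ^ p = z := surjective_frobenius Z p
  have hdvd : ∀ z, g z = 0 ↔ π 0 ∣ z := fun z =>
    ⟨fun hz => Ideal.mem_span_singleton.mp (hker hz), fun ⟨y, hy⟩ => by
      rw [hy, map_mul, h0, zero_mul]⟩
  refine ⟨(hϖ 0).trans h0, fun c => ?_, fun c hc => ?_, fun n c hc => ?_⟩
  · obtain ⟨z, rfl⟩ := hg c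
    obtain ⟨y, rfl⟩ := hroot z
    exact ⟨g y, by rw [frobenius_def, map_pow]⟩
  · obtain ⟨z, rfl⟩ := hg c
    rw [← map_pow, hdvd, ← hπ 0] at hc
    obtain ⟨w, hw⟩ := hc
    obtain ⟨y, rfl⟩ := hroot w
    rw [← mul_pow] at hw
    rw [hϖ, injective_frobenius Z p hw]
    exact map_dvd g (dvd_mul_right _ _)
  · obtain ⟨z, rfl⟩ := hg c
    rw [hϖ, ← map_mul, hdvd, ← hpow (n + 1)] at hc
    obtain ⟨y, hy⟩ := hc
    have h1 : 1 < p ^ (n + 1) := Nat.one_lt_pow (Nat.succ_ne_zero n) (Fact.out : p.Prime).one_lt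
    obtain ⟨m, hm⟩ : ∃ m, p ^ (n + 1) = m + 2 := ⟨p ^ (n + 1) - 2, by omega⟩
    have h2 : z = π (n + 1) ^ (m + 1) * y := by
      refine sub_eq_zero.mp (hregn (n + 1) _ ?_)
      rw [mul_sub, hy, hm]
      ring
    rw [← map_pow, hdvd, ← hpow (n + 1), h2, mul_pow, ← pow_mul]
    refine Dvd.dvd.mul_right (pow_dvd_pow _ ?_) _
    rw [hm]
    nlinarith [(Fact.out : p.Prime).two_le]

end TiltingCriterion

section PerfectLaurent

variable (p : ℕ) [Fact p.Prime] (k : Type u) [CommRing k] [CharP k p] [PerfectRing k p] (d : ℕ)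

instance charP_laurentRoot : CharP (LaurentRoot p k d) p := by
  have : Nontrivial k := CharP.nontrivial_of_char_ne_one (Fact.out : p.Prime).ne_one
  rw [CharP.charP_iff_prime_eq_zero Fact.out]
  have h1 := map_natCast (AddMonoidAlgebra.singleZeroRingHom (R := k) (M := Expo p d)) p
  rw [← h1, CharP.cast_eq_zero, map_zero]

variable {p d} in
lemma Expo.nsmul_injective {x y : Expo p d} (h : p • x = p • y) : x = y := by
  have hp : (p : ℚ) ≠ 0 := Nat.cast_ne_zero.mpr (Fact.out : p.Prime).ne_zero
  refine funext (fun i => Subtype.ext ?_)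
  have h1 := congrArg (fun z : Expo p d => ((z i : zInv p) : ℚ)) h
  simp only [Pi.smul_apply, AddSubgroup.coe_nsmul, nsmul_eq_mul] at h1
  exact mul_left_cancel₀ hp h1

variable {p d k} in
lemma coeff_pow_nsmul (x : LaurentRoot p k d) (m : Expo p d) :
    (x ^ p).coeff (p • m) = x.coeff m ^ p := by
  classical
  have hp : p ≠ 0 := (Fact.out : p.Prime).ne_zero
  induction x using LaurentRoot.induction with
  | single l c =>
    rw [AddMonoidAlgebra.single_pow, AddMonoidAlgebra.coeff_single, AddMonoidAlgebra.coeff_single,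
      Finsupp.single_apply, Finsupp.single_apply]
    by_cases h : l = m
    · rw [if_pos h, if_pos (by rw [h])]
    · rw [if_neg h, if_neg (fun h' => h (Expo.nsmul_injective h')), zero_pow hp]
  | add x y hx hy =>
    rw [add_pow_char x y p, AddMonoidAlgebra.coeff_add, AddMonoidAlgebra.coeff_add,
      Finsupp.add_apply, Finsupp.add_apply, hx, hy, add_pow_char _ _ p]

instance perfectRing_laurentRoot : PerfectRing (LaurentRoot p k d) p := by
  refine ⟨(injective_iff_map_eq_zero (frobenius (LaurentRoot p k d) p)).mpr (fun x hx => ?_),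
    fun x => ?_⟩
  · refine AddMonoidAlgebra.ext (Finsupp.ext (fun m => ?_))
    have h1 := coeff_pow_nsmul x m
    rw [show x ^ p = 0 from hx] at h1
    exact injective_frobenius k p ((h1.symm.trans rfl).trans (map_zero (frobenius k p)).symm)
  · induction x using LaurentRoot.induction with
    | single l c =>
      obtain ⟨c, rfl⟩ := surjective_frobenius k p c
      refine ⟨AddMonoidAlgebra.single (expDiv p l 1) c, ?_⟩
      refine (AddMonoidAlgebra.single_pow _ _ _).trans ?_
      rw [nsmul_expDiv_succ]
      rfl
    | add x y hx hy =>
      obtain ⟨x, rfl⟩ := hx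
      obtain ⟨y, rfl⟩ := hy
      exact ⟨x + y, map_add (frobenius (LaurentRoot p k d) p) x y⟩

variable {k d} in
lemma isRegular_single_zero {a : k} (ha : ∀ x, a * x = 0 → x = 0) :
    IsRegular (AddMonoidAlgebra.single 0 a : LaurentRoot p k d) := by
  have h1 : IsLeftRegular (AddMonoidAlgebra.single 0 a : LaurentRoot p k d) := by
    rw [isLeftRegular_iff_right_eq_zero_of_mul]
    intro x hx
    refine AddMonoidAlgebra.ext (Finsupp.ext (fun m => ha _ ?_))
    have h2 := congrArg (fun y : LaurentRoot p k d => y.coeff m) hx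
    change (AddMonoidAlgebra.single 0 a * x).coeff m = _ at h2
    rwa [AddMonoidAlgebra.coeff_single_zero_mul] at h2
  exact ⟨h1, fun x y hxy => h1 (by simpa [mul_comm] using hxy)⟩

end PerfectLaurent

section TiltRInf

variable {p : ℕ} [Fact p.Prime] {O : Type u} [CommRing O] [Fact (¬IsUnit (p : O))] {d : ℕ}
  {R : Type u} [CommRing R] [Nontrivial R] [IsAdicComplete (Ideal.span {(p : R)}) R]
  (sq : TateLaurent p O d →+* R)

lemma exists_expand_modPBase (x : ModP (RInf sq) p) : ∃ a : FracExpo p d →₀ ModP R p,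
    expand (modPBase sq) (fun k => monModP sq k.1) a = x := by
  obtain ⟨a, rfl⟩ := exists_expand_modP sq x
  exact ⟨a.mapRange (Ideal.Quotient.mk _) (map_zero _), expand_mapRange _ _ _ _⟩

lemma eq_zero_of_expand_modPBase_eq_zero {a : FracExpo p d →₀ ModP R p}
    (ha : expand (modPBase sq) (fun k => monModP sq k.1) a = 0) : a = 0 := by
  obtain ⟨b, rfl⟩ := Finsupp.mapRange_surjective
    (Ideal.Quotient.mk (Ideal.span {(p : R)})) (map_zero _) Ideal.Quotient.mk_surjective a
  refine Finsupp.ext (fun k => ?_)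
  rw [Finsupp.mapRange_apply, Finsupp.zero_apply, Ideal.Quotient.eq_zero_iff_mem,
    Ideal.mem_span_singleton]
  refine dvd_of_expand_modP_eq_zero sq ?_ k
  exact (expand_mapRange (modPBase sq) (fun k : FracExpo p d => monModP sq k.1)
    (Ideal.Quotient.mk (Ideal.span {(p : R)})) b).symm.trans ha

variable (p O d) in
/-- The map `A_inf(O)[U^{±1}] → O^♭[U^{±1/p^∞}]`. -/
def toPerfLaurent : Laurent (AInf p O) d →+* LaurentRoot p (PreTilt O p) d :=
  AddMonoidAlgebra.liftNCRingHom
    (AddMonoidAlgebra.singleZeroRingHom.comp WittVector.constantCoeff)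
    ((AddMonoidAlgebra.of (PreTilt O p) (Expo p d)).comp (intExp p d).toMultiplicative)
    (fun _ _ => Commute.all _ _)

lemma toPerfLaurent_single (m : Fin d → ℤ) (a : AInf p O) :
    toPerfLaurent p O d (AddMonoidAlgebra.single m a) =
      AddMonoidAlgebra.single (intExp p d m) (a.coeff 0) := by
  unfold toPerfLaurent
  rw [AddMonoidAlgebra.liftNCRingHom_single]
  change AddMonoidAlgebra.single 0 (a.coeff 0) * AddMonoidAlgebra.single (intExp p d m) 1 = _
  rw [AddMonoidAlgebra.single_mul_single, zero_add, mul_one]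

/-- The map `O^♭[U^{±1/p^∞}] → R_∞/p`. -/
def perfLaurentModP : LaurentRoot p (PreTilt O p) d →+* ModP (RInf sq) p :=
  AddMonoidAlgebra.liftNCRingHom ((modPMap p (constRInf sq)).comp (PreTilt.coeff 0))
    { toFun := fun k => monModP sq k.toAdd
      map_one' := by
        change Ideal.Quotient.mk _ (monRInf sq 0) = 1
        rw [monRInf_zero, map_one]
      map_mul' := fun k l => by
        change Ideal.Quotient.mk _ (monRInf sq (k.toAdd + l.toAdd)) = _
        rw [monRInf_add, map_mul]
        rfl }
    (fun _ _ => Commute.all _ _)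

lemma perfLaurentModP_single (k : Expo p d) (c : PreTilt O p) :
    perfLaurentModP sq (AddMonoidAlgebra.single k c) =
      modPMap p (constRInf sq) (PreTilt.coeff 0 c) * monModP sq k := by
  unfold perfLaurentModP
  rw [AddMonoidAlgebra.liftNCRingHom_single]
  rfl

lemma perfLaurentModP_toPerfLaurent (x : Laurent (AInf p O) d) :
    perfLaurentModP sq (toPerfLaurent p O d x) = modPBase sq (redR sq x) := by
  induction x using AddMonoidAlgebra.induction_linear with
  | zero => simp
  | add x y hx hy => rw [map_add, map_add, map_add, map_add, hx, hy]
  | single m a =>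
    rw [toPerfLaurent_single, perfLaurentModP_single, modPBase_redR]
    unfold uMap
    rw [AddMonoidAlgebra.liftNCRingHom_single, map_mul]
    change _ = aInfToModP p (RInf sq) (aInfMap p (constRInf sq) a) *
      aInfToModP p (RInf sq) (WittVector.teichmuller p (monFlat sq (intExp p d m)))
    rw [aInfToModP_teichmuller, aInfToModP_apply, coeff_aInfMap, coeff_tiltMap]
    rfl

variable {ξ : AInf p O} (h : IsTiltingXi ξ) {A : Type u} [CommRing A]
  [Algebra (Laurent (AInf p O) d) A] [Algebra.Etale (Laurent (AInf p O) d) A]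
  {q : A →+* ModP R p} (hq : Function.Surjective q)
  (hker : RingHom.ker q ≤ (laurentIdeal d (Ideal.span {(p : AInf p O), ξ})).map
    (algebraMap (Laurent (AInf p O) d) A))
  (hqa : ∀ x, q (algebraMap _ A x) = redR sq x)

include h hq hker hqa

/-- The element `ξ` of `A_inf(R_∞)` generates, together with `p`, the kernel of the projection to
`R_∞/p`. -/
theorem isTiltingXi_aInfToR : IsTiltingXi (aInfToR sq ξ) := by
  let k := PreTilt O p
  let L := LaurentRoot p k d
  let Q := ModP (RInf sq) p
  let Λ := Laurent (AInf p O) d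
  let _ : Algebra Λ L := (toPerfLaurent p O d).toAlgebra
  let _ : Algebra Λ Q := ((modPBase sq).comp (redR sq)).toAlgebra
  let Z := L ⊗[Λ] A
  let gL : L →ₐ[Λ] Q := { perfLaurentModP sq with
    commutes' := perfLaurentModP_toPerfLaurent sq }
  let gA : A →ₐ[Λ] Q := { (modPBase sq).comp q with
    commutes' := fun x => congrArg (modPBase sq) (hqa x) }
  let g : Z →ₐ[Λ] Q := Algebra.TensorProduct.lift gL gA (fun _ _ => Commute.all _ _)
  have hgL : ∀ x : L, g (x ⊗ₜ 1) = perfLaurentModP sq x := fun x => by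
    change gL x * gA 1 = _
    rw [map_one, mul_one]
    rfl
  have hgA : ∀ a : A, g (1 ⊗ₜ a) = modPBase sq (q a) := fun a => by
    change gL 1 * gA a = _
    rw [map_one, one_mul]
    rfl
  let ia : A →+* Z := (Algebra.TensorProduct.includeRight : A →ₐ[Λ] Z)
  let mon : FracExpo p d → Z := fun l => (AddMonoidAlgebra.single l.1 1 : L) ⊗ₜ 1
  have hmon : ∀ l, g (mon l) = monModP sq l.1 := fun l => by
    rw [hgL, perfLaurentModP_single, map_one, map_one, one_mul]
  have hgexp : ∀ a : FracExpo p d →₀ A, g (expand ia mon a) =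
      expand (modPBase sq) (fun k => monModP sq k.1) (a.mapRange q (map_zero q)) := fun a => by
    have h1 := map_expand ia mon (g : Z →+* Q) a
    refine h1.trans ?_
    rw [expand_mapRange]
    have h2 : (g : Z →+* Q).comp ia = (modPBase sq).comp q := RingHom.ext hgA
    rw [h2]
    congr 2
    exact funext hmon
  have hsurj : Function.Surjective g := fun x => by
    obtain ⟨b, rfl⟩ := exists_expand_modPBase sq x
    obtain ⟨a, rfl⟩ := Finsupp.mapRange_surjective q (map_zero q) hq b
    exact ⟨_, hgexp a⟩
  have hexp : ∀ z : Z, ∃ a, expand ia mon a = z := fun z => by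
    induction z using TensorProduct.induction_on with
    | zero => exact ⟨0, map_zero _⟩
    | add x y hx hy =>
      obtain ⟨a, rfl⟩ := hx
      obtain ⟨b, rfl⟩ := hy
      exact ⟨a + b, map_add _ _ _⟩
    | tmul x a =>
      induction x using LaurentRoot.induction with
      | add x y hx hy =>
        obtain ⟨a, ha⟩ := hx
        obtain ⟨b, hb⟩ := hy
        exact ⟨a + b, by rw [map_add, ha, hb, TensorProduct.add_tmul]⟩
      | single m c =>
        obtain ⟨m, l, rfl⟩ := exists_intExp_add m
        obtain ⟨c, rfl⟩ := WittVector.constantCoeff_surjective p c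
        refine ⟨Finsupp.single l (algebraMap Λ A (AddMonoidAlgebra.single m c) * a), ?_⟩
        have h1 : (1 : L) ⊗ₜ[Λ] (algebraMap Λ A (AddMonoidAlgebra.single m c)) =
            (AddMonoidAlgebra.single (intExp p d m) (c.coeff 0) : L) ⊗ₜ[Λ] (1 : A) := by
          rw [Algebra.algebraMap_eq_smul_one, ← TensorProduct.smul_tmul,
            ← Algebra.algebraMap_eq_smul_one]
          exact congrArg (· ⊗ₜ[Λ] (1 : A)) (toPerfLaurent_single m c)
        rw [expand_single, map_mul]
        change (1 : L) ⊗ₜ[Λ] _ * (1 : L) ⊗ₜ[Λ] a * _ ⊗ₜ 1 = _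
        rw [h1, Algebra.TensorProduct.tmul_mul_tmul, Algebra.TensorProduct.tmul_mul_tmul, mul_one,
          mul_one, one_mul, AddMonoidAlgebra.single_mul_single, mul_one]
        rfl
  have hnt : Nontrivial Z := ⟨0, 1, fun h01 => by
    have h1 := congrArg g h01
    rw [map_zero, map_one] at h1
    exact zero_ne_one h1⟩
  have hchar : CharP Z p := by
    rw [CharP.charP_iff_prime_eq_zero Fact.out, ← map_natCast (algebraMap L Z), CharP.cast_eq_zero,
      map_zero]
  have : PerfectRing Z p := perfectRing_of_etale (P := L) p
  obtain ⟨r, hr0, hr⟩ : ∃ r : ℕ → k, r 0 = ξ.coeff 0 ∧ ∀ n, r (n + 1) ^ p = r n :=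
    ⟨fun n => ((frobeniusEquiv k p).symm)^[n] (ξ.coeff 0), rfl, fun n => by
      change ((frobeniusEquiv k p).symm)^[n + 1] (ξ.coeff 0) ^ p = _
      rw [Function.iterate_succ_apply', frobeniusEquiv_symm_pow_p]⟩
  have hrn : ∀ n, r n ^ p ^ n = ξ.coeff 0 := fun n => by
    induction n with
    | zero => simpa using hr0
    | succ n ih => rw [pow_succ', pow_mul, hr, ih]
  let il : k →+* Z := (algebraMap L Z).comp AddMonoidAlgebra.singleZeroRingHom
  have hil : ∀ c : k, g (il c) = modPMap p (constRInf sq) (PreTilt.coeff 0 c) := fun c => by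
    change g ((AddMonoidAlgebra.single 0 c : L) ⊗ₜ 1) = _
    rw [hgL, perfLaurentModP_single]
    change _ * Ideal.Quotient.mk _ (monRInf sq 0) = _
    rw [monRInf_zero, map_one, mul_one]
  have hia : ∀ c : AInf p O, ia (algebraMap Λ A (AddMonoidAlgebra.single 0 c)) = il (c.coeff 0) :=
    fun c => by
      change (1 : L) ⊗ₜ[Λ] _ = (AddMonoidAlgebra.single 0 (c.coeff 0) : L) ⊗ₜ[Λ] 1
      rw [Algebra.algebraMap_eq_smul_one, ← TensorProduct.smul_tmul,
        ← Algebra.algebraMap_eq_smul_one]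
      have h1 := toPerfLaurent_single (p := p) (O := O) (d := d) 0 c
      rw [map_zero] at h1
      exact congrArg (· ⊗ₜ[Λ] (1 : A)) h1
  refine isTiltingElement_of_surjective (g := (g : Z →+* Q)) (π := fun n => il (r n)) hsurj ?_ ?_
    (fun n => by rw [← map_pow, hr]) ?_ (fun n => ?_)
  · intro z hz
    obtain ⟨a, rfl⟩ := hexp z
    have h1 := eq_zero_of_expand_modPBase_eq_zero sq ((hgexp a).symm.trans hz)
    have h2 : ∀ l, a l ∈ (laurentIdeal d (Ideal.span {(p : AInf p O), ξ})).map
        (algebraMap Λ A) := fun l => hker (by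
      rw [RingHom.mem_ker, ← Finsupp.mapRange_apply (hf := map_zero q), h1, Finsupp.zero_apply])
    refine (Ideal.map_le_iff_le_comap.mpr ?_) (expand_mem ia mon h2)
    rw [Ideal.map_le_iff_le_comap, Ideal.map_le_iff_le_comap, Ideal.span_le]
    rintro x (rfl | rfl)
    · change ia (algebraMap Λ A (AddMonoidAlgebra.singleZeroRingHom (p : AInf p O))) ∈
        Ideal.span {il (r 0)}
      rw [map_natCast, map_natCast, map_natCast, CharP.cast_eq_zero]
      exact Ideal.zero_mem _
    · change ia (algebraMap Λ A (AddMonoidAlgebra.single 0 x)) ∈ Ideal.span {il (r 0)}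
      rw [hia, hr0]
      exact Ideal.mem_span_singleton_self _
  · change g (il (r 0)) = 0
    rw [hil, hr0]
    have h1 : PreTilt.coeff 0 (ξ.coeff 0) = 0 := h.coeff_zero
    rw [h1, map_zero]
  · intro z hz
    have h1 : IsRegular (AddMonoidAlgebra.single 0 (r 0) : L) := isRegular_single_zero p
      (fun x hx => h.tilt_cancel (by rw [← hr0, hx, mul_zero]))
    have h2 : IsSMulRegular Z (AddMonoidAlgebra.single 0 (r 0) : L) :=
      Module.Flat.isSMulRegular_of_isRegular h1
    exact h2 ((Algebra.smul_def (AddMonoidAlgebra.single 0 (r 0) : L) z).trans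
      (hz.trans (smul_zero (AddMonoidAlgebra.single 0 (r 0) : L)).symm))
  · change _ = g (il (r n))
    rw [hil]
    have h1 : (aInfToR sq ξ).coeff 0 = tiltMap p (constRInf sq) (ξ.coeff 0) :=
      coeff_aInfMap p _ ξ 0
    rw [h1]
    change modPMap p (constRInf sq) (PreTilt.coeff n (ξ.coeff 0)) = _
    rw [← hrn n]
    congr 1
    exact coeff_pow_pow_self (Q := ModP O p) (r n) n

end TiltRInf

/-! ### Topological bases -/

section TopBasis

variable {K : Type w} {S : Type u} {W : Type v} [CommRing S] [CommRing W]

lemma expand_mem_pow {ι : S →+* W} {J : Ideal S} {u : K → W} {n : ℕ} {a : K →₀ S}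
    (ha : ∀ k, a k ∈ J ^ n) : expand ι u a ∈ (J.map ι) ^ n := by
  rw [← Ideal.map_pow]
  exact expand_mem ι u ha

section

variable {ι : S →+* W} {J : Ideal S} {u : K → W}
  (h : ∀ w, ∃ a : K →₀ S, w - expand ι u a ∈ J.map ι)

include h

lemma exists_expand_mem {n : ℕ} {w : W} (hw : w ∈ (J.map ι) ^ n) :
    ∃ a : K →₀ S, (∀ k, a k ∈ J ^ n) ∧ w - expand ι u a ∈ (J.map ι) ^ (n + 1) := by
  suffices H : ∀ x ∈ (J ^ n).map ι, ∀ y, ∃ a : K →₀ S, (∀ k, a k ∈ J ^ n) ∧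
      y * x - expand ι u a ∈ (J.map ι) ^ (n + 1) by
    obtain ⟨a, ha, ha'⟩ := H w (by rwa [Ideal.map_pow]) 1
    exact ⟨a, ha, by rwa [one_mul] at ha'⟩
  intro x hx
  refine Submodule.span_induction (p := fun x _ => ∀ y, ∃ a : K →₀ S, (∀ k, a k ∈ J ^ n) ∧
      y * x - expand ι u a ∈ (J.map ι) ^ (n + 1)) ?_ ?_ ?_ ?_ hx
  · rintro _ ⟨j, hj, rfl⟩ y
    obtain ⟨a, ha⟩ := h y
    refine ⟨j • a, fun k => ?_, ?_⟩
    · exact Ideal.mul_mem_right _ _ hj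
    · rw [expand_smul, mul_comm, ← mul_sub, pow_succ]
      refine Ideal.mul_mem_mul ?_ ha
      rw [← Ideal.map_pow]
      exact Ideal.mem_map_of_mem ι hj
  · exact fun y => ⟨0, fun k => Ideal.zero_mem _, by simp⟩
  · intro x x' _ _ hx hx' y
    obtain ⟨a, ha, ha'⟩ := hx y
    obtain ⟨b, hb, hb'⟩ := hx' y
    refine ⟨a + b, fun k => Ideal.add_mem _ (ha k) (hb k), ?_⟩
    have := Ideal.add_mem _ ha' hb'
    convert this using 1
    rw [map_add]
    ring
  · intro c x _ hx y
    obtain ⟨a, ha, ha'⟩ := hx (y * c)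
    exact ⟨a, ha, by rwa [smul_eq_mul, ← mul_assoc]⟩

lemma exists_expand_pow (n : ℕ) (w : W) : ∃ a : K →₀ S, w - expand ι u a ∈ (J.map ι) ^ n := by
  induction n with
  | zero => exact ⟨0, by simp⟩
  | succ n ih =>
    obtain ⟨a, ha⟩ := ih
    obtain ⟨b, -, hb⟩ := exists_expand_mem h ha
    exact ⟨a + b, by rwa [map_add, ← sub_sub]⟩

end

/-- The elements `u k` are a basis of `W` over `S`, topologically. -/
structure IsTopBasis (ι : S →+* W) (J : Ideal S) (u : K → W) : Prop where
  exists_expand : ∀ w, ∃ a : K →₀ S, w - expand ι u a ∈ J.map ι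
  mem_of_expand : ∀ n, ∃ m, ∀ a : K →₀ S, expand ι u a ∈ (J.map ι) ^ m → ∀ k, a k ∈ J ^ n

namespace IsTopBasis

variable {ι : S →+* W} {J : Ideal S} {u : K → W} (h : IsTopBasis ι J u)

include h

omit h in
/-- The family `f` consists of the coefficients of `w`. -/
def Rel (ι : S →+* W) (J : Ideal S) (u : K → W) (w : W) (f : K → S) : Prop :=
  ∀ n, ∃ a : K →₀ S, w - expand ι u a ∈ (J.map ι) ^ n ∧ ∀ k, f k - a k ∈ J ^ n

omit h in
lemma rel_add {w w' : W} {f f' : K → S} (hw : Rel ι J u w f) (hw' : Rel ι J u w' f') :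
    Rel ι J u (w + w') (f + f') := fun n => by
  obtain ⟨a, ha, ha'⟩ := hw n
  obtain ⟨b, hb, hb'⟩ := hw' n
  refine ⟨a + b, ?_, fun k => ?_⟩
  · rw [map_add, add_sub_add_comm]
    exact Ideal.add_mem _ ha hb
  · rw [Pi.add_apply, Finsupp.add_apply, add_sub_add_comm]
    exact Ideal.add_mem _ (ha' k) (hb' k)

omit h in
lemma rel_mul (s : S) {w : W} {f : K → S} (hw : Rel ι J u w f) :
    Rel ι J u (ι s * w) (fun k => s * f k) := fun n => by
  obtain ⟨a, ha, ha'⟩ := hw n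
  refine ⟨s • a, ?_, fun k => ?_⟩
  · rw [expand_smul, ← mul_sub]
    exact Ideal.mul_mem_left _ _ ha
  · rw [Finsupp.smul_apply, smul_eq_mul, ← mul_sub]
    exact Ideal.mul_mem_left _ _ (ha' k)

omit h in
lemma rel_single (k : K) (s : S) [DecidableEq K] :
    Rel ι J u (ι s * u k) (fun l => if k = l then s else 0) := fun n => by
  refine ⟨Finsupp.single k s, ?_, fun l => ?_⟩
  · rw [expand_single, sub_self]
    exact Ideal.zero_mem _
  · rw [Finsupp.single_apply, sub_self]
    exact Ideal.zero_mem _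

omit h in
lemma rel_map {σ : S →+* S} {τ : W →+* W} (χ : K → S) (hσ : ∀ x ∈ J, σ x ∈ J)
    (hτ : ∀ x, τ (ι x) = ι (σ x)) (hu : ∀ k, τ (u k) = ι (χ k) * u k) {w : W} {f : K → S}
    (hw : Rel ι J u w f) : Rel ι J u (τ w) (fun k => χ k * σ (f k)) := fun n => by
  have hσn : J ^ n ≤ (J ^ n).comap σ := by
    rw [← Ideal.map_le_iff_le_comap, Ideal.map_pow]
    exact Ideal.pow_right_mono (Ideal.map_le_iff_le_comap.mpr hσ) n
  have hτn : (J.map ι) ^ n ≤ ((J.map ι) ^ n).comap τ := by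
    rw [← Ideal.map_le_iff_le_comap, Ideal.map_pow]
    refine Ideal.pow_right_mono ?_ n
    rw [Ideal.map_map, Ideal.map_le_iff_le_comap]
    intro x hx
    change τ (ι x) ∈ J.map ι
    rw [hτ]
    exact Ideal.mem_map_of_mem ι (hσ x hx)
  obtain ⟨a, ha, ha'⟩ := hw n
  let b : K →₀ S := Finsupp.onFinset a.support (fun k => χ k * σ (a k)) (fun k hk => by
    rw [Finsupp.mem_support_iff]
    rintro h0
    rw [h0, map_zero, mul_zero] at hk
    exact hk rfl)
  have hb : τ (expand ι u a) = expand ι u b := by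
    rw [expand, Finsupp.liftAddHom_apply, Finsupp.liftAddHom_apply, Finsupp.sum, map_sum,
      Finsupp.onFinset_sum _ (fun k => map_zero _)]
    refine Finset.sum_congr rfl (fun k _ => ?_)
    change τ (ι (a k) * u k) = ι (χ k * σ (a k)) * u k
    rw [map_mul, hτ, hu, map_mul]
    ring
  refine ⟨b, ?_, fun k => ?_⟩
  · rw [← hb, ← map_sub]
    exact hτn ha
  · change χ k * σ (f k) - χ k * σ (a k) ∈ _
    rw [← mul_sub, ← map_sub]
    exact Ideal.mul_mem_left _ _ (hσn (ha' k))

lemma rel_unique [IsHausdorff J S] {w : W} {f f' : K → S} (hf : Rel ι J u w f)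
    (hf' : Rel ι J u w f') : f = f' := by
  refine funext (fun k => sub_eq_zero.mp (eq_zero_of_forall_mem_pow (I := J) (fun n => ?_)))
  obtain ⟨m, hm⟩ := h.mem_of_expand n
  obtain ⟨a, ha, ha'⟩ := hf (max m n)
  obtain ⟨b, hb, hb'⟩ := hf' (max m n)
  have h1 := hm (a - b) (by
    have := Ideal.sub_mem _ hb ha
    rw [sub_sub_sub_cancel_left, ← map_sub] at this
    exact Ideal.pow_le_pow_right (le_max_left m n) this) k
  have h2 := Ideal.pow_le_pow_right (le_max_right m n) (ha' k)
  have h3 := Ideal.pow_le_pow_right (le_max_right m n) (hb' k)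
  have h4 := Ideal.add_mem _ h1 (Ideal.sub_mem _ h2 h3)
  rw [Finsupp.sub_apply] at h4
  convert h4 using 1
  ring

lemma exists_rel [IsAdicComplete J S] (w : W) : ∃ f, Rel ι J u w f := by
  choose m hm using h.mem_of_expand
  let M : ℕ → ℕ := fun n => ∑ i ∈ Finset.range (n + 1), m i + n
  have hmM : ∀ n, m n ≤ M n := fun n =>
    (Finset.single_le_sum (f := m) (fun _ _ => Nat.zero_le _)
      (Finset.self_mem_range_succ n)).trans (Nat.le_add_right _ _)
  have hMM : ∀ n, M n ≤ M (n + 1) := fun n => by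
    change _ ≤ ∑ i ∈ Finset.range (n + 1 + 1), m i + (n + 1)
    rw [Finset.sum_range_succ _ (n + 1)]
    change ∑ i ∈ Finset.range (n + 1), m i + n ≤ _
    omega
  choose a ha using fun n => exists_expand_pow h.exists_expand (M n) w
  have hcauchy : ∀ n k, a (n + 1) k - a n k ∈ J ^ n := fun n k => by
    have h1 := Ideal.pow_le_pow_right (hMM n) (ha (n + 1))
    have h2 := Ideal.sub_mem _ (ha n) h1
    rw [sub_sub_sub_cancel_left, ← map_sub] at h2
    have h3 := hm n _ (Ideal.pow_le_pow_right (hmM n) h2) k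
    rwa [Finsupp.sub_apply] at h3
  choose f hf using fun k => exists_adic_limit J (fun n => a n k) (fun n => hcauchy n k)
  refine ⟨f, fun n => ⟨a n, Ideal.pow_le_pow_right (Nat.le_add_left n _) (ha n), fun k => ?_⟩⟩
  rw [← neg_sub]
  exact neg_mem (hf k n)

variable [IsAdicComplete J S]

/-- The coefficient of `u k`. -/
def pr (k : K) : W →+ S where
  toFun w := (h.exists_rel w).choose k
  map_zero' := by
    have h1 := h.rel_unique (h.exists_rel 0).choose_spec (f' := 0) (fun n => ⟨0, by simp, by simp⟩)
    rw [h1]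
    rfl
  map_add' w w' := by
    have h1 := h.rel_unique (h.exists_rel (w + w')).choose_spec
      (rel_add (h.exists_rel w).choose_spec (h.exists_rel w').choose_spec)
    rw [h1]
    rfl

lemma rel_pr (w : W) : Rel ι J u w (fun k => h.pr k w) := (h.exists_rel w).choose_spec

lemma pr_eq {w : W} {f : K → S} (hf : Rel ι J u w f) (k : K) : h.pr k w = f k :=
  congrFun (h.rel_unique (h.rel_pr w) hf) k

lemma pr_mul (k : K) (s : S) (w : W) : h.pr k (ι s * w) = s * h.pr k w :=
  h.pr_eq (rel_mul s (h.rel_pr w)) k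

lemma finite_pr (w : W) (n : ℕ) : {k | h.pr k w ∉ J ^ n}.Finite := by
  obtain ⟨a, -, ha⟩ := h.rel_pr w n
  refine a.hasFiniteSupport.subset (fun k hk => ?_)
  rw [Function.mem_support]
  intro h0
  have := ha k
  rw [h0, sub_zero] at this
  exact hk this

lemma mem_pow_of_pr {w : W} {n : ℕ} (hw : ∀ k, h.pr k w ∈ J ^ n) : w ∈ (J.map ι) ^ n := by
  obtain ⟨a, ha, ha'⟩ := h.rel_pr w n
  have h1 : expand ι u a ∈ (J.map ι) ^ n := expand_mem_pow (fun k => by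
    have := Ideal.sub_mem _ (hw k) (ha' k)
    rwa [sub_sub_cancel] at this)
  have := Ideal.add_mem _ ha h1
  rwa [sub_add_cancel] at this

lemma ext_pr [IsHausdorff (J.map ι) W] {w : W} (hw : ∀ k, h.pr k w = 0) : w = 0 :=
  eq_zero_of_forall_mem_pow (I := J.map ι) (fun n => h.mem_pow_of_pr (fun k => by
    rw [hw]
    exact Ideal.zero_mem _))

lemma exists_pr [IsAdicComplete (J.map ι) W] {f : K → S} (hf : ∀ n, {k | f k ∉ J ^ n}.Finite) :
    ∃ w, ∀ k, h.pr k w = f k := by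
  classical
  let a : ℕ → K →₀ S := fun n => Finsupp.onFinset (hf n).toFinset
    (fun k => if f k ∈ J ^ n then 0 else f k) (fun k hk => by
      rw [Set.Finite.mem_toFinset]
      intro h0
      exact hk (if_pos h0))
  have ha : ∀ n k, f k - a n k ∈ J ^ n := fun n k => by
    change f k - (if f k ∈ J ^ n then 0 else f k) ∈ J ^ n
    split_ifs with h0
    · rwa [sub_zero]
    · rw [sub_self]
      exact Ideal.zero_mem _
  obtain ⟨w, hw⟩ := exists_adic_limit (J.map ι) (fun n => expand ι u (a n)) (fun n => by
    rw [← map_sub]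
    refine expand_mem_pow (fun k => ?_)
    have h1 := Ideal.sub_mem _ (ha n k) (Ideal.pow_le_pow_right (Nat.le_succ n) (ha (n + 1) k))
    rwa [sub_sub_sub_cancel_left] at h1)
  refine ⟨w, fun k => h.pr_eq (f := f) (fun n => ⟨a n, ?_, ha n⟩) k⟩
  rw [← neg_sub]
  exact neg_mem (hw n)

lemma pr_ι_mul [DecidableEq K] (k l : K) (s : S) :
    h.pr l (ι s * u k) = if k = l then s else 0 :=
  h.pr_eq (rel_single k s) l

end IsTopBasis

end TopBasis

/-! ### Strict maps -/

section Strict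

variable {K : Type w} {A : Type u} {W : Type v} [CommRing A] [CommRing W]

/-- The elements `u k` are a basis of `W` over `A` modulo `(π, ξ)`, and `(π, ξ)` is regular in
`W`. -/
structure IsStrict (ψ : A →+* W) (π ξ : A) (u : K → W) : Prop where
  isRegPair : IsRegPair (ψ π) (ψ ξ)
  exists_expand : ∀ w, ∃ a : K →₀ A, w - expand ψ u a ∈ Ideal.span {ψ π, ψ ξ}
  mem_of_expand : ∀ a : K →₀ A, expand ψ u a ∈ Ideal.span {ψ π, ψ ξ} →
    ∀ k, a k ∈ Ideal.span {π, ξ}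

lemma exists_finsupp_of_mem_span_pair {x y : A} {a : K →₀ A} (ha : ∀ k, a k ∈ Ideal.span {x, y}) :
    ∃ b c : K →₀ A, a = x • b + y • c := by
  classical
  have h1 : ∀ v : A, ∃ z : A × A, (v = 0 → z = 0) ∧
      (v ∈ Ideal.span {x, y} → v = x * z.1 + y * z.2) := fun v => by
    by_cases h0 : v = 0
    · exact ⟨0, fun _ => rfl, fun _ => by simp [h0]⟩
    · by_cases h2 : v ∈ Ideal.span {x, y}
      · obtain ⟨s, t, hst⟩ := Ideal.mem_span_pair.mp h2
        exact ⟨(s, t), fun h => absurd h h0, fun _ => by rw [← hst]; ring⟩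
      · exact ⟨0, fun _ => rfl, fun h => absurd h h2⟩
  choose z hz hz' using h1
  refine ⟨a.mapRange (fun v => (z v).1) (by rw [hz 0 rfl]; rfl),
    a.mapRange (fun v => (z v).2) (by rw [hz 0 rfl]; rfl), Finsupp.ext (fun k => ?_)⟩
  simpa using hz' (a k) (ha k)

namespace IsStrict

variable {ψ : A →+* W} {π ξ : A} {u : K → W} (h : IsStrict ψ π ξ u)

lemma map_span_pair (ψ : A →+* W) (x y : A) :
    (Ideal.span {x, y}).map ψ = Ideal.span {ψ x, ψ y} := by
  rw [Ideal.map_span, Set.image_pair]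

include h

lemma mem_of_expand_one {n : ℕ} {a : K →₀ A}
    (ha : expand ψ u a ∈ Ideal.span {ψ π ^ 1, ψ ξ ^ n}) (k : K) :
    a k ∈ Ideal.span {π ^ 1, ξ ^ n} := by
  induction n generalizing a k with
  | zero => simp [Ideal.span_insert]
  | succ n ih =>
    have h1 : Ideal.span {ψ π ^ 1, ψ ξ ^ (n + 1)} ≤ Ideal.span {ψ π, ψ ξ} := by
      rw [Ideal.span_le]
      rintro x (rfl | rfl)
      · rw [pow_one]
        exact Ideal.subset_span (by simp)
      · exact Ideal.pow_mem_of_mem _ (Ideal.subset_span (by simp)) _ (Nat.succ_pos n)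
    obtain ⟨b, c, rfl⟩ := exists_finsupp_of_mem_span_pair (h.mem_of_expand a (h1 ha))
    rw [map_add, expand_smul, expand_smul] at ha
    have h2 : ψ ξ ^ 1 * expand ψ u c ∈ Ideal.span {ψ π ^ 1, ψ ξ ^ (1 + n)} := by
      have h3 : ψ π * expand ψ u b ∈ Ideal.span {ψ π ^ 1, ψ ξ ^ (n + 1)} :=
        Ideal.mul_mem_right _ _ (Ideal.subset_span (by simp))
      have := Ideal.sub_mem _ ha h3
      rwa [add_sub_cancel_left, ← pow_one (ψ ξ), ← pow_mul, one_mul, add_comm n 1] at this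
    obtain ⟨s, t, hst⟩ := mem_span_pair_pow.mp (ih (h.isRegPair.mem_of_pow_mul_mem_right h2) k)
    rw [mem_span_pair_pow]
    refine ⟨b k + ξ * s, t, ?_⟩
    rw [Finsupp.add_apply, Finsupp.smul_apply, Finsupp.smul_apply, smul_eq_mul, smul_eq_mul, hst]
    ring

lemma mem_of_expand_pow {m n : ℕ} {a : K →₀ A}
    (ha : expand ψ u a ∈ Ideal.span {ψ π ^ m, ψ ξ ^ n}) (k : K) :
    a k ∈ Ideal.span {π ^ m, ξ ^ n} := by
  induction m generalizing a k with
  | zero => simp [Ideal.span_insert]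
  | succ m ih =>
    have h1 : Ideal.span {ψ π ^ (m + 1), ψ ξ ^ n} ≤ Ideal.span {ψ π ^ 1, ψ ξ ^ n} := by
      rw [Ideal.span_le]
      rintro x (rfl | rfl)
      · have h0 : ψ π ∈ Ideal.span {ψ π ^ 1, ψ ξ ^ n} := by
          rw [pow_one]
          exact Ideal.subset_span (by simp)
        exact Ideal.pow_mem_of_mem _ h0 _ (Nat.succ_pos m)
      · exact Ideal.subset_span (by simp)
    obtain ⟨b, c, rfl⟩ := exists_finsupp_of_mem_span_pair (h.mem_of_expand_one (h1 ha))
    rw [map_add, expand_smul, expand_smul] at ha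
    have h2 : ψ π ^ 1 * expand ψ u b ∈ Ideal.span {ψ π ^ (1 + m), ψ ξ ^ n} := by
      have h3 : ψ (ξ ^ n) * expand ψ u c ∈ Ideal.span {ψ π ^ (m + 1), ψ ξ ^ n} := by
        rw [map_pow]
        exact Ideal.mul_mem_right _ _ (Ideal.subset_span (by simp))
      have := Ideal.sub_mem _ ha h3
      rwa [add_sub_cancel_right, map_pow, add_comm m 1] at this
    obtain ⟨s, t, hst⟩ := mem_span_pair_pow.mp (ih (h.isRegPair.mem_of_pow_mul_mem_left h2) k)
    rw [mem_span_pair_pow]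
    refine ⟨s, π * t + c k, ?_⟩
    rw [Finsupp.add_apply, Finsupp.smul_apply, Finsupp.smul_apply, smul_eq_mul, smul_eq_mul, hst]
    ring

lemma mem_pow_of_expand (n : ℕ) {a : K →₀ A}
    (ha : expand ψ u a ∈ (Ideal.span {ψ π, ψ ξ}) ^ (n + n)) (k : K) :
    a k ∈ (Ideal.span {π, ξ}) ^ n :=
  span_pow_pair_le n (h.mem_of_expand_pow (span_pair_pow_le n n ha) k)

lemma isTopBasis : IsTopBasis ψ (Ideal.span {π, ξ}) u where
  exists_expand w := by
    rw [map_span_pair]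
    exact h.exists_expand w
  mem_of_expand n := ⟨n + n, fun a ha => by
    rw [map_span_pair] at ha
    exact h.mem_pow_of_expand n ha⟩

end IsStrict

end Strict

/-! ### Completions of étale algebras -/

section Dense

/-- The homomorphism `g` identifies `B` with the completion of `A`, except that `B` need not be
complete. -/
structure IsAdicDense {A : Type u} {B : Type v} [CommRing A] [CommRing B] (J : Ideal A)
    (g : A →+* B) : Prop where
  exists_sub_mem : ∀ b n, ∃ a, b - g a ∈ (J.map g) ^ n
  mem_of_mem : ∀ a n, g a ∈ (J.map g) ^ n → a ∈ J ^ n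

variable {A : Type u} [CommRing A] {J : Ideal A}

lemma exists_sub_mem_pow {B : Type v} [CommRing B] {g : A →+* B}
    (h : ∀ b, ∃ a, b - g a ∈ J.map g) (b : B) (n : ℕ) : ∃ a, b - g a ∈ (J.map g) ^ n := by
  have h4 : ∀ a : Unit →₀ A, expand g (fun _ : Unit => 1) a = g (a ()) := fun a => by
    have h5 : a = Finsupp.single () (a ()) := Finsupp.ext (fun k => by simp)
    rw [h5, expand_single, mul_one, Finsupp.single_eq_same]
  obtain ⟨a, ha⟩ := exists_expand_pow (ι := g) (u := fun _ : Unit => 1) (fun w => by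
    obtain ⟨a, ha⟩ := h w
    exact ⟨Finsupp.single () a, by rwa [h4, Finsupp.single_eq_same]⟩) n b
  exact ⟨a (), by rwa [h4] at ha⟩

lemma isAdicDense_completion (hJ : J.FG) : IsAdicDense J (algebraMap A (AdicCompletion J A)) := by
  have h1 : ∀ a n, algebraMap A (AdicCompletion J A) a ∈
      (J.map (algebraMap A (AdicCompletion J A))) ^ n → a ∈ J ^ n := fun a n ha => by
    have h2 : ((J ^ n).map (algebraMap A (AdicCompletion J A))) ≤
        RingHom.ker (AdicCompletion.evalₐ J n) := by
      rw [Ideal.map_le_iff_le_comap]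
      intro x hx
      rw [Ideal.mem_comap, RingHom.mem_ker, AlgHom.commutes]
      exact Ideal.Quotient.eq_zero_iff_mem.mpr hx
    rw [← Ideal.map_pow] at ha
    have h3 := h2 ha
    rw [RingHom.mem_ker, AlgHom.commutes] at h3
    exact Ideal.Quotient.eq_zero_iff_mem.mp h3
  refine ⟨exists_sub_mem_pow (fun w => ?_), h1⟩
  obtain ⟨a, ha⟩ := Ideal.Quotient.mk_surjective (AdicCompletion.evalOneₐ J w)
  refine ⟨a, ?_⟩
  rw [← AdicCompletion.ker_evalOneₐ_eq_map J hJ, RingHom.mem_ker]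
  change AdicCompletion.evalOneₐ J (w - algebraMap A _ a) = 0
  rw [map_sub, AlgHom.commutes, ← ha]
  exact sub_self _

lemma exists_completion_lift {W : Type v} [CommRing W] (g : A →+* W) (hJ : J.FG)
    [IsAdicComplete (J.map g) W] :
    ∃ g' : AdicCompletion J A →+* W, ∀ a, g' (algebraMap A _ a) = g a := by
  have hle : ∀ n, J ^ n ≤ ((J.map g) ^ n).comap g := fun n => by
    rw [← Ideal.map_le_iff_le_comap, Ideal.map_pow]
  let f : ∀ n, AdicCompletion J A →+* W ⧸ (J.map g) ^ n := fun n =>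
    (Ideal.quotientMap ((J.map g) ^ n) g (hle n)).comp
      (AdicCompletion.evalₐ J n : AdicCompletion J A →+* A ⧸ J ^ n)
  have hf : ∀ {m n : ℕ} (hmn : m ≤ n), (Ideal.Quotient.factorPow (J.map g) hmn).comp (f n) = f m :=
    fun {m n} hmn => by
      refine RingHom.ext (fun y => ?_)
      obtain ⟨a, ha⟩ := (isAdicDense_completion hJ).exists_sub_mem y n
      have h1 : ∀ l ≤ n, AdicCompletion.evalₐ J l y = Ideal.Quotient.mk _ a := fun l hl => by
        have h2 : ((J ^ l).map (algebraMap A (AdicCompletion J A))) ≤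
            RingHom.ker (AdicCompletion.evalₐ J l) := by
          rw [Ideal.map_le_iff_le_comap]
          intro x hx
          rw [Ideal.mem_comap, RingHom.mem_ker, AlgHom.commutes]
          exact Ideal.Quotient.eq_zero_iff_mem.mpr hx
        have h3 := h2 (by
          rw [Ideal.map_pow]
          exact Ideal.pow_le_pow_right hl ha)
        rw [RingHom.mem_ker, map_sub, AlgHom.commutes] at h3
        exact sub_eq_zero.mp h3
      change Ideal.Quotient.factorPow (J.map g) hmn (Ideal.quotientMap _ g (hle n)
        (AdicCompletion.evalₐ J n y)) = Ideal.quotientMap _ g (hle m) (AdicCompletion.evalₐ J m y)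
      rw [h1 n le_rfl, h1 m hmn]
      rfl
  refine ⟨IsAdicComplete.liftRingHom (J.map g) f hf, fun a => ?_⟩
  refine sub_eq_zero.mp (eq_zero_of_forall_mem_pow (I := J.map g) (fun n => ?_))
  rw [← Ideal.Quotient.eq, IsAdicComplete.mk_liftRingHom]
  change Ideal.quotientMap _ g (hle n) (AdicCompletion.evalₐ J n (algebraMap A _ a)) = _
  rw [AlgHom.commutes]
  rfl

lemma IsAdicDense.of_equiv {B C : Type*} [CommRing B] [CommRing C] {g : A →+* B}
    (h : IsAdicDense J g) (e : B ≃+* C) : IsAdicDense J ((e : B →+* C).comp g) := by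
  have h1 : ∀ n b, e b ∈ (J.map ((e : B →+* C).comp g)) ^ n ↔ b ∈ (J.map g) ^ n := fun n b => by
    rw [← Ideal.map_map, ← Ideal.map_pow]
    exact ⟨fun hb => by
      rw [Ideal.mem_map_iff_of_surjective (e : B →+* C) e.surjective] at hb
      obtain ⟨x, hx, hxb⟩ := hb
      rwa [← e.injective hxb], fun hb => Ideal.mem_map_of_mem (e : B →+* C) hb⟩
  refine ⟨fun c n => ?_, fun a n ha => h.mem_of_mem a n ((h1 n _).mp ha)⟩
  obtain ⟨b, rfl⟩ := e.surjective c
  obtain ⟨a, ha⟩ := h.exists_sub_mem b n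
  refine ⟨a, ?_⟩
  change e b - e (g a) ∈ _
  rwa [← map_sub, h1]

lemma isAdicComplete_of_equiv {B C : Type*} [CommRing B] [CommRing C] {I : Ideal B}
    [IsAdicComplete I B] (e : B ≃+* C) : IsAdicComplete (I.map (e : B →+* C)) C := by
  have h1 : ∀ n b, e b ∈ (I.map (e : B →+* C)) ^ n ↔ b ∈ I ^ n := fun n b => by
    rw [← Ideal.map_pow]
    exact ⟨fun hb => by
      rw [Ideal.mem_map_iff_of_surjective (e : B →+* C) e.surjective] at hb
      obtain ⟨x, hx, hxb⟩ := hb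
      rwa [← e.injective hxb], fun hb => Ideal.mem_map_of_mem (e : B →+* C) hb⟩
  refine isAdicComplete_of_limits (fun x hx => ?_) (fun f hf => ?_)
  · obtain ⟨b, rfl⟩ := e.surjective x
    rw [eq_zero_of_forall_mem_pow (I := I) (fun n => (h1 n b).mp (hx n)), map_zero]
  · choose b hb using fun n => e.surjective (f n)
    obtain rfl : f = fun n => e (b n) := funext (fun n => (hb n).symm)
    obtain ⟨L, hL⟩ := exists_adic_limit I b (fun n => by rw [← h1, map_sub]; exact hf n)
    exact ⟨e L, fun n => by rw [← map_sub, h1]; exact hL n⟩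

/-- The completion of an étale algebra is formally étale of topologically finite presentation. -/
theorem IsAdicDense.adicEtale {Λ A B : Type u} [CommRing Λ] [CommRing A] [CommRing B] [Algebra Λ A]
    [Algebra.Etale Λ A] {I : Ideal Λ} {g : A →+* B}
    (h : IsAdicDense (I.map (algebraMap Λ A)) g) : AdicEtale I (g.comp (algebraMap Λ A)) := by
  intro n
  have h1 : (algebraMap (Λ ⧸ I ^ n) (A ⧸ (I ^ n).map (algebraMap Λ A))).Etale := by
    rw [RingHom.etale_algebraMap]
    exact Algebra.Etale.of_equiv (Algebra.TensorProduct.quotIdealMapEquivQuotTensor A (I ^ n)).symm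
  have hle : (I ^ n).map (algebraMap Λ A) ≤ ((I ^ n).map (g.comp (algebraMap Λ A))).comap g := by
    rw [← Ideal.map_le_iff_le_comap, Ideal.map_map]
  let f := Ideal.quotientMap ((I ^ n).map (g.comp (algebraMap Λ A))) g hle
  have hpow : (I ^ n).map (g.comp (algebraMap Λ A)) = ((I.map (algebraMap Λ A)).map g) ^ n := by
    rw [Ideal.map_map, Ideal.map_pow]
  have hf : Function.Bijective f := by
    constructor
    · rw [injective_iff_map_eq_zero]
      intro x hx
      obtain ⟨a, rfl⟩ := Ideal.Quotient.mk_surjective x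
      rw [Ideal.quotientMap_mk, Ideal.Quotient.eq_zero_iff_mem, hpow] at hx
      rw [Ideal.Quotient.eq_zero_iff_mem, Ideal.map_pow]
      exact h.mem_of_mem a n hx
    · intro y
      obtain ⟨b, rfl⟩ := Ideal.Quotient.mk_surjective y
      obtain ⟨a, ha⟩ := h.exists_sub_mem b n
      refine ⟨Ideal.Quotient.mk _ a, ?_⟩
      rw [Ideal.quotientMap_mk, eq_comm, Ideal.Quotient.eq, hpow]
      exact ha
  have h2 := RingHom.Etale.stableUnderComposition _ _ h1 (RingHom.Etale.of_bijective hf)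
  convert h2 using 1
  refine RingHom.ext (fun x => ?_)
  obtain ⟨a, rfl⟩ := Ideal.Quotient.mk_surjective x
  rfl

end Dense

section StrictCompletion

variable {K : Type w} {A : Type u} {W : Type v} [CommRing A] [CommRing W] {ψ : A →+* W} {π ξ : A}
  {u : K → W}

namespace IsStrict

lemma of_isAdicDense {B : Type*} [CommRing B] {e : A →+* B} {ι : B →+* W}
    (h : IsStrict (ι.comp e) π ξ u) (he : ∀ b, ∃ a, b - e a ∈ Ideal.span {e π, e ξ}) :
    IsStrict ι (e π) (e ξ) u := by
  classical
  refine ⟨h.isRegPair, fun w => ?_, fun b hb k => ?_⟩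
  · obtain ⟨a, ha⟩ := h.exists_expand w
    exact ⟨a.mapRange e (map_zero e), by rwa [expand_mapRange]⟩
  · have h1 : ∀ b, ∃ a, (b = 0 → a = 0) ∧ b - e a ∈ Ideal.span {e π, e ξ} := fun b => by
      by_cases h0 : b = 0
      · exact ⟨0, fun _ => rfl, by simp [h0]⟩
      · obtain ⟨a, ha⟩ := he b
        exact ⟨a, fun h => absurd h h0, ha⟩
    choose s hs hs' using h1
    let a : K →₀ A := b.mapRange s (hs 0 rfl)
    have h2 : expand ι u (b - a.mapRange e (map_zero e)) ∈ (Ideal.span {e π, e ξ}).map ι :=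
      expand_mem ι u (fun k => by
        rw [Finsupp.sub_apply, Finsupp.mapRange_apply]
        exact hs' (b k))
    rw [map_span_pair] at h2
    have h3 := Ideal.sub_mem _ hb h2
    rw [map_sub, sub_sub_cancel, expand_mapRange] at h3
    have h4 := Ideal.mem_map_of_mem e (h.mem_of_expand a h3 k)
    rw [map_span_pair] at h4
    have h5 := Ideal.add_mem _ (hs' (b k)) h4
    rwa [Finsupp.mapRange_apply, sub_add_cancel] at h5

variable (h : IsStrict ψ π ξ u) [Zero K] (hu : u 0 = 1)

include h hu

lemma mem_pow_of_map (n : ℕ) {a : A} (ha : ψ a ∈ (Ideal.span {ψ π, ψ ξ}) ^ (n + n)) :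
    a ∈ (Ideal.span {π, ξ}) ^ n := by
  have := h.mem_pow_of_expand n (a := Finsupp.single 0 a) (by
    rwa [expand_single, hu, mul_one]) 0
  rwa [Finsupp.single_eq_same] at this

/-- The completion of a strict subring, inside the ambient ring. -/
theorem exists_completion [IsAdicComplete (Ideal.span {ψ π, ψ ξ}) W] :
    ∃ (S : Subring W) (e : A →+* S), (∀ a, (e a : W) = ψ a) ∧ IsAdicDense (Ideal.span {π, ξ}) e ∧
      IsAdicComplete (Ideal.span {e π, e ξ}) S ∧ IsStrict S.subtype (e π) (e ξ) u := by
  have hJ : (Ideal.span {π, ξ}).FG := Submodule.fg_span (Set.toFinite _)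
  have : IsAdicComplete ((Ideal.span {π, ξ}).map ψ) W := by rwa [map_span_pair]
  obtain ⟨ψ', hψ'⟩ := exists_completion_lift ψ hJ
  let c := algebraMap A (AdicCompletion (Ideal.span {π, ξ}) A)
  have hc : IsAdicDense (Ideal.span {π, ξ}) c := isAdicDense_completion hJ
  have hcomp : IsAdicComplete ((Ideal.span {π, ξ}).map c) (AdicCompletion (Ideal.span {π, ξ}) A) :=
    AdicCompletion.isAdicComplete_self _ hJ
  have hcψ : ψ'.comp c = ψ := RingHom.ext hψ'
  have hstrict : IsStrict ψ' (c π) (c ξ) u := by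
    refine of_isAdicDense (e := c) (ι := ψ') (by rwa [hcψ]) (fun b => ?_)
    obtain ⟨a, ha⟩ := hc.exists_sub_mem b 1
    exact ⟨a, by rwa [pow_one, map_span_pair] at ha⟩
  have hinj : Function.Injective ψ' := by
    rw [injective_iff_map_eq_zero]
    intro y hy
    refine eq_zero_of_forall_mem_pow (I := (Ideal.span {π, ξ}).map c) (fun n => ?_)
    rw [map_span_pair]
    exact hstrict.mem_pow_of_map hu n (by rw [hy]; exact Ideal.zero_mem _)
  let r : AdicCompletion (Ideal.span {π, ξ}) A ≃+* ψ'.range := RingEquiv.ofBijective ψ'.rangeRestrict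
    ⟨fun x y hxy => hinj (congrArg Subtype.val hxy), ψ'.rangeRestrict_surjective⟩
  refine ⟨ψ'.range, (r : _ →+* ψ'.range).comp c, hψ', hc.of_equiv r, ?_, ?_⟩
  · have h1 := isAdicComplete_of_equiv (I := (Ideal.span {π, ξ}).map c) r
    rwa [Ideal.map_map, map_span_pair] at h1
  · refine of_isAdicDense (e := (r : _ →+* ψ'.range)) (ι := ψ'.range.subtype) (π := c π) (ξ := c ξ)
      ?_ (fun b => ?_)
    · exact hstrict
    · obtain ⟨a, rfl⟩ := r.surjective b
      exact ⟨a, by simp⟩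

end IsStrict

end StrictCompletion

/-! ### Homomorphisms from étale algebras into complete subrings -/

section Factor

variable {Λ A T W : Type u} [CommRing Λ] [CommRing A] [CommRing T] [CommRing W] [Algebra Λ A]

lemma iInf_pow_eq_bot (I : Ideal W) [IsHausdorff I W] : ⨅ i, I ^ i = ⊥ := by
  rw [eq_bot_iff]
  intro x hx
  rw [Ideal.mem_iInf] at hx
  exact eq_zero_of_forall_mem_pow (I := I) hx

/-- Two homomorphisms out of an étale algebra which agree on the base, and modulo an ideal for
which the target is separated, are equal. -/
lemma eq_of_sub_mem [Algebra.FormallyUnramified Λ A] {f g : A →+* W} {I : Ideal W}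
    [IsHausdorff I W] (h : ∀ x, f (algebraMap Λ A x) = g (algebraMap Λ A x))
    (hI : ∀ a, f a - g a ∈ I) (a : A) : f a = g a := by
  let _ : Algebra Λ W := (f.comp (algebraMap Λ A)).toAlgebra
  let f' : A →ₐ[Λ] W := { f with commutes' := fun _ => rfl }
  let g' : A →ₐ[Λ] W := { g with commutes' := fun x => (h x).symm }
  have h1 : f' = g' := Algebra.FormallyUnramified.ext_of_iInf I (iInf_pow_eq_bot I)
    (fun x => Ideal.Quotient.eq.mpr (hI x))
  exact congrArg (fun k : A →ₐ[Λ] W => k a) h1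

/-- A homomorphism from an étale algebra takes values in a complete subring if it does so on the
base and modulo an ideal of definition. -/
theorem exists_eq_of_etale [Algebra.Etale Λ A] (α : A →+* W) (j : T →+* W) {t : Λ →+* T}
    (ht : ∀ x, j (t x) = α (algebraMap Λ A x)) {K : Ideal T} {𝔎 : Ideal W} [IsAdicComplete K T]
    [IsHausdorff 𝔎 W] (hK : ∀ x, j x ∈ 𝔎 ↔ x ∈ K) (hα : ∀ a, ∃ x, α a - j x ∈ 𝔎) (a : A) :
    ∃ x, j x = α a := by
  let _ : Algebra Λ T := t.toAlgebra
  let j' : T ⧸ K →+* W ⧸ 𝔎 := Ideal.quotientMap 𝔎 j (fun x hx => (hK x).mpr hx)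
  have hj' : Function.Injective j' := by
    rw [injective_iff_map_eq_zero]
    intro y hy
    obtain ⟨x, rfl⟩ := Ideal.Quotient.mk_surjective y
    exact Ideal.Quotient.eq_zero_iff_mem.mpr ((hK x).mp (Ideal.Quotient.eq_zero_iff_mem.mp hy))
  choose s hs using hα
  have hs' : ∀ a, j' (Ideal.Quotient.mk K (s a)) = Ideal.Quotient.mk 𝔎 (α a) := fun a =>
    (Ideal.Quotient.eq.mpr (hs a)).symm
  let f : A →ₐ[Λ] T ⧸ K :=
    { toFun := fun a => Ideal.Quotient.mk K (s a)
      map_one' := hj' (by rw [hs', map_one, map_one, map_one])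
      map_mul' := fun a b => hj' (by rw [hs', map_mul, map_mul, map_mul, hs', hs'])
      map_zero' := hj' (by rw [hs', map_zero, map_zero, map_zero])
      map_add' := fun a b => hj' (by rw [hs', map_add, map_add, map_add, hs', hs'])
      commutes' := fun x => hj' (by
        rw [hs', ← ht]
        rfl) }
  obtain ⟨g, hg⟩ := Algebra.FormallySmooth.exists_mkₐ_comp_eq_of_isAdicComplete f
  refine ⟨g a, eq_of_sub_mem (Λ := Λ) (f := j.comp (g : A →+* T)) (g := α) (I := 𝔎) (fun x => ?_)
    (fun a => ?_) a⟩
  · change j (g (algebraMap Λ A x)) = _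
    rw [g.commutes]
    exact ht x
  · have h1 : Ideal.Quotient.mk K (g a) = Ideal.Quotient.mk K (s a) :=
      congrArg (fun k : A →ₐ[Λ] T ⧸ K => k a) hg
    rw [Ideal.Quotient.eq, ← hK, map_sub] at h1
    have h2 := Ideal.sub_mem _ h1 (hs a)
    change j (g a) - α a ∈ 𝔎
    convert h2 using 1
    ring

end Factor

/-! ### The hull of a strict homomorphism -/

section Hull

variable {K : Type w} [Zero K] {A : Type u} {W : Type v} [CommRing A] [CommRing W]

lemma exists_mem_of_forall_sub_mem {T : Type u} [CommRing T] {j : T →+* W} {J : Ideal T}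
    {𝔎 : Ideal W} [IsAdicComplete J T] [IsHausdorff 𝔎 W] (hJ : ∀ x ∈ J, j x ∈ 𝔎)
    (hj : ∀ n, ∃ m, ∀ x, j x ∈ 𝔎 ^ m → x ∈ J ^ n) {w : W}
    (hw : ∀ n, ∃ x, w - j x ∈ 𝔎 ^ n) : ∃ x, j x = w := by
  choose m hm using hj
  let M : ℕ → ℕ := fun n => ∑ i ∈ Finset.range (n + 1), m i + n
  have hmM : ∀ n, m n ≤ M n := fun n =>
    (Finset.single_le_sum (f := m) (fun _ _ => Nat.zero_le _)
      (Finset.self_mem_range_succ n)).trans (Nat.le_add_right _ _)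
  have hMM : ∀ n, M n ≤ M (n + 1) := fun n => by
    change _ ≤ ∑ i ∈ Finset.range (n + 1 + 1), m i + (n + 1)
    rw [Finset.sum_range_succ _ (n + 1)]
    change ∑ i ∈ Finset.range (n + 1), m i + n ≤ _
    omega
  choose x hx using fun n => hw (M n)
  obtain ⟨L, hL⟩ := exists_adic_limit J x (fun n => hm n _ (by
    have h1 := Ideal.pow_le_pow_right (hMM n) (hx (n + 1))
    have h2 := Ideal.sub_mem _ (hx n) h1
    rw [sub_sub_sub_cancel_left, ← map_sub] at h2
    exact Ideal.pow_le_pow_right (hmM n) h2))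
  refine ⟨L, sub_eq_zero.mp (eq_zero_of_forall_mem_pow (I := 𝔎) (fun n => ?_))⟩
  have h1 : j (x n - L) ∈ 𝔎 ^ n := by
    have h2 : J ^ n ≤ (𝔎 ^ n).comap j := by
      rw [← Ideal.map_le_iff_le_comap, Ideal.map_pow]
      exact Ideal.pow_right_mono (Ideal.map_le_iff_le_comap.mpr hJ) n
    exact h2 (hL n)
  have h2 := Ideal.add_mem _ (Ideal.pow_le_pow_right (Nat.le_add_left n _) (hx n)) h1
  rw [map_sub] at h2
  rw [← neg_sub]
  refine neg_mem ?_
  convert h2 using 1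
  ring

/-- The subring `S` of `W` is the completion of `A`. -/
structure IsHull (ψ : A →+* W) (π ξ : A) (u : K → W) (S : Subring W) : Prop where
  mem : ∀ a, ψ a ∈ S
  complete : IsAdicComplete (Ideal.span {(⟨ψ π, mem π⟩ : S), ⟨ψ ξ, mem ξ⟩}) S
  strict : IsStrict S.subtype ⟨ψ π, mem π⟩ ⟨ψ ξ, mem ξ⟩ u
  dense : ∀ s ∈ S, ∃ a, s - ψ a ∈ Ideal.span {ψ π, ψ ξ}

variable {ψ : A →+* W} {π ξ : A} {u : K → W} (hu : u 0 = 1)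

lemma IsStrict.mem_of_map (h : IsStrict ψ π ξ u) (hu : u 0 = 1) {a : A}
    (ha : ψ a ∈ Ideal.span {ψ π, ψ ξ}) : a ∈ Ideal.span {π, ξ} := by
  have := h.mem_of_expand (Finsupp.single 0 a) (by
    rwa [expand_single, hu, mul_one]) 0
  rwa [Finsupp.single_eq_same] at this

lemma IsStrict.map_mem_iff (h : IsStrict ψ π ξ u) (hu : u 0 = 1) {a : A} :
    ψ a ∈ Ideal.span {ψ π, ψ ξ} ↔ a ∈ Ideal.span {π, ξ} :=
  ⟨h.mem_of_map hu, fun ha => by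
    rw [← map_span_pair]
    exact Ideal.mem_map_of_mem ψ ha⟩

namespace IsHull

variable {S : Subring W} (hS : IsHull ψ π ξ u S)

lemma of_isAdicDense (e : A →+* S) (he : ∀ a, (e a : W) = ψ a)
    (hd : IsAdicDense (Ideal.span {π, ξ}) e) (hc : IsAdicComplete (Ideal.span {e π, e ξ}) S)
    (hs : IsStrict S.subtype (e π) (e ξ) u) : IsHull ψ π ξ u S := by
  have hmem : ∀ a, ψ a ∈ S := fun a => he a ▸ (e a).2
  have h1 : ∀ a, e a = ⟨ψ a, hmem a⟩ := fun a => Subtype.ext (he a)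
  rw [h1, h1] at hc hs
  refine ⟨hmem, hc, hs, fun s hs => ?_⟩
  obtain ⟨a, ha⟩ := hd.exists_sub_mem ⟨s, hs⟩ 1
  rw [pow_one, IsStrict.map_span_pair] at ha
  have h2 := Ideal.mem_map_of_mem S.subtype ha
  rw [IsStrict.map_span_pair, map_sub] at h2
  refine ⟨a, ?_⟩
  rw [← he, ← he, ← he]
  exact h2

/-- The homomorphism from `A`. -/
def hom (hS : IsHull ψ π ξ u S) : A →+* S := ψ.codRestrict S hS.mem

include hS hu in
lemma mem_iff [IsHausdorff (Ideal.span {ψ π, ψ ξ}) W] {w : W} :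
    w ∈ S ↔ ∀ n, ∃ a, w - ψ a ∈ (Ideal.span {ψ π, ψ ξ}) ^ n := by
  have := hS.complete
  refine ⟨fun hw n => ?_, fun hw => ?_⟩
  · obtain ⟨a, ha⟩ := exists_sub_mem_pow (J := Ideal.span {π, ξ}) (g := hS.hom) (fun b => by
      obtain ⟨a, ha⟩ := hS.dense b b.2
      refine ⟨a, ?_⟩
      rw [IsStrict.map_span_pair]
      exact hS.strict.mem_of_map hu ha) ⟨w, hw⟩ n
    refine ⟨a, ?_⟩
    have h2 := Ideal.mem_map_of_mem S.subtype ha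
    rw [Ideal.map_pow, Ideal.map_map, IsStrict.map_span_pair] at h2
    exact h2
  · obtain ⟨x, rfl⟩ := exists_mem_of_forall_sub_mem (j := S.subtype) (𝔎 := Ideal.span {ψ π, ψ ξ})
      (fun x hx => (hS.strict.map_mem_iff hu).mpr hx)
      (fun n => ⟨n + n, fun x hx => hS.strict.mem_pow_of_map hu n hx⟩)
      (fun n => by
        obtain ⟨a, ha⟩ := hw n
        exact ⟨⟨ψ a, hS.mem a⟩, ha⟩)
    exact x.2

include hS hu in
lemma eq [IsHausdorff (Ideal.span {ψ π, ψ ξ}) W] {S' : Subring W} (hS' : IsHull ψ π ξ u S') :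
    S = S' := Subring.ext (fun w => by rw [hS.mem_iff hu, hS'.mem_iff hu])

include hS hu in
/-- A homomorphism which maps `A` to the hull maps the hull to itself. -/
lemma map_mem_of_forall [IsHausdorff (Ideal.span {ψ π, ψ ξ}) W] {τ : W →+* W}
    (hτ : Ideal.span {ψ π, ψ ξ} ≤ (Ideal.span {ψ π, ψ ξ}).comap τ) (h : ∀ a, τ (ψ a) ∈ S) {s : W}
    (hs : s ∈ S) : τ s ∈ S := by
  rw [hS.mem_iff hu] at hs ⊢
  intro n
  obtain ⟨a, ha⟩ := hs n
  obtain ⟨b, hb⟩ := (hS.mem_iff hu).mp (h a) n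
  refine ⟨b, ?_⟩
  have h1 : (Ideal.span {ψ π, ψ ξ}) ^ n ≤ ((Ideal.span {ψ π, ψ ξ}) ^ n).comap τ := by
    rw [← Ideal.map_le_iff_le_comap, Ideal.map_pow]
    exact Ideal.pow_right_mono (Ideal.map_le_iff_le_comap.mpr hτ) n
  have h2 : τ (s - ψ a) ∈ (Ideal.span {ψ π, ψ ξ}) ^ n := h1 ha
  have h3 := Ideal.add_mem _ h2 hb
  rwa [map_sub, sub_add_sub_cancel] at h3

/-- A homomorphism which maps the base to the hull, and preserves the hull modulo the ideal of
definition, maps the hull to itself. -/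
theorem map_mem {Λ : Type u} {A W : Type u} [CommRing A] [CommRing W] [CommRing Λ] [Algebra Λ A]
    [Algebra.Etale Λ A] {ψ : A →+* W} {π ξ : A} {u : K → W} (hu : u 0 = 1) {S : Subring W}
    (hS : IsHull ψ π ξ u S) [IsHausdorff (Ideal.span {ψ π, ψ ξ}) W] {τ : W →+* W}
    (hτ : Ideal.span {ψ π, ψ ξ} ≤ (Ideal.span {ψ π, ψ ξ}).comap τ)
    (h : ∀ x : Λ, τ (ψ (algebraMap Λ A x)) ∈ S)
    (h' : ∀ a, ∃ b, τ (ψ a) - ψ b ∈ Ideal.span {ψ π, ψ ξ}) {s : W} (hs : s ∈ S) : τ s ∈ S := by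
  have := hS.complete
  refine hS.map_mem_of_forall hu hτ (fun a => ?_) hs
  obtain ⟨x, hx⟩ := exists_eq_of_etale (Λ := Λ) (τ.comp ψ) S.subtype
    (t := ((τ.comp ψ).comp (algebraMap Λ A)).codRestrict S h) (fun _ => rfl)
    (𝔎 := Ideal.span {ψ π, ψ ξ}) (fun x => hS.strict.map_mem_iff hu) (fun a => by
      obtain ⟨b, hb⟩ := h' a
      exact ⟨⟨ψ b, hS.mem b⟩, hb⟩) a
  exact hx ▸ x.2

end IsHull

end Hull

/-! ### The lift of the étale model to `A_inf(R_∞)` -/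

section Lift

variable {p : ℕ} [Fact p.Prime] {O : Type u} [CommRing O] [Fact (¬IsUnit (p : O))] {d : ℕ}
  {R : Type u} [CommRing R] [Nontrivial R] [IsAdicComplete (Ideal.span {(p : R)}) R]
  (sq : TateLaurent p O d →+* R)

/-- The Teichmüller lifts of the monomials. -/
def monW (k : Expo p d) : AInfR sq := WittVector.teichmuller p (monFlat sq k)

lemma monW_zero : monW sq (0 : Expo p d) = 1 := by
  rw [monW, monFlat_zero, map_one]

lemma uMap_single (m : Fin d → ℤ) (a : AInf p O) :
    uMap sq (AddMonoidAlgebra.single m a) = aInfToR sq a * monW sq (intExp p d m) := by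
  unfold uMap
  rw [AddMonoidAlgebra.liftNCRingHom_single]
  rfl

/-- The basis of `A_inf(R_∞)`. -/
def basisW (k : FracExpo p d) : AInfR sq := monW sq k.1

lemma basisW_zero : basisW sq (0 : FracExpo p d) = 1 := monW_zero sq

/-- The étale algebra `A` over `A_inf[U^{±1}]` is a model of `R/p`. -/
structure IsModel (ξ : AInf p O) {A : Type u} [CommRing A] [Algebra (Laurent (AInf p O) d) A]
    (q : A →+* ModP R p) : Prop where
  etale : Algebra.Etale (Laurent (AInf p O) d) A
  surjective : Function.Surjective q
  ker_le : RingHom.ker q ≤ (laurentIdeal d (Ideal.span {(p : AInf p O), ξ})).map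
    (algebraMap (Laurent (AInf p O) d) A)
  map_algebraMap : ∀ x, q (algebraMap _ A x) = redR sq x

variable {ξ : AInf p O} {A : Type u} [CommRing A]
  [Algebra (Laurent (AInf p O) d) A] {q : A →+* ModP R p}

variable (d A) in
/-- The image of `a` in `A`. -/
def toModel : AInf p O →+* A :=
  (algebraMap (Laurent (AInf p O) d) A).comp AddMonoidAlgebra.singleZeroRingHom

lemma map_laurentIdeal : (laurentIdeal d (Ideal.span {(p : AInf p O), ξ})).map
    (algebraMap (Laurent (AInf p O) d) A) = Ideal.span {(p : A), toModel d A ξ} := by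
  rw [Ideal.map_map, IsStrict.map_span_pair, map_natCast]
  rfl

/-- The homomorphism `ψ` lifts the model of `R/p`. -/
structure IsModelLift (q : A →+* ModP R p) (ψ : A →+* AInfR sq) : Prop where
  map_algebraMap : ∀ x, ψ (algebraMap (Laurent (AInf p O) d) A x) = uMap sq x
  toModP : ∀ a, aInfToModP p (RInf sq) (ψ a) = modPBase sq (q a)

lemma IsModelLift.map_toModel {ψ : A →+* AInfR sq} (h : IsModelLift sq q ψ) (a : AInf p O) :
    ψ (toModel d A a) = aInfToR sq a := (h.map_algebraMap _).trans (uMap_single_zero sq a)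

lemma exists_modelLift (h' : IsTiltingXi (aInfToR sq ξ)) (hq : IsModel sq ξ q) :
    ∃ ψ : A →+* AInfR sq, IsModelLift sq q ψ := by
  have := h'.isAdicComplete
  have := hq.etale
  let _ : Algebra (Laurent (AInf p O) d) (AInfR sq) := (uMap sq).toAlgebra
  let r := aInfToModP p (RInf sq)
  let e : (AInfR sq ⧸ Ideal.span {(p : AInfR sq), aInfToR sq ξ}) ≃+* ModP (RInf sq) p :=
    (Ideal.quotEquivOfEq h'.ker_aInfToModP.symm).trans
      (RingHom.quotientKerEquivOfSurjective h'.surjective_aInfToModP)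
  have he : ∀ w, e (Ideal.Quotient.mk _ w) = r w := fun _ => rfl
  let f : A →ₐ[Laurent (AInf p O) d] AInfR sq ⧸ Ideal.span {(p : AInfR sq), aInfToR sq ξ} :=
    { (e.symm : _ →+* _).comp ((modPBase sq).comp q) with
      commutes' := fun x => e.injective (by
        change e (e.symm (modPBase sq (q _))) = e (Ideal.Quotient.mk _ (uMap sq x))
        rw [he, e.apply_symm_apply, hq.map_algebraMap, modPBase_redR]) }
  obtain ⟨g, hg⟩ := Algebra.FormallySmooth.exists_mkₐ_comp_eq_of_isAdicComplete f
  refine ⟨g, g.commutes, fun a => ?_⟩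
  have h1 : Ideal.Quotient.mk _ (g a) = f a :=
    congrArg (fun k : A →ₐ[Laurent (AInf p O) d] _ => k a) hg
  have h2 := congrArg e h1
  rw [he] at h2
  exact h2.trans (e.apply_symm_apply _)

variable {sq} {ψ : A →+* AInfR sq}

lemma IsModelLift.span_eq (hψ : IsModelLift sq q ψ) :
    Ideal.span {ψ (p : A), ψ (toModel d A ξ)} = Ideal.span {(p : AInfR sq), aInfToR sq ξ} := by
  rw [map_natCast, hψ.map_toModel]

theorem IsModelLift.isStrict (h' : IsTiltingXi (aInfToR sq ξ)) (hq : IsModel sq ξ q)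
    (hψ : IsModelLift sq q ψ) : IsStrict ψ (p : A) (toModel d A ξ) (basisW sq) := by
  have hexp : ∀ a : FracExpo p d →₀ A, aInfToModP p (RInf sq) (expand ψ (basisW sq) a) =
      expand (modPBase sq) (fun k => monModP sq k.1) (a.mapRange q (map_zero q)) := fun a => by
    rw [map_expand, expand_mapRange]
    congr 2
    · exact RingHom.ext hψ.toModP
  refine ⟨by rw [map_natCast, hψ.map_toModel]; exact h'.isRegPair, fun w => ?_, fun a ha k => ?_⟩
  · obtain ⟨b, hb⟩ := exists_expand_modPBase sq (aInfToModP p (RInf sq) w)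
    obtain ⟨a, rfl⟩ := Finsupp.mapRange_surjective q (map_zero q) hq.surjective b
    refine ⟨a, ?_⟩
    rw [hψ.span_eq, h'.mem_iff, map_sub, hexp, hb, sub_self]
  · rw [hψ.span_eq, h'.mem_iff, hexp] at ha
    rw [← map_laurentIdeal]
    refine hq.ker_le ?_
    rw [RingHom.mem_ker, ← Finsupp.mapRange_apply (hf := map_zero q),
      eq_zero_of_expand_modPBase_eq_zero sq ha, Finsupp.zero_apply]

theorem IsModelLift.isHausdorff (h' : IsTiltingXi (aInfToR sq ξ)) (hψ : IsModelLift sq q ψ) :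
    IsHausdorff (Ideal.span {ψ (p : A), ψ (toModel d A ξ)}) (AInfR sq) := by
  have := h'.isAdicComplete
  rw [hψ.span_eq]
  infer_instance

/-- The hull exists, and is formally étale over the Laurent polynomials. -/
theorem IsModelLift.exists_hull (h' : IsTiltingXi (aInfToR sq ξ)) (hq : IsModel sq ξ q)
    (hψ : IsModelLift sq q ψ) : ∃ S, IsHull ψ (p : A) (toModel d A ξ) (basisW sq) S ∧
      ∃ hS : ∀ x, uMap sq x ∈ S,
        AdicEtale (laurentIdeal d (Ideal.span {(p : AInf p O), ξ})) ((uMap sq).codRestrict S hS) := by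
  have : IsAdicComplete (Ideal.span {ψ (p : A), ψ (toModel d A ξ)}) (AInfR sq) := by
    rw [hψ.span_eq]
    exact h'.isAdicComplete
  have := hq.etale
  obtain ⟨S, e, he, hd, hc, hs⟩ := (hψ.isStrict h' hq).exists_completion (basisW_zero sq)
  have hu : ∀ x, e (algebraMap (Laurent (AInf p O) d) A x) = uMap sq x := fun x => by
    rw [he, hψ.map_algebraMap]
  refine ⟨S, IsHull.of_isAdicDense e he hd hc hs, fun x => hu x ▸ (e _).2, ?_⟩
  rw [← map_laurentIdeal] at hd
  convert hd.adicEtale using 1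
  exact RingHom.ext (fun x => Subtype.ext (hu x).symm)

end Lift

/-! ### Fontaine's map -/

section TorsionFree

variable {T R : Type u} [CommRing T] [CommRing R] {p : ℕ}

/-- A formally étale algebra over a `p`-torsion free ring is `p`-torsion free. -/
theorem AdicEtale.eq_zero_of_natCast_mul {f : T →+* R} (hf : AdicEtale (Ideal.span {(p : T)}) f)
    (hT : ∀ x : T, (p : T) * x = 0 → x = 0) [IsHausdorff (Ideal.span {(p : R)}) R] (r : R)
    (hr : (p : R) * r = 0) : r = 0 := by
  have hTn : ∀ n (x y : T), (p : T) ^ n * x = (p : T) ^ n * y → x = y := fun n x y h => by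
    induction n with
    | zero => simpa using h
    | succ n ih =>
      refine ih (sub_eq_zero.mp (hT _ ?_))
      rw [mul_sub, ← mul_assoc, ← mul_assoc, ← pow_succ', h, sub_self]
  refine eq_zero_of_forall_mem_pow (I := Ideal.span {(p : R)}) (fun n => ?_)
  have h1 := hf (n + 1)
  set I := Ideal.span {(p : T)} with hI
  let g : T ⧸ I ^ (n + 1) →+* R ⧸ (I ^ (n + 1)).map f := Ideal.quotientMap _ f Ideal.le_comap_map
  let _ := g.toAlgebra
  have : Algebra.Etale (T ⧸ I ^ (n + 1)) (R ⧸ (I ^ (n + 1)).map f) := h1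
  have h2 : Module.Flat (T ⧸ I ^ (n + 1)) (R ⧸ (I ^ (n + 1)).map f) := inferInstance
  have hpr : Ideal.Quotient.mk ((I ^ (n + 1)).map f) ((p : R) * r) = 0 := by rw [hr, map_zero]
  obtain ⟨k, a, y, hy, ha⟩ := Module.Flat.iff_forall_isTrivialRelation.mp h2
    (l := 1) (f := fun _ => (p : T ⧸ I ^ (n + 1)))
    (x := fun _ => Ideal.Quotient.mk ((I ^ (n + 1)).map f) r) (by
      rw [Fin.sum_univ_one, Algebra.smul_def, map_natCast, ← map_natCast (Ideal.Quotient.mk _),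
        ← map_mul, hpr])
  have h3 : ∀ j, a 0 j ∈ Ideal.span {((p : T ⧸ I ^ (n + 1)) ^ n)} := fun j => by
    have h4 := ha j
    rw [Fin.sum_univ_one] at h4
    obtain ⟨b, hb⟩ := Ideal.Quotient.mk_surjective (a 0 j)
    rw [← hb, ← map_natCast (Ideal.Quotient.mk _), ← map_mul, Ideal.Quotient.eq_zero_iff_mem, hI,
      Ideal.span_singleton_pow, Ideal.mem_span_singleton] at h4
    obtain ⟨c, hc⟩ := h4
    have h5 : b = p ^ n * c := hTn 1 _ _ (by rw [pow_one, hc]; ring)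
    rw [← hb, h5, map_mul, map_pow, map_natCast]
    exact Ideal.mul_mem_right _ _ (Ideal.mem_span_singleton_self _)
  have h6 : Ideal.Quotient.mk ((I ^ (n + 1)).map f) r ∈
      Ideal.span {((p : R ⧸ (I ^ (n + 1)).map f) ^ n)} := by
    have h7 : Ideal.Quotient.mk ((I ^ (n + 1)).map f) r = ∑ j, a 0 j • y j := hy 0
    rw [h7]
    refine sum_mem (fun j _ => ?_)
    obtain ⟨c, hc⟩ := Ideal.mem_span_singleton.mp (h3 j)
    rw [hc, Algebra.smul_def, map_mul, map_pow, map_natCast, mul_assoc]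
    exact Ideal.mul_mem_right _ _ (Ideal.mem_span_singleton_self _)
  obtain ⟨c, hc⟩ := Ideal.mem_span_singleton.mp h6
  obtain ⟨c, rfl⟩ := Ideal.Quotient.mk_surjective c
  rw [← map_natCast (Ideal.Quotient.mk _), ← map_pow, ← map_mul, Ideal.Quotient.eq, Ideal.map_pow,
    hI, map_span_natCast] at hc
  have h7 := Ideal.pow_le_pow_right (Nat.le_succ n) hc
  have h8 : (p : R) ^ n * c ∈ Ideal.span {(p : R)} ^ n := by
    rw [Ideal.span_singleton_pow]
    exact Ideal.mul_mem_right _ _ (Ideal.mem_span_singleton_self _)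
  have h9 := Ideal.add_mem _ h7 h8
  rwa [sub_add_cancel] at h9

end TorsionFree

section Theta

variable {p : ℕ} [Fact p.Prime] {B : Type u} [CommRing B] [Fact (¬IsUnit (p : B))]
  [IsAdicComplete (Ideal.span {(p : B)}) B]

lemma dvd_fontaineTheta_sub {x : AInf p B} {y : B}
    (h : Ideal.Quotient.mk (Ideal.span {(p : B)}) y = aInfToModP p B x) :
    (p : B) ∣ WittVector.fontaineTheta B p x - y := by
  rw [← Ideal.mem_span_singleton, ← Ideal.Quotient.eq, WittVector.mk_fontaineTheta, h]
  rfl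

lemma exists_pow_pow_eq {T : Type u} [CommRing T] [Fact (¬IsUnit (p : T))] (x : PreTilt T p)
    (n : ℕ) : ∃ z, z ^ p ^ n = x ∧ PreTilt.coeff 0 z = PreTilt.coeff n x := by
  obtain ⟨z, rfl⟩ : ∃ z, z ^ p ^ n = x := by
    induction n generalizing x with
    | zero => exact ⟨x, by simp⟩
    | succ n ih =>
      obtain ⟨y, rfl⟩ := surjective_frobenius (PreTilt T p) p x
      obtain ⟨z, rfl⟩ := ih y
      exact ⟨z, by rw [frobenius_def, ← pow_mul, ← pow_succ]⟩
  exact ⟨z, rfl, (coeff_pow_pow_self (Q := ModP T p) z n).symm⟩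

lemma fontaineTheta_teichmuller_sub_mem (x : PreTilt B p) (n : ℕ) {y : B}
    (h : Ideal.Quotient.mk (Ideal.span {(p : B)}) y = PreTilt.coeff n x) :
    WittVector.fontaineTheta B p (WittVector.teichmuller p x) - y ^ p ^ n ∈
      Ideal.span {(p : B)} ^ (n + 1) := by
  obtain ⟨z, rfl, hz⟩ := exists_pow_pow_eq x n
  have h1 : WittVector.fontaineTheta B p (WittVector.teichmuller p z) ≡ y
      [SMOD Ideal.span {(p : B)}] := by
    rw [SModEq.sub_mem, Ideal.mem_span_singleton]
    exact dvd_fontaineTheta_sub (by rw [aInfToModP_teichmuller, h, hz])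
  have h2 := SModEq.pow_pow_add_one (m := n) (p := p) (Ideal.mem_span_singleton_self _) h1
  rwa [SModEq.sub_mem, ← map_pow, ← map_pow] at h2

lemma fontaineTheta_teichmuller_eq (x : PreTilt B p) {y : ℕ → B} (hy : ∀ n, y (n + 1) ^ p = y n)
    (h : ∀ n, Ideal.Quotient.mk (Ideal.span {(p : B)}) (y n) = PreTilt.coeff n x) :
    WittVector.fontaineTheta B p (WittVector.teichmuller p x) = y 0 := by
  have hpow : ∀ n, y n ^ p ^ n = y 0 := fun n => by
    induction n with
    | zero => simp
    | succ n ih => rw [pow_succ', pow_mul, hy, ih]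
  refine sub_eq_zero.mp (eq_zero_of_forall_mem_pow (I := Ideal.span {(p : B)}) (fun n => ?_))
  rw [← hpow n]
  exact Ideal.pow_le_pow_right (Nat.le_succ n) (fontaineTheta_teichmuller_sub_mem x n (h n))

lemma fontaineTheta_mem_pow {ξ : AInf p B} (hξ : WittVector.fontaineTheta B p ξ = 0) {n : ℕ}
    {x : AInf p B} (hx : x ∈ Ideal.span {(p : AInf p B), ξ} ^ n) :
    WittVector.fontaineTheta B p x ∈ Ideal.span {(p : B)} ^ n := by
  have h1 : Ideal.span {(p : AInf p B), ξ} ≤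
      (Ideal.span {(p : B)}).comap (WittVector.fontaineTheta B p) := by
    rw [Ideal.span_le]
    rintro y (rfl | rfl)
    · change WittVector.fontaineTheta B p (p : AInf p B) ∈ Ideal.span {(p : B)}
      rw [map_natCast]
      exact Ideal.mem_span_singleton_self _
    · change WittVector.fontaineTheta B p y ∈ Ideal.span {(p : B)}
      rw [hξ]
      exact Ideal.zero_mem _
  have h2 := Ideal.pow_right_mono (Ideal.map_le_iff_le_comap.mpr h1) n
  rw [← Ideal.map_pow] at h2
  exact h2 (Ideal.mem_map_of_mem _ hx)

/-- The kernel of Fontaine's map is generated by `ξ` if the target is `p`-torsion free. -/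
theorem dvd_of_fontaineTheta_eq_zero {ξ : AInf p B} (h : IsTiltingXi ξ)
    (hξ : WittVector.fontaineTheta B p ξ = 0) (hB : ∀ x : B, (p : B) * x = 0 → x = 0)
    {x : AInf p B} (hx : WittVector.fontaineTheta B p x = 0) : ξ ∣ x := by
  have := h.isAdicComplete
  have h1 : AdicEmbedding (Ideal.span {(p : AInf p B), ξ}) ξ :=
    h.isRegPair.adicEmbedding (N := 1) (by
      rw [pow_one]
      exact Ideal.subset_span (by simp))
  have h2 : ∀ y, WittVector.fontaineTheta B p y = 0 → ∃ z w, y = p * z + ξ * w ∧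
      WittVector.fontaineTheta B p z = 0 := fun y hy => by
    have h3 : y ∈ Ideal.span {(p : AInf p B), ξ} := by
      rw [h.mem_iff, aInfToModP_apply, ← WittVector.mk_fontaineTheta, hy, map_zero]
    obtain ⟨z, w, rfl⟩ := Ideal.mem_span_pair.mp h3
    refine ⟨z, w, by ring, hB _ ?_⟩
    rwa [map_add, map_mul, map_mul, hξ, mul_zero, add_zero, map_natCast, mul_comm] at hy
  refine h1.dvd_of_forall (fun n => ?_)
  suffices H : ∃ z w, x = p ^ n * z + ξ * w ∧ WittVector.fontaineTheta B p z = 0 by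
    obtain ⟨z, w, hzw, -⟩ := H
    refine ⟨w, ?_⟩
    rw [hzw, add_sub_cancel_right]
    exact Ideal.mul_mem_right _ _ (Ideal.pow_mem_pow (Ideal.subset_span (by simp)) n)
  induction n with
  | zero => exact ⟨x, 0, by ring, hx⟩
  | succ n ih =>
    obtain ⟨z, w, hzw, hz⟩ := ih
    obtain ⟨z', w', rfl, hz'⟩ := h2 z hz
    exact ⟨z', p ^ n * w' + w, by rw [hzw]; ring, hz'⟩

end Theta

/-! ### Fontaine's map on the hull -/

section ThetaHull

variable {p : ℕ} [Fact p.Prime] {O : Type u} [CommRing O] [Fact (¬IsUnit (p : O))] {d : ℕ}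
  {R : Type u} [CommRing R] [Nontrivial R] [IsAdicComplete (Ideal.span {(p : R)}) R]
  {sq : TateLaurent p O d →+* R} (hR : ∀ r : R, (p : R) * r = 0 → r = 0)

local notation "θR" => WittVector.fontaineTheta (RInf sq) p

lemma laurent_natCast_mul (hO : ∀ x : O, (p : O) * x = 0 → x = 0) (f : Laurent O d)
    (hf : (p : Laurent O d) * f = 0) : f = 0 := by
  refine AddMonoidAlgebra.ext (Finsupp.ext (fun m => hO _ ?_))
  have h1 := congrArg (fun g : Laurent O d => g.coeff m) hf
  rw [← nsmul_eq_mul, AddMonoidAlgebra.coeff_smul] at h1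
  rw [← nsmul_eq_mul]
  exact h1

lemma natCast_mul_framed (hO : ∀ x : O, (p : O) * x = 0 → x = 0)
    (hsq : AdicEtale (Ideal.span {(p : TateLaurent p O d)}) sq) (r : R)
    (hr : (p : R) * r = 0) : r = 0 :=
  hsq.eq_zero_of_natCast_mul
    (fun _ hx => eq_zero_of_natCast_mul_completion p (laurent_natCast_mul hO) hx) r hr

include hR in
lemma mem_pow_of_baseRInf_mem {n : ℕ} {r : R}
    (hr : baseRInf sq r ∈ Ideal.span {(p : RInf sq)} ^ n) : r ∈ Ideal.span {(p : R)} ^ n := by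
  rw [Ideal.span_singleton_pow, Ideal.mem_span_singleton] at hr ⊢
  induction n generalizing r with
  | zero => simp
  | succ n ih =>
    obtain ⟨r', rfl⟩ := dvd_of_dvd_baseRInf sq ((dvd_pow_self _ (Nat.succ_ne_zero n)).trans hr)
    obtain ⟨z, hz⟩ := hr
    rw [pow_succ']
    refine mul_dvd_mul_left _ (ih ⟨z, sub_eq_zero.mp (eq_zero_of_natCast_mul_RInf sq hR ?_)⟩)
    rw [map_mul, map_natCast] at hz
    rw [mul_sub, hz]
    ring

include hR in
lemma baseRInf_injective : Function.Injective (baseRInf sq) := by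
  rw [injective_iff_map_eq_zero]
  intro r hr
  exact eq_zero_of_forall_mem_pow (I := Ideal.span {(p : R)}) (fun n =>
    mem_pow_of_baseRInf_mem hR (by rw [hr]; exact Ideal.zero_mem _))

include hR in
lemma exists_baseRInf_eq {x : RInf sq}
    (hx : ∀ n, ∃ r, x - baseRInf sq r ∈ Ideal.span {(p : RInf sq)} ^ n) :
    ∃ r, baseRInf sq r = x :=
  exists_mem_of_forall_sub_mem (J := Ideal.span {(p : R)}) (𝔎 := Ideal.span {(p : RInf sq)})
    (fun r hr => by
      rw [← map_span_natCast p (baseRInf sq)]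
      exact Ideal.mem_map_of_mem _ hr)
    (fun n => ⟨n, fun _ hr => mem_pow_of_baseRInf_mem hR hr⟩) hx

lemma exists_constRInf_sub_mem (a : AInf p O) (n : ℕ) :
    ∃ b : O, θR (aInfToR sq a) - constRInf sq b ∈ Ideal.span {(p : RInf sq)} ^ n := by
  cases n with
  | zero => exact ⟨0, by simp⟩
  | succ n =>
    have hlift : ∀ x : PreTilt O p, ∃ b : O, θR (aInfToR sq (WittVector.teichmuller p x)) -
        constRInf sq b ∈ Ideal.span {(p : RInf sq)} ^ (n + 1) := fun x => by
      obtain ⟨b, hb⟩ := Ideal.Quotient.mk_surjective (PreTilt.coeff n x)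
      refine ⟨b ^ p ^ n, ?_⟩
      rw [map_pow, aInfToR, aInfMap, WittVector.map_teichmuller]
      refine fontaineTheta_teichmuller_sub_mem _ n ?_
      rw [coeff_tiltMap, ← hb, modPMap_mk]
    choose b hb using hlift
    obtain ⟨c, hc⟩ := WittVector.dvd_sub_sum_teichmuller_iterateFrobeniusEquiv_coeff a n
    refine ⟨∑ i ∈ Finset.Iic n, b (((frobeniusEquiv (PreTilt O p) p).symm ^ i) (a.coeff i)) * p ^ i,
      ?_⟩
    have h1 := congrArg (fun y => θR (aInfToR sq y)) hc
    simp only [map_sub, map_mul, map_pow, map_natCast, map_sum] at h1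
    have h2 : ∑ i ∈ Finset.Iic n, θR (aInfToR sq (WittVector.teichmuller p
        (((frobeniusEquiv (PreTilt O p) p).symm ^ i) (a.coeff i)))) * (p : RInf sq) ^ i -
        ∑ i ∈ Finset.Iic n, constRInf sq (b (((frobeniusEquiv (PreTilt O p) p).symm ^ i)
          (a.coeff i))) * (p : RInf sq) ^ i ∈ Ideal.span {(p : RInf sq)} ^ (n + 1) := by
      rw [← Finset.sum_sub_distrib]
      refine sum_mem (fun i _ => ?_)
      rw [← sub_mul]
      exact Ideal.mul_mem_right _ _ (hb _)
    have h3 : (p : RInf sq) ^ (n + 1) * θR (aInfToR sq c) ∈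
        Ideal.span {(p : RInf sq)} ^ (n + 1) :=
      Ideal.mul_mem_right _ _ (Ideal.pow_mem_pow (Ideal.mem_span_singleton_self _) _)
    have h4 := Ideal.add_mem _ h3 h2
    rw [← h1] at h4
    simp only [map_sum, map_mul, map_pow, map_natCast]
    rwa [sub_add_sub_cancel] at h4

lemma expDiv_intExp_pow (k : Expo p d) (n : ℕ) :
    monRInf sq (expDiv p k (n + 1)) ^ p = monRInf sq (expDiv p k n) := by
  rw [← monRInf_nsmul, nsmul_expDiv_succ]

lemma fontaineTheta_monW (k : Expo p d) : θR (monW sq k) = monRInf sq k :=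
  fontaineTheta_teichmuller_eq _ (y := fun n => monRInf sq (expDiv p k n))
    (fun n => expDiv_intExp_pow k n) (fun _ => rfl)

include hR in
lemma exists_baseRInf_eq_uMap (x : Laurent (AInf p O) d) :
    ∃ r, baseRInf sq r = θR (uMap sq x) := by
  induction x using AddMonoidAlgebra.induction_linear with
  | zero => exact ⟨0, by simp⟩
  | add x y hx hy =>
    obtain ⟨r, hr⟩ := hx
    obtain ⟨s, hs⟩ := hy
    exact ⟨r + s, by rw [map_add, map_add, map_add, hr, hs]⟩
  | single m a =>
    obtain ⟨r, hr⟩ := exists_baseRInf_eq hR (x := θR (aInfToR sq a)) (fun n => by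
      obtain ⟨b, hb⟩ := exists_constRInf_sub_mem (sq := sq) a n
      exact ⟨_, hb⟩)
    have h1 : baseRInf sq (sq (toTate p O d (AddMonoidAlgebra.single m 1))) =
        monRInf sq (intExp p d m) := congrArg (toRInf sq) (monRInf0_intExp sq m (1 : O)).symm
    exact ⟨r * sq (toTate p O d (AddMonoidAlgebra.single m 1)), by rw [map_mul, hr, h1, uMap_single, map_mul, fontaineTheta_monW]⟩

variable {ξ : AInf p O} {A : Type u} [CommRing A]
  [Algebra (Laurent (AInf p O) d) A] {q : A →+* ModP R p} {ψ : A →+* AInfR sq}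
  (h' : IsTiltingXi (aInfToR sq ξ)) (hq : IsModel sq ξ q) (hψ : IsModelLift sq q ψ)
  (hθ : WittVector.fontaineTheta (RInf sq) p (aInfToR sq ξ) = 0)

include hψ in
lemma IsModelLift.dvd_fontaineTheta_sub {a : A} {r : R} (hr : Ideal.Quotient.mk _ r = q a) :
    (p : RInf sq) ∣ θR (ψ a) - baseRInf sq r := by
  refine SmallRep.dvd_fontaineTheta_sub ?_
  rw [hψ.toModP, ← hr]
  rfl

include hR hq hψ in
lemma IsModelLift.exists_baseRInf_eq (a : A) : ∃ r, baseRInf sq r = θR (ψ a) := by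
  have := hq.etale
  let e : R ≃+* (baseRInf sq).range := RingEquiv.ofBijective (baseRInf sq).rangeRestrict
    ⟨fun x y hxy => baseRInf_injective hR (congrArg Subtype.val hxy),
      (baseRInf sq).rangeRestrict_surjective⟩
  have he : ∀ y, baseRInf sq (e.symm y) = y := fun y => congrArg Subtype.val (e.apply_symm_apply y)
  let t : Laurent (AInf p O) d →+* R := (e.symm : _ →+* R).comp
    (((WittVector.fontaineTheta (RInf sq) p).comp (uMap sq)).codRestrict (baseRInf sq).range
      (exists_baseRInf_eq_uMap hR))
  refine exists_eq_of_etale (Λ := Laurent (AInf p O) d)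
    ((WittVector.fontaineTheta (RInf sq) p).comp ψ) (baseRInf sq) (t := t)
    (K := Ideal.span {(p : R)}) (𝔎 := Ideal.span {(p : RInf sq)}) (fun x => ?_)
    (fun r => ⟨fun hr => ?_, fun hr => ?_⟩) (fun a => ?_) a
  · refine (he _).trans ?_
    change θR (uMap sq x) = θR (ψ _)
    rw [hψ.map_algebraMap]
  · rw [← pow_one (Ideal.span {(p : RInf sq)})] at hr
    rw [← pow_one (Ideal.span {(p : R)})]
    exact mem_pow_of_baseRInf_mem hR hr
  · rw [← map_span_natCast p (baseRInf sq)]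
    exact Ideal.mem_map_of_mem _ hr
  · obtain ⟨r, hr⟩ := Ideal.Quotient.mk_surjective (q a)
    exact ⟨r, Ideal.mem_span_singleton.mpr (hψ.dvd_fontaineTheta_sub hr)⟩

variable {S : Subring (AInfR sq)} (hS : IsHull ψ (p : A) (toModel d A ξ) (basisW sq) S)

include h' hψ hS in
lemma IsModelLift.mem_hull_iff {w : AInfR sq} :
    w ∈ S ↔ ∀ n, ∃ a, w - ψ a ∈ (Ideal.span {(p : AInfR sq), aInfToR sq ξ}) ^ n := by
  have := hψ.isHausdorff h'
  rw [hS.mem_iff (basisW_zero sq), hψ.span_eq]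

include hR h' hq hψ hθ hS in
/-- Fontaine's map identifies the reduction of the hull modulo `ξ` with `R`. -/
theorem IsModelLift.map_fontaineTheta : S.map θR = (baseRInf sq).range := by
  refine le_antisymm ?_ ?_
  · rintro _ ⟨s, hs, rfl⟩
    refine SmallRep.exists_baseRInf_eq hR (fun n => ?_)
    obtain ⟨a, ha⟩ := (hψ.mem_hull_iff h' hS).mp hs n
    obtain ⟨r, hr⟩ := hψ.exists_baseRInf_eq hR hq a
    exact ⟨r, by rw [hr, ← map_sub]; exact fontaineTheta_mem_pow hθ ha⟩
  · rintro _ ⟨r, rfl⟩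
    have hstep : ∀ r : R, ∃ (a : A) (r' : R), baseRInf sq r = θR (ψ a) + p * baseRInf sq r' :=
      fun r => by
        obtain ⟨a, ha⟩ := hq.surjective (Ideal.Quotient.mk _ r)
        obtain ⟨r₁, hr₁⟩ := hψ.exists_baseRInf_eq hR hq a
        have h1 := hψ.dvd_fontaineTheta_sub ha.symm
        rw [← hr₁, ← map_sub] at h1
        obtain ⟨r', hr'⟩ := dvd_of_dvd_baseRInf sq h1
        refine ⟨a, -r', ?_⟩
        have h2 := congrArg (baseRInf sq) hr'
        rw [map_sub, map_mul, map_natCast] at h2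
        rw [← hr₁, map_neg]
        linear_combination -h2
    choose f g hfg using hstep
    have hsum : ∀ n, baseRInf sq r = θR (ψ (∑ i ∈ Finset.range n, (p : A) ^ i * f (g^[i] r))) +
        p ^ n * baseRInf sq (g^[n] r) := fun n => by
      induction n with
      | zero => simp
      | succ n ih =>
        rw [Finset.sum_range_succ, map_add, map_add, map_mul, map_mul, map_pow, map_pow,
          map_natCast, map_natCast, Function.iterate_succ_apply', ih]
        linear_combination (p : RInf sq) ^ n * hfg (g^[n] r)
    have := h'.isAdicComplete
    have hpmem : ∀ n, (p : AInfR sq) ^ n ∈ (Ideal.span {(p : AInfR sq), aInfToR sq ξ}) ^ n :=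
      fun n => Ideal.pow_mem_pow (Ideal.subset_span (by simp)) n
    obtain ⟨L, hL⟩ := exists_adic_limit (Ideal.span {(p : AInfR sq), aInfToR sq ξ})
      (fun n => ψ (∑ i ∈ Finset.range n, (p : A) ^ i * f (g^[i] r))) (fun n => by
        rw [← map_sub, Finset.sum_range_succ, add_sub_cancel_left, map_mul, map_pow, map_natCast]
        exact Ideal.mul_mem_right _ _ (hpmem n))
    refine ⟨L, (hψ.mem_hull_iff h' hS).mpr
      (fun n => ⟨∑ i ∈ Finset.range n, (p : A) ^ i * f (g^[i] r), ?_⟩), ?_⟩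
    · rw [← neg_sub]
      exact neg_mem (hL n)
    · refine sub_eq_zero.mp (eq_zero_of_forall_mem_pow (I := Ideal.span {(p : RInf sq)})
        (fun n => ?_))
      have h1 := fontaineTheta_mem_pow hθ (hL n)
      have h2 : (p : RInf sq) ^ n * baseRInf sq (g^[n] r) ∈ Ideal.span {(p : RInf sq)} ^ n :=
        Ideal.mul_mem_right _ _ (Ideal.pow_mem_pow (Ideal.mem_span_singleton_self _) _)
      have h3 := neg_mem (Ideal.add_mem _ h1 h2)
      rw [map_sub] at h3
      convert h3 using 1
      rw [hsum n]
      ring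

include hR h' hψ hθ hS in
lemma IsModelLift.exists_eq_xi_mul {x : AInfR sq} (hx : x ∈ S) (hx' : θR x = 0) :
    ∃ y ∈ S, x = aInfToR sq ξ * y := by
  have := hS.complete
  have hB := hS.strict.isTopBasis
  obtain ⟨w, rfl⟩ := dvd_of_fontaineTheta_eq_zero h' hθ (fun _ h => eq_zero_of_natCast_mul_RInf sq hR h)
    hx'
  let pr := hB.pr 0
  refine ⟨pr w, (pr w).2, ?_⟩
  have h1 := hB.pr_mul 0 ⟨ψ (toModel d A ξ), hS.mem _⟩ w
  have h2 : hB.pr 0 (S.subtype ⟨_, hx⟩) = ⟨_, hx⟩ := by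
    classical
    have := hB.pr_ι_mul 0 0 ⟨_, hx⟩
    rwa [basisW_zero, mul_one, if_pos rfl] at this
  have h3 : S.subtype ⟨ψ (toModel d A ξ), hS.mem _⟩ * w = S.subtype ⟨_, hx⟩ :=
    congrArg (· * w) (hψ.map_toModel sq ξ)
  rw [h3, h2] at h1
  have h4 := congrArg Subtype.val h1
  refine h4.trans ?_
  exact congrArg (· * _) (hψ.map_toModel sq ξ)

end ThetaHull

/-! ### The hull is the framed period ring -/

section FramedHull

variable {p : ℕ} [Fact p.Prime] {O : Type u} [CommRing O] [Fact (¬IsUnit (p : O))]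
  (ζ : PRoots p O) {d : ℕ}
  {R : Type u} [CommRing R] [Nontrivial R] [IsAdicComplete (Ideal.span {(p : R)}) R]

lemma coeff_eps (n : ℕ) : PreTilt.coeff n ζ.eps = Ideal.Quotient.mk _ (ζ.zeta n) := rfl

lemma coeff_epsRoot (n : ℕ) :
    PreTilt.coeff n ζ.epsRoot = Ideal.Quotient.mk _ (ζ.zeta (n + 1)) := by
  rw [PRoots.epsRoot, PreTilt.coeff_frobeniusEquiv_symm]
  rfl

lemma aInfToR_teichmuller (sq : TateLaurent p O d →+* R) (x : PreTilt O p) :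
    aInfToR sq (WittVector.teichmuller p x) =
      WittVector.teichmuller p (tiltMap p (constRInf sq) x) := by
  rw [aInfToR, aInfMap, WittVector.map_teichmuller]

lemma fontaineTheta_xi [IsDomain O] (sq : TateLaurent p O d →+* R) :
    WittVector.fontaineTheta (RInf sq) p (aInfToR sq ζ.xi) = 0 := by
  have h1 : WittVector.fontaineTheta (RInf sq) p (aInfToR sq (WittVector.teichmuller p ζ.epsRoot)) =
      constRInf sq (ζ.zeta 1) := by
    rw [aInfToR_teichmuller]
    refine fontaineTheta_teichmuller_eq _ (y := fun n => constRInf sq (ζ.zeta (n + 1)))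
      (fun n => by rw [← map_pow, ζ.pow_succ]) (fun n => ?_)
    rw [coeff_tiltMap, coeff_epsRoot, modPMap_mk]
  have h2 : IsPrimitiveRoot (ζ.zeta 1) p := by simpa using ζ.primitive 1
  rw [PRoots.xi, map_sum, map_sum]
  simp only [map_pow, h1]
  rw [← map_zero (constRInf sq), ← h2.geom_sum_eq_zero (Fact.out : p.Prime).one_lt, map_sum]
  simp only [map_pow]

variable {ζ} {sq : TateLaurent p O d →+* R} (hR : ∀ r : R, (p : R) * r = 0 → r = 0)
  {A : Type u} [CommRing A]
  [Algebra (Laurent (AInf p O) d) A] {q : A →+* ModP R p} {ψ : A →+* AInfR sq}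
  (h' : IsTiltingXi (aInfToR sq ζ.xi)) (hq : IsModel sq ζ.xi q) (hψ : IsModelLift sq q ψ)
  (hθ : WittVector.fontaineTheta (RInf sq) p (aInfToR sq ζ.xi) = 0)
  {S : Subring (AInfR sq)}

local notation "θR" => WittVector.fontaineTheta (RInf sq) p

lemma map_pxIdeal {B : Type*} [CommRing B] (f : AInf p O →+* B) :
    ζ.pxIdeal.map f = Ideal.span {(p : B), f ζ.xi} := by
  rw [PRoots.pxIdeal, IsStrict.map_span_pair, map_natCast]

include hR h' hq hψ hθ in
lemma IsModelLift.isFramedPeriodRing (hS : IsHull ψ (p : A) (toModel d A ζ.xi) (basisW sq) S)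
    (hU : ∀ x, uMap sq x ∈ S)
    (he : AdicEtale (laurentIdeal d (Ideal.span {(p : AInf p O), ζ.xi}))
      ((uMap sq).codRestrict S hU)) : IsFramedPeriodRing ζ sq S where
  uMap_mem := hU
  isAdicComplete := by
    have h1 := hS.complete
    have h2 : (p : S) = ⟨ψ (p : A), hS.mem _⟩ := Subtype.ext (map_natCast ψ p).symm
    have h3 : ((uMap sq).codRestrict S hU).comp AddMonoidAlgebra.singleZeroRingHom ζ.xi =
        ⟨ψ (toModel d A ζ.xi), hS.mem _⟩ :=
      Subtype.ext ((uMap_single_zero sq _).trans (hψ.map_toModel sq _).symm)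
    rwa [Ideal.map_map, map_pxIdeal, h2, h3]
  adicEtale := he
  map_theta := hψ.map_fontaineTheta hR h' hq hθ hS
  ker_theta _ hx hx' := hψ.exists_eq_xi_mul hR h' hθ hS hx hx'

include h' in
lemma mem_span_iff_dvd_fontaineTheta {w : AInfR sq} :
    w ∈ Ideal.span {(p : AInfR sq), aInfToR sq ζ.xi} ↔ (p : RInf sq) ∣ θR w := by
  rw [h'.mem_iff, ← Ideal.mem_span_singleton, ← Ideal.Quotient.eq_zero_iff_mem,
    WittVector.mk_fontaineTheta]
  rfl

lemma IsFramedPeriodRing.aInfToR_mem (hS : IsFramedPeriodRing ζ sq S) (a : AInf p O) :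
    aInfToR sq a ∈ S := uMap_single_zero sq a ▸ hS.uMap_mem _

lemma IsFramedPeriodRing.exists_fontaineTheta_eq (hS : IsFramedPeriodRing ζ sq S) (r : R) :
    ∃ s ∈ S, θR s = baseRInf sq r := hS.map_theta.ge ⟨r, rfl⟩

lemma IsFramedPeriodRing.exists_baseRInf_eq (hS : IsFramedPeriodRing ζ sq S) {s : AInfR sq}
    (hs : s ∈ S) : ∃ r, baseRInf sq r = θR s := hS.map_theta.le ⟨s, hs, rfl⟩

lemma IsFramedPeriodRing.complete (hS : IsFramedPeriodRing ζ sq S) :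
    IsAdicComplete (Ideal.span {(p : S), ⟨aInfToR sq ζ.xi, hS.aInfToR_mem _⟩}) S := by
  have h1 := hS.isAdicComplete
  have h3 : ((uMap sq).codRestrict S hS.uMap_mem).comp AddMonoidAlgebra.singleZeroRingHom ζ.xi =
      ⟨aInfToR sq ζ.xi, hS.aInfToR_mem _⟩ := Subtype.ext (uMap_single_zero sq _)
  rwa [Ideal.map_map, map_pxIdeal, h3] at h1

include h' in
lemma IsFramedPeriodRing.mem_span_iff (hS : IsFramedPeriodRing ζ sq S) (x : S) :
    (x : AInfR sq) ∈ Ideal.span {(p : AInfR sq), aInfToR sq ζ.xi} ↔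
      x ∈ Ideal.span {(p : S), ⟨aInfToR sq ζ.xi, hS.aInfToR_mem _⟩} := by
  constructor
  · intro hx
    rw [mem_span_iff_dvd_fontaineTheta h'] at hx
    obtain ⟨r, hr⟩ := hS.exists_baseRInf_eq x.2
    rw [← hr] at hx
    obtain ⟨r', rfl⟩ := dvd_of_dvd_baseRInf sq hx
    obtain ⟨s, hs, hsr⟩ := hS.exists_fontaineTheta_eq r'
    obtain ⟨y, hy, hxy⟩ := hS.ker_theta (x - (p : AInfR sq) * s)
      (sub_mem x.2 (mul_mem (natCast_mem S p) hs)) (by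
      rw [map_sub, map_mul, hsr, ← hr, map_mul, map_natCast, map_natCast, sub_self])
    rw [Ideal.mem_span_pair]
    refine ⟨⟨s, hs⟩, ⟨y, hy⟩, Subtype.ext ?_⟩
    change s * ((p : S) : AInfR sq) + y * aInfToR sq ζ.xi = _
    rw [Subring.coe_natCast, mul_comm y, ← hxy]
    ring
  · intro hx
    have h1 := Ideal.mem_map_of_mem S.subtype hx
    rwa [IsStrict.map_span_pair, map_natCast] at h1

include h' hψ in
lemma IsModelLift.sub_mem_of_fontaineTheta_eq {a : A} {r : R} {s : AInfR sq}
    (hr : Ideal.Quotient.mk _ r = q a) (hs : θR s = baseRInf sq r) :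
    s - ψ a ∈ Ideal.span {(p : AInfR sq), aInfToR sq ζ.xi} := by
  rw [mem_span_iff_dvd_fontaineTheta h', map_sub, hs, ← neg_sub, dvd_neg]
  exact hψ.dvd_fontaineTheta_sub hr

include h' hq hψ in
lemma IsModelLift.mem_of_isFramedPeriodRing (hS : IsFramedPeriodRing ζ sq S) (a : A) :
    ψ a ∈ S := by
  have := hq.etale
  have := h'.isAdicComplete
  have := hS.complete
  obtain ⟨x, hx⟩ := exists_eq_of_etale (Λ := Laurent (AInf p O) d) ψ S.subtype
    (t := (uMap sq).codRestrict S hS.uMap_mem) (fun x => (hψ.map_algebraMap x).symm)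
    (hS.mem_span_iff h') (fun a => by
      obtain ⟨r, hr⟩ := Ideal.Quotient.mk_surjective (q a)
      obtain ⟨s, hs, hsr⟩ := hS.exists_fontaineTheta_eq r
      refine ⟨⟨s, hs⟩, ?_⟩
      rw [← neg_sub]
      exact neg_mem (hψ.sub_mem_of_fontaineTheta_eq h' hr hsr)) a
  exact hx ▸ x.2

include h' hq hψ in
/-- Every framed period ring is the hull of the model. -/
theorem IsModelLift.isHull (hS : IsFramedPeriodRing ζ sq S) :
    IsHull ψ (p : A) (toModel d A ζ.xi) (basisW sq) S := by
  have hψS := hψ.mem_of_isFramedPeriodRing h' hq hS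
  have hdense : ∀ s ∈ S, ∃ a, s - ψ a ∈ Ideal.span {(p : AInfR sq), aInfToR sq ζ.xi} :=
    fun s hs => by
      obtain ⟨r, hr⟩ := hS.exists_baseRInf_eq hs
      obtain ⟨a, ha⟩ := hq.surjective (Ideal.Quotient.mk _ r)
      exact ⟨a, hψ.sub_mem_of_fontaineTheta_eq h' ha.symm hr.symm⟩
  have h2 : (⟨ψ (p : A), hψS _⟩ : S) = (p : S) := Subtype.ext (map_natCast ψ p)
  have h3 : (⟨ψ (toModel d A ζ.xi), hψS _⟩ : S) = ⟨aInfToR sq ζ.xi, hS.aInfToR_mem _⟩ :=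
    Subtype.ext (hψ.map_toModel sq _)
  have hJ : Ideal.span {(⟨ψ (p : A), hψS _⟩ : S), ⟨ψ (toModel d A ζ.xi), hψS _⟩} =
      Ideal.span {(p : S), ⟨aInfToR sq ζ.xi, hS.aInfToR_mem _⟩} := by rw [h2, h3]
  refine ⟨hψS, hJ ▸ hS.complete, ?_, fun s hs => hψ.span_eq.symm ▸ hdense s hs⟩
  refine IsStrict.of_isAdicDense (e := ψ.codRestrict S hψS) (ι := S.subtype)
    (hψ.isStrict h' hq) (fun s => ?_)
  obtain ⟨a, ha⟩ := hdense s s.2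
  exact ⟨a, hJ.ge ((hS.mem_span_iff h' (s - ψ.codRestrict S hψS a)).mp ha)⟩

end FramedHull

/-! ### Stability of the hull under the group and the Frobenius -/

section Stability

variable {p : ℕ} [Fact p.Prime] {O : Type u} [CommRing O] {d : ℕ}

lemma Gam.eval_nsmul (γ : Gam p O d) (n : ℕ) (k : Expo p d) : γ.eval (n • k) = γ.eval k ^ n := by
  induction n with
  | zero => rw [zero_smul, pow_zero, Gam.eval_zero]
  | succ n ih => rw [succ_nsmul, Gam.eval_add, ih, pow_succ]

variable [Fact (¬IsUnit (p : O))]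

/-- The element `(γ(k), γ(k/p), …)` of `O^♭`. -/
def Gam.etaFlat (γ : Gam p O d) (k : Expo p d) : PreTilt O p :=
  (⟨fun n => Ideal.Quotient.mk (Ideal.span {(p : O)}) (γ.eval (expDiv p k n) : O), fun n => by
    rw [← map_pow, ← Units.val_pow_eq_pow_val, ← Gam.eval_nsmul, nsmul_expDiv_succ]⟩ :
    Perfection (ModP O p) p)

/-- The character through which `Γ` acts on `[T^k]`. -/
def Gam.char (γ : Gam p O d) (k : Expo p d) : AInf p O := WittVector.teichmuller p (γ.etaFlat k)

lemma Gam.coeff_etaFlat (γ : Gam p O d) (k : Expo p d) (n : ℕ) :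
    PreTilt.coeff n (γ.etaFlat k) = Ideal.Quotient.mk _ (γ.eval (expDiv p k n) : O) := rfl

variable {R : Type u} [CommRing R] [Nontrivial R] [IsAdicComplete (Ideal.span {(p : R)}) R]
  (sq : TateLaurent p O d →+* R)

lemma smul_monW (γ : Gam p O d) (k : Expo p d) :
    γ • monW sq k = aInfToR sq (γ.char k) * monW sq k := by
  have h1 : tiltMap p (actRInf sq γ) (monFlat sq k) =
      tiltMap p (constRInf sq) (γ.etaFlat k) * monFlat sq k := tilt_ext p (fun n => by
    rw [map_mul, coeff_tiltMap, coeff_tiltMap, Gam.coeff_etaFlat, modPMap_mk]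
    change modPMap p (actRInf sq γ) (Ideal.Quotient.mk _ (monRInf sq (expDiv p k n))) =
      _ * Ideal.Quotient.mk _ (monRInf sq (expDiv p k n))
    rw [modPMap_mk, actRInf_monRInf, map_mul])
  rw [smul_aInfR, monW, aInfMap, WittVector.map_teichmuller, h1, map_mul, Gam.char,
    aInfToR_teichmuller]

lemma aInfToModP_smul (γ : Gam p O d) (w : AInfR sq) :
    aInfToModP p (RInf sq) (γ • w) = modPMap p (actRInf sq γ) (aInfToModP p (RInf sq) w) := by
  rw [smul_aInfR, aInfToModP_apply, coeff_aInfMap, coeff_tiltMap, aInfToModP_apply]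

lemma modPMap_actRInf_modPBase (γ : Gam p O d) (x : ModP R p) :
    modPMap p (actRInf sq γ) (modPBase sq x) = modPBase sq x := by
  obtain ⟨r, rfl⟩ := Ideal.Quotient.mk_surjective x
  rw [modPBase, modPMap_mk, modPMap_mk, actRInf_baseRInf]

lemma aInfToModP_frobenius (w : AInfR sq) :
    aInfToModP p (RInf sq) (WittVector.frobenius w) = aInfToModP p (RInf sq) w ^ p := by
  rw [aInfToModP_apply, WittVector.coeff_frobenius_charP, map_pow, aInfToModP_apply]

lemma smul_uMap_single (γ : Gam p O d) (m : Fin d → ℤ) (a : AInf p O) :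
    γ • uMap sq (AddMonoidAlgebra.single m a) =
      uMap sq (AddMonoidAlgebra.single m (a * γ.char (intExp p d m))) := by
  rw [uMap_single, uMap_single, smul_mul', smul_aInfToR, smul_monW, map_mul, mul_assoc]

lemma exists_smul_uMap (γ : Gam p O d) (x : Laurent (AInf p O) d) :
    ∃ y, γ • uMap sq x = uMap sq y := by
  induction x using AddMonoidAlgebra.induction_linear with
  | zero => exact ⟨0, by rw [map_zero, smul_zero]⟩
  | add x y hx hy =>
    obtain ⟨x', hx⟩ := hx
    obtain ⟨y', hy⟩ := hy
    exact ⟨x' + y', by rw [map_add, smul_add, hx, hy, map_add]⟩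
  | single m a => exact ⟨_, smul_uMap_single sq γ m a⟩

lemma frobenius_monW (k : Expo p d) : WittVector.frobenius (monW sq k) = monW sq k ^ p := by
  rw [monW, PRoots.frobenius_teichmuller, map_pow]

lemma exists_frobenius_uMap (x : Laurent (AInf p O) d) :
    ∃ y, WittVector.frobenius (uMap sq x) = uMap sq y := by
  induction x using AddMonoidAlgebra.induction_linear with
  | zero => exact ⟨0, by rw [map_zero, map_zero]⟩
  | add x y hx hy =>
    obtain ⟨x', hx⟩ := hx
    obtain ⟨y', hy⟩ := hy
    exact ⟨x' + y', by rw [map_add, map_add, hx, hy, map_add]⟩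
  | single m a =>
    refine ⟨AddMonoidAlgebra.single 0 (WittVector.frobenius a) *
      AddMonoidAlgebra.single m 1 ^ p, ?_⟩
    rw [uMap_single, map_mul, map_mul, map_pow, uMap_single, uMap_single, frobenius_monW, map_one,
      one_mul, aInfToR_frobenius, map_zero, monW_zero, mul_one]

variable {sq} {ξ : AInf p O} {A : Type u} [CommRing A]
  [Algebra (Laurent (AInf p O) d) A] {q : A →+* ModP R p} {ψ : A →+* AInfR sq}
  (h' : IsTiltingXi (aInfToR sq ξ)) (hq : IsModel sq ξ q) (hψ : IsModelLift sq q ψ)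
  {S : Subring (AInfR sq)} (hS : IsHull ψ (p : A) (toModel d A ξ) (basisW sq) S)

include h' in
lemma smul_mem_span (γ : Gam p O d) {w : AInfR sq}
    (hw : w ∈ Ideal.span {(p : AInfR sq), aInfToR sq ξ}) :
    γ • w ∈ Ideal.span {(p : AInfR sq), aInfToR sq ξ} := by
  rw [h'.mem_iff] at hw ⊢
  rw [aInfToModP_smul, hw, map_zero]

include hψ hS in
lemma IsModelLift.uMap_mem (x : Laurent (AInf p O) d) : uMap sq x ∈ S :=
  hψ.map_algebraMap x ▸ hS.mem _

include h' hψ in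
lemma IsModelLift.smul_sub_mem (γ : Gam p O d) (a : A) :
    γ • ψ a - ψ a ∈ Ideal.span {(p : AInfR sq), aInfToR sq ξ} := by
  rw [h'.mem_iff, map_sub, aInfToModP_smul, hψ.toModP, modPMap_actRInf_modPBase, sub_self]

include h' hq hψ hS in
theorem IsModelLift.smul_mem_hull (γ : Gam p O d) {s : AInfR sq} (hs : s ∈ S) : γ • s ∈ S := by
  have := hψ.isHausdorff h'
  have := hq.etale
  refine hS.map_mem (Λ := Laurent (AInf p O) d) (basisW_zero sq)
    (τ := MulSemiringAction.toRingHom (Gam p O d) (AInfR sq) γ) ?_ (fun x => ?_)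
    (fun a => ⟨a, ?_⟩) hs
  · rw [hψ.span_eq]
    exact fun w hw => smul_mem_span h' γ hw
  · obtain ⟨y, hy⟩ := exists_smul_uMap sq γ x
    rw [hψ.map_algebraMap]
    change γ • _ ∈ S
    exact hy ▸ hψ.uMap_mem hS y
  · rw [hψ.span_eq]
    exact hψ.smul_sub_mem h' γ a

include h' hq hψ hS in
theorem IsModelLift.frobenius_mem_hull {s : AInfR sq} (hs : s ∈ S) :
    WittVector.frobenius s ∈ S := by
  have := hψ.isHausdorff h'
  have := hq.etale
  refine hS.map_mem (Λ := Laurent (AInf p O) d) (basisW_zero sq)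
    (τ := (WittVector.frobenius : AInfR sq →+* AInfR sq)) ?_ (fun x => ?_)
    (fun a => ⟨a ^ p, ?_⟩) hs
  · rw [hψ.span_eq]
    intro w hw
    rw [Ideal.mem_comap]
    rw [h'.mem_iff] at hw ⊢
    rw [aInfToModP_frobenius, hw, zero_pow (Fact.out : p.Prime).ne_zero]
  · obtain ⟨y, hy⟩ := exists_frobenius_uMap sq x
    rw [hψ.map_algebraMap]
    exact hy ▸ hψ.uMap_mem hS y
  · rw [hψ.span_eq, h'.mem_iff, map_sub, aInfToModP_frobenius, map_pow, map_pow, sub_self]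

end Stability

/-! ### The element `μ` and the characters of `Γ` -/

section Characters

lemma AdicEmbedding.of_map {B W : Type*} [CommRing B] [CommRing W] {j : B →+* W} {J : Ideal B}
    {𝔧 : Ideal W} (hle : J.map j ≤ 𝔧) (hj : ∀ n, ∃ m, ∀ x, j x ∈ 𝔧 ^ m → x ∈ J ^ n) {c : B}
    (h : AdicEmbedding 𝔧 (j c)) : AdicEmbedding J c := fun n => by
  obtain ⟨m, hm⟩ := hj n
  obtain ⟨N, hN⟩ := h m
  refine ⟨N, fun b hb => hm _ (hN _ ?_)⟩
  rw [← map_mul]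
  have h1 := Ideal.mem_map_of_mem j hb
  rw [Ideal.map_pow] at h1
  exact Ideal.pow_right_mono hle N h1

lemma geom_sum_charP {p : ℕ} [Fact p.Prime] {k : Type*} [CommRing k] [CharP k p] (x : k) :
    ∑ i ∈ Finset.range p, x ^ i = (x - 1) ^ (p - 1) := by
  have h1 : (∑ i ∈ Finset.range p, (Polynomial.X : Polynomial (ZMod p)) ^ i) =
      (Polynomial.X - 1) ^ (p - 1) := by
    have h2 : (Polynomial.X - 1 : Polynomial (ZMod p)) ≠ 0 := Polynomial.X_sub_C_ne_zero 1
    refine mul_right_cancel₀ h2 ?_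
    rw [geom_sum_mul, ← pow_succ, Nat.sub_add_cancel (Fact.out : p.Prime).one_le,
      sub_pow_char, one_pow]
  have h3 := congrArg (Polynomial.eval₂ (ZMod.castHom (dvd_refl p) k) x) h1
  simpa [Polynomial.eval₂_finsetSum, Polynomial.eval₂_pow] using h3

variable {p : ℕ} [Fact p.Prime] {O : Type u} [CommRing O] [Fact (¬IsUnit (p : O))]
  (ζ : PRoots p O)

lemma IsTiltingXi.isUnit_of_map {T : Type u} [CommRing T] [Fact (¬IsUnit (p : T))] {ξ : AInf p T}
    (h : IsTiltingXi ξ) {x : AInf p T} (hx : IsUnit (aInfToModP p T x)) : IsUnit x := by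
  have := h.isAdicComplete
  obtain ⟨u, hu⟩ := hx
  obtain ⟨y, hy⟩ := h.surjective_aInfToModP (↑u⁻¹ : ModP T p)
  have h1 : x * y - 1 ∈ Ideal.span {(p : AInf p T), ξ} := by
    rw [h.mem_iff, map_sub, map_mul, map_one, ← hu, hy, Units.mul_inv, sub_self]
  have h2 := isUnit_one_add_of_pow_mem (c := x * y - 1) (N := 1) (by rwa [pow_one]) (dvd_refl _)
  rw [add_sub_cancel] at h2
  exact isUnit_of_mul_isUnit_left h2

lemma constantCoeff_xi : ζ.xi.coeff 0 = (ζ.epsRoot - 1) ^ (p - 1) := by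
  rw [← geom_sum_charP]
  change WittVector.constantCoeff ζ.xi = _
  rw [PRoots.xi, map_sum]
  refine Finset.sum_congr rfl (fun i _ => ?_)
  rw [map_pow]
  exact congrArg (· ^ i) (WittVector.teichmuller_coeff_zero p _)

lemma eps_sub_one : ζ.eps - 1 = (ζ.epsRoot - 1) ^ p := by
  rw [sub_pow_char, one_pow, PRoots.epsRoot, frobeniusEquiv_symm_pow_p]

lemma mu_coeff_zero : ζ.mu.coeff 0 = ζ.eps - 1 := by
  change WittVector.constantCoeff ζ.mu = _
  rw [PRoots.mu, map_sub, map_one]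
  exact congrArg (· - 1) (WittVector.teichmuller_coeff_zero p _)

/-- Modulo `p`, the element `μ` divides a power of `ξ`. -/
lemma xi_pow_mem : ζ.xi ^ p ∈ Ideal.span {(p : AInf p O), ζ.mu} := by
  have hp := (Fact.out : p.Prime).two_le
  obtain ⟨k, hk⟩ : ∃ k, (p - 1) * p = p + k := Nat.exists_eq_add_of_le (by
    exact Nat.le_mul_of_pos_left p (by omega))
  have h1 : WittVector.constantCoeff
      (ζ.xi ^ p - ζ.mu * WittVector.teichmuller p (ζ.epsRoot - 1) ^ k) = 0 := by
    have h2 : WittVector.constantCoeff (WittVector.teichmuller p (ζ.epsRoot - 1)) =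
      ζ.epsRoot - 1 := WittVector.teichmuller_coeff_zero p _
    have h3 : WittVector.constantCoeff ζ.xi = (ζ.epsRoot - 1) ^ (p - 1) := constantCoeff_xi ζ
    have h4 : WittVector.constantCoeff ζ.mu = (ζ.epsRoot - 1) ^ p :=
      (mu_coeff_zero ζ).trans (eps_sub_one ζ)
    rw [map_sub, map_mul, map_pow, map_pow, h2, h3, h4, ← pow_mul, hk, pow_add, sub_self]
  obtain ⟨w, hw⟩ : (p : AInf p O) ∣
      ζ.xi ^ p - ζ.mu * WittVector.teichmuller p (ζ.epsRoot - 1) ^ k := witt_dvd_iff.mpr h1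
  rw [Ideal.mem_span_pair]
  exact ⟨w, WittVector.teichmuller p (ζ.epsRoot - 1) ^ k, by linear_combination -hw⟩

lemma adicEmbedding_mu {B : Type*} [CommRing B] (f : AInf p O →+* B)
    (h : IsRegPair (p : B) (f ζ.xi)) : AdicEmbedding (Ideal.span {(p : B), f ζ.xi}) (f ζ.mu) :=
  h.adicEmbedding (N := p) (by
    have h1 := Ideal.mem_map_of_mem f (xi_pow_mem ζ)
    rwa [IsStrict.map_span_pair, map_natCast, map_pow] at h1)

/-- The element `ε^{1/p^j}`. -/
def PRoots.epsDiv (j : ℕ) : PreTilt O p :=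
  (⟨fun n => Ideal.Quotient.mk (Ideal.span {(p : O)}) (ζ.zeta (n + j)), fun n => by
    rw [← map_pow, show n + 1 + j = n + j + 1 by ring, ζ.pow_succ]⟩ : Perfection (ModP O p) p)

lemma coeff_epsDiv (j n : ℕ) :
    PreTilt.coeff n (ζ.epsDiv j) = Ideal.Quotient.mk _ (ζ.zeta (n + j)) := rfl

lemma epsDiv_zero : ζ.epsDiv 0 = ζ.eps := tilt_ext p (fun _ => rfl)

lemma epsDiv_one : ζ.epsDiv 1 = ζ.epsRoot := tilt_ext p (fun n => by
  rw [coeff_epsDiv, coeff_epsRoot])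

lemma epsDiv_succ_pow (j : ℕ) : ζ.epsDiv (j + 1) ^ p = ζ.epsDiv j := tilt_ext p (fun n => by
  rw [map_pow, coeff_epsDiv, coeff_epsDiv, ← map_pow, ← add_assoc, ζ.pow_succ])

lemma epsDiv_pow_pow (j i : ℕ) : ζ.epsDiv (i + j) ^ p ^ j = ζ.epsDiv i := by
  induction j with
  | zero => rw [pow_zero, pow_one, add_zero]
  | succ j ih => rw [pow_succ', pow_mul, ← add_assoc, epsDiv_succ_pow, ih]

lemma teichmuller_epsDiv_sub_one_dvd (j : ℕ) :
    WittVector.teichmuller p (ζ.epsDiv (j + 1)) - 1 ∣ ζ.phiInvMu := by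
  rw [PRoots.phiInvMu_eq, ← epsDiv_one, ← epsDiv_pow_pow ζ j 1, map_pow, add_comm j]
  simpa using sub_dvd_pow_sub_pow (WittVector.teichmuller p (ζ.epsDiv (1 + j))) 1 (p ^ j)

variable {ζ}

/-- For `a` prime to `p`, the elements `[ε^{a/p^j}] - 1` and `[ε^{1/p^j}] - 1` are associated. -/
lemma teichmuller_epsDiv_pow_sub_one_dvd (h : IsTiltingXi ζ.xi) [IsDomain O] (j : ℕ) {a : ℕ}
    (ha : ¬p ∣ a) : WittVector.teichmuller p (ζ.epsDiv j) ^ a - 1 ∣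
      WittVector.teichmuller p (ζ.epsDiv j) - 1 := by
  have hz : ζ.zeta 0 = 1 := by simpa using ζ.primitive 0
  have hnil : IsNilpotent (PreTilt.coeff 0 (ζ.epsDiv j) - 1) := by
    refine ⟨p ^ j, ?_⟩
    have h1 : (ζ.epsDiv j - 1) ^ p ^ j = ζ.eps - 1 := by
      have h2 := epsDiv_pow_pow ζ j 0
      rw [zero_add, epsDiv_zero] at h2
      rw [sub_pow_char_pow, one_pow, h2]
    rw [← map_one (PreTilt.coeff 0), ← map_sub, ← map_pow, h1, map_sub, coeff_eps, hz, map_one,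
      map_one, sub_self]
  have hu : IsUnit (∑ i ∈ Finset.range a, WittVector.teichmuller p (ζ.epsDiv j) ^ i) := by
    refine h.isUnit_of_map ?_
    rw [map_sum]
    simp only [map_pow, aInfToModP_teichmuller]
    have h1 : IsUnit ((a : ℕ) : ModP O p) :=
      (CharP.isUnit_natCast_iff (Fact.out : p.Prime)).mpr ha
    have h2 : PreTilt.coeff 0 (ζ.epsDiv j) - 1 ∣
        ∑ i ∈ Finset.range a, PreTilt.coeff 0 (ζ.epsDiv j) ^ i - (a : ModP O p) := by
      have h3 : (a : ModP O p) = ∑ i ∈ Finset.range a, 1 := by simp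
      rw [h3, ← Finset.sum_sub_distrib]
      exact Finset.dvd_sum (fun i _ => by
        simpa using sub_dvd_pow_sub_pow (PreTilt.coeff 0 (ζ.epsDiv j)) 1 i)
    obtain ⟨c, hc⟩ := h2
    rw [sub_eq_iff_eq_add] at hc
    rw [hc]
    exact IsNilpotent.isUnit_add_right_of_commute ((Commute.all _ _).isNilpotent_mul_right hnil)
      h1 (Commute.all _ _)
  obtain ⟨v, hv⟩ := hu
  refine ⟨(↑v⁻¹ : AInf p O), ?_⟩
  rw [← geom_sum_mul, ← hv, mul_comm, ← mul_assoc, Units.inv_mul, one_mul]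

variable {d : ℕ}

lemma expDiv_pow_smul (k : Expo p d) (n : ℕ) : p ^ n • expDiv p k n = k := by
  induction n with
  | zero => rw [pow_zero, one_smul]; rfl
  | succ n ih => rw [pow_succ, mul_smul, nsmul_expDiv_succ, ih]

/-- On integral exponents the characters are trivial modulo `μ`. -/
lemma mu_dvd_char_sub_one [IsDomain O] (h : IsTiltingXi ζ.xi) (γ : Gam p O d) (m : Fin d → ℤ) :
    ζ.mu ∣ γ.char (intExp p d m) - 1 := by
  have := h.isAdicComplete
  refine (adicEmbedding_mu ζ (RingHom.id _) h.isRegPair).dvd_of_forall (fun n => ?_)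
  have h1 : (γ.eval (expDiv p (intExp p d m) n) : O) ^ p ^ n = 1 := by
    rw [← Units.val_pow_eq_pow_val, ← Gam.eval_nsmul, expDiv_pow_smul, Gam.eval_intExp,
      Units.val_one]
  obtain ⟨i, -, hi⟩ := (ζ.primitive n).eq_pow_of_pow_eq_one h1
  have h2 : PreTilt.coeff n (γ.etaFlat (intExp p d m)) = PreTilt.coeff n (ζ.eps ^ i) := by
    rw [Gam.coeff_etaFlat, map_pow, coeff_eps, ← hi, map_pow]
  have h3 := h.teichmuller_sub_mem n h2
  obtain ⟨w, hw⟩ : ζ.mu ∣ WittVector.teichmuller p ζ.eps ^ i - 1 := by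
    have h4 := sub_dvd_pow_sub_pow (WittVector.teichmuller p ζ.eps) 1 i
    rwa [one_pow] at h4
  refine ⟨w, Ideal.pow_le_pow_right n.le_succ ?_⟩
  change γ.char (intExp p d m) - 1 - ζ.mu * w ∈ _
  rw [← hw, sub_sub_sub_cancel_right, ← map_pow]
  exact h3

variable (ζ)

/-- The root of unity `ζ.zeta n`, as a unit. -/
def PRoots.zetaUnit (n : ℕ) : Oˣ :=
  Units.ofPowEqOne (ζ.zeta n) (p ^ n) (ζ.primitive n).pow_eq_one
    (pow_ne_zero _ (Fact.out : p.Prime).ne_zero)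

lemma PRoots.zetaUnit_pow (n j : ℕ) : ζ.zetaUnit (n + j) ^ p ^ j = ζ.zetaUnit n := by
  induction j with
  | zero => rw [pow_zero, pow_one, add_zero]
  | succ j ih =>
    rw [pow_succ', pow_mul, ← ih]
    congr 1
    refine Units.ext ?_
    rw [Units.val_pow_eq_pow_val]
    exact ζ.pow_succ _

/-- The root of unity `ζ^x` for `x` in `ℤ[1/p]`. -/
def PRoots.zetaPow (x : zInv p) : Oˣ := ζ.zetaUnit x.2.choose ^ x.2.choose_spec.choose

lemma PRoots.zetaPow_eq (x : zInv p) {n : ℕ} {a : ℤ} (h : (p : ℚ) ^ n * x = a) :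
    ζ.zetaPow x = ζ.zetaUnit n ^ a := by
  have h1 : ∀ (n m : ℕ) (a b : ℤ), (p : ℚ) ^ n * x = a → (p : ℚ) ^ m * x = b →
      ζ.zetaUnit n ^ a = ζ.zetaUnit m ^ b := fun n m a b ha hb => by
    have h2 : (p : ℤ) ^ m * a = (p : ℤ) ^ n * b := by
      have h3 : ((p : ℚ) ^ m * a) = (p : ℚ) ^ n * b := by rw [← ha, ← hb]; ring
      exact_mod_cast h3
    rw [← ζ.zetaUnit_pow n m, ← ζ.zetaUnit_pow m n, ← zpow_natCast, ← zpow_natCast, ← zpow_mul,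
      ← zpow_mul, add_comm m]
    push_cast
    rw [h2]
  exact h1 _ _ _ _ x.2.choose_spec.choose_spec h

lemma PRoots.zetaPow_add (x y : zInv p) : ζ.zetaPow (x + y) = ζ.zetaPow x * ζ.zetaPow y := by
  obtain ⟨n, a, ha⟩ := x.2
  obtain ⟨m, b, hb⟩ := y.2
  have h1 : (p : ℚ) ^ (n + m) * x = ((p ^ m * a : ℤ) : ℚ) := by push_cast; rw [← ha]; ring
  have h2 : (p : ℚ) ^ (n + m) * y = ((p ^ n * b : ℤ) : ℚ) := by push_cast; rw [← hb]; ring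
  rw [ζ.zetaPow_eq x h1, ζ.zetaPow_eq y h2, ← zpow_add]
  refine ζ.zetaPow_eq _ ?_
  push_cast [← h1, ← h2]
  rw [mul_add]

/-- The element of `Γ` with `k ↦ ζ^{k_i}`. -/
def PRoots.gen (i : Fin d) : Gam p O d :=
  ⟨MonoidHom.mk' (fun k => ζ.zetaPow (k.toAdd i)) (fun k l => ζ.zetaPow_add _ _), fun k => by
    refine (ζ.zetaPow_eq (n := 0) (a := k i) _ (by simp [intExp])).trans ?_
    have h0 : ζ.zetaUnit 0 = 1 := Units.ext (by
      have h1 := ζ.primitive 0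
      rw [pow_zero, IsPrimitiveRoot.one_right_iff] at h1
      exact h1)
    rw [h0]
    exact one_zpow _⟩

lemma PRoots.eval_gen (i : Fin d) (k : Expo p d) : (ζ.gen i).eval k = ζ.zetaPow (k i) := rfl

lemma expDiv_apply (k : Expo p d) (n : ℕ) (i : Fin d) :
    (p : ℚ) ^ n * (expDiv p k n i : ℚ) = k i := by
  have h1 := congrArg (fun x : Expo p d => (x i : ℚ)) (expDiv_pow_smul k n)
  simpa using h1

lemma PRoots.char_gen (i : Fin d) (k : Expo p d) {j a : ℕ} (h : (p : ℚ) ^ j * k i = a) :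
    (ζ.gen i).char k = WittVector.teichmuller p (ζ.epsDiv j) ^ a := by
  rw [Gam.char, ← map_pow]
  congr 1
  refine tilt_ext p (fun n => ?_)
  rw [Gam.coeff_etaFlat, map_pow, coeff_epsDiv, ζ.eval_gen, ← map_pow,
    ζ.zetaPow_eq (n := n + j) (a := a) _ (by
      rw [Int.cast_natCast, ← h, ← expDiv_apply k n i]
      ring), zpow_natCast, Units.val_pow_eq_pow_val]
  rfl

lemma exists_eq_natCast_of_pos (x : zInv p) (h0 : 0 < (x : ℚ)) (h1 : (x : ℚ) < 1) :
    ∃ j a : ℕ, (p : ℚ) ^ (j + 1) * x = a ∧ ¬p ∣ a := by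
  have hp : (0 : ℚ) < p := by exact_mod_cast (Fact.out : p.Prime).pos
  obtain ⟨n, b, hb⟩ := x.2
  induction n generalizing b with
  | zero =>
    rw [pow_zero, one_mul] at hb
    rw [hb] at h0 h1
    have h2 : 0 < b := by exact_mod_cast h0
    have h3 : b < 1 := by exact_mod_cast h1
    omega
  | succ n ih =>
    have h2 : 0 < b := by
      have : (0 : ℚ) < b := by rw [← hb]; positivity
      exact_mod_cast this
    obtain ⟨a, rfl⟩ := Int.eq_ofNat_of_zero_le h2.le
    by_cases ha : p ∣ a
    · obtain ⟨c, rfl⟩ := ha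
      refine ih c (mul_left_cancel₀ hp.ne' ?_)
      rw [← mul_assoc, ← pow_succ', hb]
      push_cast
      rfl
    · exact ⟨n, a, by simpa using hb, ha⟩

/-- Every non-trivial fractional exponent is detected by one of the generators. -/
lemma exists_char_gen_sub_one_dvd [IsDomain O] (h : IsTiltingXi ζ.xi) {k : FracExpo p d}
    (hk : k ≠ 0) : ∃ i, (ζ.gen i).char k.1 - 1 ∣ ζ.phiInvMu := by
  obtain ⟨i, hi⟩ : ∃ i, k.1 i ≠ 0 := by
    by_contra hcon
    push Not at hcon
    exact hk (Subtype.ext (funext hcon))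
  have h0 : (0 : ℚ) < k.1 i := lt_of_le_of_ne (k.2 i).1 (fun h => hi (Subtype.ext h.symm))
  obtain ⟨j, a, hja, ha⟩ := exists_eq_natCast_of_pos (k.1 i) h0 (k.2 i).2
  refine ⟨i, ?_⟩
  rw [ζ.char_gen i k.1 hja]
  exact (teichmuller_epsDiv_pow_sub_one_dvd h (j + 1) ha).trans
    (teichmuller_epsDiv_sub_one_dvd ζ j)

end Characters

/-! ### Quotients of complete rings by closed principal ideals -/

section Quotients

section Complete

variable {B C : Type*} [CommRing B] [CommRing C] {J : Ideal B} {c : B} {r : B →+* C}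

lemma exists_mem_pow_of_map_mem (hr : Function.Surjective r) {n : ℕ} {x : B}
    (hx : r x ∈ (J.map r) ^ n) : ∃ y ∈ J ^ n, r (x - y) = 0 := by
  rw [← Ideal.map_pow, Ideal.mem_map_iff_of_surjective r hr] at hx
  obtain ⟨y, hy, h⟩ := hx
  exact ⟨y, hy, by rw [map_sub, h, sub_self]⟩

/-- The quotient of a complete ring by a closed principal ideal is complete. -/
theorem AdicEmbedding.isAdicComplete_of_surjective [IsAdicComplete J B] (h : AdicEmbedding J c)
    (hr : Function.Surjective r) (hc : ∀ x, r x = 0 ↔ c ∣ x) : IsAdicComplete (J.map r) C := by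
  refine isAdicComplete_of_limits (fun y hy => ?_) (fun f hf => ?_)
  · obtain ⟨x, rfl⟩ := hr y
    refine (hc x).mpr (h.dvd_of_forall (fun n => ?_))
    obtain ⟨z, hz, hxz⟩ := exists_mem_pow_of_map_mem hr (hy n)
    obtain ⟨a, ha⟩ := (hc _).mp hxz
    exact ⟨a, by rwa [← ha, sub_sub_cancel]⟩
  · choose g hg using fun n => hr (f n)
    have hstep : ∀ n, ∃ j ∈ J ^ n, r j = f (n + 1) - f n := fun n => by
      have h1 := hf n
      rwa [← Ideal.map_pow, Ideal.mem_map_iff_of_surjective r hr] at h1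
    choose j hj hjf using hstep
    obtain ⟨L, hL⟩ := exists_adic_limit J (fun n => g 0 + ∑ i ∈ Finset.range n, j i) (fun n => by
      rw [Finset.sum_range_succ, add_sub_add_left_eq_sub, add_sub_cancel_left]
      exact hj n)
    have hF : ∀ n, r (g 0 + ∑ i ∈ Finset.range n, j i) = f n := fun n => by
      induction n with
      | zero => rw [Finset.sum_range_zero, add_zero, hg]
      | succ n ih => rw [Finset.sum_range_succ, ← add_assoc, map_add, ih, hjf, add_sub_cancel]
    refine ⟨r L, fun n => ?_⟩
    rw [← hF, ← map_sub, ← Ideal.map_pow]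
    exact Ideal.mem_map_of_mem r (hL n)

end Complete

lemma IsRegPair.adicEmbedding_left {B : Type*} [CommRing B] {π ξ : B} (h : IsRegPair π ξ) :
    AdicEmbedding (Ideal.span {π, ξ}) π := fun n =>
  ⟨(1 + n) + n, fun b hb => span_pow_pair_le n (h.mem_of_pow_mul_mem_left (a := 1) (by
    rw [pow_one]
    exact span_pair_pow_le _ _ hb))⟩

/-- An endomorphism which is trivial modulo a closed principal ideal on the base of an étale
algebra is so on its completion. -/
theorem dvd_map_sub_of_etale {Λ A B : Type u} [CommRing Λ] [CommRing A] [CommRing B] [Algebra Λ A]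
    [Algebra.FormallyUnramified Λ A] {e : A →+* B} {τ : B →+* B} {J : Ideal B}
    [IsAdicComplete J B] {c : B} (hc : AdicEmbedding J c) (hJ : ∀ x ∈ J, τ x ∈ J)
    (h : ∀ x, c ∣ τ (e (algebraMap Λ A x)) - e (algebraMap Λ A x))
    (h' : ∀ a, τ (e a) - e a ∈ J) (hd : ∀ b n, ∃ a, b - e a ∈ J ^ n) (b : B) : c ∣ τ b - b := by
  let r := Ideal.Quotient.mk (Ideal.span {c})
  have hr : ∀ x, r x = 0 ↔ c ∣ x := fun x => by
    rw [Ideal.Quotient.eq_zero_iff_mem, Ideal.mem_span_singleton]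
  have := hc.isAdicComplete_of_surjective (r := r) Ideal.Quotient.mk_surjective hr
  have h1 : ∀ a, c ∣ τ (e a) - e a := fun a => by
    rw [← hr, map_sub, sub_eq_zero]
    refine eq_of_sub_mem (Λ := Λ) (f := r.comp (τ.comp e)) (g := r.comp e) (I := J.map r)
      (fun x => ?_) (fun a => ?_) a
    · exact sub_eq_zero.mp (by rw [← (hr _).mpr (h x), map_sub]; rfl)
    · have h2 := Ideal.mem_map_of_mem r (h' a)
      rwa [map_sub] at h2
  have hJn : ∀ n, J ^ n ≤ (J ^ n).comap τ := fun n => by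
    rw [← Ideal.map_le_iff_le_comap, Ideal.map_pow]
    exact Ideal.pow_right_mono (Ideal.map_le_iff_le_comap.mpr hJ) n
  refine hc.dvd_of_forall (fun n => ?_)
  obtain ⟨a, ha⟩ := hd b n
  obtain ⟨y, hy⟩ := h1 a
  refine ⟨y, ?_⟩
  have h3 : τ (b - e a) ∈ J ^ n := hJn n ha
  have h4 := Ideal.sub_mem _ h3 ha
  rw [map_sub] at h4
  rw [← hy]
  convert h4 using 1
  ring

namespace IsStrict

variable {K : Type w} {A : Type u} {W : Type v} [CommRing A] [CommRing W] {ψ : A →+* W} {π ξ : A}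
  {u : K → W} (h : IsStrict ψ π ξ u)

include h

/-- The sequence `(π, ξ)` is also regular in the source of a strict homomorphism. -/
theorem isRegPair_source [Zero K] (hu : u 0 = 1) [IsAdicComplete (Ideal.span {π, ξ}) A]
    (hψ : Function.Injective ψ) : IsRegPair π ξ where
  left x hx := hψ (by
    rw [map_zero]
    refine h.isRegPair.left _ ?_
    rw [← map_mul, hx, map_zero])
  right x hx := by
    have h1 : AdicEmbedding (Ideal.span {π, ξ}) π := AdicEmbedding.of_map (j := ψ)
      (𝔧 := Ideal.span {ψ π, ψ ξ}) (map_span_pair ψ π ξ).le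
      (fun n => ⟨n + n, fun x hx => h.mem_pow_of_map hu n hx⟩) h.isRegPair.adicEmbedding_left
    refine h1.dvd_of_forall (fun n => ?_)
    obtain ⟨y, hy⟩ := hx
    obtain ⟨w, hw⟩ := h.isRegPair.right (ψ x) ⟨ψ y, by rw [← map_mul, hy, map_mul]⟩
    have h2 := h.mem_of_expand_pow (m := 1) (n := n) (a := Finsupp.single 0 x) (by
      rw [expand_single, hu, mul_one, hw]
      exact Ideal.mul_mem_right _ _ (Ideal.subset_span (by simp))) 0
    rw [Finsupp.single_eq_same] at h2
    obtain ⟨s, t, hst⟩ := mem_span_pair_pow.mp h2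
    refine ⟨s, ?_⟩
    rw [hst, pow_one, add_sub_cancel_left]
    exact Ideal.mul_mem_right _ _ (Ideal.pow_mem_pow (Ideal.subset_span (by simp)) n)

/-- The reduction of a topological basis modulo `π`. -/
theorem isTopBasis_quotient {A' W' : Type*} [CommRing A'] [CommRing W'] {r : A →+* A'}
    {s : W →+* W'} {ψ' : A' →+* W'} (hr : Function.Surjective r) (hs : Function.Surjective s)
    (hrπ : r π = 0) (hsπ : ∀ w, s w = 0 → ψ π ∣ w) (hc : ψ'.comp r = s.comp ψ) :
    IsTopBasis ψ' ((Ideal.span {π, ξ}).map r) (fun k => s (u k)) := by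
  have hI : ((Ideal.span {π, ξ}).map r).map ψ' = (Ideal.span {ψ π, ψ ξ}).map s := by
    rw [Ideal.map_map, hc, ← Ideal.map_map, map_span_pair]
  have hexp : ∀ a : K →₀ A, expand ψ' (fun k => s (u k)) (a.mapRange r (map_zero r)) =
      s (expand ψ u a) := fun a => by rw [map_expand, expand_mapRange, hc]
  refine ⟨fun w' => ?_, fun n => ⟨1 + n, fun a' ha k => ?_⟩⟩
  · obtain ⟨w, rfl⟩ := hs w'
    obtain ⟨a, ha⟩ := h.exists_expand w
    refine ⟨a.mapRange r (map_zero r), ?_⟩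
    rw [hexp, hI, ← map_sub]
    exact Ideal.mem_map_of_mem s ha
  · obtain ⟨a, rfl⟩ := Finsupp.mapRange_surjective r (map_zero r) hr a'
    rw [hI, hexp] at ha
    obtain ⟨j, hj, hsj⟩ := exists_mem_pow_of_map_mem hs ha
    obtain ⟨t, ht⟩ := hsπ _ hsj
    have h1 : expand ψ u a ∈ Ideal.span {ψ π ^ 1, ψ ξ ^ n} := by
      rw [sub_eq_iff_eq_add.mp ht]
      refine Ideal.add_mem _ (Ideal.mul_mem_right _ _ ?_) (span_pair_pow_le 1 n hj)
      exact Ideal.subset_span (by simp)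
    obtain ⟨x, y, hxy⟩ := mem_span_pair_pow.mp (h.mem_of_expand_pow h1 k)
    rw [Finsupp.mapRange_apply, hxy, map_add, map_mul, pow_one, hrπ, zero_mul, zero_add, map_mul,
      ← Ideal.map_pow]
    exact Ideal.mul_mem_right _ _ (Ideal.mem_map_of_mem r
      (Ideal.pow_mem_pow (Ideal.subset_span (by simp)) n))

end IsStrict

lemma IsHull.exists_sub_hom_mem {K : Type w} [Zero K] {A : Type u} {W : Type v} [CommRing A]
    [CommRing W] {ψ : A →+* W} {π ξ : A} {u : K → W} (hu : u 0 = 1) {S : Subring W}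
    (hS : IsHull ψ π ξ u S) (s : S) (n : ℕ) :
    ∃ a, s - hS.hom a ∈ (Ideal.span {hS.hom π, hS.hom ξ}) ^ n := by
  rw [← IsStrict.map_span_pair]
  refine exists_sub_mem_pow (fun b => ?_) s n
  obtain ⟨a, ha⟩ := hS.dense b b.2
  refine ⟨a, ?_⟩
  rw [IsStrict.map_span_pair]
  exact hS.strict.mem_of_map hu ha

variable {G : Type v} [CommGroup G] {B B' : Type u} [CommRing B] [MulSemiringAction G B]
  [CommRing B'] [MulSemiringAction G B'] {K : Type w} [Zero K] {ι : B →+*[G] B'} {J : Ideal B}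
  {u : K → B'} {c₀ c₁ ν : B}

open Classical in
/-- A topological basis consisting of eigenvectors for `G` yields a decomposition. -/
def IsTopBasis.descentDatum (h : IsTopBasis (ι : B →+* B') J u) (hu : u 0 = 1)
    (hB : IsAdicComplete J B) (hB' : IsAdicComplete (J.map (ι : B →+* B')) B')
    (hJ : ∀ g : G, ∀ b ∈ J, g • b ∈ J) (χ : K → G → B)
    (hχ : ∀ (g : G) k, g • u k = ι (χ k g) * u k) (gen : K → G) (hgen : (Set.range gen).Finite)
    (hc : c₁ = c₀ * ν) (hν : ∀ k, k ≠ 0 → χ k (gen k) - 1 ∣ ν) (hc₀ : ∀ g : G, g • c₀ = c₀)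
    (hc₁ : ∀ g : G, g • c₁ = c₁) (hsmul : ∀ (g : G) (b : B), c₁ ∣ g • b - b)
    (hemb : AdicEmbedding J c₁) (N : ℕ) (hN : c₀ ^ N ∈ J) : DescentDatum ι J K c₀ c₁ where
  χ := χ
  pr := h.pr
  pr_mul := h.pr_mul
  pr_smul k g x := h.pr_eq (IsTopBasis.rel_map (σ := MulSemiringAction.toRingHom G B g)
    (τ := MulSemiringAction.toRingHom G B' g) (fun k => χ k g) (hJ g)
    (fun b => (map_smul ι g b).symm) (hχ g) (h.rel_pr x)) k
  finite_pr := h.finite_pr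
  ext_pr _ hx := h.ext_pr hx
  exists_pr _ hf := h.exists_pr hf
  pr_zero b := by
    have h1 := h.pr_ι_mul 0 0 b
    rwa [hu, mul_one, if_pos rfl] at h1
  pr_ne_zero k hk b := by
    have h1 := h.pr_ι_mul 0 k b
    rwa [hu, mul_one, if_neg hk.symm] at h1
  complete := hB
  complete' := hB'
  gen := gen
  finite_gen := hgen
  ν := ν
  c₁_eq := hc
  gen_dvd := hν
  smul_c₀ := hc₀
  smul_c₁ := hc₁
  dvd_smul_sub := hsmul
  embedding := hemb
  N := N
  pow_mem := hN

end Quotients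

/-! ### Continuity of the action of `Γ` -/

section Continuity

open Topology

variable {p : ℕ} [Fact p.Prime] {O : Type u} [CommRing O] {d : ℕ}

lemma Gam.eventually_eval_eq (γ₀ : Gam p O d) (k : Expo p d) :
    ∀ᶠ γ in 𝓝 γ₀, γ.eval k = γ₀.eval k := by
  let _ : TopologicalSpace Oˣ := ⊥
  have : DiscreteTopology Oˣ := ⟨rfl⟩
  have h1 : Continuous (fun γ : Gam p O d => γ.eval k) :=
    (continuous_apply k).comp (continuous_induced_dom (f := fun (γ : Gam p O d) k => γ.eval k))
  have h2 : ∀ᶠ χ in 𝓝 (γ₀.eval k), χ = γ₀.eval k := mem_nhds_discrete.mpr rfl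
  exact (h1.tendsto γ₀).eventually h2

variable {R : Type u} [CommRing R] [Nontrivial R] [IsAdicComplete (Ideal.span {(p : R)}) R]
  (sq : TateLaurent p O d →+* R)

lemma eventually_modPMap_eq (γ₀ : Gam p O d) (z : ModP (RInf sq) p) :
    ∀ᶠ γ in 𝓝 γ₀, modPMap p (actRInf sq γ) z = modPMap p (actRInf sq γ₀) z := by
  obtain ⟨a, rfl⟩ := exists_expand_modP sq z
  induction a using Finsupp.induction_linear with
  | zero => simp
  | add x y hx hy =>
    filter_upwards [hx, hy] with γ h1 h2
    rw [map_add, map_add, map_add, h1, h2]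
  | single k r =>
    filter_upwards [γ₀.eventually_eval_eq k.1] with γ h1
    rw [expand_single, map_mul, map_mul]
    change _ * Ideal.Quotient.mk _ (actRInf sq γ (monRInf sq k.1)) =
      _ * Ideal.Quotient.mk _ (actRInf sq γ₀ (monRInf sq k.1))
    rw [actRInf_monRInf, actRInf_monRInf, h1]
    congr 1
    change Ideal.Quotient.mk _ (actRInf sq γ (baseRInf sq r)) =
      Ideal.Quotient.mk _ (actRInf sq γ₀ (baseRInf sq r))
    rw [actRInf_baseRInf, actRInf_baseRInf]

variable [Fact (¬IsUnit (p : O))] {sq} {ξ : AInf p O}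

/-- The action of `Γ` on `A_inf(R_∞)` is continuous. -/
theorem eventually_smul_sub_smul_mem (h' : IsTiltingXi (aInfToR sq ξ)) (x : AInfR sq) (n : ℕ)
    (γ₀ : Gam p O d) :
    ∀ᶠ γ in 𝓝 γ₀, γ • x - γ₀ • x ∈ (Ideal.span {(p : AInfR sq), aInfToR sq ξ}) ^ n := by
  have hp : (p : AInfR sq) ∈ Ideal.span {(p : AInfR sq), aInfToR sq ξ} :=
    Ideal.subset_span (by simp)
  have hT : ∀ y : PreTilt (RInf sq) p, ∀ᶠ γ in 𝓝 γ₀,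
      γ • (WittVector.teichmuller p y : AInfR sq) - γ₀ • (WittVector.teichmuller p y : AInfR sq) ∈
        (Ideal.span {(p : AInfR sq), aInfToR sq ξ}) ^ n := fun y => by
    filter_upwards [eventually_modPMap_eq sq γ₀ (PreTilt.coeff n y)] with γ hγ
    rw [smul_aInfR, smul_aInfR, aInfMap, aInfMap, WittVector.map_teichmuller,
      WittVector.map_teichmuller]
    exact Ideal.pow_le_pow_right n.le_succ (h'.teichmuller_sub_mem n (by
      rw [coeff_tiltMap, coeff_tiltMap, hγ]))
  obtain ⟨c, hc⟩ := WittVector.dvd_sub_sum_teichmuller_iterateFrobeniusEquiv_coeff x n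
  have hall := (Finset.eventually_all (Finset.Iic n)).mpr
    (fun i _ => hT (((frobeniusEquiv (PreTilt (RInf sq) p) p).symm ^ i) (x.coeff i)))
  filter_upwards [hall] with γ hγ
  rw [sub_eq_iff_eq_add] at hc
  have h1 : ∀ δ : Gam p O d, δ • x = p ^ (n + 1) * δ • c + ∑ i ∈ Finset.Iic n,
      δ • (WittVector.teichmuller p (((frobeniusEquiv (PreTilt (RInf sq) p) p).symm ^ i)
        (x.coeff i)) : AInfR sq) * p ^ i := fun δ => by
    have h2 := congrArg (MulSemiringAction.toRingHom (Gam p O d) (AInfR sq) δ) hc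
    rw [map_add, map_mul, map_pow, map_natCast, map_sum] at h2
    simp only [map_mul, map_pow, map_natCast] at h2
    exact h2
  rw [h1 γ, h1 γ₀, add_sub_add_comm, ← mul_sub, ← Finset.sum_sub_distrib]
  refine Ideal.add_mem _ (Ideal.mul_mem_right _ _ (Ideal.pow_le_pow_right n.le_succ
    (Ideal.pow_mem_pow hp _))) (sum_mem (fun i hi => ?_))
  rw [← sub_mul]
  exact Ideal.mul_mem_right _ _ (hγ i hi)

end Continuity

/-! ### Descent for the framed period ring -/

section FramedDescent

open Topology

lemma smul_mem_map_of_fixed {G : Type v} [Group G] {A B : Type*} [CommRing A] [CommRing B]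
    [MulSemiringAction G B] {f : A →+* B} (hf : ∀ (g : G) a, g • f a = f a) (I : Ideal A) (g : G)
    {b : B} (hb : b ∈ I.map f) : g • b ∈ I.map f := by
  have h1 : I.map f ≤ (I.map f).comap (MulSemiringAction.toRingHom G B g) := by
    rw [Ideal.map_le_iff_le_comap]
    intro a ha
    change g • f a ∈ I.map f
    rw [hf]
    exact Ideal.mem_map_of_mem f ha
  exact h1 hb

lemma IsRegPair.adicEmbedding_quotient {B C : Type*} [CommRing B] [CommRing C] {π ξ c : B}
    (h : IsRegPair π ξ) {N : ℕ} (hc : ξ ^ N ∈ Ideal.span {π, c}) {r : B →+* C}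
    (hr : Function.Surjective r) (hπ : ∀ x, r x = 0 ↔ π ∣ x) :
    AdicEmbedding ((Ideal.span {π, ξ}).map r) (r c) := fun n => by
  refine ⟨1 + (N + n), fun b hb => ?_⟩
  obtain ⟨b, rfl⟩ := hr b
  rw [← map_mul] at hb
  obtain ⟨j, hj, hsj⟩ := exists_mem_pow_of_map_mem hr hb
  obtain ⟨t, ht⟩ := (hπ _).mp hsj
  obtain ⟨a', a, ha⟩ := Ideal.mem_span_pair.mp hc
  have h1 : c * b ∈ Ideal.span {π ^ 1, ξ ^ (N + n)} := by
    rw [sub_eq_iff_eq_add.mp ht]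
    exact Ideal.add_mem _ (Ideal.mul_mem_right _ _ (Ideal.subset_span (by simp)))
      (span_pair_pow_le 1 _ hj)
  have h2 : ξ ^ N * b ∈ Ideal.span {π ^ 1, ξ ^ (N + n)} := by
    rw [← ha, show (a' * π + a * c) * b = π ^ 1 * (a' * b) + a * (c * b) by ring]
    exact Ideal.add_mem _ (Ideal.mul_mem_right _ _ (Ideal.subset_span (by simp)))
      (Ideal.mul_mem_left _ _ h1)
  obtain ⟨x, y, hxy⟩ := mem_span_pair_pow.mp (h.mem_of_pow_mul_mem_right h2)
  rw [hxy, map_add, map_mul, pow_one, (hπ π).mpr (dvd_refl _), zero_mul, zero_add, map_mul,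
    ← Ideal.map_pow]
  exact Ideal.mul_mem_right _ _ (Ideal.mem_map_of_mem r
    (Ideal.pow_mem_pow (Ideal.subset_span (by simp)) n))

lemma toRedP_eq_zero_iff {p : ℕ} {B : Type u} [CommRing B] (x : B) :
    toRedP p B x = 0 ↔ (p : B) ∣ x := by
  rw [← Ideal.mem_span_singleton]
  exact Ideal.Quotient.eq_zero_iff_mem

variable {p : ℕ} [Fact p.Prime] {O : Type u} [CommRing O] [IsDomain O] [Fact (¬IsUnit (p : O))]
  {ζ : PRoots p O} {d : ℕ}

variable (d) in
lemma exists_generators (h₀ : IsTiltingXi ζ.xi) : ∃ gen : FracExpo p d → Gam p O d,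
    (Set.range gen).Finite ∧ ∀ k, k ≠ 0 → (gen k).char k.1 - 1 ∣ ζ.phiInvMu := by
  classical
  let gen : FracExpo p d → Gam p O d := fun k =>
    if h : k ≠ 0 then ζ.gen (exists_char_gen_sub_one_dvd ζ h₀ h).choose else 1
  refine ⟨gen, ((Set.finite_range ζ.gen).insert 1).subset ?_, fun k hk => ?_⟩
  · rintro _ ⟨k, rfl⟩
    by_cases h : k ≠ 0
    · refine Or.inr ?_
      change (dite (k ≠ 0) _ _ : Gam p O d) ∈ _
      rw [dif_pos h]
      exact ⟨_, rfl⟩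
    · exact Or.inl (dif_neg h)
  · change (dite (k ≠ 0) _ _ : Gam p O d).char k.1 - 1 ∣ _
    rw [dif_pos hk]
    exact (exists_char_gen_sub_one_dvd ζ h₀ hk).choose_spec

variable {R : Type u} [CommRing R] [Nontrivial R] [IsAdicComplete (Ideal.span {(p : R)}) R]
  {sq : TateLaurent p O d →+* R} {P : StableSubring sq}

/-- The properties of the framed period ring which are used in the descent. -/
structure IsStrictSubring (ζ : PRoots p O) (P : StableSubring sq) : Prop where
  base : IsTiltingXi ζ.xi
  total : IsTiltingXi (aInfToR sq ζ.xi)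
  strict : IsStrict P.val (p : P.Ring) (P.base ζ.xi) (basisW sq)
  complete : IsAdicComplete (Ideal.span {(p : P.Ring), P.base ζ.xi}) P.Ring
  mu_dvd : ∀ (γ : Gam p O d) (x : P.Ring), P.base ζ.mu ∣ γ • x - x

namespace IsStrictSubring

variable (h : IsStrictSubring ζ P)

include h

lemma isRegPair : IsRegPair (p : P.Ring) (P.base ζ.xi) :=
  have := h.complete
  h.strict.isRegPair_source (basisW_zero sq) P.val_injective

lemma map_incl : (ζ.pxIdeal.map P.base).map (P.incl : P.Ring →+* AInfR sq) =
    ζ.pxIdeal.map (aInfToR sq) := Ideal.map_map _ _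

lemma exists_descentDatum {c₀ c₁ : AInf p O} (hc : c₁ = c₀ * ζ.phiInvMu) (hc₁ : c₁ ∣ ζ.mu)
    {N : ℕ} (hN : c₀ ^ N ∈ ζ.pxIdeal) : Nonempty (DescentDatum P.incl (ζ.pxIdeal.map P.base)
      (FracExpo p d) (P.base c₀) (P.base c₁)) := by
  obtain ⟨gen, hgen, hgen'⟩ := exists_generators d h.base
  have hT : IsTopBasis (P.incl : P.Ring →+* AInfR sq) (ζ.pxIdeal.map P.base) (basisW sq) := by
    rw [map_pxIdeal]
    exact h.strict.isTopBasis
  refine ⟨hT.descentDatum (basisW_zero sq) ?_ ?_ (fun g _ hb => smul_mem_map_of_fixed P.smul_base _ g hb)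
    (fun k g => P.base (g.char k.1)) (fun g k => smul_monW sq g k.1) gen hgen
    (ν := P.base ζ.phiInvMu) (by rw [hc, map_mul]) (fun k hk => ?_) (fun g => P.smul_base g _)
    (fun g => P.smul_base g _) (fun g b => (map_dvd P.base hc₁).trans (h.mu_dvd g b))
    ?_ N ?_⟩
  · rw [map_pxIdeal]
    exact h.complete
  · rw [h.map_incl, map_pxIdeal]
    exact h.total.isAdicComplete
  · have h1 := map_dvd P.base (hgen' k hk)
    rwa [map_sub, map_one] at h1
  · rw [map_pxIdeal]
    exact (adicEmbedding_mu ζ P.base h.isRegPair).of_dvd (map_dvd P.base hc₁)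
  · rw [← map_pow]
    exact Ideal.mem_map_of_mem _ hN

lemma eventually_mem (x : AInfR sq) (n : ℕ) (γ₀ : Gam p O d) : ∀ᶠ γ in 𝓝 γ₀, γ • x - γ₀ • x ∈
    ((ζ.pxIdeal.map P.base).map (P.incl : P.Ring →+* AInfR sq)) ^ n := by
  rw [h.map_incl, map_pxIdeal]
  exact eventually_smul_sub_smul_mem h.total x n γ₀

theorem isRepEquivalence {c₀ c₁ : AInf p O} (hc : c₁ = c₀ * ζ.phiInvMu) (hc₁ : c₁ ∣ ζ.mu)
    {N : ℕ} (hN : c₀ ^ N ∈ ζ.pxIdeal) :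
    IsRepEquivalence P.incl (ζ.pxIdeal.map P.base) (ζ.pxIdeal.map (aInfToR sq))
      (P.base c₁) (aInfToR sq c₁) := by
  obtain ⟨D⟩ := h.exists_descentDatum hc hc₁ hN
  have h1 := D.isRepEquivalence (fun g _ hb => smul_mem_map_of_fixed P.smul_base _ g hb) h.eventually_mem
  rwa [h.map_incl] at h1

end IsStrictSubring

end FramedDescent

/-! ### Descent modulo `p` and with Frobenius structures -/

section Variants

open Topology

lemma Loc.isInvariantLoc_incl {G : Type v} [CommGroup G] {B : Type u} [CommRing B]
    [MulSemiringAction G B] {b : B} (hb : ∀ g : G, g • b = b) (h : ∀ x, b * x = 0 → x = 0) :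
    IsInvariantLoc (Loc.incl hb) b where
  fixed := hb
  isUnit := IsLocalization.Away.algebraMap_isUnit (S := Loc b hb) b
  injective := IsLocalization.injective (Loc b hb) (M := Submonoid.powers b) (by
    refine Submonoid.powers_le.mpr ?_
    rw [mem_nonZeroDivisors_iff_left]
    exact h)
  exists_pow_mul y := by
    obtain ⟨n, a, ha⟩ := IsLocalization.Away.surj b y
    exact ⟨n, a, by rw [mul_comm]; exact ha⟩

variable {p : ℕ} [Fact p.Prime] {O : Type u} [CommRing O] [IsDomain O] [Fact (¬IsUnit (p : O))]
  {ζ : PRoots p O} {d : ℕ} {R : Type u} [CommRing R] [Nontrivial R]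
  [IsAdicComplete (Ideal.span {(p : R)}) R] {sq : TateLaurent p O d →+* R} {P : StableSubring sq}

lemma PRoots.frobenius_mu (ζ : PRoots p O) : WittVector.frobenius ζ.mu = ζ.xiTilde * ζ.mu := by
  have h1 := congrArg (WittVector.frobenius (p := p)) ζ.xi_mul_phiInvMu
  rw [map_mul] at h1
  rw [← h1]
  congr 1
  exact (WittVector.frobeniusEquiv p (PreTilt O p)).apply_symm_apply ζ.mu

lemma xiTilde_mul_eq_zero (h : IsTiltingXi (aInfToR sq ζ.xi)) {x : AInfR sq}
    (hx : aInfToR sq ζ.xiTilde * x = 0) : x = 0 := by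
  have := h.isAdicComplete
  obtain ⟨y, rfl⟩ := (WittVector.frobeniusEquiv p (PreTilt (RInf sq) p)).surjective x
  have h1 : WittVector.frobenius (aInfToR sq ζ.xi * y) = 0 := by
    rw [map_mul, ← aInfToR_frobenius]
    exact hx
  have h2 : aInfToR sq ζ.xi * y = 0 :=
    (WittVector.frobeniusEquiv p (PreTilt (RInf sq) p)).injective (h1.trans (map_zero _).symm)
  have h3 : AdicEmbedding (Ideal.span {(p : AInfR sq), aInfToR sq ζ.xi}) (aInfToR sq ζ.xi) :=
    h.isRegPair.adicEmbedding (N := 1) (by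
      rw [pow_one]
      exact Ideal.subset_span (by simp))
  rw [h3.eq_zero h2, map_zero]

namespace IsStrictSubring

variable (h : IsStrictSubring ζ P)

include h

lemma map_toRedP : (ζ.pxIdeal.map (toRedP p (AInf p O))).map (redP p P.base) =
    (Ideal.span {(p : P.Ring), P.base ζ.xi}).map (toRedP p P.Ring) := by
  rw [← map_pxIdeal P.base, Ideal.map_map, Ideal.map_map]
  rfl

lemma map_redP : ((ζ.pxIdeal.map (toRedP p (AInf p O))).map (redP p P.base)).map
      (redPEquiv p P.incl : RedP p P.Ring →+* RedP p (AInfR sq)) =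
    (Ideal.span {(p : AInfR sq), aInfToR sq ζ.xi}).map (toRedP p (AInfR sq)) := by
  rw [← map_pxIdeal (aInfToR sq), Ideal.map_map, Ideal.map_map, Ideal.map_map]
  rfl

omit h in
lemma smul_redP_base (γ : Gam p O d) (a : RedP p (AInf p O)) :
    γ • redP p P.base a = redP p P.base a := by
  obtain ⟨b, rfl⟩ := toRedP_surjective p a
  exact congrArg (toRedP p P.Ring) (P.smul_base γ b)

lemma exists_descentDatum_redP {c₀ c₁ : RedP p (AInf p O)} (hc : c₁ = c₀ * toRedP p _ ζ.phiInvMu)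
    (hc₁ : c₁ ∣ toRedP p _ ζ.mu) {N : ℕ} (hN : c₀ ^ N ∈ ζ.pxIdeal.map (toRedP p (AInf p O))) :
    Nonempty (DescentDatum (redPEquiv p P.incl)
      ((ζ.pxIdeal.map (toRedP p (AInf p O))).map (redP p P.base)) (FracExpo p d)
      (redP p P.base c₀) (redP p P.base c₁)) := by
  have := h.complete
  have := h.total.isAdicComplete
  obtain ⟨gen, hgen, hgen'⟩ := exists_generators d h.base
  have hT : IsTopBasis (redPEquiv p P.incl : RedP p P.Ring →+* RedP p (AInfR sq))
      ((ζ.pxIdeal.map (toRedP p (AInf p O))).map (redP p P.base))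
      (fun k => toRedP p _ (basisW sq k)) := by
    rw [h.map_toRedP]
    exact h.strict.isTopBasis_quotient (toRedP_surjective p) (toRedP_surjective p)
      ((toRedP_eq_zero_iff _).mpr (dvd_refl _))
      (fun w hw => by rw [map_natCast]; exact (toRedP_eq_zero_iff w).mp hw) rfl
  refine ⟨hT.descentDatum ?_ ?_ ?_
    (fun g _ hb => smul_mem_map_of_fixed smul_redP_base _ g hb)
    (fun k g => redP p P.base (toRedP p _ (g.char k.1)))
    (fun g k => congrArg (toRedP p (AInfR sq)) (smul_monW sq g k.1)) gen hgen
    (ν := redP p P.base (toRedP p _ ζ.phiInvMu)) (by rw [hc, map_mul]) (fun k hk => ?_)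
    (fun g => smul_redP_base g _) (fun g => smul_redP_base g _) (fun g b => ?_) ?_ N ?_⟩
  · rw [basisW_zero, map_one]
  · rw [h.map_toRedP]
    exact h.isRegPair.adicEmbedding_left.isAdicComplete_of_surjective (toRedP_surjective p)
      toRedP_eq_zero_iff
  · rw [h.map_redP]
    exact h.total.isRegPair.adicEmbedding_left.isAdicComplete_of_surjective (toRedP_surjective p)
      toRedP_eq_zero_iff
  · have h1 := map_dvd ((redP p P.base).comp (toRedP p _)) (hgen' k hk)
    rwa [map_sub, map_one] at h1
  · obtain ⟨b, rfl⟩ := toRedP_surjective p b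
    exact (map_dvd (redP p P.base) hc₁).trans (map_dvd (toRedP p P.Ring) (h.mu_dvd g b))
  · rw [h.map_toRedP]
    refine AdicEmbedding.of_dvd (c := toRedP p P.Ring (P.base ζ.mu)) ?_
      (map_dvd (redP p P.base) hc₁)
    refine h.isRegPair.adicEmbedding_quotient (N := p) ?_ (toRedP_surjective p) toRedP_eq_zero_iff
    have h1 := Ideal.mem_map_of_mem P.base (xi_pow_mem ζ)
    rwa [IsStrict.map_span_pair, map_natCast, map_pow] at h1
  · rw [← map_pow]
    exact Ideal.mem_map_of_mem _ hN

theorem isRepEquivalence_redP {c₀ c₁ : RedP p (AInf p O)} (hc : c₁ = c₀ * toRedP p _ ζ.phiInvMu)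
    (hc₁ : c₁ ∣ toRedP p _ ζ.mu) {N : ℕ} (hN : c₀ ^ N ∈ ζ.pxIdeal.map (toRedP p (AInf p O))) :
    IsRepEquivalence (redPEquiv p P.incl) ((ζ.pxIdeal.map (toRedP p _)).map (redP p P.base))
      ((ζ.pxIdeal.map (toRedP p _)).map (redP p (aInfToR sq)))
      (redP p P.base c₁) (redP p (aInfToR sq) c₁) := by
  obtain ⟨D⟩ := h.exists_descentDatum_redP hc hc₁ hN
  have h1 := D.isRepEquivalence
    (fun g _ hb => smul_mem_map_of_fixed smul_redP_base _ g hb) (fun x n γ₀ => by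
      obtain ⟨w, rfl⟩ := toRedP_surjective p x
      filter_upwards [eventually_smul_sub_smul_mem h.total w n γ₀] with γ hγ
      rw [h.map_redP, ← Ideal.map_pow]
      have h2 := Ideal.mem_map_of_mem (toRedP p (AInfR sq)) hγ
      rwa [map_sub] at h2)
  have h3 : ((ζ.pxIdeal.map (toRedP p (AInf p O))).map (redP p P.base)).map
      (redPEquiv p P.incl : RedP p P.Ring →+* RedP p (AInfR sq)) =
      (ζ.pxIdeal.map (toRedP p _)).map (redP p (aInfToR sq)) := by
    rw [Ideal.map_map]
    congr 1
    refine RingHom.ext (fun a => ?_)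
    obtain ⟨b, rfl⟩ := toRedP_surjective p a
    rfl
  have h4 : redPEquiv p P.incl (redP p P.base c₁) = redP p (aInfToR sq) c₁ := by
    obtain ⟨b, rfl⟩ := toRedP_surjective p c₁
    rfl
  rwa [h3, h4] at h1

omit h in
lemma xi_pow_one_mem : ζ.xi ^ 1 ∈ ζ.pxIdeal := by
  rw [pow_one]
  exact Ideal.subset_span (by simp)

theorem isRepFrobEquivalence : IsRepFrobEquivalence (φ := P.frob)
    (l := Loc.incl (P.xiTilde_fixed ζ)) (φ' := frobAInfR sq) (l' := Loc.incl (xiTilde_fixed sq ζ))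
    P.incl (Loc.map (P.xiTilde_fixed ζ) (xiTilde_fixed sq ζ) P.incl (P.incl_base ζ.xiTilde))
    P.frob_incl
    (Loc.map_incl (P.xiTilde_fixed ζ) (xiTilde_fixed sq ζ) P.incl (P.incl_base ζ.xiTilde))
    (ζ.pxIdeal.map P.base) (ζ.pxIdeal.map (aInfToR sq)) (P.base ζ.mu) (aInfToR sq ζ.mu) := by
  obtain ⟨D⟩ := h.exists_descentDatum ζ.xi_mul_phiInvMu.symm (dvd_refl _) xi_pow_one_mem
  have h1 := D.isRepFrobEquivalence (φ := P.frob) (l := Loc.incl (P.xiTilde_fixed ζ))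
    (φ' := frobAInfR sq) (l' := Loc.incl (xiTilde_fixed sq ζ)) (t := P.base ζ.xiTilde)
    (fun g _ hb => smul_mem_map_of_fixed P.smul_base _ g hb) h.eventually_mem P.frob_incl
    (Loc.map_incl (P.xiTilde_fixed ζ) (xiTilde_fixed sq ζ) P.incl (P.incl_base ζ.xiTilde))
    (Loc.isInvariantLoc_incl _ (fun x hx => P.val_injective (by
      rw [map_zero]
      refine xiTilde_mul_eq_zero (ζ := ζ) h.total ?_
      rw [← P.val_base, ← map_mul, hx, map_zero])))
    (Loc.isInvariantLoc_incl (xiTilde_fixed sq ζ) (fun x hx => xiTilde_mul_eq_zero h.total hx))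
    ⟨P.base ζ.xiTilde, P.val_injective (by
      change WittVector.frobenius (aInfToR sq ζ.mu) = aInfToR sq ζ.mu * aInfToR sq ζ.xiTilde
      rw [← aInfToR_frobenius, ζ.frobenius_mu, map_mul, mul_comm])⟩
  rwa [h.map_incl] at h1

end IsStrictSubring

end Variants

/-! ### The action on the hull is trivial modulo `μ` -/

section HullStrict

variable {p : ℕ} [Fact p.Prime] {O : Type u} [CommRing O] [IsDomain O] [Fact (¬IsUnit (p : O))]
  {ζ : PRoots p O} {d : ℕ} {R : Type u} [CommRing R] [Nontrivial R]
  [IsAdicComplete (Ideal.span {(p : R)}) R] {sq : TateLaurent p O d →+* R}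

lemma mu_dvd_smul_uMap_sub (h₀ : IsTiltingXi ζ.xi) (γ : Gam p O d) (x : Laurent (AInf p O) d) :
    ∃ y, γ • uMap sq x - uMap sq x = aInfToR sq ζ.mu * uMap sq y := by
  induction x using AddMonoidAlgebra.induction_linear with
  | zero => exact ⟨0, by rw [map_zero, smul_zero, sub_zero, mul_zero]⟩
  | add x y hx hy =>
    obtain ⟨x', hx⟩ := hx
    obtain ⟨y', hy⟩ := hy
    exact ⟨x' + y', by rw [map_add, smul_add, add_sub_add_comm, hx, hy, map_add, mul_add]⟩
  | single m a =>
    obtain ⟨c, hc⟩ := mu_dvd_char_sub_one h₀ γ m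
    have h1 : a * γ.char (intExp p d m) - a = ζ.mu * (a * c) := by linear_combination a * hc
    refine ⟨AddMonoidAlgebra.single m (a * c), ?_⟩
    rw [smul_uMap_single, ← map_sub, ← AddMonoidAlgebra.single_sub, h1, uMap_single, uMap_single,
      map_mul, mul_assoc]

variable {A : Type u} [CommRing A] [Algebra (Laurent (AInf p O) d) A] {q : A →+* ModP R p}
  {ψ : A →+* AInfR sq}

theorem IsModelLift.isStrictSubring (h₀ : IsTiltingXi ζ.xi) (h' : IsTiltingXi (aInfToR sq ζ.xi))
    (hq : IsModel sq ζ.xi q) (hψ : IsModelLift sq q ψ) {P : StableSubring sq}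
    (hS : IsHull ψ (p : A) (toModel d A ζ.xi) (basisW sq) P.toSubring) : IsStrictSubring ζ P := by
  have := hq.etale
  let e : A →+* P.Ring := hS.hom
  have h2 : e p = (p : P.Ring) := map_natCast e p
  have h3 : e (toModel d A ζ.xi) = P.base ζ.xi := P.val_injective (hψ.map_toModel sq ζ.xi)
  have hst : IsStrict P.val (e p) (e (toModel d A ζ.xi)) (basisW sq) := hS.strict
  have hcp : IsAdicComplete (Ideal.span {e p, e (toModel d A ζ.xi)}) P.Ring := hS.complete
  have hd : ∀ (b : P.Ring) n, ∃ a, b - e a ∈ (Ideal.span {e p, e (toModel d A ζ.xi)}) ^ n :=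
    hS.exists_sub_hom_mem (basisW_zero sq)
  rw [h2, h3] at hst hcp
  simp only [h2, h3] at hd
  refine ⟨h₀, h', hst, hcp, fun γ x => ?_⟩
  refine dvd_map_sub_of_etale (Λ := Laurent (AInf p O) d) (e := e)
    (τ := MulSemiringAction.toRingHom (Gam p O d) P.Ring γ)
    (J := Ideal.span {(p : P.Ring), P.base ζ.xi})
    (adicEmbedding_mu ζ P.base (hst.isRegPair_source (basisW_zero sq) P.val_injective))
    (fun x hx => ?_) (fun x => ?_) (fun a => hst.mem_of_map (basisW_zero sq) ?_) hd x
  · rw [← map_pxIdeal] at hx ⊢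
    exact smul_mem_map_of_fixed P.smul_base _ γ hx
  · obtain ⟨y, hy⟩ := mu_dvd_smul_uMap_sub (sq := sq) h₀ γ x
    refine ⟨⟨uMap sq y, P.uMap_mem y⟩, P.val_injective ?_⟩
    rw [← hψ.map_algebraMap] at hy
    exact hy
  · have h4 := hψ.smul_sub_mem h' γ a
    rw [map_natCast]
    exact h4

end HullStrict

/-! ### The main theorem -/

section Main

variable {p : ℕ} [Fact p.Prime] {C : Type u} [NontriviallyNormedField C] [IsUltrametricDist C]
  [CharZero C] [IsPerfectoidField p C] (ζ : PRoots p (IntegerRing C)) {d : ℕ}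

lemma exists_pow_mem_pxIdeal {c : AInf p (IntegerRing C)} (hc : ¬IsUnit c) :
    ∃ N, c ^ N ∈ ζ.pxIdeal := by
  obtain ⟨N, hN⟩ := isNilpotent_modP (fun h => hc ((isTiltingXi_xi ζ).isUnit_of_map h))
  refine ⟨N, (isTiltingXi_xi ζ).mem_iff.mpr ?_⟩
  rw [map_pow, hN]

variable {R : Type u} [CommRing R] [Nontrivial R] [IsAdicComplete (Ideal.span {(p : R)}) R]
  {sq : TateLaurent p (IntegerRing C) d →+* R}

/-- The framed period ring exists, is unique, and is stable under `Γ` and the Frobenius. -/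
theorem exists_framedPeriodRing
    (hsq : AdicEtale (Ideal.span {(p : TateLaurent p (IntegerRing C) d)}) sq) :
    ∃ P : StableSubring sq, IsFramedPeriodRing ζ sq P.toSubring ∧
      (∀ S : Subring (AInfR sq), IsFramedPeriodRing ζ sq S → S = P.toSubring) ∧
      IsStrictSubring ζ P := by
  have h₀ := isTiltingXi_xi ζ
  have hp : (p : IntegerRing C) ≠ 0 := Nat.cast_ne_zero.mpr (Fact.out : p.Prime).ne_zero
  have hR := natCast_mul_framed (fun x hx => (mul_eq_zero.mp hx).resolve_left hp) hsq
  obtain ⟨A, _, _, hA, q, hqs, hqk, hqa⟩ := exists_etale_model sq h₀ hsq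
  have hq : IsModel sq ζ.xi q := ⟨hA, hqs, hqk, hqa⟩
  have h' : IsTiltingXi (aInfToR sq ζ.xi) := isTiltingXi_aInfToR sq h₀ hqs hqk hqa
  have hθ := fontaineTheta_xi ζ sq
  obtain ⟨ψ, hψ⟩ := exists_modelLift sq h' hq
  obtain ⟨S, hS, hU, he⟩ := hψ.exists_hull h' hq
  have := hψ.isHausdorff h'
  exact ⟨⟨S, hU, fun γ x hx => hψ.smul_mem_hull h' hq hS γ hx,
    fun x hx => hψ.frobenius_mem_hull h' hq hS hx⟩,
    hψ.isFramedPeriodRing hR h' hq hθ hS hU he,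
    fun S' hS' => (hψ.isHull h' hq hS').eq (basisW_zero sq) hS,
    hψ.isStrictSubring h₀ h' hq hS⟩

end Main

end SmallRep

end

theorem mainTheorem1 (p : ℕ) [Fact p.Prime] (C : Type u) [NontriviallyNormedField C]
    [IsUltrametricDist C] [CharZero C] [IsPerfectoidField p C] (ζ : PRoots p (IntegerRing C))
    (d : ℕ) (R : Type u) [CommRing R] [Nontrivial R] [IsAdicComplete (Ideal.span {(p : R)}) R]
    (sq : TateLaurent p (IntegerRing C) d →+* R)
    (hsq : AdicEtale (Ideal.span {(p : TateLaurent p (IntegerRing C) d)}) sq) :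
    -- the framed period ring: existence, uniqueness, stability under `Γ` and the Frobenius
    ∃ P : StableSubring sq, IsFramedPeriodRing ζ sq P.toSubring ∧
      (∀ S : Subring (AInfR sq), IsFramedPeriodRing ζ sq S → S = P.toSubring) ∧
      -- descent for representations which are trivial modulo `μ`
      IsRepEquivalence P.incl (ζ.pxIdeal.map P.base) (ζ.pxIdeal.map (aInfToR sq))
        (P.base ζ.mu) (aInfToR sq ζ.mu) ∧
      -- the general form in the integral case
      (∀ c₀ c₁ : AInf p (IntegerRing C), c₁ = c₀ * ζ.phiInvMu → c₁ ∣ ζ.mu → ¬IsUnit c₀ →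
        IsRepEquivalence P.incl (ζ.pxIdeal.map P.base) (ζ.pxIdeal.map (aInfToR sq))
          (P.base c₁) (aInfToR sq c₁)) ∧
      -- the general form modulo `p`
      (∀ c₀ c₁ : RedP p (AInf p (IntegerRing C)), c₁ = c₀ * toRedP p _ ζ.phiInvMu →
        c₁ ∣ toRedP p _ ζ.mu → ¬IsUnit c₀ →
        IsRepEquivalence (redPEquiv p P.incl)
          ((ζ.pxIdeal.map (toRedP p _)).map (redP p P.base))
          ((ζ.pxIdeal.map (toRedP p _)).map (redP p (aInfToR sq)))
          (redP p P.base c₁) (redP p (aInfToR sq) c₁)) ∧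
      -- the variant with Frobenius structures, over the localisations at `ξ̃`
      IsRepFrobEquivalence (φ := P.frob) (l := Loc.incl (P.xiTilde_fixed ζ))
        (φ' := frobAInfR sq) (l' := Loc.incl (xiTilde_fixed sq ζ))
        P.incl (Loc.map (P.xiTilde_fixed ζ) (xiTilde_fixed sq ζ) P.incl (P.incl_base ζ.xiTilde))
        P.frob_incl
        (Loc.map_incl (P.xiTilde_fixed ζ) (xiTilde_fixed sq ζ) P.incl (P.incl_base ζ.xiTilde))
        (ζ.pxIdeal.map P.base) (ζ.pxIdeal.map (aInfToR sq)) (P.base ζ.mu) (aInfToR sq ζ.mu) := by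
  obtain ⟨P, hP, hunique, h⟩ := exists_framedPeriodRing ζ hsq
  refine ⟨P, hP, hunique, h.isRepEquivalence ζ.xi_mul_phiInvMu.symm (dvd_refl _)
    IsStrictSubring.xi_pow_one_mem, fun c₀ c₁ hc hc₁ hc₀ => ?_, fun c₀ c₁ hc hc₁ hc₀ => ?_,
    h.isRepFrobEquivalence⟩
  · obtain ⟨N, hN⟩ := exists_pow_mem_pxIdeal ζ hc₀
    exact h.isRepEquivalence hc hc₁ hN
  · obtain ⟨c, rfl⟩ := toRedP_surjective p c₀
    obtain ⟨N, hN⟩ := exists_pow_mem_pxIdeal ζ (fun hu => hc₀ (hu.map (toRedP p _)))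
    exact h.isRepEquivalence_redP hc hc₁ (N := N) (by
      rw [← map_pow]
      exact Ideal.mem_map_of_mem _ hN)
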